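/- **Setting.** Let $k$ be a perfect field, $X$ a smooth separated scheme over $k$, $D$ a divisor of $X$ with simple normal crossings and irreducible components $D_1,\dots,D_h$, $U=X\smallsetminus D$, $G$ a finite group and $V\to U$ a $G$-torsor. Let $R=\sum r_iD_i$ with rational $r_i\ge 1$ and $M=\sum m_iD_i$ with integers $m_i\ge 1$ such that every $m_ir_i$ is an integer. **Oversimplicial objects.** Let $\widetilde\Delta$ be the category of the sets $[0,n]=\{0,\dots,n\}$ $(n\ge 0)$ and all maps. An oversimplicial scheme is a contravariant functor $P_\bullet$ from $\widetilde\Delta$ to schemes. It is *multiplicative* if, for every cocartesian square in $\widetilde\Delta$ with sides $[0,0]\to[0,m]$, $[0,0]\to[0,l]$, $[0,m]\to[0,n]$, $[0,l]\to[0,n]$, we have $P_n=P_m\times_{P_0}P_l$; it is *strictly multiplicative* if moreover the two morphisms $P_1\to P_0$ are equal. A morphism $Q_\bullet\to P_\bullet$ is *multiplicative* if for every such square $Q_n=(Q_m\times_{P_m}P_n)\times_{P_n}(Q_l\times_{P_l}P_n)$. A strictly multiplicative $P_\bullet$ is *associated to* a group scheme structure on $P_1$ over $P_0$ if the unit, inverse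 and multiplication are given by $[0,1]\to[0,0]$, by the transposition of $[0,1]$, and by $P_1\times_{P_0}P_1\cong P_2\to P_1$ (the isomorphism being given by $(0,1)\mapsto(0,1)$ and $(0,1)\mapsto(1,2)$, the last map by $(0,1)\mapsto(0,2)$). **Dilatations.** For $n\ge 0$ let $P_n^{(D)}$ be the affine $X^{n+1}$-scheme given locally by the algebra $A[I/t_0,\dots,I/t_n]\subset A[1/(t_0\cdots t_n)]$, where $A$ is the structure sheaf of $X^{n+1}$, $I$ the ideal of the diagonal $X\subset X^{n+1}$ and $t_j$ a local equation of $\mathrm{pr}_j^*D$. Let $P_n^{(D,M)}$ be the affine scheme over $P_n^{(D)}\times\mathbf A^h$ obtained by adjoining all $x_i^{m_i}/t_{i,j}$ and $t_{i,j}/x_i^{m_i}$ (inside the ring where all $t_{i,j}$ and $x_i$ are inverted), where $x_1,\dots,x_h$ are the coordinates of $\mathbf A^h$ and $t_{i,j}$ is a local equation of $\mathrm{pr}_j^*D_i$; put $\widetilde X^{(M)}=P_0^{(D,M)}$. Let $P_n^{(R,M)}$ be the dilatation of $P_n^{(D,M)}$ given by adjoining $J_n/\prod_i x_i^{m_i(r_i-1)}$,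 where $J_n$ is the ideal of the diagonal $\widetilde X^{(M)}\to P_n^{(D,M)}$. Let $\widetilde Z^{(M)}\subset\widetilde X^{(M)}$ and $T_n^{(R,M)}\subset P_n^{(R,M)}$ be the closed subschemes defined by $\prod_{r_i>1}x_i=0$. All these form oversimplicial schemes, and $T_0^{(R,M)}=\widetilde Z^{(M)}$. **Coverings.** Let $Q_n^{(R,M)}$ be the normalization of $P_n^{(R,M)}$ in $(V^{n+1}/\Delta G)\times\mathbf G_m^h=P_n^{(R,M)}\times_{X^{n+1}}(V^{n+1}/\Delta G)$, where $\Delta G$ is the diagonal in $G^{n+1}$. Assume that the ramification of $V$ over $U$ along $D$ is *bounded by $R+$*: $Q_1^{(R,M)}\to P_1^{(R,M)}$ is étale on a neighbourhood of the image of the diagonal $Q_0^{(R,M)}=\widetilde X^{(M)}\to Q_1^{(R,M)}$. Let $W_n^{(R,M)}\subset Q_n^{(R,M)}$ be the largest open subscheme étale over $P_n^{(R,M)}$. **Statement.** The $W_n^{(R,M)}$ form an oversimplicial open subscheme $W_\bullet^{(R,M)}$ of $Q_\bullet^{(R,M)}$. Put $E_\bullet^{(R,M)}=T_\bullet^{(R,M)}\times_{P_\bullet^{(R,M)}}W_\bullet^{(R,M)}$.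 Then: 1. $E_\bullet^{(R,M)}$ is strictly multiplicative, and $E_\bullet^{(R,M)}\to T_\bullet^{(R,M)}$ is étale and multiplicative. 2. $E_0^{(R,M)}=\widetilde Z^{(M)}$, and $E_\bullet^{(R,M)}$ is associated to a smooth group scheme $E^{(R,M)}=E_1^{(R,M)}$ over $\widetilde Z^{(M)}$. 3. $T_\bullet^{(R,M)}$ is associated to a smooth group scheme $T^{(R,M)}=T_1^{(R,M)}$ over $\widetilde Z^{(M)}$, which is the additive group scheme of a vector bundle, and $E^{(R,M)}\to T^{(R,M)}$ is an étale homomorphism of smooth group schemes over $\widetilde Z^{(M)}$. -/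

import Mathlib

open CategoryTheory Limits AlgebraicGeometry Scheme Scheme.Hom

universe u
set_option linter.unusedSimpArgs false
set_option linter.unusedVariables false
set_option linter.unusedSectionVars false

noncomputable section
namespace RamGrp

/-- Restriction of sections of the structure sheaf. -/
def rs {X : Scheme.{u}} {V W : X.Opens} (h : V ≤ W) : Γ(X, W) →+* Γ(X, V) :=
  (X.presheaf.map (homOfLE h).op).hom

/-- Pullback of sections `Γ(Y, U) → Γ(X, f⁻¹ U)`. -/
def pb {X Y : Scheme.{u}} (f : X ⟶ Y) (U : Y.Opens) : Γ(Y, U) →+* Γ(X, f ⁻¹ᵁ U) := (f.app U).hom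

lemma rs_self {X : Scheme.{u}} {V : X.Opens} (h : V ≤ V) (x) : rs h x = x := by
  change X.presheaf.map (𝟙 _) x = x
  simp

lemma rs_rs {X : Scheme.{u}} {U V W : X.Opens} (h : U ≤ V) (h' : V ≤ W) (x : Γ(X, W)) :
    rs h (rs h' x) = rs (h.trans h') x := by
  change (X.presheaf.map _ ≫ X.presheaf.map _) x = _
  rw [← Functor.map_comp]
  rfl

lemma pb_rs {X Y : Scheme.{u}} (f : X ⟶ Y) {U V : Y.Opens} (h : U ≤ V) (a : Γ(Y, V)) :
    pb f U (rs h a) = rs (f.preimage_mono h) (pb f V a) :=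
  ConcreteCategory.congr_hom (f.naturality (homOfLE h).op) a

lemma pb_congr {X' Y : Scheme.{u}} {a b : X' ⟶ Y} (e : a = b) {U : Y.Opens} {V : X'.Opens} (hV : V ≤ a ⁻¹ᵁ U)
    (x : Γ(Y, U)) : rs hV (pb a U x) = rs (e ▸ hV) (pb b U x) := by
  subst e; rfl

lemma le_of_comm {X Y X' Y' : Scheme.{u}} {f : X ⟶ Y} {f' : X' ⟶ Y'} {h : X' ⟶ X} {g : Y' ⟶ Y} (e : f' ≫ g = h ≫ f)
    {U : Y.Opens} {U' : Y'.Opens} (hU : U' ≤ g ⁻¹ᵁ U) : f' ⁻¹ᵁ U' ≤ h ⁻¹ᵁ f ⁻¹ᵁ U := by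
  refine (f'.preimage_mono hU).trans ?_
  rw [← Scheme.Hom.comp_preimage, e, Scheme.Hom.comp_preimage]

lemma exists_small {Y Y' : Scheme.{u}} (y : Y') (g : Y' ⟶ Y) : ∃ (U : Y.affineOpens) (U' : Y'.affineOpens),
    U'.1 ≤ g ⁻¹ᵁ U.1 ∧ y ∈ U'.1 := by
  obtain ⟨U, hxU⟩ := TopologicalSpace.Opens.mem_iSup.mp
    ((iSup_affineOpens_eq_top Y).ge (Set.mem_univ (g y)))
  obtain ⟨_, ⟨V, hV, rfl⟩, hxV, hVU⟩ := Y'.isBasis_affineOpens.exists_subset_of_mem_open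
    (show y ∈ (g ⁻¹ᵁ U.1 : Set Y') from hxU) (g ⁻¹ᵁ U.1).isOpen
  exact ⟨U, ⟨V, hV⟩, hVU, hxV⟩

lemma exists_pow_mul_eq {X Y : Scheme.{u}} (f : X ⟶ Y) [QuasiCompact f] [QuasiSeparated f]
    (U V : Y.affineOpens) (h : V.1 ≤ U.1) (r : Γ(Y, U.1))
    (hV : V.1 = Y.basicOpen r) (x y : Γ(X, f ⁻¹ᵁ U.1))
    (e : rs (f.preimage_mono h) x = rs (f.preimage_mono h) y) :
    ∃ n : ℕ, pb f _ r ^ n * x = pb f _ r ^ n * y := by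
  have hle : X.basicOpen (f.app U.1 r) ≤ f ⁻¹ᵁ V.1 := by
    rw [hV]; exact (Scheme.preimage_basicOpen f r).ge
  refine exists_of_res_eq_of_qcqs (f.isCompact_preimage U.2.isCompact)
        (f.isQuasiSeparated_preimage U.2.isQuasiSeparated) (s := f.app U.1 r) ?_
  change rs (X.basicOpen_le _) x = rs (X.basicOpen_le _) y
  rw [← rs_rs hle (f.preimage_mono h), e, rs_rs]


lemma ext_of_open {X T : Scheme.{u}} (a b : X ⟶ T)
    (h : ∀ x : X, ∃ (W : Scheme.{u}) (w : W ⟶ X), IsOpenImmersion w ∧ x ∈ Set.range w ∧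
      w ≫ a = w ≫ b) : a = b := by
  choose W w hw hx e using h
  exact Cover.hom_ext (Cover.mkOfCovers X W w (fun x ↦ ⟨x, hx x⟩) hw) _ _ e

lemma exists_glue {X T : Scheme.{u}} {J : Type*} (V : J → Scheme.{u}) (j : ∀ i, V i ⟶ X)
    [∀ i, IsOpenImmersion (j i)] (hj : ∀ x : X, ∃ i, x ∈ Set.range (j i)) (φ : ∀ i, V i ⟶ T)
    (H : ∀ i i' (x : V i) (x' : V i'), j i x = j i' x' →
      ∃ (W : Scheme.{u}) (w : W ⟶ V i) (w' : W ⟶ V i'), IsOpenImmersion w ∧ x ∈ Set.range w ∧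
        w ≫ j i = w' ≫ j i' ∧ w ≫ φ i = w' ≫ φ i') :
    ∃ a : X ⟶ T, ∀ i, j i ≫ a = φ i := by
  let 𝒰 : X.OpenCover := Cover.mkOfCovers J V j hj fun _ ↦ inferInstance
  have key (i i' : J) : pullback.fst (j i) (j i') ≫ φ i = pullback.snd (j i) (j i') ≫ φ i' := by
    refine ext_of_open _ _ fun p ↦ ?_
    obtain ⟨W, w, w', hw, ⟨y, hy⟩, e, e'⟩ := H i i' (pullback.fst (j i) (j i') p)
      (pullback.snd (j i) (j i') p) (by
        rw [← Scheme.Hom.comp_apply, pullback.condition, Scheme.Hom.comp_apply])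
    have hl : pullback.lift w w' e ≫ pullback.fst (j i) (j i') = w := pullback.lift_fst _ _ _
    refine ⟨W, pullback.lift w w' e, ?_, ⟨y, ?_⟩, ?_⟩
    · have : IsOpenImmersion (pullback.lift w w' e ≫ pullback.fst (j i) (j i')) := by rwa [hl]
      exact IsOpenImmersion.of_comp _ (pullback.fst (j i) (j i'))
    · apply (pullback.fst (j i) (j i')).isOpenEmbedding.injective
      rw [← hy, ← Scheme.Hom.comp_apply, hl]
    · rw [pullback.lift_fst_assoc, pullback.lift_snd_assoc, e']
  exact ⟨𝒰.glueMorphisms φ key, fun i ↦ 𝒰.ι_glueMorphisms φ _ i⟩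

lemma ext_of_dominant {P W T Z : Scheme.{u}} (p : P ⟶ W) [IsSchemeTheoreticallyDominant p]
    (g : T ⟶ Z) [IsSeparated g] (a b : W ⟶ T) (h : a ≫ g = b ≫ g) (h' : p ≫ a = p ≫ b) : a = b := by
  let W' : Over Z := Over.mk (a ≫ g)
  let T' : Over Z := Over.mk g
  let P' : Over Z := Over.mk (p ≫ a ≫ g)
  let a' : W' ⟶ T' := Over.homMk a
  let b' : W' ⟶ T' := Over.homMk b h.symm
  let p' : P' ⟶ W' := Over.homMk p
  have : IsSeparated T'.hom := ‹_›
  have e : p' ≫ a' = p' ≫ b' := by ext1; exact h'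
  have e2 : (equalizer.lift p' e).left ≫ (equalizer.ι a' b').left = p := by
    rw [← Over.comp_left, equalizer.lift_ι]
    rfl
  have hk : (equalizer.ι a' b').left.ker = ⊥ := by
    rw [eq_bot_iff]
    refine (Hom.le_ker_comp (equalizer.lift p' e).left _).trans ?_
    rw [e2, p.ker_eq_bot]
  have : IsIso (equalizer.ι a' b').left :=
    IsClosedImmersion.isIso_of_ker_eq (equalizer.ι a' b').left (𝟙 W) (equalizer.ι a' b').left
      (by simp) (by rw [hk]; simp)
  rw [← cancel_epi (equalizer.ι a' b').left]
  exact congr($(equalizer.condition a' b').left)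

lemma dominant_Spec_map {A B : Type u} [CommRing A] [CommRing B] (φ : A →+* B) (h : Function.Injective φ) :
    IsSchemeTheoreticallyDominant (Spec.map (CommRingCat.ofHom φ)) where
  ker_eq_bot := by
    have h1 : Function.Injective (Spec.map (CommRingCat.ofHom φ)).appTop := by
      have := ΓSpecIso_naturality (CommRingCat.ofHom φ)
      rw [← Iso.eq_comp_inv] at this
      rw [this]
      exact ((ConcreteCategory.bijective_of_isIso (ΓSpecIso (.of B)).inv).1.comp h).comp
        (ConcreteCategory.bijective_of_isIso (ΓSpecIso (.of A)).hom).1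
    refine Scheme.IdealSheafData.ext_of_isAffine ?_
    rw [Hom.ker_apply, Scheme.IdealSheafData.ideal_bot, Pi.bot_apply]
    exact (RingHom.injective_iff_ker_eq_bot _).mp h1

/-- qc subalgebra -/
structure QCSubalgebra {X Y : Scheme.{u}} (f : X ⟶ Y) where
  B : ∀ U : Y.affineOpens, Subring Γ(X, f ⁻¹ᵁ U.1)
  app_mem : ∀ (U : Y.affineOpens) (a : Γ(Y, U.1)), pb f U.1 a ∈ B U
  res_mem : ∀ {U V : Y.affineOpens} (h : U.1 ≤ V.1), ∀ x ∈ B V, rs (f.preimage_mono h) x ∈ B U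
  loc : ∀ (U V : Y.affineOpens) (h : V.1 ≤ U.1) (r : Γ(Y, U.1)), V.1 = Y.basicOpen r →
    ∀ x ∈ B V, ∃ (n : ℕ), ∃ y ∈ B U,
      rs (f.preimage_mono h) y = rs (f.preimage_mono h) (pb f _ r) ^ n * x

namespace QCSubalgebra

open AffineZariskiSite

variable {X Y : Scheme.{u}} {f : X ⟶ Y} (𝓑 : QCSubalgebra f)

def res {U V : Y.affineOpens} (h : U.1 ≤ V.1) : 𝓑.B V →+* 𝓑.B U :=
  (rs (f.preimage_mono h)).restrict (𝓑.B V) (𝓑.B U) (𝓑.res_mem h)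

def diagram : Y.AffineZariskiSiteᵒᵖ ⥤ CommRingCat.{u} where
  obj U := .of (𝓑.B U.unop)
  map {V U} i := CommRingCat.ofHom (𝓑.res (toOpens_mono i.unop.le))
  map_id U := by ext x; exact rs_self _ _
  map_comp {U V W} i j := by ext x; exact (rs_rs _ _ _).symm

def algMap (U : Y.affineOpens) : Γ(Y, U.1) →+* 𝓑.B U :=
  (pb f U.1).codRestrict (𝓑.B U) (𝓑.app_mem U)

def diagramMap : (toOpensFunctor Y).op ⋙ Y.presheaf ⟶ 𝓑.diagram where
  app U := CommRingCat.ofHom (𝓑.algMap U.unop)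
  naturality {U V} i := by
    ext x
    exact Subtype.ext (pb_rs f (toOpens_mono i.unop.le) x)

variable [QuasiCompact f] [QuasiSeparated f]

lemma coequifibered : 𝓑.diagramMap.Coequifibered := by
  refine coequifibered_iff_forall_isLocalizationAway.mpr fun U r ↦ ?_
  let V : Y.affineOpens := U.basicOpen r
  have hVU : V.1 ≤ U.1 := Y.basicOpen_le r
  let _ := (𝓑.res (U := V) (V := U) hVU).toAlgebra
  change IsLocalization.Away (𝓑.algMap U r) (𝓑.B V)
  have key : algebraMap (𝓑.B U) (𝓑.B V) (𝓑.algMap U r) = 𝓑.algMap V (rs hVU r) :=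
    Subtype.ext (pb_rs f hVU r).symm
  have h1 : IsUnit (rs hVU r) := Y.toRingedSpace.isUnit_res_basicOpen r
  refine ⟨?_, ?_, ?_⟩
  · rintro ⟨_, n, rfl⟩
    dsimp only
    rw [map_pow, key]
    exact (h1.map (𝓑.algMap V)).pow _
  · rintro ⟨x, hx⟩
    obtain ⟨n, y, hy, e⟩ := 𝓑.loc U V hVU r rfl x hx
    refine ⟨⟨⟨y, hy⟩, ⟨_, n, rfl⟩⟩, Subtype.ext ?_⟩
    dsimp only
    rw [mul_comm, map_pow, key]
    refine Eq.trans ?_ e.symm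
    rw [← pb_rs]
    rfl
  · intro x y e
    obtain ⟨n, hn⟩ := exists_pow_mul_eq f U V hVU r rfl x.1 y.1 congr(($e).1)
    exact ⟨⟨_, n, rfl⟩, Subtype.ext hn⟩

def glueData := relativeGluingData 𝓑.coequifibered

instance : (𝓑.glueData.functor ⋙ Scheme.forget).IsLocallyDirected :=
  Cover.RelativeGluingData.instIsLocallyDirectedI₀CompFunctorForgetOfIsThin ..

/-- rel spec -/
def spec : Scheme.{u} := 𝓑.glueData.glued

def cover : 𝓑.spec.OpenCover := 𝓑.glueData.cover

def toBase : 𝓑.spec ⟶ Y := 𝓑.glueData.toBase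

def chart (U : Y.affineOpens) : Spec (.of (𝓑.B U)) ⟶ 𝓑.spec :=
  colimit.ι 𝓑.glueData.functor U

lemma chart_toBase (U : Y.affineOpens) :
    𝓑.chart U ≫ 𝓑.toBase = Spec.map (CommRingCat.ofHom (𝓑.algMap U)) ≫ U.2.fromSpec :=
  colimit.ι_desc _ _

lemma chart_res {U V : Y.affineOpens} (h : ∃ r : Γ(Y, V.1), Y.basicOpen r = U.1) (h' : U.1 ≤ V.1) :
    Spec.map (CommRingCat.ofHom (𝓑.res h')) ≫ 𝓑.chart V = 𝓑.chart U :=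
  colimit.w 𝓑.glueData.functor (homOfLE (show @LE.le Y.AffineZariskiSite _ U V from h) :
    @Quiver.Hom Y.AffineZariskiSite _ U V)

instance (U : Y.affineOpens) : IsOpenImmersion (𝓑.chart U) :=
  𝓑.glueData.cover.map_prop U

lemma toBase_preimage (U : Y.affineOpens) :
    𝓑.toBase ⁻¹ᵁ U = (𝓑.chart U).opensRange := by
  simpa using! 𝓑.glueData.toBase_preimage_eq_opensRange_ι U

instance : IsAffineHom 𝓑.toBase := by
  refine isAffineHom_of_forall_exists_isAffineOpen _ fun x ↦ ?_
  obtain ⟨U, hxU⟩ := TopologicalSpace.Opens.mem_iSup.mp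
      ((iSup_affineOpens_eq_top Y).ge (Set.mem_univ x))
  refine ⟨U, hxU, U.2, ?_⟩
  rw [toBase_preimage]
  exact isAffineOpen_opensRange _


/-- The restriction of `fromSource`. -/
def fromSourceRes (U : Y.affineOpens) : (f ⁻¹ᵁ U.1).toScheme ⟶ 𝓑.spec :=
  (f ⁻¹ᵁ U.1).toSpecΓ ≫ Spec.map (CommRingCat.ofHom (𝓑.B U).subtype) ≫ 𝓑.chart U

lemma homOfLE_fromSourceRes {U V : Y.affineOpens} (h : ∃ r : Γ(Y, V.1), Y.basicOpen r = U.1)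
    (h' : U.1 ≤ V.1) :
    X.homOfLE (f.preimage_mono h') ≫ 𝓑.fromSourceRes V = 𝓑.fromSourceRes U := by
  rw [fromSourceRes, fromSourceRes, ← 𝓑.chart_res h h',
    ← Scheme.Opens.toSpecΓ_SpecMap_presheaf_map_assoc (f ⁻¹ᵁ U.1) (f ⁻¹ᵁ V.1) (f.preimage_mono h'),
    ← Spec.map_comp_assoc, ← Spec.map_comp_assoc]
  rfl

lemma exists_fromSource : ∃ a : X ⟶ 𝓑.spec,
    ∀ U : Y.affineOpens, (f ⁻¹ᵁ U.1).ι ≫ a = 𝓑.fromSourceRes U := by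
  refine exists_glue _ (fun U : Y.affineOpens ↦ (f ⁻¹ᵁ U.1).ι) (fun x ↦ ?_) _ ?_
  · obtain ⟨U, hxU⟩ := TopologicalSpace.Opens.mem_iSup.mp
      ((iSup_affineOpens_eq_top Y).ge (Set.mem_univ (f x)))
    exact ⟨U, ⟨x, hxU⟩, rfl⟩
  · rintro U V ⟨x, hx⟩ ⟨x', hx'⟩ e
    obtain rfl : x = x' := e
    obtain ⟨r, s, hrs, hr⟩ := exists_basicOpen_le_affine_inter U.2 V.2 (f x) ⟨hx, hx'⟩
    let W : Y.affineOpens := ⟨_, U.2.basicOpen r⟩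
    have hU : W.1 ≤ U.1 := Y.basicOpen_le r
    have hV : W.1 ≤ V.1 := hrs.le.trans (Y.basicOpen_le s)
    refine ⟨_, X.homOfLE (f.preimage_mono hU), X.homOfLE (f.preimage_mono hV), inferInstance,
      ⟨⟨x, hr⟩, Subtype.ext (by simp)⟩, by simp, ?_⟩
    rw [𝓑.homOfLE_fromSourceRes ⟨r, rfl⟩ hU, 𝓑.homOfLE_fromSourceRes ⟨s, hrs.symm⟩ hV]

def fromSource : X ⟶ 𝓑.spec := 𝓑.exists_fromSource.choose

lemma ι_fromSource (U : Y.affineOpens) : (f ⁻¹ᵁ U.1).ι ≫ 𝓑.fromSource = 𝓑.fromSourceRes U :=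
  𝓑.exists_fromSource.choose_spec U

lemma fromSource_toBase : 𝓑.fromSource ≫ 𝓑.toBase = f := by
  refine ext_of_open _ _ fun x ↦ ?_
  obtain ⟨U, hxU⟩ := TopologicalSpace.Opens.mem_iSup.mp
      ((iSup_affineOpens_eq_top Y).ge (Set.mem_univ (f x)))
  refine ⟨_, (f ⁻¹ᵁ U.1).ι, inferInstance, ⟨⟨x, hxU⟩, rfl⟩, ?_⟩
  rw [← Category.assoc, ι_fromSource, fromSourceRes, Category.assoc, Category.assoc,
    𝓑.chart_toBase, ← Spec.map_comp_assoc]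
  change (f ⁻¹ᵁ U.1).toSpecΓ ≫ Spec.map (f.app _) ≫ U.2.fromSpec = (f ⁻¹ᵁ U.1).ι ≫ _
  have := Scheme.Opens.toSpecΓ_SpecMap_appLE f U.1 (f ⁻¹ᵁ U.1) le_rfl
  rw [Hom.app_eq_appLE, reassoc_of% this, U.2.toSpecΓ_fromSpec]
  simp

instance : QuasiCompact 𝓑.fromSource := by
  have : QuasiCompact (𝓑.fromSource ≫ 𝓑.toBase) := by rw [fromSource_toBase]; infer_instance
  exact MorphismProperty.of_postcomp (W := @QuasiCompact) (W' := @QuasiSeparated) _ 𝓑.toBase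
    inferInstance this

instance : IsSchemeTheoreticallyDominant 𝓑.fromSource where
  ker_eq_bot := by
    refine Scheme.IdealSheafData.ext_of_iSup_eq_top
      (fun U : Y.affineOpens ↦ ⟨𝓑.toBase ⁻¹ᵁ U.1, U.2.preimage _⟩)
      (TopologicalSpace.IsOpenCover.comap (iSup_affineOpens_eq_top _) _) fun U ↦ ?_
    rw [Scheme.IdealSheafData.ideal_bot, Pi.bot_apply, Hom.ker_apply,
      ← RingHom.injective_iff_ker_eq_bot]
    have : CompactSpace (f ⁻¹ᵁ U.1).toScheme :=
      isCompact_iff_compactSpace.mp (f.isCompact_preimage U.2.isCompact)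
    have h1 : IsSchemeTheoreticallyDominant (f ⁻¹ᵁ U.1).toSpecΓ := by
      have : IsSchemeTheoreticallyDominant (f ⁻¹ᵁ U.1).toScheme.toSpecΓ := ⟨ker_toSpecΓ _⟩
      rw [Opens.toSpecΓ]
      infer_instance
    have h2 := dominant_Spec_map (𝓑.B U).subtype Subtype.val_injective
    let q := (f ⁻¹ᵁ U.1).toSpecΓ ≫ Spec.map (CommRingCat.ofHom (𝓑.B U).subtype)
    have h3 : q ≫ 𝓑.chart U = (f ⁻¹ᵁ U.1).ι ≫ 𝓑.fromSource := by
      rw [ι_fromSource, fromSourceRes, Category.assoc]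
    have : IsIso ((𝓑.chart U).app (𝓑.toBase ⁻¹ᵁ U.1)) :=
      Scheme.Hom.isIso_app _ _ (by rw [toBase_preimage])
    have h4 : Function.Injective ((q ≫ 𝓑.chart U).app (𝓑.toBase ⁻¹ᵁ U.1)) := by
      rw [Scheme.Hom.comp_app]
      exact (q.app_injective _).comp
        ((ConcreteCategory.bijective_of_isIso ((𝓑.chart U).app (𝓑.toBase ⁻¹ᵁ U.1))).1)
    rw [h3, Scheme.Hom.comp_app] at h4
    exact Function.Injective.of_comp (f := ((f ⁻¹ᵁ U.1).ι.app _).hom) h4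


/-- Morphisms from flat schemes over `𝓑.spec` to separated schemes are determined on `X`. -/
lemma hom_ext {W T Z : Scheme.{u}} (w : W ⟶ 𝓑.spec) [Flat w] (g : T ⟶ Z) [IsSeparated g]
    (a b : W ⟶ T) (h : a ≫ g = b ≫ g)
    (h' : pullback.fst w 𝓑.fromSource ≫ a = pullback.fst w 𝓑.fromSource ≫ b) : a = b :=
  ext_of_dominant (pullback.fst w 𝓑.fromSource) g a b h h'

section Functoriality

variable {X' Y' : Scheme.{u}} {f' : X' ⟶ Y'} [QuasiCompact f'] [QuasiSeparated f']
  (𝓑' : QCSubalgebra f') {h : X' ⟶ X} {g : Y' ⟶ Y} (e : f' ≫ g = h ≫ f)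

/-- Pulling back along `h` maps `𝓑` into `𝓑'`. -/
def MapsTo (𝓑 : QCSubalgebra f) (𝓑' : QCSubalgebra f') (e : f' ≫ g = h ≫ f) : Prop :=
  ∀ (U : Y.affineOpens) (U' : Y'.affineOpens) (hU : U'.1 ≤ g ⁻¹ᵁ U.1), ∀ s ∈ 𝓑.B U,
    rs (le_of_comm e hU) (pb h (f ⁻¹ᵁ U.1) s) ∈ 𝓑'.B U'

variable {𝓑 𝓑'} {e} (H : MapsTo 𝓑 𝓑' e)

def mapRing (H : MapsTo 𝓑 𝓑' e) {U : Y.affineOpens} {U' : Y'.affineOpens}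
    (hU : U'.1 ≤ g ⁻¹ᵁ U.1) : 𝓑.B U →+* 𝓑'.B U' :=
  ((rs (le_of_comm e hU)).comp (pb h (f ⁻¹ᵁ U.1))).restrict (𝓑.B U) (𝓑'.B U') (H U U' hU)

def mapChart {U : Y.affineOpens} {U' : Y'.affineOpens}
    (hU : U'.1 ≤ g ⁻¹ᵁ U.1) : Spec (.of (𝓑'.B U')) ⟶ 𝓑.spec :=
  Spec.map (CommRingCat.ofHom (mapRing H hU)) ≫ 𝓑.chart U

lemma mapChart_toBase {U : Y.affineOpens} {U' : Y'.affineOpens}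
    (hU : U'.1 ≤ g ⁻¹ᵁ U.1) : mapChart H hU ≫ 𝓑.toBase = 𝓑'.chart U' ≫ 𝓑'.toBase ≫ g := by
  have h1 : U'.2.fromSpec ≫ g = Spec.map (g.appLE U.1 U'.1 hU) ≫ U.2.fromSpec :=
    (IsAffineOpen.SpecMap_appLE_fromSpec g U.2 U'.2 hU).symm
  rw [mapChart, Category.assoc, chart_toBase, ← Category.assoc (𝓑'.chart U'), chart_toBase,
    Category.assoc, h1, ← Spec.map_comp_assoc, ← Spec.map_comp_assoc]
  congr 2
  ext x
  change rs (le_of_comm e hU) (pb (h ≫ f) U.1 x) = pb f' _ (rs hU (pb g U.1 x))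
  rw [pb_rs]
  exact (pb_congr e (f'.preimage_mono hU) x).symm

lemma mapChart_of_comm {U : Y.affineOpens} {U' : Y'.affineOpens}
    (hU : U'.1 ≤ g ⁻¹ᵁ U.1) {Q : Scheme.{u}} (q : Q ⟶ Spec (.of (𝓑'.B U'))) (q' : Q ⟶ X')
    (hq : q ≫ 𝓑'.chart U' = q' ≫ 𝓑'.fromSource) :
    q ≫ mapChart H hU = q' ≫ h ≫ 𝓑.fromSource := by
  have hr : Set.range q' ⊆ Set.range (f' ⁻¹ᵁ U'.1).ι := by
    rintro _ ⟨x, rfl⟩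
    rw [Scheme.Opens.range_ι]
    change f' (q' x) ∈ U'.1
    rw [← 𝓑'.fromSource_toBase, Scheme.Hom.comp_apply, ← Scheme.Hom.comp_apply q', ← hq]
    change _ ∈ 𝓑'.toBase ⁻¹ᵁ U'.1
    rw [toBase_preimage]
    exact ⟨q x, by simp⟩
  obtain ⟨p, rfl⟩ : ∃ p, p ≫ (f' ⁻¹ᵁ U'.1).ι = q' :=
    ⟨IsOpenImmersion.lift _ q' hr, IsOpenImmersion.lift_fac _ _ _⟩
  have hp : q = p ≫ (f' ⁻¹ᵁ U'.1).toSpecΓ ≫ Spec.map (CommRingCat.ofHom (𝓑'.B U').subtype) := by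
    rw [← cancel_mono (𝓑'.chart U'), hq, Category.assoc, ι_fromSource, fromSourceRes]
    simp
  have h2 := Scheme.Opens.toSpecΓ_SpecMap_appLE h (f ⁻¹ᵁ U.1) (f' ⁻¹ᵁ U'.1) (le_of_comm e hU)
  have h3 : (f' ⁻¹ᵁ U'.1).ι ≫ h = h.resLE _ _ (le_of_comm e hU) ≫ (f ⁻¹ᵁ U.1).ι := by simp
  rw [Category.assoc, reassoc_of% h3, ι_fromSource, fromSourceRes, ← reassoc_of% h2, hp, mapChart]
  simp only [Category.assoc]
  rw [← Spec.map_comp_assoc, ← Spec.map_comp_assoc]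
  rfl

lemma exists_map : ∃ a : 𝓑'.spec ⟶ 𝓑.spec, ∀ (U : Y.affineOpens) (U' : Y'.affineOpens)
    (hU : U'.1 ≤ g ⁻¹ᵁ U.1), 𝓑'.chart U' ≫ a = mapChart H hU := by
  suffices h : ∃ a : 𝓑'.spec ⟶ 𝓑.spec,
      ∀ p : {p : Y.affineOpens × Y'.affineOpens // p.2.1 ≤ g ⁻¹ᵁ p.1.1},
        𝓑'.chart p.1.2 ≫ a = mapChart H p.2 from
    h.imp fun a ha U U' hU ↦ ha ⟨(U, U'), hU⟩
  refine exists_glue (J := {p : Y.affineOpens × Y'.affineOpens // p.2.1 ≤ g ⁻¹ᵁ p.1.1}) _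
    (fun p ↦ 𝓑'.chart p.1.2) (fun x ↦ ?_) (fun p ↦ mapChart H p.2) ?_
  · obtain ⟨U, U', hU, hx⟩ := exists_small (𝓑'.toBase x) g
    refine ⟨⟨(U, U'), hU⟩, ?_⟩
    have : x ∈ 𝓑'.toBase ⁻¹ᵁ U'.1 := hx
    rwa [𝓑'.toBase_preimage U'] at this
  · rintro ⟨⟨U, U'⟩, hU⟩ ⟨⟨V, V'⟩, hV⟩ x x' ex
    obtain ⟨y, hy, -⟩ := Scheme.Pullback.exists_preimage_pullback x x' ex
    refine ⟨pullback (𝓑'.chart U') (𝓑'.chart V'), pullback.fst _ _, pullback.snd _ _,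
      inferInstance, ⟨y, hy⟩, pullback.condition, ?_⟩
    refine 𝓑'.hom_ext (pullback.fst _ _ ≫ 𝓑'.chart U') 𝓑.toBase _ _ ?_ ?_
    · simp only [Category.assoc, mapChart_toBase]
      rw [pullback.condition_assoc]
    · have k := pullback.condition
        (f := pullback.fst (𝓑'.chart U') (𝓑'.chart V') ≫ 𝓑'.chart U') (g := 𝓑'.fromSource)
      rw [← Category.assoc, ← Category.assoc, mapChart_of_comm H hU _ (pullback.snd _ _),
        mapChart_of_comm H hV _ (pullback.snd _ _)]
      · rw [Category.assoc]
        exact (by rw [← pullback.condition] : _ = _).trans k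
      · rw [Category.assoc]
        exact k

def map : 𝓑'.spec ⟶ 𝓑.spec := (exists_map H).choose

lemma chart_map {U : Y.affineOpens} {U' : Y'.affineOpens} (hU : U'.1 ≤ g ⁻¹ᵁ U.1) :
    𝓑'.chart U' ≫ map H = mapChart H hU := (exists_map H).choose_spec U U' hU

lemma map_toBase : map H ≫ 𝓑.toBase = 𝓑'.toBase ≫ g := by
  refine ext_of_open _ _ fun x ↦ ?_
  obtain ⟨U, U', hU, hx⟩ := exists_small (𝓑'.toBase x) g
  have : x ∈ 𝓑'.toBase ⁻¹ᵁ U'.1 := hx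
  rw [𝓑'.toBase_preimage U'] at this
  refine ⟨_, 𝓑'.chart U', inferInstance, this, ?_⟩
  rw [← Category.assoc, chart_map H hU, mapChart_toBase]

lemma fromSource_map : 𝓑'.fromSource ≫ map H = h ≫ 𝓑.fromSource := by
  refine ext_of_open _ _ fun x ↦ ?_
  obtain ⟨U, U', hU, hx⟩ := exists_small (f' x) g
  refine ⟨_, (f' ⁻¹ᵁ U'.1).ι, inferInstance, ⟨⟨x, hx⟩, rfl⟩, ?_⟩
  rw [← mapChart_of_comm H hU ((f' ⁻¹ᵁ U'.1).toSpecΓ ≫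
    Spec.map (CommRingCat.ofHom (𝓑'.B U').subtype)) (f' ⁻¹ᵁ U'.1).ι, ← chart_map H hU,
    ← Category.assoc, ι_fromSource, fromSourceRes]
  · simp
  · rw [ι_fromSource, fromSourceRes]
    simp

/-- A morphism over `Y` out of `spec` is determined by its restriction to the source. -/
lemma hom_ext' {T Z : Scheme.{u}} (g : T ⟶ Z) [IsSeparated g] (a b : 𝓑.spec ⟶ T)
    (h : a ≫ g = b ≫ g) (h' : 𝓑.fromSource ≫ a = 𝓑.fromSource ≫ b) : a = b :=
  ext_of_dominant 𝓑.fromSource g a b h h'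

lemma map_eq_id {h : X ⟶ X} {g : Y ⟶ Y} {e : f ≫ g = h ≫ f} (H : MapsTo 𝓑 𝓑 e) (hg : g = 𝟙 Y)
    (hh : h = 𝟙 X) : map H = 𝟙 _ := by
  refine hom_ext' 𝓑.toBase _ _ ?_ ?_
  · rw [map_toBase, hg, Category.comp_id, Category.id_comp]
  · rw [fromSource_map, hh, Category.comp_id, Category.id_comp]

lemma map_eq_comp {X'' Y'' : Scheme.{u}} {f'' : X'' ⟶ Y''} [QuasiCompact f''] [QuasiSeparated f'']
    {𝓑'' : QCSubalgebra f''} {h' : X'' ⟶ X'} {g' : Y'' ⟶ Y'} {e' : f'' ≫ g' = h' ≫ f'}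
    {h'' : X'' ⟶ X} {g'' : Y'' ⟶ Y} {e'' : f'' ≫ g'' = h'' ≫ f}
    (H : MapsTo 𝓑 𝓑' e) (H' : MapsTo 𝓑' 𝓑'' e') (H'' : MapsTo 𝓑 𝓑'' e'')
    (hg : g'' = g' ≫ g) (hh : h'' = h' ≫ h) : map H'' = map H' ≫ map H := by
  refine hom_ext' 𝓑.toBase _ _ ?_ ?_
  · rw [map_toBase, Category.assoc, map_toBase, ← Category.assoc, map_toBase, hg, Category.assoc]
  · rw [fromSource_map, ← Category.assoc, fromSource_map, Category.assoc, fromSource_map, hh,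
      Category.assoc]

end Functoriality

end QCSubalgebra

section IdealSheaves

open IdealSheafData

variable {X Y : Scheme.{u}}

lemma ideal_comap_top [IsAffine X] [IsAffine Y] (I : Y.IdealSheafData) (f : X ⟶ Y) :
    (I.comap f).ideal ⟨⊤, isAffineOpen_top X⟩ =
      (I.ideal ⟨⊤, isAffineOpen_top Y⟩).map f.appTop.hom := by
  have key (K : X.IdealSheafData) : (K.map f).ideal ⟨⊤, isAffineOpen_top Y⟩ =
      (K.ideal ⟨⊤, isAffineOpen_top X⟩).comap f.appTop.hom :=
    ideal_map K f ⟨⊤, isAffineOpen_top Y⟩ (isAffineOpen_top X)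
  apply le_antisymm
  · let K : X.IdealSheafData := equivOfIsAffine.symm
      ((I.ideal ⟨⊤, isAffineOpen_top Y⟩).map f.appTop.hom)
    have hK : K.ideal ⟨⊤, isAffineOpen_top X⟩ =
        (I.ideal ⟨⊤, isAffineOpen_top Y⟩).map f.appTop.hom := equivOfIsAffine.apply_symm_apply _
    have : I.comap f ≤ K := by
      rw [← le_map_iff_comap_le]
      refine le_of_isAffine ?_
      rw [key, hK, ← Ideal.map_le_iff_le_comap]
    exact (this _).trans hK.le
  · rw [Ideal.map_le_iff_le_comap, ← key]
    exact I.le_map_comap f _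

lemma ideal_comap_ι (I : Y.IdealSheafData) (U : Y.affineOpens) :
    haveI : IsAffine U.1.toScheme := U.2
    (I.comap U.1.ι).ideal ⟨⊤, isAffineOpen_top U.1.toScheme⟩ =
      (I.ideal U).map U.1.topIso.inv.hom := by
  have : IsAffine U.1.toScheme := U.2
  have h : U.1.ι ''ᵁ ⊤ ≤ U.1 := by simp
  have e := I.map_ideal (U := ⟨U.1.ι ''ᵁ ⊤, (isAffineOpen_top U.1.toScheme).image_of_isOpenImmersion _⟩)
    (V := U) h
  refine (ideal_comap_of_isOpenImmersion I U.1.ι ⟨⊤, isAffineOpen_top U.1.toScheme⟩).trans ?_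
  rw [Scheme.Opens.ι_appIso]
  exact e.symm

/-- Sections of a pulled back ideal sheaf. -/
lemma ideal_comap (I : Y.IdealSheafData) (f : X ⟶ Y) (U : Y.affineOpens) (V : X.affineOpens)
    (h : V.1 ≤ f ⁻¹ᵁ U.1) :
    (I.comap f).ideal V = (I.ideal U).map ((rs h).comp (pb f U.1)) := by
  have : IsAffine U.1.toScheme := U.2
  have : IsAffine V.1.toScheme := V.2
  have h1 := ideal_comap_ι (I.comap f) V
  have h2 : V.1.ι ≫ f = f.resLE _ _ h ≫ U.1.ι := by simp
  rw [← comap_comp, h2, comap_comp, ideal_comap_top, ideal_comap_ι, Ideal.map_map] at h1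
  apply_fun Ideal.map V.1.topIso.hom.hom at h1
  rw [Ideal.map_map, Ideal.map_map, ← CommRingCat.hom_comp, ← CommRingCat.hom_comp,
    ← CommRingCat.hom_comp, Iso.inv_hom_id, CommRingCat.hom_id, Ideal.map_id] at h1
  rw [← h1]
  have h3 : (U.1.topIso.inv ≫ (f.resLE _ _ h).appTop) ≫ V.1.topIso.hom = f.appLE _ _ h := by
    rw [Scheme.Hom.appTop, Scheme.Hom.resLE_app_top]
    simp only [Category.assoc, Iso.inv_hom_id_assoc, Iso.inv_hom_id, Category.comp_id]
  rw [h3]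
  rfl

/-- Ideal sheaf of finite type. -/
def IsFG (J : Y.IdealSheafData) : Prop := ∀ U : Y.affineOpens, (J.ideal U).FG

lemma IsFG.of_local {J : Y.IdealSheafData}
    (h : ∀ y : Y, ∃ U : Y.affineOpens, y ∈ U.1 ∧ (J.ideal U).FG) : IsFG J := by
  intro U
  refine Ideal.fg_of_localizationSpan {r | (J.ideal (Y.affineBasicOpen r)).FG} ?_ ?_
  · rw [← U.2.iSup_basicOpen_eq_self_iff]
    refine le_antisymm (iSup_le fun r ↦ Y.basicOpen_le _) fun x hx ↦ ?_
    obtain ⟨V, hxV, hV⟩ := h x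
    obtain ⟨r, s, hrs, hr⟩ := exists_basicOpen_le_affine_inter U.2 V.2 x ⟨hx, hxV⟩
    refine TopologicalSpace.Opens.mem_iSup.mpr ⟨⟨r, ?_⟩, hr⟩
    have hle : Y.affineBasicOpen r ≤ V := hrs.le.trans (Y.basicOpen_le s)
    change (J.ideal _).FG
    rw [← J.map_ideal hle]
    exact hV.map _
  · rintro ⟨r, hr⟩
    have := U.2.isLocalization_basicOpen r
    let e := IsLocalization.algEquiv (.powers r) Γ(Y, Y.basicOpen r) (Localization.Away r)
    change (J.ideal _).FG at hr
    rw [← J.map_ideal (Y.affineBasicOpen_le r)] at hr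
    have h2 := hr.map e.toRingEquiv.toRingHom
    erw [Ideal.map_map] at h2
    convert h2
    ext x
    exact (e.commutes x).symm

lemma IsFG.comap {J : Y.IdealSheafData} (h : IsFG J) (f : X ⟶ Y) : IsFG (J.comap f) := by
  refine .of_local fun x ↦ ?_
  obtain ⟨U, V, hV, hx⟩ := exists_small x f
  refine ⟨V, hx, ?_⟩
  rw [ideal_comap J f U V hV]
  exact (h U).map _

end IdealSheaves

lemma exists_lift {X Y : Scheme.{u}} (f : X ⟶ Y) [QuasiCompact f] [QuasiSeparated f]
    (U V : Y.affineOpens) (h : V.1 ≤ U.1) (r : Γ(Y, U.1))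
    (hV : V.1 = Y.basicOpen r) (x : Γ(X, f ⁻¹ᵁ V.1)) :
    ∃ (n : ℕ) (y : Γ(X, f ⁻¹ᵁ U.1)),
      rs (f.preimage_mono h) y = rs (f.preimage_mono h) (pb f _ r) ^ n * x := by
  obtain ⟨V, hV'⟩ := V
  obtain rfl : V = _ := hV
  have key : ∀ (W : X.Opens) (hW : W ≤ f ⁻¹ᵁ U.1) (_ : W = X.basicOpen (f.app U.1 r)) (x : Γ(X, W)),
      ∃ (n : ℕ) (y : Γ(X, f ⁻¹ᵁ U.1)), rs hW y = rs hW (pb f _ r) ^ n * x := by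
    rintro _ hW rfl x
    exact exists_eq_pow_mul_of_isCompact_of_isQuasiSeparated _ _
      (f.isCompact_preimage U.2.isCompact)
      (f.isQuasiSeparated_preimage U.2.isQuasiSeparated) _ x
  exact key _ _ (Scheme.preimage_basicOpen f r) x

lemma IsFG.prod {Y : Scheme.{u}} {A : Type*} {s : Finset A} {J : A → Y.IdealSheafData} (h : ∀ a, IsFG (J a)) :
    IsFG (∏ a ∈ s, J a) := by
  classical
  induction s using Finset.induction with
  | empty =>
    intro U
    rw [Finset.prod_empty]
    exact ⟨{1}, by simp⟩
  | insert a s ha ih =>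
    intro U
    rw [Finset.prod_insert ha]
    exact (h a U).mul (ih U)

lemma IsFG.quasiCompact_compl {Y : Scheme.{u}} {J : Y.IdealSheafData} (h : IsFG J) :
    QuasiCompact (Opens.ι J.support.compl) := by
  refine quasiCompact_iff_forall_isAffineOpen.mpr fun U hU ↦ ?_
  obtain ⟨T, hT⟩ := h ⟨U, hU⟩
  rw [(Opens.ι J.support.compl).isOpenEmbedding.isInducing.isCompact_iff]
  have : (Opens.ι J.support.compl) '' ((Opens.ι J.support.compl) ⁻¹ᵁ U) =
      ⋃ d ∈ T, (Y.basicOpen d : Set Y) := by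
    ext x
    simp only [Set.mem_iUnion, Set.mem_image]
    constructor
    · rintro ⟨⟨x, hx⟩, hxU, rfl⟩
      have h2 := (J.mem_support_iff_of_mem (U := ⟨U, hU⟩) hxU).not.mp hx
      rw [← hT, zeroLocus_span, mem_zeroLocus_iff] at h2
      push Not at h2
      obtain ⟨d, hd, hxd⟩ := h2
      exact ⟨d, hd, hxd⟩
    · rintro ⟨d, hd, hxd⟩
      have hxU : x ∈ U := Y.basicOpen_le d hxd
      refine ⟨⟨x, (J.mem_support_iff_of_mem (U := ⟨U, hU⟩) hxU).not.mpr ?_⟩, hxU, rfl⟩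
      rw [← hT, zeroLocus_span, mem_zeroLocus_iff]
      push Not
      exact ⟨d, hd, hxd⟩
  rw [this]
  exact T.finite_toSet.isCompact_biUnion fun d _ ↦ (hU.basicOpen d).isCompact

section Dilatation

/-- A finite family of pairs `(J a, I a)` of ideal sheaves on `Y`, the `J a` being of finite type;
`J a` is the ideal of a divisor and `I a` the ideal of a closed subscheme. -/
structure Centers (Y : Scheme.{u}) (A : Type*) where
  J : A → Y.IdealSheafData
  I : A → Y.IdealSheafData
  fg : ∀ a, IsFG (J a)

variable {Y : Scheme.{u}} {A : Type*} [Fintype A] (𝓒 : Centers Y A)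

/-- The product of the ideals of the divisors. -/
def Centers.prod : Y.IdealSheafData := ∏ a, 𝓒.J a

/-- The complement of the divisors. -/
def Centers.compl : Y.Opens := 𝓒.prod.support.compl

instance : QuasiCompact 𝓒.compl.ι := (IsFG.prod 𝓒.fg).quasiCompact_compl

/-- The ideal of the `d` such that `d * s` is the restriction of a section of `I`. -/
def colon {V : Y.Opens} {U : Y.Opens} (I : Ideal Γ(Y, U)) (s : Γ(V.toScheme, V.ι ⁻¹ᵁ U)) :
    Ideal Γ(Y, U) where
  carrier := {d | ∃ c ∈ I, pb V.ι U d * s = pb V.ι U c}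
  add_mem' := by
    rintro d d' ⟨c, hc, e⟩ ⟨c', hc', e'⟩
    exact ⟨c + c', I.add_mem hc hc', by rw [map_add, map_add, add_mul, e, e']⟩
  zero_mem' := ⟨0, I.zero_mem, by simp⟩
  smul_mem' := by
    rintro b d ⟨c, hc, e⟩
    exact ⟨b * c, I.mul_mem_left b hc, by rw [smul_eq_mul, map_mul, map_mul, mul_assoc, e]⟩

/-- The sections `s` on the complement of the divisors such that `J a * s ⊆ I a` for some `a`. If
`J a` is generated by `t`, these are the fractions `c / t` with `c` in `I a`. -/
def Centers.fractions (U : Y.affineOpens) : Set Γ(𝓒.compl.toScheme, 𝓒.compl.ι ⁻¹ᵁ U.1) :=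
  {s | ∃ a, (𝓒.J a).ideal U ≤ colon ((𝓒.I a).ideal U) s}

/-- The quasi-coherent algebra generated by the fractions. -/
def Centers.algebra : QCSubalgebra 𝓒.compl.ι where
  B U := Subring.closure (Set.range (pb 𝓒.compl.ι U.1) ∪ 𝓒.fractions U)
  app_mem U a := Subring.subset_closure (.inl ⟨a, rfl⟩)
  res_mem := by
    intro U V h x hx
    rw [← Subring.mem_comap]
    refine (Subring.closure_le (t := Subring.comap _ _)).mpr ?_ hx
    rintro _ (⟨b, rfl⟩ | ⟨a, ha⟩)
    · exact Subring.subset_closure (.inl ⟨rs h b, pb_rs _ _ _⟩)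
    · refine Subring.subset_closure (.inr ⟨a, ?_⟩)
      rw [← (𝓒.J a).map_ideal (U := U) (V := V) h, Ideal.map_le_iff_le_comap]
      intro d hd
      obtain ⟨c, hc, e⟩ := ha hd
      refine ⟨rs h c, ?_, ?_⟩
      · rw [← (𝓒.I a).map_ideal (U := U) (V := V) h]
        exact Ideal.mem_map_of_mem _ hc
      · change pb _ _ (rs h d) * _ = _
        rw [pb_rs, pb_rs, ← e, map_mul]
  loc := by
    intro U W h r hW x hx
    have hr : rs (𝓒.compl.ι.preimage_mono h) (pb 𝓒.compl.ι _ r) = pb 𝓒.compl.ι W.1 (rs h r) :=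
      (pb_rs _ _ _).symm
    obtain ⟨W, hW'⟩ := W
    obtain rfl : W = _ := hW
    have hloc := U.2.isLocalization_basicOpen r
    induction hx using Subring.closure_induction with
    | mem x hx =>
      obtain (⟨b, rfl⟩ | ⟨a, ha⟩) := hx
      · obtain ⟨n, b', e⟩ := IsLocalization.Away.surj r b
        refine ⟨n, pb _ _ b', Subring.subset_closure (.inl ⟨b', rfl⟩), ?_⟩
        rw [← pb_rs _ h, hr, ← map_pow, ← map_mul, mul_comm]
        exact congr(pb _ _ $(e.symm))
      · obtain ⟨n, s', hs'⟩ := exists_lift 𝓒.compl.ι U ⟨_, hW'⟩ h r rfl x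
        have key (d : Γ(Y, U.1)) : ∃ k, d ∈ (𝓒.J a).ideal U →
            ∀ k' ≥ k, d ∈ colon ((𝓒.I a).ideal U) (pb 𝓒.compl.ι U.1 r ^ k' * s') := by
          by_cases hd : d ∈ (𝓒.J a).ideal U
          · have hd' : rs h d ∈ (𝓒.J a).ideal ⟨_, hW'⟩ := by
              rw [← (𝓒.J a).map_ideal (U := ⟨_, hW'⟩) (V := U) h]
              exact Ideal.mem_map_of_mem _ hd
            obtain ⟨c, hc, e⟩ := ha hd'
            have : ∃ m, ∃ c' ∈ (𝓒.I a).ideal U, rs h c' = rs h r ^ m * c := by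
              rw [← (𝓒.I a).map_ideal (U := ⟨_, hW'⟩) (V := U) h] at hc
              obtain ⟨⟨⟨c', hc'⟩, ⟨_, m, rfl⟩⟩, e⟩ :=
                (IsLocalization.mem_map_algebraMap_iff (.powers r) Γ(Y, Y.basicOpen r)).mp hc
              refine ⟨m, c', hc', ?_⟩
              rw [mul_comm, ← map_pow]
              exact e.symm
            obtain ⟨m, c', hc', e'⟩ := this
            have h1 := (pb_rs 𝓒.compl.ι h d).symm
            have h2 := (pb_rs 𝓒.compl.ι h c').symm
            rw [e', map_mul, map_pow] at h2
            obtain ⟨N, hN⟩ := exists_pow_mul_eq 𝓒.compl.ι U ⟨_, hW'⟩ h r rfl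
              (pb _ _ d * s' * pb _ _ r ^ m) (pb _ _ (c' * r ^ n)) (by
                simp only [map_mul, map_pow, hs', hr, h1, h2]
                linear_combination (pb 𝓒.compl.ι (Y.basicOpen r) (rs h r)) ^ (n + m) * e)
            refine ⟨N + m, fun _ k hk ↦ ?_⟩
            obtain ⟨l, rfl⟩ := Nat.exists_eq_add_of_le hk
            refine ⟨r ^ (l + N) * (c' * r ^ n), ?_, ?_⟩
            · exact Ideal.mul_mem_left _ _ (Ideal.mul_mem_right _ _ hc')
            · rw [map_mul (pb _ _) (r ^ (l + N)), map_pow]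
              linear_combination (pb 𝓒.compl.ι U.1 r) ^ l * hN
          · exact ⟨0, fun h ↦ (hd h).elim⟩
        choose k hk using key
        obtain ⟨T, hT⟩ := 𝓒.fg a U
        refine ⟨T.sup k + n, pb _ _ r ^ T.sup k * s', Subring.subset_closure (.inr ⟨a, ?_⟩), ?_⟩
        · rw [← hT]
          refine Ideal.span_le.mpr fun d hd ↦ hk d ?_ _ (Finset.le_sup hd)
          rw [← hT]
          exact Ideal.subset_span hd
        · rw [map_mul, map_pow, hs']
          ring
    | zero => exact ⟨0, 0, Subring.zero_mem _, by simp⟩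
    | one => exact ⟨0, 1, Subring.one_mem _, by simp⟩
    | add x y _ _ hx hy =>
      obtain ⟨n, x', hx', e⟩ := hx
      obtain ⟨m, y', hy', e'⟩ := hy
      refine ⟨n + m, pb _ _ r ^ m * x' + pb _ _ r ^ n * y', ?_, ?_⟩
      · exact Subring.add_mem _
          (Subring.mul_mem _ (Subring.pow_mem _ (Subring.subset_closure (.inl ⟨r, rfl⟩)) _) hx')
          (Subring.mul_mem _ (Subring.pow_mem _ (Subring.subset_closure (.inl ⟨r, rfl⟩)) _) hy')
      · rw [map_add, map_mul, map_mul, map_pow, map_pow, e, e']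
        ring
    | neg x _ hx =>
      obtain ⟨n, x', hx', e⟩ := hx
      exact ⟨n, -x', Subring.neg_mem _ hx', by rw [map_neg, e]; ring⟩
    | mul x y _ _ hx hy =>
      obtain ⟨n, x', hx', e⟩ := hx
      obtain ⟨m, y', hy', e'⟩ := hy
      exact ⟨n + m, x' * y', Subring.mul_mem _ hx' hy', by rw [map_mul, e, e']; ring⟩

/-- The dilatation of `Y`. -/
def Centers.dil : Scheme.{u} := 𝓒.algebra.spec

/-- The structure morphism of the dilatation. -/
def Centers.dilProj : 𝓒.dil ⟶ Y := 𝓒.algebra.toBase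

instance : IsAffineHom 𝓒.dilProj := inferInstanceAs (IsAffineHom 𝓒.algebra.toBase)

/-- Compatibility of centers with a morphism. -/
def Centers.Compat {Y' : Scheme.{u}} {A' : Type*} (𝓒' : Centers Y' A') (𝓒 : Centers Y A)
    (g : Y' ⟶ Y) : Prop :=
  ∀ a, ∃ b, (𝓒.J a).comap g = 𝓒'.J b ∧ (𝓒.I a).comap g ≤ 𝓒'.I b

variable {𝓒} {Y' : Scheme.{u}} {A' : Type*} [Fintype A'] {𝓒' : Centers Y' A'} {g : Y' ⟶ Y}

lemma Centers.mem_compl {y : Y} : y ∈ 𝓒.compl ↔ ∀ a, y ∉ (𝓒.J a).support := by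
  classical
  have (s : Finset A) : y ∈ (∏ a ∈ s, 𝓒.J a).support ↔ ∃ a ∈ s, y ∈ (𝓒.J a).support := by
    induction s using Finset.induction with
    | empty =>
      rw [Finset.prod_empty, Scheme.IdealSheafData.one_eq_top, Scheme.IdealSheafData.support_top]
      simp only [Finset.notMem_empty, false_and, exists_false, iff_false]
      exact fun h ↦ h
    | insert a s ha ih =>
      rw [Finset.prod_insert ha, Scheme.IdealSheafData.support_mul]
      change (_ ∨ _) ↔ _
      rw [Finset.exists_mem_insert, ← ih]
      rfl
  have h2 := (this Finset.univ).not
  simp only [Finset.mem_univ, true_and, not_exists] at h2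
  exact h2

lemma Centers.Compat.compl_le (H : 𝓒'.Compat 𝓒 g) : 𝓒'.compl ≤ g ⁻¹ᵁ 𝓒.compl := by
  intro y hy
  change g y ∈ 𝓒.compl
  rw [mem_compl] at hy ⊢
  intro a ha
  obtain ⟨b, hb, -⟩ := H a
  apply hy b
  rw [← hb, Scheme.IdealSheafData.support_comap]
  exact ha

lemma Centers.Compat.comm (H : 𝓒'.Compat 𝓒 g) :
    𝓒'.compl.ι ≫ g = g.resLE _ _ H.compl_le ≫ 𝓒.compl.ι := by simp

lemma Centers.Compat.mapsTo (H : 𝓒'.Compat 𝓒 g) :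
    QCSubalgebra.MapsTo 𝓒.algebra 𝓒'.algebra H.comm := by
  intro U U' hU s hs
  rw [← RingHom.comp_apply, ← Subring.mem_comap]
  refine (Subring.closure_le (t := Subring.comap _ _)).mpr ?_ hs
  have key (c : Γ(Y, U.1)) : ((rs (le_of_comm H.comm hU)).comp (pb (g.resLE _ _ H.compl_le) _))
      (pb 𝓒.compl.ι U.1 c) = pb 𝓒'.compl.ι U'.1 (rs hU (pb g U.1 c)) := by
    rw [pb_rs]
    exact (pb_congr H.comm (𝓒'.compl.ι.preimage_mono hU) c).symm
  rintro _ (⟨b, rfl⟩ | ⟨a, ha⟩)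
  · exact Subring.subset_closure (.inl ⟨_, (key b).symm⟩)
  · obtain ⟨b, hb, hb'⟩ := H a
    refine Subring.subset_closure (.inr ⟨b, ?_⟩)
    rw [← hb, ideal_comap _ g U U' hU, Ideal.map_le_iff_le_comap]
    intro d hd
    obtain ⟨c, hc, e⟩ := ha hd
    refine ⟨rs hU (pb g U.1 c), hb' _ ?_, ?_⟩
    · rw [ideal_comap _ g U U' hU]
      exact Ideal.mem_map_of_mem _ hc
    · rw [← key, ← e, map_mul, key]
      rfl

/-- The functoriality of dilatations. -/
def Centers.Compat.map (H : 𝓒'.Compat 𝓒 g) : 𝓒'.dil ⟶ 𝓒.dil := QCSubalgebra.map H.mapsTo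

lemma Centers.Compat.map_proj (H : 𝓒'.Compat 𝓒 g) : H.map ≫ 𝓒.dilProj = 𝓒'.dilProj ≫ g :=
  QCSubalgebra.map_toBase H.mapsTo

lemma Centers.Compat.map_eq_id {g : Y ⟶ Y} (H : 𝓒.Compat 𝓒 g) (hg : g = 𝟙 Y) : H.map = 𝟙 _ :=
  QCSubalgebra.map_eq_id H.mapsTo hg (by
    rw [← cancel_mono (Opens.ι _), ← H.comm, hg, Category.comp_id, Category.id_comp])

lemma Centers.Compat.map_eq_comp {Y'' : Scheme.{u}} {A'' : Type*} [Fintype A'']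
    {𝓒'' : Centers Y'' A''} {g' : Y'' ⟶ Y'} {g'' : Y'' ⟶ Y} (H : 𝓒'.Compat 𝓒 g)
    (H' : 𝓒''.Compat 𝓒' g') (H'' : 𝓒''.Compat 𝓒 g'') (hg : g'' = g' ≫ g) :
    H''.map = H'.map ≫ H.map :=
  QCSubalgebra.map_eq_comp H.mapsTo H'.mapsTo H''.mapsTo hg (by
    rw [← cancel_mono (Opens.ι _), ← H''.comm, Category.assoc, ← H.comm, ← Category.assoc,
      ← H'.comm, hg, Category.assoc])

end Dilatation
/-- The category `Δ̃`: the full subcategory of the category of sets with the objects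
`[0, n] = {0, …, n}`. -/
structure OSimp where
  /-- The integer `n`. -/
  len : ℕ

namespace OSimp

instance : Category OSimp where
  Hom m n := Fin (m.len + 1) → Fin (n.len + 1)
  id _ := id
  comp f g := g ∘ f

/-- The morphism given by a map. -/
def of {m n : ℕ} (f : Fin (m + 1) → Fin (n + 1)) : OSimp.mk m ⟶ OSimp.mk n := f

end OSimp

/-- Oversimplicial objects. -/
abbrev OS (C : Type*) [Category C] := OSimpᵒᵖ ⥤ C
section DilOS

variable (Y : OS Scheme.{u}) {A : ℕ → Type*} [∀ n, Fintype (A n)]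
  (𝓒 : ∀ n, Centers (Y.obj (.op ⟨n⟩)) (A n))

/-- The dilatations of the members of an oversimplicial scheme. -/
def dilOS (H : ∀ ⦃m n⦄ (f : OSimp.mk m ⟶ OSimp.mk n), (𝓒 n).Compat (𝓒 m) (Y.map f.op)) :
    OS Scheme.{u} where
  obj n := (𝓒 n.unop.len).dil
  map f := (H f.unop).map
  map_id n := (H (𝟙 n.unop)).map_eq_id (Y.map_id n)
  map_comp f g := (H g.unop).map_eq_comp (H f.unop) _ (Y.map_comp f g)

/-- The structure morphism of the dilatations. -/
def dilOSProj (H : ∀ ⦃m n⦄ (f : OSimp.mk m ⟶ OSimp.mk n), (𝓒 n).Compat (𝓒 m) (Y.map f.op)) :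
    dilOS Y 𝓒 H ⟶ Y where
  app n := (𝓒 n.unop.len).dilProj
  naturality _ _ f := (H f.unop).map_proj

end DilOS

section Quotient

variable {X Y : Scheme.{u}} {f : X ⟶ Y} [QuasiCompact f] [QuasiSeparated f] {ι : Type*} [Finite ι]
  (σ : ι → (X ⟶ X)) (hσ : ∀ i, σ i ≫ f = f)

lemma preimage_le_of_comp_eq {X Y : Scheme.{u}} {f : X ⟶ Y} {σ : X ⟶ X} (h : σ ≫ f = f)
    (U : Y.Opens) : f ⁻¹ᵁ U ≤ σ ⁻¹ᵁ f ⁻¹ᵁ U := by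
  rw [← Scheme.Hom.comp_preimage, h]

/-- The action of an automorphism of `X` over `Y` on sections. -/
def act {X Y : Scheme.{u}} {f : X ⟶ Y} {σ : X ⟶ X} (h : σ ≫ f = f) (U : Y.Opens) :
    Γ(X, f ⁻¹ᵁ U) →+* Γ(X, f ⁻¹ᵁ U) :=
  (rs (preimage_le_of_comp_eq h U)).comp (pb σ (f ⁻¹ᵁ U))

lemma act_rs {X Y : Scheme.{u}} {f : X ⟶ Y} {σ : X ⟶ X} (h : σ ≫ f = f) {U V : Y.Opens}
    (hU : U ≤ V) (x : Γ(X, f ⁻¹ᵁ V)) :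
    act h U (rs (f.preimage_mono hU) x) = rs (f.preimage_mono hU) (act h V x) := by
  simp only [act, RingHom.comp_apply, pb_rs, rs_rs]

lemma act_pb {X Y : Scheme.{u}} {f : X ⟶ Y} {σ : X ⟶ X} (h : σ ≫ f = f) (U : Y.Opens)
    (a : Γ(Y, U)) : act h U (pb f U a) = pb f U a :=
  (pb_congr h (preimage_le_of_comp_eq h U) a).trans (rs_self _ _)

/-- The sections of `X` invariant under the `σ i`. -/
def invariants : QCSubalgebra f where
  B U := ⨅ i, (act (hσ i) U.1).eqLocus (RingHom.id _)
  app_mem U a := Subring.mem_iInf.mpr fun i ↦ act_pb (hσ i) U.1 a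
  res_mem h x hx := Subring.mem_iInf.mpr fun i ↦
    (act_rs (hσ i) h x).trans congr(rs _ $(Subring.mem_iInf.mp hx i))
  loc U W h r hW x hx := by
    have := Fintype.ofFinite ι
    obtain ⟨n, y, e⟩ := exists_lift f U W h r hW x
    have (i : ι) : ∃ k, pb f _ r ^ k * act (hσ i) U.1 y = pb f _ r ^ k * y := by
      refine exists_pow_mul_eq f U W h r hW _ _ ?_
      rw [← act_rs (hσ i) h, e, map_mul, map_pow, act_rs (hσ i) h, act_pb,
        show act (hσ i) W.1 x = x from Subring.mem_iInf.mp hx i]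
    choose k hk using this
    refine ⟨∑ i, k i + n, pb f _ r ^ (∑ i, k i) * y, Subring.mem_iInf.mpr fun i ↦ ?_, ?_⟩
    · change act (hσ i) U.1 _ = _
      obtain ⟨l, hl⟩ := Nat.exists_eq_add_of_le'
        (Finset.single_le_sum (f := k) (fun _ _ ↦ Nat.zero_le _) (Finset.mem_univ i))
      rw [map_mul, map_pow, act_pb, hl, pow_add, mul_assoc, hk, RingHom.id_apply, mul_assoc]
    · rw [map_mul, map_pow, e, pow_add, mul_assoc]

end Quotient

section QuotOS

variable {C : Type*} [Category C] {𝒳 𝒴 : C ⥤ Scheme.{u}} (φ : 𝒳 ⟶ 𝒴)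
  [∀ c, QuasiCompact (φ.app c)] [∀ c, QuasiSeparated (φ.app c)] {ι : Type*} [Finite ι]
  (σ : ι → (𝒳 ⟶ 𝒳)) (hσ : ∀ i, σ i ≫ φ = φ)

lemma mapsTo_invariants {c d : C} (g : c ⟶ d) :
    QCSubalgebra.MapsTo
      (invariants (fun i ↦ (σ i).app d) fun i ↦ congr($(hσ i).app d))
      (invariants (fun i ↦ (σ i).app c) fun i ↦ congr($(hσ i).app c)) (φ.naturality g).symm := by
  intro U U' hU s hs
  refine Subring.mem_iInf.mpr fun i ↦ ?_
  have hi : act congr($(hσ i).app d) U.1 s = s := Subring.mem_iInf.mp hs i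
  have e := (σ i).naturality g
  have hle : φ.app c ⁻¹ᵁ U'.1 ≤ (𝒳.map g ≫ (σ i).app d) ⁻¹ᵁ φ.app d ⁻¹ᵁ U.1 :=
    (le_of_comm (φ.naturality g).symm hU).trans
      ((𝒳.map g).preimage_mono (preimage_le_of_comp_eq congr($(hσ i).app d) U.1))
  have h1 := pb_congr e hle s
  change rs _ (pb ((σ i).app c) _ (rs _ _)) = rs _ _
  rw [pb_rs, rs_rs]
  refine h1.symm.trans ?_
  conv_rhs => rw [← hi]
  rw [act, RingHom.comp_apply, pb_rs, rs_rs]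
  rfl

/-- The quotient of a diagram of schemes by a finite group (or set) of automorphisms. -/
def quotOS : C ⥤ Scheme.{u} where
  obj c := (invariants (fun i ↦ (σ i).app c) fun i ↦ congr($(hσ i).app c)).spec
  map g := QCSubalgebra.map (mapsTo_invariants φ σ hσ g)
  map_id c := QCSubalgebra.map_eq_id _ (𝒴.map_id c) (𝒳.map_id c)
  map_comp g g' := QCSubalgebra.map_eq_comp _ _ _ (𝒴.map_comp g g') (𝒳.map_comp g g')

/-- The structure morphism of the quotient. -/
def quotOSProj : quotOS φ σ hσ ⟶ 𝒴 where
  app c := (invariants (fun i ↦ (σ i).app c) fun i ↦ congr($(hσ i).app c)).toBase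
  naturality _ _ g := QCSubalgebra.map_toBase (mapsTo_invariants φ σ hσ g)

end QuotOS

section Powers

variable {C : Type*} [Category C] [HasFiniteProducts C]

/-- The oversimplicial object `n ↦ X ^ (n + 1)`. -/
def power (X : C) : OS C where
  obj n := ∏ᶜ fun _ : Fin (n.unop.len + 1) ↦ X
  map f := Pi.lift fun j ↦ Pi.π _ (f.unop j)
  map_id n := Pi.hom_ext _ _ fun j ↦ by simp; rfl
  map_comp f g := Pi.hom_ext _ _ fun j ↦ by simp; rfl

/-- The functoriality of powers. -/
def powerMap {X Y : C} (v : X ⟶ Y) : power X ⟶ power Y where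
  app n := Limits.Pi.map fun _ ↦ v
  naturality m n f := Pi.hom_ext _ _ fun j ↦ by simp [power]

lemma piMap_mem (P : MorphismProperty C) [P.IsMultiplicative] [P.IsStableUnderBaseChange]
    {X Y : C} (v : X ⟶ Y) (hv : P v) (n : ℕ) : P (Limits.Pi.map fun _ : Fin n ↦ v) := by
  induction n with
  | zero =>
    have : IsIso (Limits.Pi.map fun _ : Fin 0 ↦ v) :=
      ⟨Pi.lift fun i ↦ i.elim0, Pi.hom_ext _ _ fun i ↦ i.elim0, Pi.hom_ext _ _ fun i ↦ i.elim0⟩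
    exact P.of_isIso _
  | succ n ih =>
    let e (Z : C) : (∏ᶜ fun _ : Fin (n + 1) ↦ Z) ≅ Z ⨯ (∏ᶜ fun _ : Fin n ↦ Z) :=
      { hom := prod.lift (Pi.π _ 0) (Pi.lift fun i ↦ Pi.π _ i.succ)
        inv := Pi.lift (Fin.cases prod.fst fun i ↦ prod.snd ≫ Pi.π _ i)
        hom_inv_id := Pi.hom_ext _ _ (Fin.cases (by simp [Limits.prod.lift_fst, Limits.prod.lift_fst_assoc, Limits.prod.lift_snd, Limits.prod.lift_snd_assoc]) (by simp [Limits.prod.lift_fst, Limits.prod.lift_fst_assoc, Limits.prod.lift_snd, Limits.prod.lift_snd_assoc]))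
        inv_hom_id := prod.hom_ext (by simp [Limits.prod.lift_fst, Limits.prod.lift_fst_assoc, Limits.prod.lift_snd, Limits.prod.lift_snd_assoc]) (Pi.hom_ext _ _ (by simp [Limits.prod.lift_fst, Limits.prod.lift_fst_assoc, Limits.prod.lift_snd, Limits.prod.lift_snd_assoc])) }
    have h : (Limits.Pi.map fun _ : Fin (n + 1) ↦ v) = (e X).hom ≫ prod.map v (𝟙 _) ≫
        prod.map (𝟙 _) (Limits.Pi.map fun _ : Fin n ↦ v) ≫ (e Y).inv :=
      Pi.hom_ext _ _ (Fin.cases (by simp [e, Limits.prod.lift_fst, Limits.prod.lift_fst_assoc, Limits.prod.lift_snd, Limits.prod.lift_snd_assoc]) (by simp [e, Limits.prod.lift_fst, Limits.prod.lift_fst_assoc, Limits.prod.lift_snd, Limits.prod.lift_snd_assoc]))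
    rw [h]
    refine P.comp_mem _ _ (@MorphismProperty.of_isIso _ _ P _ _ _ _ _ (e X).isIso_hom)
      (P.comp_mem _ _ ?_ (P.comp_mem _ _ ?_ (@MorphismProperty.of_isIso _ _ P _ _ _ _ _ (e Y).isIso_inv)))
    · exact P.of_isPullback (IsPullback.of_prod_fst_with_id v _) hv
    · have h2 : prod.map (𝟙 Y) (Limits.Pi.map fun _ : Fin n ↦ v) =
          (prod.braiding _ _).hom ≫ prod.map (Limits.Pi.map fun _ : Fin n ↦ v) (𝟙 Y) ≫
            (prod.braiding _ _).hom := by ext <;> simp [Limits.prod.lift_fst, Limits.prod.lift_fst_assoc, Limits.prod.lift_snd, Limits.prod.lift_snd_assoc]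
      rw [h2]
      exact P.comp_mem _ _ (P.of_isIso _) (P.comp_mem _ _
        (P.of_isPullback (IsPullback.of_prod_fst_with_id _ _) ih) (P.of_isIso _))

end Powers

section OverPowers

variable {S : Scheme.{u}}

/-- The oversimplicial scheme of fibred powers of a scheme `X` over `S`. -/
def schPower (X : Over S) : OS Scheme.{u} := power X ⋙ Over.forget S

/-- The functoriality of fibred powers. -/
def schPowerMap {X Y : Over S} (v : X ⟶ Y) : schPower X ⟶ schPower Y :=
  Functor.whiskerRight (powerMap v) (Over.forget S)

lemma schPowerMap_mem (P : MorphismProperty Scheme.{u}) [P.IsMultiplicative]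
    [P.IsStableUnderBaseChange] {X Y : Over S} (v : X ⟶ Y) (hv : P v.left) (n) :
    P ((schPowerMap v).app n) := by
  let Q : MorphismProperty (Over S) := P.inverseImage (Over.forget S)
  have : Q.IsStableUnderBaseChange := ⟨fun h h' ↦ P.of_isPullback (h.map (Over.forget S)) h'⟩
  exact piMap_mem Q v hv _

instance {X Y : Over S} (v : X ⟶ Y) [QuasiCompact v.left] (n) :
    QuasiCompact ((schPowerMap v).app n) := schPowerMap_mem @QuasiCompact v ‹_› n

instance {X Y : Over S} (v : X ⟶ Y) [QuasiSeparated v.left] (n) :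
    QuasiSeparated ((schPowerMap v).app n) := schPowerMap_mem @QuasiSeparated v ‹_› n

end OverPowers

section Normalization

variable {X Y X' Y' : Scheme.{u}} {f : X ⟶ Y} {f' : X' ⟶ Y'} [QuasiCompact f] [QuasiSeparated f]
  [QuasiCompact f'] [QuasiSeparated f'] {h : X' ⟶ X} {g : Y' ⟶ Y}

instance : IsSchemeTheoreticallyDominant f.toNormalization := ⟨f.ker_toNormalization⟩

/-- The functoriality of the relative normalization. -/
def normMap (e : f' ≫ g = h ≫ f) : f'.normalization ⟶ f.normalization :=
  f'.normalizationDesc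
    (pullback.lift (f := f.fromNormalization) (g := g) (h ≫ f.toNormalization) f' (by rw [Category.assoc, Hom.toNormalization_fromNormalization, e]))
    (pullback.snd f.fromNormalization g) (pullback.lift_snd _ _ _).symm ≫ pullback.fst f.fromNormalization g

lemma normMap_from (e : f' ≫ g = h ≫ f) :
    normMap e ≫ f.fromNormalization = f'.fromNormalization ≫ g := by
  rw [normMap, Category.assoc, pullback.condition, Hom.normalizationDesc_comp_assoc]

lemma to_normMap (e : f' ≫ g = h ≫ f) :
    f'.toNormalization ≫ normMap e = h ≫ f.toNormalization := by
  rw [normMap, Hom.toNormalization_normalizationDesc_assoc, pullback.lift_fst]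

lemma norm_ext {a b : f'.normalization ⟶ f.normalization}
    (h : a ≫ f.fromNormalization = b ≫ f.fromNormalization)
    (h' : f'.toNormalization ≫ a = f'.toNormalization ≫ b) : a = b :=
  ext_of_dominant f'.toNormalization f.fromNormalization a b h h'

end Normalization

section NormOS

variable {C : Type*} [Category C] {𝒳 𝒴 : C ⥤ Scheme.{u}} (φ : 𝒳 ⟶ 𝒴)
  [∀ c, QuasiCompact (φ.app c)] [∀ c, QuasiSeparated (φ.app c)]

/-- The relative normalization of a diagram of schemes. -/
def normOS : C ⥤ Scheme.{u} where
  obj c := (φ.app c).normalization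
  map g := normMap (φ.naturality g).symm
  map_id c := norm_ext (by simp [normMap_from]) (by simp [to_normMap])
  map_comp g g' := norm_ext
    (by rw [normMap_from, Category.assoc, normMap_from (φ.naturality g').symm, ← Category.assoc,
      normMap_from (φ.naturality g).symm, 𝒴.map_comp, Category.assoc])
    (by rw [to_normMap, ← Category.assoc, to_normMap (φ.naturality g).symm, Category.assoc,
      to_normMap (φ.naturality g').symm, 𝒳.map_comp, Category.assoc])

/-- The structure morphism of the relative normalization. -/
def normOSProj : normOS φ ⟶ 𝒴 where
  app c := (φ.app c).fromNormalization
  naturality _ _ g := normMap_from (φ.naturality g).symm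

end NormOS

section Etale

variable {C : Type*} [Category C] {𝒬 𝒯 : C ⥤ Scheme.{u}} (q : 𝒬 ⟶ 𝒯)

/-- The largest open subscheme étale over the base. -/
def etaleLocus {X Y : Scheme.{u}} (f : X ⟶ Y) : X.Opens := sSup {O | Etale (O.ι ≫ f)}

/-- A diagram of open subschemes. -/
def openOS (O : ∀ c, (𝒬.obj c).Opens) (hO : ∀ ⦃c d⦄ (g : c ⟶ d), O c ≤ 𝒬.map g ⁻¹ᵁ O d) :
    C ⥤ Scheme.{u} where
  obj c := (O c).toScheme
  map {c d} g := (𝒬.map g).resLE (O d) (O c) (hO g)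
  map_id c := by
    rw [← cancel_mono (Opens.ι _)]
    simp
  map_comp g g' := by
    rw [← cancel_mono (Opens.ι _)]
    simp

/-- The inclusion of the open subdiagram. -/
def openOSι (O : ∀ c, (𝒬.obj c).Opens) (hO : ∀ ⦃c d⦄ (g : c ⟶ d), O c ≤ 𝒬.map g ⁻¹ᵁ O d) :
    openOS O hO ⟶ 𝒬 where
  app c := (O c).ι
  naturality c d g := by simp [openOS]

end Etale

section Pullback

variable {C : Type*} [Category C] {𝒳 𝒴 𝒵 : C ⥤ Scheme.{u}} (f : 𝒳 ⟶ 𝒵) (g : 𝒴 ⟶ 𝒵)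

/-- The fibre product of diagrams of schemes. -/
def pbOS : C ⥤ Scheme.{u} where
  obj c := pullback (f.app c) (g.app c)
  map a := pullback.map _ _ _ _ (𝒳.map a) (𝒴.map a) (𝒵.map a)
    (f.naturality a).symm (g.naturality a).symm
  map_id c := by
    refine pullback.hom_ext ?_ ?_
    · exact (pullback.lift_fst _ _ _).trans (by simp)
    · exact (pullback.lift_snd _ _ _).trans (by simp)
  map_comp a b := by
    refine pullback.hom_ext ?_ ?_
    · simp only [pullback.map, Category.assoc, limit.lift_π, PullbackCone.mk_π_app,
        pullback.lift_fst, pullback.lift_fst_assoc, Functor.map_comp]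
    · simp only [pullback.map, Category.assoc, limit.lift_π, PullbackCone.mk_π_app,
        pullback.lift_snd, pullback.lift_snd_assoc, Functor.map_comp]

/-- The first projection. -/
def pbOSFst : pbOS f g ⟶ 𝒳 where
  app c := pullback.fst _ _
  naturality _ _ _ := pullback.lift_fst _ _ _

/-- The second projection. -/
def pbOSSnd : pbOS f g ⟶ 𝒴 where
  app c := pullback.snd _ _
  naturality _ _ _ := pullback.lift_snd _ _ _

end Pullback

section Setup

variable {S : Scheme.{u}}

/-- The projections of a fibred power. -/
def pr (X : Over S) (n : ℕ) (j : Fin (n + 1)) : (schPower X).obj (.op ⟨n⟩) ⟶ X.left :=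
  (Pi.π (fun _ : Fin (n + 1) ↦ X) j).left

lemma map_pr (X : Over S) {m n : ℕ} (f : OSimp.mk m ⟶ OSimp.mk n) (j : Fin (m + 1)) :
    (schPower X).map f.op ≫ pr X m j = pr X n (f j) :=
  (congr_arg CommaMorphism.left (Pi.lift_π (fun j ↦ Pi.π (fun _ : Fin (n + 1) ↦ X) (f j)) j) :)

lemma powerMap_comp {C : Type*} [Category C] [HasFiniteProducts C] {X Y Z : C} (v : X ⟶ Y)
    (w : Y ⟶ Z) : powerMap (v ≫ w) = powerMap v ≫ powerMap w := by
  ext n : 2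
  exact (Limits.Pi.map_comp_map (fun _ ↦ v) (fun _ ↦ w)).symm

lemma schPowerMap_comp {X Y Z : Over S} (v : X ⟶ Y) (w : Y ⟶ Z) :
    schPowerMap (v ≫ w) = schPowerMap v ≫ schPowerMap w := by
  refine (congrArg (Functor.whiskerRight · (Over.forget S)) (powerMap_comp v w)).trans
    (Functor.whiskerRight_comp (powerMap v) (powerMap w) (Over.forget S))

/-- Integral coordinates `ℤ[x_i]`. -/
abbrev coordRing (ι : Type u) : CommRingCat.{u} := .of (MvPolynomial ι (ULift.{u} ℤ))

/-- The ideal sheaf on the integral affine space generated by the monomial `∏ x_i ^ e_i`. -/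
def monoIdeal {ι : Type u} [Fintype ι] (e : ι → ℕ) : (Spec (coordRing ι)).IdealSheafData :=
  Scheme.IdealSheafData.ofIdealTop (Ideal.span {(ΓSpecIso (coordRing ι)).inv (∏ i, MvPolynomial.X i ^ e i)})

lemma monoIdeal_isFG {ι : Type u} [Fintype ι] (e : ι → ℕ) : IsFG (monoIdeal e) := by
  intro U
  rw [← (monoIdeal e).map_ideal (U := U) (V := ⟨⊤, isAffineOpen_top _⟩) (le_top (a := U.1))]
  refine Ideal.FG.map ?_ _
  have := Scheme.IdealSheafData.equivOfIsAffine.apply_symm_apply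
    (Ideal.span {(ΓSpecIso (coordRing ι)).inv (∏ i, MvPolynomial.X i ^ e i)})
  change (Scheme.IdealSheafData.equivOfIsAffine (monoIdeal e)).FG
  rw [show monoIdeal e = _ from rfl]
  erw [this]
  exact ⟨{_}, by simp; rfl⟩

/-- The unique map `[0, n] → [0, 0]`. -/
def OSimp.toPt (n : ℕ) : OSimp.mk n ⟶ OSimp.mk 0 := fun _ ↦ 0

/-- The ideal of the image of the diagonal `P_0 ⟶ P_n`. -/
def diagIdeal (P : OS Scheme.{u}) (n : ℕ) : (P.obj (.op ⟨n⟩)).IdealSheafData :=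
  (P.map (OSimp.toPt n).op).ker

lemma diagIdeal_comap (P : OS Scheme.{u}) {m n : ℕ} (f : OSimp.mk m ⟶ OSimp.mk n) :
    (diagIdeal P m).comap (P.map f.op) ≤ diagIdeal P n := by
  rw [← Scheme.IdealSheafData.le_map_iff_comap_le, diagIdeal, diagIdeal,
    show OSimp.toPt m = f ≫ OSimp.toPt n from rfl, op_comp, P.map_comp]
  exact (Scheme.IdealSheafData.map_ker _ _).ge

end Setup

section Tower


variable {S : Scheme.{u}} (X : Over S) {ι : Type u} [Fintype ι] [DecidableEq ι]
  (D : ι → X.left.IdealSheafData) (hD : ∀ i, IsFG (D i)) (m : ι → ℕ) (r : ι → ℚ)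

/-- Centers on `X ^ (n + 1)`: the divisors `pr_j^* D` and the diagonal. -/
def centersD (n : ℕ) : Centers ((schPower X).obj (.op ⟨n⟩)) (Fin (n + 1)) where
  J j := (∏ i, D i).comap (pr X n j)
  I _ := diagIdeal (schPower X) n
  fg j := (IsFG.prod hD).comap _

/-- The oversimplicial scheme `P^{(D)}`. -/
def PD : OS Scheme.{u} :=
  dilOS (schPower X) (centersD X D hD) fun _ _ f j ↦
    ⟨f j, by simp only [centersD, ← Scheme.IdealSheafData.comap_comp, map_pr],
      diagIdeal_comap _ f⟩

/-- The structure morphism. -/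
def PDProj : PD X D hD ⟶ schPower X := dilOSProj _ _ _

/-- The product of `P^{(D)}` with the affine space with coordinates `x_i`. -/
def AD : OS Scheme.{u} := PD X D hD ⋙ AffineSpace.functor.obj (.op ι)

/-- The projection. -/
def ADProj : AD X D hD ⟶ PD X D hD where
  app n := 𝔸(ι; (PD X D hD).obj n) ↘ (PD X D hD).obj n
  naturality _ _ f := AffineSpace.map_over _

/-- The coordinates `x_i`. -/
def ADCoord : AD X D hD ⟶ (Functor.const _).obj (Spec (coordRing ι)) where
  app n := AffineSpace.toSpecMvPoly ι ((PD X D hD).obj n)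
  naturality _ _ f := (AffineSpace.map_toSpecMvPoly _).trans (Category.comp_id _).symm

/-- The pullback of the ideal of `D_i` to `AD_n` by the `j`-th projection. -/
def divIdeal (n : ℕ) (j : Fin (n + 1)) (i : ι) : ((AD X D hD).obj (.op ⟨n⟩)).IdealSheafData :=
  (D i).comap ((ADProj X D hD ≫ PDProj X D hD).app (.op ⟨n⟩) ≫ pr X n j)

/-- The pullback to `AD_n` of the ideal generated by `x_i ^ m_i`. -/
def coordIdeal (n : ℕ) (i : ι) : ((AD X D hD).obj (.op ⟨n⟩)).IdealSheafData :=
  (monoIdeal (Pi.single i (m i))).comap ((ADCoord X D hD).app (.op ⟨n⟩))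

/-- Centers on `AD_n`: both `x_i ^ m_i / t` and `t / x_i ^ m_i` are adjoined, for local equations
`t` of the pullbacks of `D_i`. -/
def centersDM (n : ℕ) : Centers ((AD X D hD).obj (.op ⟨n⟩)) (Fin (n + 1) × ι × Bool) where
  J a := if a.2.2 then divIdeal X D hD n a.1 a.2.1 else coordIdeal X D hD m n a.2.1
  I a := if a.2.2 then coordIdeal X D hD m n a.2.1 else divIdeal X D hD n a.1 a.2.1
  fg a := by
    split_ifs
    · exact (hD _).comap _
    · exact (monoIdeal_isFG _).comap _

lemma divIdeal_comap {k l : ℕ} (f : OSimp.mk k ⟶ OSimp.mk l) (j : Fin (k + 1)) (i : ι) :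
    (divIdeal X D hD k j i).comap ((AD X D hD).map f.op) = divIdeal X D hD l (f j) i := by
  rw [divIdeal, divIdeal, ← Scheme.IdealSheafData.comap_comp, ← Category.assoc,
    (ADProj X D hD ≫ PDProj X D hD).naturality, Category.assoc, map_pr]

lemma coordIdeal_comap {k l : ℕ} (f : OSimp.mk k ⟶ OSimp.mk l) (i : ι) :
    (coordIdeal X D hD m k i).comap ((AD X D hD).map f.op) = coordIdeal X D hD m l i := by
  rw [coordIdeal, coordIdeal, ← Scheme.IdealSheafData.comap_comp,
    (ADCoord X D hD).naturality]
  exact congrArg (Scheme.IdealSheafData.comap _) (Category.comp_id _)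

/-- The oversimplicial scheme `P^{(D, M)}`. -/
def PDM : OS Scheme.{u} :=
  dilOS (AD X D hD) (centersDM X D hD m) fun _ _ f a ↦
    ⟨(f a.1, a.2), by
      obtain ⟨j, i, b⟩ := a
      cases b <;> simp [centersDM, divIdeal_comap, coordIdeal_comap]⟩

/-- The structure morphism. -/
def PDMProj : PDM X D hD m ⟶ AD X D hD := dilOSProj _ _ _

/-- The coordinates `x_i` on `P^{(D, M)}`. -/
def PDMCoord : PDM X D hD m ⟶ (Functor.const _).obj (Spec (coordRing ι)) :=
  PDMProj X D hD m ≫ ADCoord X D hD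

/-- Centers on `P^{(D, M)}_n`: the divisor `∏ x_i ^ (m_i (r_i - 1))` and the image of
`P^{(D, M)}_0`. -/
def centersRM (n : ℕ) : Centers ((PDM X D hD m).obj (.op ⟨n⟩)) Unit where
  J _ := (monoIdeal fun i ↦ ⌊m i * (r i - 1)⌋₊).comap ((PDMCoord X D hD m).app (.op ⟨n⟩))
  I _ := diagIdeal (PDM X D hD m) n
  fg _ := (monoIdeal_isFG _).comap _

/-- The oversimplicial scheme `P^{(R, M)}`. -/
def PRM : OS Scheme.{u} :=
  dilOS (PDM X D hD m) (centersRM X D hD m r) fun _ _ f _ ↦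
    ⟨(), by
      simp only [centersRM]
      rw [← Scheme.IdealSheafData.comap_comp, (PDMCoord X D hD m).naturality]
      exact congrArg (Scheme.IdealSheafData.comap _) (Category.comp_id _),
      diagIdeal_comap _ f⟩

/-- The structure morphism. -/
def PRMProj : PRM X D hD m r ⟶ PDM X D hD m := dilOSProj _ _ _

/-- The coordinates `x_i` on `P^{(R, M)}`. -/
def PRMCoord : PRM X D hD m r ⟶ (Functor.const _).obj (Spec (coordRing ι)) :=
  PRMProj X D hD m r ≫ PDMCoord X D hD m

/-- The canonical morphisms `P^{(R, M)}_n ⟶ X ^ (n + 1)`. -/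
def PRMToPower : PRM X D hD m r ⟶ schPower X :=
  PRMProj X D hD m r ≫ PDMProj X D hD m ≫ ADProj X D hD ≫ PDProj X D hD

/-- The ideal of the divisor `∏_{r_i > 1} x_i = 0` in the integral affine space. -/
def boundaryIdeal (r : ι → ℚ) : (Spec (coordRing ι)).IdealSheafData :=
  monoIdeal fun i ↦ if 1 < r i then 1 else 0

/-- The inclusion of the divisor `∏_{r_i > 1} x_i = 0`, as a constant diagram. -/
def boundaryι (r : ι → ℚ) : (Functor.const OSimpᵒᵖ).obj (boundaryIdeal r).subscheme ⟶
    (Functor.const _).obj (Spec (coordRing ι)) :=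
  (Functor.const _).map (boundaryIdeal r).subschemeι

/-- The boundary `T^{(R, M)}` of `P^{(R, M)}`. -/
def TRM : OS Scheme.{u} := pbOS (PRMCoord X D hD m r) (boundaryι r)

/-- The inclusion. -/
def TRMι : TRM X D hD m r ⟶ PRM X D hD m r := pbOSFst _ _

/-- The scheme `Z̃^{(M)}`, the inverse image of the boundary in `X̃^{(M)} = P^{(D, M)}_0`. -/
def ZM : Scheme.{u} := pullback ((PDMCoord X D hD m).app (.op ⟨0⟩)) (boundaryIdeal r).subschemeι

/-- The canonical morphism `T^{(R, M)}_0 ⟶ Z̃^{(M)}`. -/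
def TRMToZM : (TRM X D hD m r).obj (.op ⟨0⟩) ⟶ ZM X D hD m r :=
  pullback.map _ _ _ _ ((PRMProj X D hD m r).app _) (𝟙 _) (𝟙 _)
    (Category.comp_id _) ((Category.comp_id _).trans (Category.id_comp _).symm)

end Tower

section Torsor

/-- The morphism `V ⟶ U` is a torsor under the finite group `G` acting on `V` by `ρ`. -/
structure IsTorsor {G : Type*} [Group G] [Finite G] {V U : Scheme.{u}} (v : V ⟶ U)
    (ρ : G →* Aut V) : Prop where
  etale : Etale v
  finite : IsFinite v
  surjective : Surjective v
  comp (g : G) : (ρ g).hom ≫ v = v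
  isIso : IsIso (Sigma.desc fun g : G ↦
    pullback.lift (f := v) (g := v) (𝟙 V) (ρ g).hom ((Category.id_comp v).trans (comp g).symm))

variable {S : Scheme.{u}} (X : Over S) {ι : Type u} [Fintype ι] [DecidableEq ι]
  (D : ι → X.left.IdealSheafData) (hD : ∀ i, IsFG (D i)) (m : ι → ℕ) (r : ι → ℚ)

/-- The complement `U` of the union of the `D_i`. -/
def complement : X.left.Opens := (∏ i, D i).support.compl

/-- The complement `U` over the base. -/
def complOver : Over S := Over.mk ((complement X D).ι ≫ X.hom)

/-- The open immersion `U ⟶ X`. -/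
def complOverι : complOver X D ⟶ X := Over.homMk (complement X D).ι

variable {G : Type*} [Group G] [Finite G] {V : Scheme.{u}} (v : V ⟶ (complement X D).toScheme)
  (ρ : G →* Aut V)

/-- The covering `V` over the base. -/
def coverOver : Over S := Over.mk (v ≫ (complement X D).ι ≫ X.hom)

/-- The covering `V ⟶ U`. -/
def coverOverHom : coverOver X D v ⟶ complOver X D := Over.homMk v

instance [IsFinite v] : IsFinite (coverOverHom X D v).left := ‹IsFinite v›

lemma quasiCompact_complOverι {D : ι → X.left.IdealSheafData} (hD : ∀ i, IsFG (D i)) :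
    QuasiCompact (complOverι X D).left := (IsFG.prod hD).quasiCompact_compl

instance : IsOpenImmersion (complOverι X D).left := inferInstanceAs (IsOpenImmersion (Opens.ι _))

variable (hρ : ∀ g, (ρ g).hom ≫ v = v)

/-- The diagonal action of `G` on the powers of `V`. -/
def diagAction (g : G) : schPower (coverOver X D v) ⟶ schPower (coverOver X D v) :=
  schPowerMap (Over.homMk (ρ g).hom (by simp [coverOver, reassoc_of% hρ g]))

lemma diagAction_comp (g : G) :
    diagAction X D v ρ hρ g ≫ schPowerMap (coverOverHom X D v) = schPowerMap (coverOverHom X D v) := by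
  have : (Over.homMk (ρ g).hom (by simp [coverOver, reassoc_of% hρ g]) :
      coverOver X D v ⟶ coverOver X D v) ≫ coverOverHom X D v = coverOverHom X D v :=
    Over.OverMorphism.ext (hρ g)
  rw [diagAction, ← schPowerMap_comp, this]

variable [IsFinite v]

/-- The quotients `V ^ (n + 1) / ΔG`. -/
def CRM : OS Scheme.{u} :=
  quotOS (schPowerMap (coverOverHom X D v)) (diagAction X D v ρ hρ) (diagAction_comp X D v ρ hρ)

/-- The canonical morphisms `V ^ (n + 1) / ΔG ⟶ U ^ (n + 1) ⟶ X ^ (n + 1)`. -/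
def CRMProj : CRM X D v ρ hρ ⟶ schPower X :=
  quotOSProj (schPowerMap (coverOverHom X D v)) (diagAction X D v ρ hρ)
    (diagAction_comp X D v ρ hρ) ≫ schPowerMap (complOverι X D)

/-- The quotients `V ^ (n + 1) / ΔG × 𝔾ₘ ^ h`, as the base change of `V ^ (n + 1) / ΔG` to
`P^{(R, M)}_n`. -/
def CPRM : OS Scheme.{u} := pbOS (PRMToPower X D hD m r) (CRMProj X D v ρ hρ)

/-- The projection. -/
def CPRMProj : CPRM X D hD m r v ρ hρ ⟶ PRM X D hD m r := pbOSFst _ _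

lemma isAffineHom_quotProj (n) : IsAffineHom ((quotOSProj (schPowerMap (coverOverHom X D v))
    (diagAction X D v ρ hρ) (diagAction_comp X D v ρ hρ)).app n) :=
  inferInstanceAs (IsAffineHom (QCSubalgebra.toBase _))

lemma quasiCompact_CPRMProj (n) : QuasiCompact ((CPRMProj X D hD m r v ρ hρ).app n) := by
  have := quasiCompact_complOverι X hD
  have := isAffineHom_quotProj X D v ρ hρ n
  have : QuasiCompact ((CRMProj X D v ρ hρ).app n) :=
    MorphismProperty.comp_mem @QuasiCompact _ _
      (inferInstanceAs (QuasiCompact ((quotOSProj (schPowerMap (coverOverHom X D v))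
        (diagAction X D v ρ hρ) (diagAction_comp X D v ρ hρ)).app n)))
      (inferInstanceAs (QuasiCompact ((schPowerMap (complOverι X D)).app n)))
  exact inferInstanceAs (QuasiCompact (pullback.fst _ _))

lemma quasiSeparated_CPRMProj (n) : QuasiSeparated ((CPRMProj X D hD m r v ρ hρ).app n) := by
  have := isAffineHom_quotProj X D v ρ hρ n
  have : QuasiSeparated ((CRMProj X D v ρ hρ).app n) :=
    MorphismProperty.comp_mem @QuasiSeparated _ _
      (inferInstanceAs (QuasiSeparated ((quotOSProj (schPowerMap (coverOverHom X D v))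
        (diagAction X D v ρ hρ) (diagAction_comp X D v ρ hρ)).app n)))
      (inferInstanceAs (QuasiSeparated ((schPowerMap (complOverι X D)).app n)))
  exact inferInstanceAs (QuasiSeparated (pullback.fst _ _))

/-- The oversimplicial scheme `Q^{(R, M)}`: the normalizations of `P^{(R, M)}_n` in
`V ^ (n + 1) / ΔG × 𝔾ₘ ^ h`. -/
def QRM : OS Scheme.{u} :=
  haveI := quasiCompact_CPRMProj X D hD m r v ρ hρ
  haveI := quasiSeparated_CPRMProj X D hD m r v ρ hρ
  normOS (CPRMProj X D hD m r v ρ hρ)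

/-- The structure morphism. -/
def QRMProj : QRM X D hD m r v ρ hρ ⟶ PRM X D hD m r :=
  haveI := quasiCompact_CPRMProj X D hD m r v ρ hρ
  haveI := quasiSeparated_CPRMProj X D hD m r v ρ hρ
  normOSProj (CPRMProj X D hD m r v ρ hρ)

/-- The ramification of `V` over `U` is bounded by `R+`: the morphism `Q_1 ⟶ P_1` is étale on a
neighbourhood of the image of `Q_0 ⟶ Q_1`. -/
def IsBounded : Prop := ∃ O : ((QRM X D hD m r v ρ hρ).obj (.op ⟨1⟩)).Opens,
  Set.range ((QRM X D hD m r v ρ hρ).map (OSimp.toPt 1).op) ⊆ O ∧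
    Etale (O.ι ≫ (QRMProj X D hD m r v ρ hρ).app (.op ⟨1⟩))

/-- The largest open subscheme of `Q^{(R, M)}_n` étale over `P^{(R, M)}_n`. -/
def WRM (n) : ((QRM X D hD m r v ρ hρ).obj n).Opens :=
  etaleLocus ((QRMProj X D hD m r v ρ hρ).app n)

/-- The `W^{(R, M)}_n` form an oversimplicial open subscheme of `Q^{(R, M)}`. -/
def WRMStable : Prop := ∀ ⦃c d⦄ (g : c ⟶ d), WRM X D hD m r v ρ hρ c ≤
  (QRM X D hD m r v ρ hρ).map g ⁻¹ᵁ WRM X D hD m r v ρ hρ d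

variable (hW : WRMStable X D hD m r v ρ hρ)

/-- The oversimplicial scheme `W^{(R, M)}` over `P^{(R, M)}`. -/
def WRMProj : openOS (WRM X D hD m r v ρ hρ) hW ⟶ PRM X D hD m r :=
  openOSι (WRM X D hD m r v ρ hρ) hW ≫ QRMProj X D hD m r v ρ hρ

/-- The oversimplicial scheme `E^{(R, M)}`, the base change of `W^{(R, M)}` to `T^{(R, M)}`. -/
def ERM : OS Scheme.{u} := pbOS (TRMι X D hD m r) (WRMProj X D hD m r v ρ hρ hW)

/-- The canonical morphism `E^{(R, M)} ⟶ T^{(R, M)}`. -/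
def ERMProj : ERM X D hD m r v ρ hρ hW ⟶ TRM X D hD m r := pbOSFst _ _

end Torsor

section SNC

/-- The ideals `D i` of a locally noetherian regular scheme `X` define the irreducible components
of a divisor with simple normal crossings: the closed subschemes are irreducible, and locally the
`D i` are generated by elements `t i` such that those vanishing at a given point `x` are part of a
regular system of parameters at `x`, i.e. are linearly independent in the cotangent space. -/
structure IsSNC {X : Scheme.{u}} {ι : Type*} (D : ι → X.IdealSheafData) : Prop where
  irreducible (i : ι) : IrreducibleSpace (D i).subscheme
  transversal (x : X) : ∃ (U : X.affineOpens) (hx : x ∈ U.1) (t : ι → Γ(X, U.1)),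
    (∀ i, (D i).ideal U = Ideal.span {t i}) ∧
    LinearIndependent (IsLocalRing.ResidueField (X.presheaf.stalk x))
      (fun i : {i // X.presheaf.germ U.1 x hx (t i) ∈
          IsLocalRing.maximalIdeal (X.presheaf.stalk x)} ↦
        ((IsLocalRing.maximalIdeal (X.presheaf.stalk x)).toCotangent ⟨_, i.2⟩ :
          IsLocalRing.CotangentSpace (X.presheaf.stalk x)))

lemma IsSNC.isFG {X : Scheme.{u}} {ι : Type*} {D : ι → X.IdealSheafData} (h : IsSNC D) (i : ι) :
    IsFG (D i) := by
  refine .of_local fun x ↦ ?_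
  obtain ⟨U, hx, t, ht, -⟩ := h.transversal x
  exact ⟨U, hx, {t i}, by rw [ht, Finset.coe_singleton]⟩

end SNC

section Multiplicative

variable {C : Type*} [Category C]

/-- Multiplicative oversimplicial objects: a cocartesian square
`[0] → [m]`, `[0] → [l]`, `[m] → [n]`, `[l] → [n]` gives a cartesian square. -/
def IsMultiplicative (P : OS C) : Prop :=
  ∀ ⦃l m n : ℕ⦄ (a : OSimp.mk 0 ⟶ OSimp.mk m) (b : OSimp.mk 0 ⟶ OSimp.mk l)
    (c : OSimp.mk m ⟶ OSimp.mk n) (d : OSimp.mk l ⟶ OSimp.mk n), IsPushout a b c d →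
    IsPullback (P.map c.op) (P.map d.op) (P.map a.op) (P.map b.op)

/-- The map `0 ↦ j` from `[0, 0]` to `[0, n]`. -/
def OSimp.pt {n : ℕ} (j : Fin (n + 1)) : OSimp.mk 0 ⟶ OSimp.mk n := fun _ ↦ j

/-- Strictly multiplicative oversimplicial objects. -/
structure IsStrictlyMultiplicative (P : OS C) : Prop where
  multiplicative : IsMultiplicative P
  strict : P.map (OSimp.pt (n := 1) 0).op = P.map (OSimp.pt (n := 1) 1).op

/-- Multiplicative morphisms: for every cocartesian square as above, the square formed by `Q_n`,
`Q_m ×_{P_m} P_n`, `Q_l ×_{P_l} P_n` and `P_n` is cartesian. -/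
def IsMultiplicativeHom [HasPullbacks C] {Q P : OS C} (φ : Q ⟶ P) : Prop :=
  ∀ ⦃l m n : ℕ⦄ (a : OSimp.mk 0 ⟶ OSimp.mk m) (b : OSimp.mk 0 ⟶ OSimp.mk l)
    (c : OSimp.mk m ⟶ OSimp.mk n) (d : OSimp.mk l ⟶ OSimp.mk n), IsPushout a b c d →
    IsPullback
      (pullback.lift (f := φ.app _) (g := P.map c.op) (Q.map c.op) (φ.app _) (φ.naturality c.op))
      (pullback.lift (f := φ.app _) (g := P.map d.op) (Q.map d.op) (φ.app _) (φ.naturality d.op))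
      (pullback.snd (φ.app _) (P.map c.op)) (pullback.snd (φ.app _) (P.map d.op))

end Multiplicative

section Groups

open MonoidalCategory CartesianMonoidalCategory MonObj

variable {Z : Scheme.{u}}

/-- The scheme `P_1` over `Z`, where `b : P_0 ⟶ Z`, through the map `0 ↦ 0`. -/
def groupOver (P : OS Scheme.{u}) (b : P.obj (.op ⟨0⟩) ⟶ Z) : Over Z :=
  Over.mk (P.map (OSimp.pt (n := 1) 0).op ≫ b)

/-- The morphism `P_1 ⟶ Q_1` over `Z`. -/
def groupHom {P Q : OS Scheme.{u}} (φ : P ⟶ Q) (b : Q.obj (.op ⟨0⟩) ⟶ Z) :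
    groupOver P (φ.app _ ≫ b) ⟶ groupOver Q b :=
  Over.homMk (φ.app (.op ⟨1⟩)) 
    ((Category.assoc _ _ _).symm.trans ((congrArg (· ≫ b) (φ.naturality _).symm).trans
      (Category.assoc _ _ _)))

/-- The map `[0, 1] → [0, n]` with values `i` and `j`. -/
def OSimp.edge {n : ℕ} (i j : Fin (n + 1)) : OSimp.mk 1 ⟶ OSimp.mk n := ![i, j]

lemma IsStrictlyMultiplicative.comm {P : OS Scheme.{u}} (hP : IsStrictlyMultiplicative P)
    (b : P.obj (.op ⟨0⟩) ⟶ Z) :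
    P.map (OSimp.edge (n := 2) 0 1).op ≫ (groupOver P b).hom =
      P.map (OSimp.edge (n := 2) 1 2).op ≫ (groupOver P b).hom := by
  have h1 : P.map (OSimp.edge (n := 2) 0 1).op ≫ P.map (OSimp.pt (n := 1) 1).op =
      P.map (OSimp.edge (n := 2) 1 2).op ≫ P.map (OSimp.pt (n := 1) 0).op := by
    rw [← P.map_comp, ← P.map_comp]
    rfl
  rw [← hP.strict] at h1
  exact (Category.assoc _ _ _).symm.trans ((congrArg (· ≫ b) h1).trans (Category.assoc _ _ _))

/-- The oversimplicial scheme `P` is associated to the group scheme `P_1` over `Z = P_0`: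
it is strictly multiplicative, the unit is given by `[0, 1] → [0, 0]`, the inverse by the
transposition of `[0, 1]`, and the multiplication by the map `P_2 ⟶ P_1` defined by
`0 ↦ 0, 1 ↦ 2`, where `P_2` is identified with `P_1 ×_{P_0} P_1` by the maps
`0 ↦ 0, 1 ↦ 1` and `0 ↦ 1, 1 ↦ 2`. -/
structure IsAssociated (P : OS Scheme.{u}) (b : P.obj (.op ⟨0⟩) ⟶ Z)
    [GrpObj (groupOver P b)] : Prop where
  isIso : IsIso b
  strict : IsStrictlyMultiplicative P
  one : b ≫ η[groupOver P b].left = P.map (OSimp.toPt 1).op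
  inv : ι[groupOver P b].left = P.map (OSimp.edge (n := 1) 1 0).op
  mul : pullback.lift (P.map (OSimp.edge (n := 2) 0 1).op) (P.map (OSimp.edge (n := 2) 1 2).op)
    (strict.comm b) ≫ μ[groupOver P b].left = P.map (OSimp.edge (n := 2) 0 2).op

/-- The group scheme `T` over `Z` is (the additive group scheme of) a vector bundle: the functions
on `Y` act functorially on the `Y`-valued points, and locally on `Z` the points are functorially
identified with tuples of functions, compatibly with addition and scalar multiplication. -/
def IsVectorBundle (T : Over Z) [GrpObj T] : Prop :=
  ∃ smul : ∀ Y : Over Z, Γ(Y.left, ⊤) → (Y ⟶ T) → (Y ⟶ T),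
    (∀ ⦃Y Y' : Over Z⦄ (g : Y' ⟶ Y) (a : Γ(Y.left, ⊤)) (x : Y ⟶ T),
      g ≫ smul Y a x = smul Y' (g.left.appTop a) (g ≫ x)) ∧
    ∀ z : Z, ∃ (U : Z.Opens) (_ : z ∈ U) (n : ℕ)
      (e : ∀ Y : Over Z, Set.range Y.hom ⊆ U → (Y ⟶ T) ≃ (Fin n → Γ(Y.left, ⊤))),
      (∀ ⦃Y Y' : Over Z⦄ (hY : Set.range Y.hom ⊆ U) (hY' : Set.range Y'.hom ⊆ U) (g : Y' ⟶ Y)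
        (x : Y ⟶ T) (i : Fin n), e Y' hY' (g ≫ x) i = g.left.appTop (e Y hY x i)) ∧
      (∀ (Y : Over Z) (hY : Set.range Y.hom ⊆ U) (x y : Y ⟶ T),
        e Y hY (lift x y ≫ μ) = e Y hY x + e Y hY y) ∧
      ∀ (Y : Over Z) (hY : Set.range Y.hom ⊆ U) (a : Γ(Y.left, ⊤)) (x : Y ⟶ T) (i : Fin n),
        e Y hY (smul Y a x) i = a * e Y hY x i

end Groups

section Main

variable {S : Scheme.{u}} (X : Over S) {ι : Type u} [Fintype ι] [DecidableEq ι]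
  (D : ι → X.left.IdealSheafData) (hD : ∀ i, IsFG (D i)) (m : ι → ℕ) (r : ι → ℚ)
  {G : Type*} [Group G] [Finite G] {V : Scheme.{u}} (v : V ⟶ (complement X D).toScheme)
  (ρ : G →* Aut V) (hρ : ∀ g, (ρ g).hom ≫ v = v) [IsFinite v]
  (hW : WRMStable X D hD m r v ρ hρ)

/-- The canonical morphism `E^{(R, M)}_0 ⟶ Z̃^{(M)}`. -/
abbrev ERMToZM : (ERM X D hD m r v ρ hρ hW).obj (.op ⟨0⟩) ⟶ ZM X D hD m r :=
  (ERMProj X D hD m r v ρ hρ hW).app (.op ⟨0⟩) ≫ TRMToZM X D hD m r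

/-- The scheme `T^{(R, M)} = T^{(R, M)}_1` over `Z̃^{(M)}`. -/
abbrev TRMGroup : Over (ZM X D hD m r) := groupOver (TRM X D hD m r) (TRMToZM X D hD m r)

/-- The scheme `E^{(R, M)} = E^{(R, M)}_1` over `Z̃^{(M)}`. -/
abbrev ERMGroup : Over (ZM X D hD m r) :=
  groupOver (ERM X D hD m r v ρ hρ hW) (ERMToZM X D hD m r v ρ hρ hW)

/-- The morphism `E^{(R, M)} ⟶ T^{(R, M)}`. -/
abbrev ERMGroupHom : ERMGroup X D hD m r v ρ hρ hW ⟶ TRMGroup X D hD m r :=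
  groupHom (ERMProj X D hD m r v ρ hρ hW) (TRMToZM X D hD m r)

end Main

end RamGrp

end

open RamGrp

/-!
The schemes `P_n = P_n^{(R, M)}` are iterated dilatations, and are used only through their universal property (`isUniv_PRM`): on schemes in
which `∏ x_i ≠ 0` is schematically dense, a point of `P_n` consists of points `y_0, …, y_n` of `X` and coordinates `x_i` such that the
pullback of `D_i` by each `y_j` is defined by `x_i ^ m_i` and the `y_j` agree modulo `∏ x_i ^ (m_i r_i)` (`Adm`, `IsUniv`). A cocartesian
square glues such families along a common member, so `P` is multiplicative as soon as the fibre products still have `∏ x_i ≠ 0` dense, for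
which flatness of `P_1 ⟶ P_0` is enough. In étale coordinates `a_l` of `X` adapted to the divisors (`exists_chart`, which uses that the base
field is perfect), a second point near the first one is `a_l + d_l ∏ x_i ^ (m_i r_i)` with free parameters `d_l` (`Param.exists_model`); hence
`P_1` is smooth over `P_0` (`smooth_pt_zero`), and similarly `P_0` is smooth over the affine space of the `x_i` (`smooth_coordAff`).

On the boundary `T`, where `∏_{r_i > 1} x_i = 0`, all the vertices of a point coincide, so that `T` is strictly multiplicative, and the `d_l` are
coordinates identifying `T_1` locally with an affine space over `T_0`. Composition adds the `d_l` (`IsCoord.add`), and the change of charts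
is linear in them (`IsCoord.exists_transition`), since the higher order terms are divisible by the equation of the boundary. So `T_1` is
the additive group of a vector bundle (`isVectorBundle`). The group structures come from strict multiplicativity alone (`grpObj`,
`isAssociated`, `isMonHom`): a point of degree `2` is a pair of composable edges, and degree `3` gives associativity.

The quotient `V^{n+1}/ΔG` becomes `V^{n+1}` after base change to `V` along any vertex (`isPullback_quotOS`, by Galois descent). Hence the
quotients are finite étale over `U^{n+1}`, trivial for `n = 0`, and form a multiplicative morphism (`isMultiplicativeHom_quotOSProj`). The
open of `P_n` where the `x_i` are invertible is the inverse image of `U^{n+1}`, and `P_n` is integrally closed along it, being smooth over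
affine space. These properties of the covering (`IsCover`, `isCover_CPRMProj`) are all that is used of `V`.

For such a covering let `Q_n` be the normalization of `P_n` in it and `W_n` the étale locus. Normalization commutes with smooth base change, so
a section of the covering over the inner open of a scheme `T` smooth over `P_n` extends to `T ⟶ Q_n`: its graph is open and closed, and its
normalization is `T`. The extension lands in `W_n`, because the étale locus descends along flat base change (`exists_section_etaleLocus`,
`exists_etale_of_baseChange`; the normalization is not assumed finite, so the descent first passes to a finitely generated subalgebra).
Consequently points of `Q_m` and `Q_l` with values in smooth schemes glue to points of `Q_n` as they do for the covering
(`IsCover.exists_glue`). This gives that `W` is stable under face maps, which are smooth on `P`, and that `W ⟶ P` is multiplicative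
(`IsCover.isMultiplicativeHom_etaleProj`). For degeneracies, a degenerate simplex is glued from a simplex of `W` and a degenerate edge, and
the bound on the ramification says precisely that degenerate edges are in `W_1` (`IsCover.isStable`). Finally `E = T ×_P W` is étale and
multiplicative over `T` with `E_0 = T_0`, hence strictly multiplicative, and the statement follows (`main_of_isCover`).
-/

set_option linter.unusedSectionVars false

noncomputable section

namespace RamGrp

/-! ### Relative spectra and the universal property of dilatations -/

lemma dominant_of_comp {X Y Z : Scheme.{u}} (f : X ⟶ Y) (g : Y ⟶ Z)
    [IsSchemeTheoreticallyDominant (f ≫ g)] : IsSchemeTheoreticallyDominant g where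
  ker_eq_bot := by
    rw [eq_bot_iff, ← (f ≫ g).ker_eq_bot]
    exact Hom.le_ker_comp f g

/-- A family of ideal sheaves is locally principal if the members are, near each point, all
generated by single sections. -/
def IsLP {Y : Scheme.{u}} {A : Type*} (J : A → Y.IdealSheafData) : Prop :=
  ∀ y : Y, ∃ U : Y.affineOpens, y ∈ U.1 ∧ ∀ a, ∃ t, (J a).ideal U = Ideal.span {t}

lemma IsLP.comap {X Y : Scheme.{u}} {A : Type*} {J : A → Y.IdealSheafData} (h : IsLP J)
    (f : X ⟶ Y) : IsLP fun a ↦ (J a).comap f := by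
  intro x
  obtain ⟨U, hU, ht⟩ := h (f x)
  obtain ⟨_, ⟨V, hV, rfl⟩, hxV, hVU⟩ := X.isBasis_affineOpens.exists_subset_of_mem_open
    (show x ∈ (f ⁻¹ᵁ U.1 : Set X) from hU) (f ⁻¹ᵁ U.1).isOpen
  refine ⟨⟨V, hV⟩, hxV, fun a ↦ ?_⟩
  obtain ⟨t, e⟩ := ht a
  exact ⟨_, by rw [ideal_comap (J a) f U ⟨V, hV⟩ hVU, e, Ideal.map_span, Set.image_singleton]⟩

lemma iSup_eq_top_of_forall {Y : Scheme.{u}} {ι : Type*} {O : ι → Y.Opens}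
    (h : ∀ y, ∃ i, y ∈ O i) : ⨆ i, O i = ⊤ :=
  top_le_iff.mp fun y _ ↦ TopologicalSpace.Opens.mem_iSup.mpr (h y)

/-- Morphisms landing in an open over which `h` is an isomorphism are determined by their
composition with `h`. -/
lemma eq_of_isIso_restrict {W Z Y : Scheme.{u}} (h : Z ⟶ Y) (O : Y.Opens) [IsIso (h ∣_ O)]
    (p q : W ⟶ Z) (e : p ≫ h = q ≫ h) (hO : Set.range (p ≫ h) ⊆ O) : p = q := by
  have h1 : Set.range p ⊆ Set.range (h ⁻¹ᵁ O).ι := by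
    rintro _ ⟨x, rfl⟩
    rw [Scheme.Opens.range_ι]
    exact hO ⟨x, by simp⟩
  have h2 : Set.range q ⊆ Set.range (h ⁻¹ᵁ O).ι := by
    rintro _ ⟨x, rfl⟩
    rw [Scheme.Opens.range_ι]
    exact hO ⟨x, by rw [e]; simp⟩
  rw [← IsOpenImmersion.lift_fac (h ⁻¹ᵁ O).ι p h1, ← IsOpenImmersion.lift_fac (h ⁻¹ᵁ O).ι q h2]
  congr 1
  rw [← cancel_mono (h ∣_ O), ← cancel_mono O.ι, Category.assoc, Category.assoc, morphismRestrict_ι,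
    IsOpenImmersion.lift_fac_assoc, IsOpenImmersion.lift_fac_assoc, e]

lemma isIso_of_locally {X Y : Scheme.{u}} (f : X ⟶ Y) (h : ∀ y : Y, ∃ U : Y.Opens, y ∈ U ∧ IsIso (f ∣_ U)) :
    IsIso f := by
  choose U hU hi using h
  exact (IsZariskiLocalAtTarget.iff_of_iSup_eq_top (P := MorphismProperty.isomorphisms Scheme) (f := f) U
    (iSup_eq_top_of_forall fun y ↦ ⟨y, hU y⟩)).mpr hi

namespace QCSubalgebra

variable {X Y : Scheme.{u}} {f : X ⟶ Y} (𝓑 : QCSubalgebra f) [QuasiCompact f] [QuasiSeparated f]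

lemma chart_preimage (U : Y.affineOpens) : 𝓑.chart U ⁻¹ᵁ (𝓑.toBase ⁻¹ᵁ U.1) = ⊤ := by
  rw [toBase_preimage]; simp

/-- The identification of the sections of the relative spectrum over an affine open. -/
def secHom (U : Y.affineOpens) : Γ(𝓑.spec, 𝓑.toBase ⁻¹ᵁ U.1) ⟶ .of (𝓑.B U) :=
  (𝓑.chart U).appLE (𝓑.toBase ⁻¹ᵁ U.1) ⊤ (𝓑.chart_preimage U).ge ≫ (ΓSpecIso _).hom

instance (U : Y.affineOpens) : IsIso (𝓑.secHom U) := by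
  have h1 : IsIso ((𝓑.chart U).app (𝓑.toBase ⁻¹ᵁ U.1)) :=
    Scheme.Hom.isIso_app _ _ (by rw [toBase_preimage])
  have h2 : IsIso ((𝓑.chart U).appLE (𝓑.toBase ⁻¹ᵁ U.1) ⊤ (𝓑.chart_preimage U).ge) := by
    have : ∀ (V : (Spec (.of (𝓑.B U))).Opens) (h : V = (𝓑.chart U) ⁻¹ᵁ (𝓑.toBase ⁻¹ᵁ U.1)),
        IsIso ((𝓑.chart U).appLE (𝓑.toBase ⁻¹ᵁ U.1) V h.le) := by
      rintro _ rfl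
      rwa [← Hom.app_eq_appLE]
    exact this _ (𝓑.chart_preimage U).symm
  unfold secHom
  infer_instance

lemma app_secHom (U : Y.affineOpens) : 𝓑.toBase.app U.1 ≫ 𝓑.secHom U =
    CommRingCat.ofHom (𝓑.algMap U) := by
  have h1 : (𝓑.chart U ≫ 𝓑.toBase).appLE U.1 ⊤ (𝓑.chart_preimage U).ge =
      (Spec.map (CommRingCat.ofHom (𝓑.algMap U)) ≫ U.2.fromSpec).appLE U.1 ⊤
        ((𝓑.chart_toBase U) ▸ (𝓑.chart_preimage U).ge) := by
    congr 1
    exact 𝓑.chart_toBase U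
  rw [secHom, ← Category.assoc, Hom.app_eq_appLE, Hom.appLE_comp_appLE, h1, ← Hom.appLE_comp_appLE _ _ U.1 ⊤ ⊤
    U.2.fromSpec_preimage_self.ge (by simp)]
  rw [Category.assoc]
  have h2 := ΓSpecIso_naturality (CommRingCat.ofHom (𝓑.algMap U))
  have h3 : (Spec.map (CommRingCat.ofHom (𝓑.algMap U))).appLE ⊤ ⊤ (by simp) = 
      (Spec.map (CommRingCat.ofHom (𝓑.algMap U))).appTop := by
    rw [Hom.appTop, Hom.app_eq_appLE]; rfl
  rw [h3, h2, ← Category.assoc]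
  have h5 : U.2.fromSpec.appLE U.1 ⊤ U.2.fromSpec_preimage_self.ge ≫
      (ΓSpecIso (CommRingCat.of Γ(Y, U.1))).hom = 𝟙 _ := by
    rw [← cancel_mono (ΓSpecIso _).inv, Category.assoc, Iso.hom_inv_id, Category.comp_id,
      Category.id_comp, Hom.appLE, U.2.fromSpec_app_self, Category.assoc, ← Functor.map_comp]
    exact (congrArg _ ((Spec Γ(Y, U.1)).presheaf.map_id _)).trans (Category.comp_id _)
  rw [h5]
  exact Category.id_comp _

/-- The inverse of `secHom`. -/
def sec (U : Y.affineOpens) : 𝓑.B U →+* Γ(𝓑.spec, 𝓑.toBase ⁻¹ᵁ U.1) := (inv (𝓑.secHom U)).hom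

lemma sec_algMap (U : Y.affineOpens) (a) : 𝓑.sec U (𝓑.algMap U a) = pb 𝓑.toBase U.1 a := by
  have := 𝓑.app_secHom U
  rw [← IsIso.eq_comp_inv] at this
  exact congr($(this.symm) a)

lemma sec_bijective (U : Y.affineOpens) : Function.Bijective (𝓑.sec U) :=
  ConcreteCategory.bijective_of_isIso (inv (𝓑.secHom U))

lemma isIso_restrict_of_bijective (U : Y.affineOpens) (h : Function.Bijective (𝓑.algMap U)) :
    IsIso (𝓑.toBase ∣_ U.1) := by
  rw [isIso_morphismRestrict_iff_isIso_app _ U.2, ConcreteCategory.isIso_iff_bijective]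
  have e : (𝓑.sec U) ∘ (𝓑.algMap U) = 𝓑.toBase.app U.1 := funext fun a ↦ 𝓑.sec_algMap U a
  rw [← e]
  exact (𝓑.sec_bijective U).comp h

end QCSubalgebra

section Dil

variable {Y : Scheme.{u}} {A : Type*} [Fintype A] (𝓒 : Centers Y A)


lemma isUnit_of_le_basicOpen {X : Scheme.{u}} {U : X.Opens} (t : Γ(X, U))
    (h : U ≤ X.basicOpen t) : IsUnit t :=
  X.toRingedSpace.isUnit_of_isUnit_germ _ _ fun x hx ↦ (X.mem_basicOpen t x hx).mp (h hx)

lemma isUnit_pb {X Y : Scheme.{u}} (f : X ⟶ Y) {U : Y.Opens} (t : Γ(Y, U))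
    (h : ∀ x : X, f x ∈ U → f x ∈ Y.basicOpen t) : IsUnit (pb f U t) := by
  refine isUnit_of_le_basicOpen _ fun x hx ↦ ?_
  have : x ∈ f ⁻¹ᵁ Y.basicOpen t := h x hx
  rwa [Scheme.preimage_basicOpen] at this

/-- A section invertible on a dense open is a nonzerodivisor. -/
lemma cancel_of_dominant {T : Scheme.{u}} (O : T.Opens) [QuasiCompact O.ι]
    [IsSchemeTheoreticallyDominant O.ι] {W : T.Opens} (t : Γ(T, W))
    (h : ∀ x ∈ O, x ∈ W → x ∈ T.basicOpen t) {a b : Γ(T, W)} (e : t * a = t * b) : a = b := by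
  refine O.ι.app_injective W ?_
  have hu : IsUnit (pb O.ι W t) := isUnit_pb _ _ fun x hx ↦ h _ x.2 hx
  refine hu.mul_left_cancel ?_
  change _ * pb O.ι W a = _ * pb O.ι W b
  rw [← map_mul, ← map_mul, e]

lemma mem_basicOpen_of_span {J : Y.IdealSheafData} {U : Y.affineOpens} {t : Γ(Y, U.1)}
    (ht : J.ideal U = Ideal.span {t}) {y : Y} (hy : y ∈ U.1) :
    y ∈ Y.basicOpen t ↔ y ∉ J.support := by
  rw [J.mem_support_iff_of_mem hy, ht, zeroLocus_span, mem_zeroLocus_iff]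
  simp

variable {𝓒} in
/-- The generator of `J a` is invertible on the complement. -/
lemma Centers.isUnit_generator {a : A} {U : Y.affineOpens} {t : Γ(Y, U.1)}
    (ht : (𝓒.J a).ideal U = Ideal.span {t}) : IsUnit (pb 𝓒.compl.ι U.1 t) :=
  isUnit_pb _ _ fun x hx ↦ (mem_basicOpen_of_span ht hx).mpr (Centers.mem_compl.mp x.2 a)

variable {𝓒} in
/-- The fraction `c / t` as an element of the algebra of the dilatation. -/
lemma Centers.exists_fraction {a : A} {U : Y.affineOpens} {t : Γ(Y, U.1)}
    (ht : (𝓒.J a).ideal U = Ideal.span {t}) {c : Γ(Y, U.1)} (hc : c ∈ (𝓒.I a).ideal U) :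
    ∃ s : 𝓒.algebra.B U, 𝓒.algebra.algMap U t * s = 𝓒.algebra.algMap U c := by
  obtain ⟨w, hw⟩ := (Centers.isUnit_generator ht).exists_right_inv
  refine ⟨⟨w * pb 𝓒.compl.ι U.1 c, Subring.subset_closure (.inr ⟨a, ?_⟩)⟩, Subtype.ext ?_⟩
  · rw [ht, Ideal.span_singleton_le_iff_mem]
    exact ⟨c, hc, by rw [← mul_assoc, hw, one_mul]⟩
  · change pb _ _ t * (w * pb _ _ c) = pb _ _ c
    rw [← mul_assoc, hw, one_mul]

/-- The inclusion of the complement of the divisors in the dilatation. -/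
def Centers.fromCompl : 𝓒.compl.toScheme ⟶ 𝓒.dil := 𝓒.algebra.fromSource

instance : IsSchemeTheoreticallyDominant 𝓒.fromCompl :=
  inferInstanceAs (IsSchemeTheoreticallyDominant 𝓒.algebra.fromSource)

lemma Centers.fromCompl_dilProj : 𝓒.fromCompl ≫ 𝓒.dilProj = 𝓒.compl.ι :=
  𝓒.algebra.fromSource_toBase

/-- The elements of the algebra of the dilatation as sections. -/
def Centers.sec (U : Y.affineOpens) : 𝓒.algebra.B U →+* Γ(𝓒.dil, 𝓒.dilProj ⁻¹ᵁ U.1) :=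
  𝓒.algebra.sec U

lemma Centers.sec_algMap (U : Y.affineOpens) (a) :
    𝓒.sec U (𝓒.algebra.algMap U a) = pb 𝓒.dilProj U.1 a := 𝓒.algebra.sec_algMap U a

lemma Centers.sec_bijective (U : Y.affineOpens) : Function.Bijective (𝓒.sec U) :=
  𝓒.algebra.sec_bijective U

/-- The complement of the divisors is schematically dense in the dilatation. -/
instance dominant_dilProj_preimage :
    IsSchemeTheoreticallyDominant (𝓒.dilProj ⁻¹ᵁ 𝓒.compl).ι := by
  have h : Set.range 𝓒.fromCompl ⊆ Set.range (𝓒.dilProj ⁻¹ᵁ 𝓒.compl).ι := by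
    rintro _ ⟨x, rfl⟩
    rw [Scheme.Opens.range_ι]
    change (𝓒.fromCompl ≫ 𝓒.dilProj) x ∈ 𝓒.compl
    rw [𝓒.fromCompl_dilProj]
    exact x.2
  have : IsSchemeTheoreticallyDominant
      (IsOpenImmersion.lift (𝓒.dilProj ⁻¹ᵁ 𝓒.compl).ι 𝓒.fromCompl h ≫
        (𝓒.dilProj ⁻¹ᵁ 𝓒.compl).ι) := by
    rw [IsOpenImmersion.lift_fac]
    infer_instance
  exact dominant_of_comp (IsOpenImmersion.lift _ 𝓒.fromCompl h) _

lemma isUnit_pb_ι {Y : Scheme.{u}} {O U : Y.Opens} (h : U ≤ O) : Function.Bijective (pb O.ι U) := by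
  have : IsIso (O.ι.app U) := Scheme.Hom.isIso_app _ _ (by simpa using h)
  exact ConcreteCategory.bijective_of_isIso (O.ι.app U)

/-- The dilatation is an isomorphism over the complement of the divisors. -/
lemma Centers.isIso_dilProj {U : Y.affineOpens} (h : U.1 ≤ 𝓒.compl) : IsIso (𝓒.dilProj ∣_ U.1) := by
  refine 𝓒.algebra.isIso_restrict_of_bijective U ⟨fun a b e ↦ ?_, fun s ↦ ?_⟩
  · exact (isUnit_pb_ι h).1 congr(($e).1)
  · obtain ⟨a, ha⟩ := (isUnit_pb_ι h).2 s.1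
    exact ⟨a, Subtype.ext ha⟩

/-- The ideals `I a` are divisible by `J a` on the dilatation. -/
lemma Centers.comap_dilProj_le (h : IsLP 𝓒.J) (a : A) :
    (𝓒.I a).comap 𝓒.dilProj ≤ (𝓒.J a).comap 𝓒.dilProj := by
  choose U hU ht using h
  refine Scheme.IdealSheafData.le_of_iSup_eq_top
    (fun y ↦ ⟨𝓒.dilProj ⁻¹ᵁ (U y).1, (U y).2.preimage 𝓒.dilProj⟩)
    (iSup_eq_top_of_forall fun x ↦ ⟨𝓒.dilProj x, hU _⟩) fun y ↦ ?_
  rw [ideal_comap _ 𝓒.dilProj (U y) _ le_rfl, ideal_comap _ 𝓒.dilProj (U y) _ le_rfl, Ideal.map_le_iff_le_comap]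
  intro c hc
  obtain ⟨t, ht⟩ := ht y a
  obtain ⟨s, hs⟩ := Centers.exists_fraction ht hc
  have e := congr(𝓒.sec (U y) $hs)
  rw [map_mul, 𝓒.sec_algMap, 𝓒.sec_algMap] at e
  rw [Ideal.mem_comap, RingHom.comp_apply, rs_self]
  rw [← e]
  apply Ideal.mul_mem_right
  rw [ht]
  have := Ideal.mem_map_of_mem ((rs (le_refl (𝓒.dilProj ⁻¹ᵁ (U y).1))).comp (pb 𝓒.dilProj (U y).1)) (Ideal.mem_span_singleton_self t)
  rwa [RingHom.comp_apply, rs_self] at this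

variable {T : Scheme.{u}} (f : T ⟶ Y)

/-- The centers on `T` with `I = J` obtained by pulling back the divisors. -/
def Centers.pull : Centers T A where
  J a := (𝓒.J a).comap f
  I a := (𝓒.J a).comap f
  fg a := (𝓒.fg a).comap f

lemma Centers.pull_compl : (𝓒.pull f).compl = f ⁻¹ᵁ 𝓒.compl := by
  ext x
  change x ∈ (𝓒.pull f).compl ↔ f x ∈ 𝓒.compl
  simp only [Centers.mem_compl, Centers.pull, Scheme.IdealSheafData.support_comap]
  rfl

lemma Centers.isIso_dilProj_pull (h : IsLP 𝓒.J)
    [hd : IsSchemeTheoreticallyDominant (f ⁻¹ᵁ 𝓒.compl).ι] : IsIso (𝓒.pull f).dilProj := by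
  have hd : IsSchemeTheoreticallyDominant (𝓒.pull f).compl.ι := by rwa [𝓒.pull_compl f]
  refine isIso_of_locally _ fun x ↦ ?_
  obtain ⟨U, hU, ht⟩ := h.comap f x
  refine ⟨U, hU, (𝓒.pull f).algebra.isIso_restrict_of_bijective U ⟨fun a b e ↦ ?_, ?_⟩⟩
  · exact (𝓒.pull f).compl.ι.app_injective U.1 congr(($e).1)
  · rintro ⟨s, hs⟩
    have key : s ∈ (pb (𝓒.pull f).compl.ι U.1).range := by
      refine (Subring.closure_le.mpr ?_) hs
      rintro s (⟨a, rfl⟩ | ⟨a, ha⟩)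
      · exact ⟨a, rfl⟩
      · obtain ⟨t, e⟩ := ht a
        obtain ⟨c, hc, hct⟩ := ha (show t ∈ ((𝓒.pull f).J a).ideal U from e ▸ Ideal.mem_span_singleton_self t)
        obtain ⟨b, rfl⟩ := Ideal.mem_span_singleton'.mp (show c ∈ Ideal.span {t} from e ▸ hc)
        refine ⟨b, (Centers.isUnit_generator (𝓒 := 𝓒.pull f) e).mul_left_cancel ?_⟩
        rw [hct, map_mul, mul_comm]
    obtain ⟨a, rfl⟩ := key
    exact ⟨a, rfl⟩

/-- The universal property of the dilatation: existence. -/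
lemma Centers.exists_dil_lift (h : IsLP 𝓒.J) [IsSchemeTheoreticallyDominant (f ⁻¹ᵁ 𝓒.compl).ι]
    (hf : ∀ a, (𝓒.I a).comap f ≤ (𝓒.J a).comap f) : ∃ l : T ⟶ 𝓒.dil, l ≫ 𝓒.dilProj = f := by
  have H : (𝓒.pull f).Compat 𝓒 f := fun a ↦ ⟨a, rfl, hf a⟩
  have := 𝓒.isIso_dilProj_pull f h
  exact ⟨inv (𝓒.pull f).dilProj ≫ H.map, by rw [Category.assoc, H.map_proj, IsIso.inv_hom_id_assoc]⟩

/-- The universal property of the dilatation: uniqueness. -/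
lemma Centers.dil_lift_unique {l l' : T ⟶ 𝓒.dil} (e : l ≫ 𝓒.dilProj = l' ≫ 𝓒.dilProj)
    [hd : IsSchemeTheoreticallyDominant ((l ≫ 𝓒.dilProj) ⁻¹ᵁ 𝓒.compl).ι] : l = l' := by
  refine ext_of_dominant (((l ≫ 𝓒.dilProj) ⁻¹ᵁ 𝓒.compl).ι) 𝓒.dilProj _ _ e ?_
  refine ext_of_open _ _ fun x ↦ ?_
  obtain ⟨_, ⟨U, hU, rfl⟩, hxU, hUO⟩ := Y.isBasis_affineOpens.exists_subset_of_mem_open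
    (show (l ≫ 𝓒.dilProj) x.1 ∈ 𝓒.compl from x.2) 𝓒.compl.isOpen
  have := 𝓒.isIso_dilProj (U := ⟨U, hU⟩) hUO
  let g := ((l ≫ 𝓒.dilProj) ⁻¹ᵁ 𝓒.compl).ι
  refine ⟨_, ((g ≫ l ≫ 𝓒.dilProj) ⁻¹ᵁ U).ι, inferInstance, ⟨⟨x, hxU⟩, rfl⟩, ?_⟩
  refine eq_of_isIso_restrict 𝓒.dilProj U _ _ (by simp only [Category.assoc, e]) ?_
  rintro _ ⟨z, rfl⟩
  have := z.2
  simpa [g] using! this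

/-- Two lifts to a dilatation of morphisms `p'`, `q'` agreeing modulo an ideal agree modulo it as
soon as the fractions `c / t` do. -/
lemma Centers.dil_congr {K : Scheme.{u}} (κ : K ⟶ T) (p q : T ⟶ 𝓒.dil)
    (e : κ ≫ p ≫ 𝓒.dilProj = κ ≫ q ≫ 𝓒.dilProj)
    (H : ∀ x : K, ∃ (U : Y.affineOpens) (W : T.Opens) (hp : W ≤ (p ≫ 𝓒.dilProj) ⁻¹ᵁ U.1)
      (hq : W ≤ (q ≫ 𝓒.dilProj) ⁻¹ᵁ U.1), κ x ∈ W ∧ ∀ a, ∃ t, (𝓒.J a).ideal U = Ideal.span {t} ∧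
        (∀ s s' : Γ(T, W), rs hp (pb _ _ t) * rs hq (pb _ _ t) * s =
          rs hp (pb _ _ t) * rs hq (pb _ _ t) * s' → s = s') ∧
        ∀ c ∈ (𝓒.I a).ideal U, ∃ n ∈ RingHom.ker (pb κ W),
          rs hp (pb (p ≫ 𝓒.dilProj) _ c) * rs hq (pb (q ≫ 𝓒.dilProj) _ t) -
            rs hq (pb _ _ c) * rs hp (pb _ _ t) = rs hp (pb _ _ t) * rs hq (pb _ _ t) * n) :
    κ ≫ p = κ ≫ q := by
  refine ext_of_open _ _ fun x ↦ ?_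
  obtain ⟨U, W, hp, hq, hxW, h⟩ := H x
  refine ⟨_, (κ ⁻¹ᵁ W).ι, inferInstance, ⟨⟨x, hxW⟩, rfl⟩, ?_⟩
  have hWp (l : T ⟶ 𝓒.dil) (hl : W ≤ (l ≫ 𝓒.dilProj) ⁻¹ᵁ U.1) :
      W ≤ l ⁻¹ᵁ (𝓒.dilProj ⁻¹ᵁ U.1) := hl
  let P := (rs (hWp p hp)).comp ((pb p _).comp (𝓒.sec U))
  let Q := (rs (hWp q hq)).comp ((pb q _).comp (𝓒.sec U))
  have hP (a) : P (𝓒.algebra.algMap U a) = rs hp (pb (p ≫ 𝓒.dilProj) U.1 a) := by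
    change rs _ (pb p _ (𝓒.sec U _)) = _
    rw [𝓒.sec_algMap]
    rfl
  have hQ (a) : Q (𝓒.algebra.algMap U a) = rs hq (pb (q ≫ 𝓒.dilProj) U.1 a) := by
    change rs _ (pb q _ (𝓒.sec U _)) = _
    rw [𝓒.sec_algMap]
    rfl
  have key (s : 𝓒.algebra.B U) : pb κ W (P s) = pb κ W (Q s) := by
    obtain ⟨s, hs⟩ := s
    induction hs using Subring.closure_induction with
    | mem s hs0 =>
      obtain (⟨a, rfl⟩ | ⟨a, ha⟩) := hs0
      · have h1 := hP a
        have h2 := hQ a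
        change P ⟨pb _ _ a, _⟩ = _ at h1
        change Q ⟨pb _ _ a, _⟩ = _ at h2
        rw [h1, h2, pb_rs, pb_rs]
        exact pb_congr (a := κ ≫ p ≫ 𝓒.dilProj) e _ a
      · obtain ⟨t, ht, hc, hI⟩ := h a
        obtain ⟨c, hcI, hct⟩ := ha (show t ∈ (𝓒.J a).ideal U from ht ▸ Ideal.mem_span_singleton_self t)
        obtain ⟨n, hn, hn'⟩ := hI c hcI
        let S : 𝓒.algebra.B U := ⟨s, Subring.subset_closure (.inr ⟨a, ha⟩)⟩
        have h3 : 𝓒.algebra.algMap U t * S = 𝓒.algebra.algMap U c := Subtype.ext hct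
        have h4 := congr(P $h3)
        have h5 := congr(Q $h3)
        rw [map_mul, hP, hP] at h4
        rw [map_mul, hQ, hQ] at h5
        have h6 : P S - Q S = n := by
          refine hc _ _ ?_
          rw [← hn', ← h4, ← h5]
          ring
        change pb κ W (P S) = pb κ W (Q S)
        rw [← sub_eq_zero, ← map_sub, h6]
        exact hn
    | zero => exact (congr(pb κ W $((P.map_zero).trans Q.map_zero.symm)))
    | one => exact (congr(pb κ W $((P.map_one).trans Q.map_one.symm)))
    | add x y hx hy h1 h2 =>
      have := congr($h1 + $h2)
      rwa [← map_add, ← map_add, ← map_add, ← map_add] at this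
    | neg x hx h1 =>
      have := congr(-$h1)
      rwa [← map_neg, ← map_neg, ← map_neg, ← map_neg] at this
    | mul x y hx hy h1 h2 =>
      have := congr($h1 * $h2)
      rwa [← map_mul, ← map_mul, ← map_mul, ← map_mul] at this
  have hS (s : Γ(𝓒.dil, 𝓒.dilProj ⁻¹ᵁ U.1)) : pb κ W (rs (hWp p hp) (pb p _ s)) =
      pb κ W (rs (hWp q hq) (pb q _ s)) := by
    obtain ⟨s, rfl⟩ := (𝓒.sec_bijective U).2 s
    exact key s
  have hO : IsAffineOpen (𝓒.dilProj ⁻¹ᵁ U.1) := U.2.preimage _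
  have hK (l : T ⟶ 𝓒.dil) (hl : W ≤ (l ≫ 𝓒.dilProj) ⁻¹ᵁ U.1) :
      κ ⁻¹ᵁ W ≤ (κ ≫ l) ⁻¹ᵁ (𝓒.dilProj ⁻¹ᵁ U.1) := κ.preimage_mono (hWp l hl)
  have hl (l : T ⟶ 𝓒.dil) (hl : W ≤ (l ≫ 𝓒.dilProj) ⁻¹ᵁ U.1) :
      (κ ⁻¹ᵁ W).ι ≫ κ ≫ l = (κ ⁻¹ᵁ W).toSpecΓ ≫ Spec.map ((κ ≫ l).appLE (𝓒.dilProj ⁻¹ᵁ U.1) (κ ⁻¹ᵁ W)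
        (hK l hl)) ≫ hO.fromSpec := by
    have := Scheme.Opens.toSpecΓ_SpecMap_appLE (κ ≫ l) _ _ (hK l hl)
    rw [reassoc_of% this, hO.toSpecΓ_fromSpec]
    simp
  rw [hl p hp, hl q hq]
  congr 3
  ext s
  have := hS s
  rw [pb_rs, pb_rs] at this
  exact this

end Dil

/-! ### Coordinate functions and monomials -/

section Mon

variable {ι : Type u} [Fintype ι] {T T' : Scheme.{u}}

/-- The functions `x_i` defined by a morphism to the affine space. -/
def xc (ξ : T ⟶ Spec (coordRing ι)) (i : ι) : Γ(T, ⊤) :=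
  ξ.appTop ((ΓSpecIso (coordRing ι)).inv (MvPolynomial.X i))

/-- The monomial functions `∏ x_i ^ e_i`. -/
def mon (ξ : T ⟶ Spec (coordRing ι)) (e : ι → ℕ) : Γ(T, ⊤) := ∏ i, xc ξ i ^ e i

lemma xc_comp (f : T' ⟶ T) (ξ : T ⟶ Spec (coordRing ι)) (i : ι) :
    xc (f ≫ ξ) i = f.appTop (xc ξ i) := by
  rw [xc, Scheme.Hom.comp_appTop]
  rfl

lemma mon_comp (f : T' ⟶ T) (ξ : T ⟶ Spec (coordRing ι)) (e : ι → ℕ) :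
    mon (f ≫ ξ) e = f.appTop (mon ξ e) := by
  simp only [mon, xc_comp, map_prod, map_pow]

lemma mon_add (ξ : T ⟶ Spec (coordRing ι)) (e e' : ι → ℕ) :
    mon ξ (e + e') = mon ξ e * mon ξ e' := by
  simp [mon, pow_add, Finset.prod_mul_distrib]

lemma mon_zero (ξ : T ⟶ Spec (coordRing ι)) : mon ξ 0 = 1 := by simp [mon]

lemma mon_single [DecidableEq ι] (ξ : T ⟶ Spec (coordRing ι)) (i : ι) (n : ℕ) :
    mon ξ (Pi.single i n) = xc ξ i ^ n := by
  rw [mon, Finset.prod_eq_single i]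
  · simp
  · intro j _ hj
    simp [Pi.single_eq_of_ne hj]
  · simp

lemma mon_appTop (ξ : T ⟶ Spec (coordRing ι)) (e : ι → ℕ) :
    mon ξ e = ξ.appTop ((ΓSpecIso (coordRing ι)).inv (∏ i, MvPolynomial.X i ^ e i)) := by
  simp only [mon, xc, map_prod, map_pow]

/-- The open subscheme where all the coordinates `x_i` are invertible. -/
def inner (ξ : T ⟶ Spec (coordRing ι)) : T.Opens := T.basicOpen (mon ξ 1)

lemma mem_basicOpen_mon {ξ : T ⟶ Spec (coordRing ι)} {e : ι → ℕ} {x : T} :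
    x ∈ T.basicOpen (mon ξ e) ↔ ∀ i, e i ≠ 0 → x ∈ T.basicOpen (xc ξ i) := by
  have key (s : Finset ι) : x ∈ T.basicOpen (∏ i ∈ s, xc ξ i ^ e i) ↔
      ∀ i ∈ s, e i ≠ 0 → x ∈ T.basicOpen (xc ξ i) := by
    classical
    induction s using Finset.induction with
    | empty => simp
    | insert a s ha ih =>
      rw [Finset.prod_insert ha, Scheme.basicOpen_mul, Finset.forall_mem_insert, ← ih]
      refine and_congr ?_ Iff.rfl
      by_cases h : e a = 0
      · simp [h]
      · have := Scheme.basicOpen_pow T (xc ξ a) (Nat.pos_of_ne_zero h)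
        simp [h, this]
  exact (key Finset.univ).trans (by simp)

lemma mem_inner {ξ : T ⟶ Spec (coordRing ι)} {x : T} :
    x ∈ inner ξ ↔ ∀ i, x ∈ T.basicOpen (xc ξ i) := by
  rw [inner, mem_basicOpen_mon]
  simp

lemma inner_le (ξ : T ⟶ Spec (coordRing ι)) (e : ι → ℕ) : inner ξ ≤ T.basicOpen (mon ξ e) :=
  fun _ hx ↦ mem_basicOpen_mon.mpr fun i _ ↦ mem_inner.mp hx i

lemma basicOpen_mon_eq_inner (ξ : T ⟶ Spec (coordRing ι)) {e : ι → ℕ} (he : ∀ i, e i ≠ 0) :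
    T.basicOpen (mon ξ e) = inner ξ := by
  ext x
  exact mem_basicOpen_mon.trans (by simp [he, ← mem_inner])

lemma inner_comp (f : T' ⟶ T) (ξ : T ⟶ Spec (coordRing ι)) : inner (f ≫ ξ) = f ⁻¹ᵁ inner ξ := by
  rw [inner, mon_comp, inner, Scheme.preimage_basicOpen]
  rfl

lemma ideal_monoIdeal_comap (ξ : T ⟶ Spec (coordRing ι)) (e : ι → ℕ) (W : T.affineOpens) :
    ((monoIdeal e).comap ξ).ideal W = Ideal.span {rs le_top (mon ξ e)} := by
  rw [ideal_comap (monoIdeal e) ξ ⟨⊤, isAffineOpen_top _⟩ W le_top]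
  have := Scheme.IdealSheafData.equivOfIsAffine.apply_symm_apply
    (Ideal.span {(ΓSpecIso (coordRing ι)).inv (∏ i, MvPolynomial.X i ^ e i)})
  have h2 : (monoIdeal e).ideal ⟨⊤, isAffineOpen_top _⟩ = Ideal.span {(ΓSpecIso (coordRing ι)).inv (∏ i, MvPolynomial.X i ^ e i)} := this
  rw [h2, Ideal.map_span, Set.image_singleton, mon_appTop]
  rfl

lemma monoIdeal_isLP {A : Type*} (ξ : T ⟶ Spec (coordRing ι)) (e : A → ι → ℕ) :
    IsLP fun a ↦ (monoIdeal (e a)).comap ξ := by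
  intro y
  obtain ⟨_, ⟨V, hV, rfl⟩, hxV, -⟩ := T.isBasis_affineOpens.exists_subset_of_mem_open
    (Set.mem_univ y) isOpen_univ
  exact ⟨⟨V, hV⟩, hxV, fun a ↦ ⟨_, ideal_monoIdeal_comap ξ (e a) _⟩⟩

lemma monoIdeal_comap_le {ξ : T ⟶ Spec (coordRing ι)} {e e' : ι → ℕ} (h : e ≤ e') :
    (monoIdeal e').comap ξ ≤ (monoIdeal e).comap ξ := by
  intro W
  rw [ideal_monoIdeal_comap, ideal_monoIdeal_comap, Ideal.span_singleton_le_span_singleton]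
  obtain ⟨d, rfl⟩ := le_iff_exists_add.mp h
  rw [mon_add, map_mul]
  exact Dvd.intro _ rfl

lemma notMem_support_monoIdeal {ξ : T ⟶ Spec (coordRing ι)} {e : ι → ℕ} {x : T} :
    x ∉ ((monoIdeal e).comap ξ).support ↔ x ∈ T.basicOpen (mon ξ e) := by
  obtain ⟨_, ⟨V, hV, rfl⟩, hxV, -⟩ := T.isBasis_affineOpens.exists_subset_of_mem_open
    (Set.mem_univ x) isOpen_univ
  rw [← mem_basicOpen_of_span (U := ⟨V, hV⟩) (ideal_monoIdeal_comap ξ e ⟨V, hV⟩) hxV]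
  change _ ∈ T.basicOpen (T.presheaf.map _ _) ↔ _
  rw [Scheme.basicOpen_res]
  exact ⟨fun h ↦ h.2, fun h ↦ ⟨hxV, h⟩⟩

end Mon

lemma dominant_mono {T : Scheme.{u}} {O O' : T.Opens} (h : O ≤ O') [hd : IsSchemeTheoreticallyDominant O.ι] :
    IsSchemeTheoreticallyDominant O'.ι := by
  have : IsSchemeTheoreticallyDominant (T.homOfLE h ≫ O'.ι) := by
    rw [Scheme.homOfLE_ι]; exact hd
  exact dominant_of_comp (T.homOfLE h) _

lemma IsLP.of_finite {Y : Scheme.{u}} {A : Type*} [Finite A] {J : A → Y.IdealSheafData}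
    (h : ∀ a, ∀ y : Y, ∃ U : Y.affineOpens, y ∈ U.1 ∧ ∃ t, (J a).ideal U = Ideal.span {t}) :
    IsLP J := by
  intro y
  choose U hU t ht using fun a ↦ h a y
  have := isOpen_iInter_of_finite (fun a ↦ (U a).1.isOpen)
  obtain ⟨_, ⟨V, hV, rfl⟩, hxV, hVU⟩ := Y.isBasis_affineOpens.exists_subset_of_mem_open
    (show y ∈ ⋂ a, ((U a).1 : Set Y) by simpa using hU) this
  have hVU (a) : V ≤ (U a).1 := fun x hx ↦ Set.mem_iInter.mp (hVU hx) a
  refine ⟨⟨V, hV⟩, hxV, fun a ↦ ⟨rs (hVU a) (t a), ?_⟩⟩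
  rw [← (J a).map_ideal (U := ⟨V, hV⟩) (V := U a) (hVU a), ht, Ideal.map_span, Set.image_singleton]
  rfl

lemma IsLP.prod {Y : Scheme.{u}} {A : Type*} {J : A → Y.IdealSheafData} (h : IsLP J) (s : Finset A)
    (y : Y) : ∃ U : Y.affineOpens, y ∈ U.1 ∧ ∃ t, (∏ a ∈ s, J a).ideal U = Ideal.span {t} := by
  classical
  obtain ⟨U, hU, ht⟩ := h y
  choose t ht using ht
  refine ⟨U, hU, ∏ a ∈ s, t a, ?_⟩
  induction s using Finset.induction with
  | empty => simp
  | insert a s ha ih =>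
    rw [Finset.prod_insert ha, Finset.prod_insert ha, Scheme.IdealSheafData.ideal_mul, Pi.mul_apply,
      ih, ht, Ideal.span_singleton_mul_span_singleton]

lemma prod_comap {X Y : Scheme.{u}} {A : Type*} (J : A → Y.IdealSheafData) (s : Finset A)
    (f : X ⟶ Y) : (∏ a ∈ s, J a).comap f = ∏ a ∈ s, (J a).comap f := by
  classical
  induction s using Finset.induction with
  | empty => simp [Scheme.IdealSheafData.one_eq_top]
  | insert a s ha ih =>
    rw [Finset.prod_insert ha, Finset.prod_insert ha, ← ih]
    choose U U' hU hx using fun x : X ↦ exists_small x f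
    refine Scheme.IdealSheafData.ext_of_iSup_eq_top U' (iSup_eq_top_of_forall fun x ↦ ⟨x, hx x⟩) fun x ↦ ?_
    rw [ideal_comap _ f _ _ (hU x), Scheme.IdealSheafData.ideal_mul, Scheme.IdealSheafData.ideal_mul, Pi.mul_apply,
      Pi.mul_apply, Ideal.map_mul, ideal_comap _ f _ _ (hU x), ideal_comap _ f _ _ (hU x)]

lemma prod_monoIdeal_comap {ι : Type u} [Fintype ι] {T : Scheme.{u}} {A : Type*} (ξ : T ⟶ Spec (coordRing ι)) (s : Finset A)
    (e : A → ι → ℕ) : ∏ a ∈ s, (monoIdeal (e a)).comap ξ = (monoIdeal (∑ a ∈ s, e a)).comap ξ := by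
  classical
  induction s using Finset.induction with
  | empty =>
    ext W : 2
    rw [ideal_monoIdeal_comap, Finset.sum_empty, mon_zero, map_one, Ideal.span_singleton_one]
    simp
  | insert a s ha ih =>
    rw [Finset.prod_insert ha, Finset.sum_insert ha, ih]
    ext W : 2
    rw [Scheme.IdealSheafData.ideal_mul, Pi.mul_apply, ideal_monoIdeal_comap, ideal_monoIdeal_comap, ideal_monoIdeal_comap,
      Ideal.span_singleton_mul_span_singleton, mon_add, map_mul]

/-! ### Fibred powers and admissible points -/

section Powers

variable {S : Scheme.{u}} {X : Over S} {T : Scheme.{u}} {n : ℕ}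

/-- The morphism to a fibred power given by its components. -/
def powLift (f : Fin (n + 1) → (T ⟶ X.left)) (h : ∀ j, f j ≫ X.hom = f 0 ≫ X.hom) :
    T ⟶ (schPower X).obj (.op ⟨n⟩) :=
  (Pi.lift (fun j ↦ (Over.homMk (f j) (h j) : Over.mk (f 0 ≫ X.hom) ⟶ X)) :
    Over.mk (f 0 ≫ X.hom) ⟶ (power X).obj (.op ⟨n⟩)).left

lemma powLift_pr (f : Fin (n + 1) → (T ⟶ X.left)) (h : ∀ j, f j ≫ X.hom = f 0 ≫ X.hom) (j) :
    powLift f h ≫ pr X n j = f j :=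
  congr_arg CommaMorphism.left
    (Pi.lift_π (fun j ↦ (Over.homMk (f j) (h j) : Over.mk (f 0 ≫ X.hom) ⟶ X)) j)

lemma pr_hom (j : Fin (n + 1)) : pr X n j ≫ X.hom = ((power X).obj (.op ⟨n⟩)).hom :=
  Over.w (Pi.π (fun _ : Fin (n + 1) ↦ X) j)

lemma schPower_hom_ext {y y' : T ⟶ (schPower X).obj (.op ⟨n⟩)}
    (h : ∀ j, y ≫ pr X n j = y' ≫ pr X n j) : y = y' := by
  have e : y' ≫ ((power X).obj (.op ⟨n⟩)).hom = y ≫ ((power X).obj (.op ⟨n⟩)).hom := by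
    rw [← pr_hom (X := X) 0, ← Category.assoc, ← h, Category.assoc]
  let Y : Over.mk (y ≫ ((power X).obj (.op ⟨n⟩)).hom) ⟶ (power X).obj (.op ⟨n⟩) := Over.homMk y
  let Y' : Over.mk (y ≫ ((power X).obj (.op ⟨n⟩)).hom) ⟶ (power X).obj (.op ⟨n⟩) :=
    Over.homMk y' e
  have : Y = Y' := Pi.hom_ext _ _ fun j ↦ by ext1; exact h j
  exact congr_arg CommaMorphism.left this

lemma comp_pr_hom (y : T ⟶ (schPower X).obj (.op ⟨n⟩)) (j j') :
    (y ≫ pr X n j) ≫ X.hom = (y ≫ pr X n j') ≫ X.hom := by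
  rw [Category.assoc, Category.assoc, pr_hom, pr_hom]

end Powers

/-- The constant map `[0, n] → [0, n]` with value `0`. -/
def OSimp.const (n : ℕ) : OSimp.mk n ⟶ OSimp.mk n := OSimp.toPt n ≫ OSimp.pt 0

/-- The ideal of the diagonal is contained in an ideal modulo which a point is constant. -/
lemma diagIdeal_comap_le (P : OS Scheme.{u}) {n : ℕ} {T : Scheme.{u}} (p : T ⟶ P.obj (.op ⟨n⟩))
    (I : T.IdealSheafData) (h : I.subschemeι ≫ p = I.subschemeι ≫ p ≫ P.map (OSimp.const n).op) :
    (diagIdeal P n).comap p ≤ I := by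
  have e : I.map p = (I.subschemeι ≫ p).ker := by
    rw [← Scheme.IdealSheafData.map_ker, Scheme.IdealSheafData.ker_subschemeι]
  rw [← Scheme.IdealSheafData.le_map_iff_comap_le, e, h, OSimp.const, op_comp, P.map_comp,
    ← Category.assoc, ← Category.assoc]
  exact Hom.le_ker_comp _ _

lemma mon_subschemeι {ι : Type u} [Fintype ι] {T : Scheme.{u}} (ξ : T ⟶ Spec (coordRing ι)) (e : ι → ℕ) :
    mon (((monoIdeal e).comap ξ).subschemeι ≫ ξ) e = 0 := by
  set I := (monoIdeal e).comap ξ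
  rw [mon_comp]
  choose U hU using fun y : T ↦ TopologicalSpace.Opens.mem_iSup.mp
    ((iSup_affineOpens_eq_top T).ge (Set.mem_univ y))
  refine TopCat.Sheaf.eq_of_locally_eq' I.subscheme.sheaf (fun y ↦ I.subschemeι ⁻¹ᵁ (U y).1) ⊤
    (fun y ↦ homOfLE le_top) (fun x _ ↦ TopologicalSpace.Opens.mem_iSup.mpr ⟨I.subschemeι x, hU _⟩)
    _ _ fun y ↦ ?_
  have h1 : rs le_top (mon ξ e) ∈ I.ideal (U y) := by
    rw [ideal_monoIdeal_comap]
    exact Ideal.mem_span_singleton_self _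
  rw [← I.ker_subschemeι] at h1
  have h2 : pb I.subschemeι (U y).1 (rs le_top (mon ξ e)) = 0 := Hom.ideal_ker_le _ _ h1
  rw [pb_rs] at h2
  exact h2.trans (map_zero (rs (le_top : I.subschemeι ⁻¹ᵁ (U y).1 ≤ ⊤))).symm

lemma mon_eq_zero_of_le {ι : Type u} [Fintype ι] {T : Scheme.{u}} {ξ : T ⟶ Spec (coordRing ι)} {e e' : ι → ℕ}
    (h : e ≤ e') (h0 : mon ξ e = 0) : mon ξ e' = 0 := by
  obtain ⟨d, rfl⟩ := le_iff_exists_add.mp h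
  rw [mon_add, h0, zero_mul]

/-- Functions vanishing on the closed subscheme defined by a monomial are divisible by it. -/
lemma exists_eq_mul_mon {ι : Type u} [Fintype ι] {T : Scheme.{u}} (ξ : T ⟶ Spec (coordRing ι)) (e : ι → ℕ) (W : T.affineOpens)
    (s : Γ(T, W.1)) (hs : pb ((monoIdeal e).comap ξ).subschemeι W.1 s = 0) :
    ∃ a, s = a * rs le_top (mon ξ e) := by
  have : s ∈ ((monoIdeal e).comap ξ).ideal W := by
    rw [← ((monoIdeal e).comap ξ).ker_subschemeι, Hom.ker_apply]
    exact hs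
  rw [ideal_monoIdeal_comap] at this
  obtain ⟨a, ha⟩ := Ideal.mem_span_singleton'.mp this
  exact ⟨a, ha.symm⟩

instance {ι : Type u} [Fintype ι] {T : Scheme.{u}} (ξ : T ⟶ Spec (coordRing ι)) :
    QuasiCompact (inner ξ).ι := inferInstanceAs (QuasiCompact (T.basicOpen _).ι)

/-- Divisors of monomials are nonzerodivisors. -/
lemma cancel_of_dvd_mon {ι : Type u} [Fintype ι] {T : Scheme.{u}} {ξ : T ⟶ Spec (coordRing ι)}
    (hd : IsSchemeTheoreticallyDominant (inner ξ).ι) {W : T.Opens} {t : Γ(T, W)} {e : ι → ℕ}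
    (h : t ∣ rs le_top (mon ξ e)) {a b : Γ(T, W)} (hab : t * a = t * b) : a = b := by
  refine cancel_of_dominant (inner ξ) t (fun x hx hxW ↦ ?_) hab
  obtain ⟨c, hc⟩ := h
  have : x ∈ T.basicOpen (rs (le_top : W ≤ ⊤) (mon ξ e)) := by
    change _ ∈ T.basicOpen (T.presheaf.map _ _)
    rw [Scheme.basicOpen_res]
    exact ⟨hxW, inner_le ξ e hx⟩
  rw [hc, Scheme.basicOpen_mul] at this
  exact this.1

lemma rs_mon_comp {ι : Type u} [Fintype ι] {T K : Scheme.{u}} (κ : K ⟶ T) (ξ : T ⟶ Spec (coordRing ι)) (e : ι → ℕ)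
    (W : T.Opens) : pb κ W (rs le_top (mon ξ e)) = rs le_top (mon (κ ≫ ξ) e) := by
  rw [pb_rs, mon_comp]
  rfl

section Tower

variable {S : Scheme.{u}} {X : Over S} {ι : Type u} [Fintype ι] [DecidableEq ι]
  (D : ι → X.left.IdealSheafData) (hD : ∀ i, IsFG (D i)) (m : ι → ℕ) (r : ι → ℚ)

/-- The exponents `m_i (r_i - 1)`. -/
def expo (m : ι → ℕ) (r : ι → ℚ) : ι → ℕ := fun i ↦ ⌊m i * (r i - 1)⌋₊

/-- The conditions on a point `(y, ξ)` of `X ^ (n + 1) × 𝔸 ^ h` with values in a scheme in which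
the locus `∏ x_i ≠ 0` is schematically dense to lift to `P^{(R, M)}_n`: the pullbacks of `D_i` are
defined by `x_i ^ m_i`, and the `y_j` agree modulo `∏ x_i ^ (m_i r_i)`. -/
structure Adm (e : ι → ℕ) (n : ℕ) {T : Scheme.{u}} (y : T ⟶ (schPower X).obj (.op ⟨n⟩))
    (ξ : T ⟶ Spec (coordRing ι)) : Prop where
  dom : IsSchemeTheoreticallyDominant (inner ξ).ι
  div : ∀ j i, (D i).comap (y ≫ pr X n j) = (monoIdeal (Pi.single i (m i))).comap ξ
  diag : ∀ {K : Scheme.{u}} (κ : K ⟶ T), mon (κ ≫ ξ) (m + e) = 0 → ∀ j j',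
    κ ≫ y ≫ pr X n j = κ ≫ y ≫ pr X n j'

variable {D m} {e : ι → ℕ} {n : ℕ} {T : Scheme.{u}} {y : T ⟶ (schPower X).obj (.op ⟨n⟩)}
    {ξ : T ⟶ Spec (coordRing ι)}

lemma const_pr (j : Fin (n + 1)) : (schPower X).map (OSimp.const n).op ≫ pr X n j = pr X n 0 :=
  map_pr X (OSimp.const n) j

lemma Adm.comp_const (h : Adm D m e n y ξ) {K : Scheme.{u}} (κ : K ⟶ T) (hκ : mon (κ ≫ ξ) (m + e) = 0) :
    κ ≫ y = κ ≫ y ≫ (schPower X).map (OSimp.const n).op := by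
  refine schPower_hom_ext fun j ↦ ?_
  simp only [Category.assoc, const_pr]
  exact h.diag κ hκ j 0

lemma Adm.diagIdeal_le (h : Adm D m e n y ξ) :
    (diagIdeal (schPower X) n).comap y ≤ (monoIdeal (m + e)).comap ξ :=
  diagIdeal_comap_le _ _ _ (h.comp_const _ (mon_subschemeι _ _))

lemma Adm.div_prod (h : Adm D m e n y ξ) (j) :
    (∏ i, D i).comap (y ≫ pr X n j) = (monoIdeal m).comap ξ := by
  rw [prod_comap, Finset.prod_congr rfl fun i _ ↦ h.div j i, prod_monoIdeal_comap,
    Finset.univ_sum_single]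

lemma IsLP.centersD (hLP : IsLP D) (n : ℕ) : IsLP (centersD X D hD n).J :=
  .of_finite fun j y ↦ by
    have h : IsLP fun _ : Unit ↦ ∏ i, D i := fun x ↦ by
      obtain ⟨U, hU, ht⟩ := hLP.prod Finset.univ x
      exact ⟨U, hU, fun _ ↦ ht⟩
    obtain ⟨U, hU, ht⟩ := h.comap (pr X n j) y
    exact ⟨U, hU, ht ()⟩

lemma span_eq_mul {A : Type*} [CommRing A] {s t : A} (h : Ideal.span {s} = Ideal.span {t}) :
    (∃ a, s = t * a) ∧ ∃ a, t = s * a :=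
  ⟨Ideal.mem_span_singleton.mp (h ▸ Ideal.mem_span_singleton_self s),
    Ideal.mem_span_singleton.mp (h ▸ Ideal.mem_span_singleton_self t)⟩

/-- A lift of an admissible point to `P^{(D)}_n` is constant modulo `∏ x_i ^ e_i`. -/
lemma Adm.congr_PD (hLP : IsLP D) {P Q : T ⟶ (centersD X D hD n).dil}
    (hP : Adm D m e n (P ≫ (centersD X D hD n).dilProj) ξ)
    (hQ : Q ≫ (centersD X D hD n).dilProj =
      P ≫ (centersD X D hD n).dilProj ≫ (schPower X).map (OSimp.const n).op)
    {K : Scheme.{u}} (κ : K ⟶ T) (hκ : mon (κ ≫ ξ) e = 0) : κ ≫ P = κ ≫ Q := by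
  have e1 : κ ≫ P ≫ (centersD X D hD n).dilProj = κ ≫ Q ≫ (centersD X D hD n).dilProj := by
    have := hP.comp_const κ (mon_eq_zero_of_le (self_le_add_left e m) hκ)
    simp only [Category.assoc] at this
    rw [hQ, this]
  refine (centersD X D hD n).dil_congr κ P Q e1 fun x ↦ ?_
  obtain ⟨U, hU, ht⟩ := hLP.centersD hD n ((κ ≫ P ≫ (centersD X D hD n).dilProj) x)
  obtain ⟨_, ⟨W, hWa, rfl⟩, hxW, hW⟩ := T.isBasis_affineOpens.exists_subset_of_mem_open
    (show κ x ∈ (((P ≫ (centersD X D hD n).dilProj) ⁻¹ᵁ U.1 ⊓ (Q ≫ (centersD X D hD n).dilProj) ⁻¹ᵁ U.1 : T.Opens) : Set T) from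
      ⟨hU, by rw [e1] at hU; exact hU⟩) (TopologicalSpace.Opens.isOpen _)
  have hp : W ≤ (P ≫ (centersD X D hD n).dilProj) ⁻¹ᵁ U.1 := fun x hx ↦ (hW hx).1
  have hq : W ≤ (Q ≫ (centersD X D hD n).dilProj) ⁻¹ᵁ U.1 := fun x hx ↦ (hW hx).2
  refine ⟨U, W, hp, hq, hxW, fun j ↦ ?_⟩
  obtain ⟨t, ht⟩ := ht j
  have key (f : T ⟶ (schPower X).obj (.op ⟨n⟩)) (hf : W ≤ f ⁻¹ᵁ U.1) (j')
      (hj : f ≫ pr X n j = (P ≫ (centersD X D hD n).dilProj) ≫ pr X n j') :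
      Ideal.span {rs hf (pb f U.1 t)} = Ideal.span {rs le_top (mon ξ m)} := by
    have h1 := ideal_comap ((centersD X D hD n).J j) f U ⟨W, hWa⟩ hf
    rw [ht, Ideal.map_span, Set.image_singleton] at h1
    refine h1.symm.trans ?_
    rw [← ideal_monoIdeal_comap ξ m ⟨W, hWa⟩, ← hP.div_prod j', ← hj, Scheme.IdealSheafData.comap_comp]
    rfl
  obtain ⟨⟨a, ha⟩, b, hb⟩ := span_eq_mul (key _ hp j rfl)
  obtain ⟨⟨a', ha'⟩, b', hb'⟩ := span_eq_mul (key _ hq 0 (by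
    rw [hQ, Category.assoc, Category.assoc, const_pr, Category.assoc]))
  refine ⟨t, ht, fun s s' h ↦ ?_, fun c hc ↦ ?_⟩
  · refine cancel_of_dvd_mon hP.dom (e := m + m) ?_ h
    rw [mon_add, map_mul]
    exact mul_dvd_mul ⟨b, hb⟩ ⟨b', hb'⟩
  · have hqc : rs hq (pb (Q ≫ (centersD X D hD n).dilProj) U.1 c) = 0 := by
      have h1 : pb ((schPower X).map (OSimp.toPt n).op) U.1 c = 0 := Hom.ideal_ker_le _ _ hc
      have h2 : Q ≫ (centersD X D hD n).dilProj = (P ≫ (centersD X D hD n).dilProj ≫ (schPower X).map (OSimp.pt 0).op) ≫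
          (schPower X).map (OSimp.toPt n).op := by
        rw [hQ, OSimp.const, op_comp, Functor.map_comp]
        simp only [Category.assoc]
      rw [pb_congr h2 hq]
      change rs _ (pb _ _ (pb _ _ c)) = 0
      rw [h1, map_zero, map_zero]
    have hpc : rs hp (pb (P ≫ (centersD X D hD n).dilProj) U.1 c) ∈ Ideal.span {rs le_top (mon ξ (m + e))} := by
      rw [← ideal_monoIdeal_comap ξ (m + e) ⟨W, hWa⟩]
      refine hP.diagIdeal_le _ ?_
      rw [ideal_comap _ _ U ⟨W, hWa⟩ hp]
      exact Ideal.mem_map_of_mem ((rs hp).comp (pb (P ≫ (centersD X D hD n).dilProj) U.1)) hc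
    obtain ⟨z, hz⟩ := Ideal.mem_span_singleton'.mp hpc
    refine ⟨z * b * rs le_top (mon ξ e), ?_, ?_⟩
    · rw [RingHom.mem_ker, map_mul, rs_mon_comp, hκ, map_zero, mul_zero]
    · rw [hqc, ← hz, mon_add, map_mul, zero_mul, sub_zero]
      conv_lhs => rw [hb]
      ring

lemma divIdeal_isLP (hLP : IsLP D) (n : ℕ) : IsLP (centersDM X D hD m n).J :=
  .of_finite fun a y ↦ by
    obtain ⟨j, i, b⟩ := a
    cases b
    · obtain ⟨U, hU, ht⟩ := monoIdeal_isLP ((ADCoord X D hD).app (.op ⟨n⟩)) (fun i ↦ Pi.single i (m i)) y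
      exact ⟨U, hU, ht i⟩
    · obtain ⟨U, hU, ht⟩ := hLP.comap ((ADProj X D hD ≫ PDProj X D hD).app (.op ⟨n⟩) ≫ pr X n j) y
      exact ⟨U, hU, ht i⟩

/-- The ring identity behind the congruence of the fractions `τ / μ` and `μ / τ`. -/
lemma fraction_congr {A : Type*} [CommRing A] {N : Ideal A} {μ v w z z' : A} (hvw : v - w ∈ N) (hz : z - z' ∈ N)
    (hv : IsUnit v) (hw : IsUnit w) :
    (∃ n ∈ N, z * μ * (μ * w) - z' * μ * (μ * v) = μ * v * (μ * w) * n) ∧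
      ∃ n ∈ N, z * (μ * v) * μ - z' * (μ * w) * μ = μ * μ * n := by
  obtain ⟨v, rfl⟩ := hv
  obtain ⟨w, rfl⟩ := hw
  refine ⟨⟨(z * w - z' * v) * (v⁻¹ : Aˣ) * (w⁻¹ : Aˣ), ?_, ?_⟩, z * v - z' * w, ?_, by ring⟩
  · refine Ideal.mul_mem_right _ _ (Ideal.mul_mem_right _ _ ?_)
    rw [show z * w - z' * v = (z - z') * w - z' * (v - w) by ring]
    exact N.sub_mem (Ideal.mul_mem_right _ _ hz) (Ideal.mul_mem_left _ _ hvw)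
  · have h1 := v.mul_inv
    have h2 := w.mul_inv
    linear_combination (-(z * w - z' * v) * μ * μ) * (h1 * w * (w⁻¹ : Aˣ) + h2)
  · rw [show z * v - z' * w = (z - z') * v + z' * (v - w) by ring]
    exact N.add_mem (Ideal.mul_mem_right _ _ hz) (Ideal.mul_mem_left _ _ hvw)

end Tower

/-! ### Congruences of lifts to the dilatations -/

section Tower

variable {S : Scheme.{u}} {X : Over S} {ι : Type u} [Fintype ι] [DecidableEq ι]
  (D : ι → X.left.IdealSheafData) (hD : ∀ i, IsFG (D i)) (m : ι → ℕ) (r : ι → ℚ)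

variable {D m} {e : ι → ℕ} {n : ℕ} {T : Scheme.{u}} {y : T ⟶ (schPower X).obj (.op ⟨n⟩)}
    {ξ : T ⟶ Spec (coordRing ι)}

/-- A lift of an admissible point to `P^{(D, M)}_n` is constant modulo `∏ x_i ^ e_i` if its image
in `P^{(D)}_n × 𝔸 ^ h` is. -/
lemma Adm.congr_PDM (hLP : IsLP D) {P Q : T ⟶ (centersDM X D hD m n).dil}
    (hP : Adm D m e n ((P ≫ (centersDM X D hD m n).dilProj) ≫
      (ADProj X D hD ≫ PDProj X D hD).app (.op ⟨n⟩)) ξ)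
    (hξ : (P ≫ (centersDM X D hD m n).dilProj) ≫ (ADCoord X D hD).app (.op ⟨n⟩) = ξ)
    (hQ : Q ≫ (centersDM X D hD m n).dilProj =
      P ≫ (centersDM X D hD m n).dilProj ≫ (AD X D hD).map (OSimp.const n).op)
    {K : Scheme.{u}} (κ : K ⟶ T) (hκ : mon (κ ≫ ξ) e = 0)
    (e1 : κ ≫ P ≫ (centersDM X D hD m n).dilProj = κ ≫ Q ≫ (centersDM X D hD m n).dilProj) :
    κ ≫ P = κ ≫ Q := by
  have hQξ : (Q ≫ (centersDM X D hD m n).dilProj) ≫ (ADCoord X D hD).app (.op ⟨n⟩) = ξ := by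
    rw [hQ, ← hξ, Category.assoc, Category.assoc, (ADCoord X D hD).naturality]
    rw [Category.assoc]
    exact congrArg (fun z ↦ P ≫ (centersDM X D hD m n).dilProj ≫ z) (Category.comp_id _)
  have hQy (j) : ((Q ≫ (centersDM X D hD m n).dilProj) ≫
      (ADProj X D hD ≫ PDProj X D hD).app (.op ⟨n⟩)) ≫ pr X n j =
      ((P ≫ (centersDM X D hD m n).dilProj) ≫
      (ADProj X D hD ≫ PDProj X D hD).app (.op ⟨n⟩)) ≫ pr X n 0 := by
    rw [hQ, ← const_pr j]
    simp only [Category.assoc]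
    rw [NatTrans.naturality_assoc]
  set p := P ≫ (centersDM X D hD m n).dilProj with hp'
  set q := Q ≫ (centersDM X D hD m n).dilProj with hq'
  set Φ := (ADProj X D hD ≫ PDProj X D hD).app (.op ⟨n⟩) with hΦ
  refine (centersDM X D hD m n).dil_congr κ P Q e1 fun x ↦ ?_
  have hpt (j) : ((κ ≫ p) ≫ Φ) ≫ pr X n j = ((κ ≫ p) ≫ Φ) ≫ pr X n 0 := by
    have := hP.diag κ (mon_eq_zero_of_le (self_le_add_left e m) hκ) j 0
    simpa only [Category.assoc] using this
  obtain ⟨UX, hUX, hτ⟩ := hLP ((((κ ≫ p) ≫ Φ) ≫ pr X n 0) x)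
  choose τ hτ using hτ
  obtain ⟨_, ⟨U, hUa, rfl⟩, hxU, hU⟩ := ((AD X D hD).obj (.op ⟨n⟩)).isBasis_affineOpens.exists_subset_of_mem_open
    (show (κ ≫ p) x ∈ ⋂ j, (((Φ ≫ pr X n j) ⁻¹ᵁ UX.1 : ((AD X D hD).obj (.op ⟨n⟩)).Opens) : Set _) from
      Set.mem_iInter.mpr fun j ↦ by
        have := hpt j
        change ((((κ ≫ p) ≫ Φ) ≫ pr X n j) x) ∈ UX.1
        rw [this]; exact hUX) (isOpen_iInter_of_finite fun j ↦ TopologicalSpace.Opens.isOpen _)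
  have hUj (j) : U ≤ (Φ ≫ pr X n j) ⁻¹ᵁ UX.1 := fun x hx ↦ Set.mem_iInter.mp (hU hx) j
  obtain ⟨_, ⟨W, hWa, rfl⟩, hxW, hW⟩ := T.isBasis_affineOpens.exists_subset_of_mem_open
    (show κ x ∈ ((p ⁻¹ᵁ U ⊓ q ⁻¹ᵁ U : T.Opens) : Set T) from
      ⟨hxU, by rw [e1] at hxU; exact hxU⟩) (TopologicalSpace.Opens.isOpen _)
  have hp : W ≤ p ⁻¹ᵁ U := fun x hx ↦ (hW hx).1
  have hq : W ≤ q ⁻¹ᵁ U := fun x hx ↦ (hW hx).2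
  refine ⟨⟨U, hUa⟩, W, hp, hq, hxW, fun a ↦ ?_⟩
  obtain ⟨j, i, b⟩ := a
  -- the local equations of the two divisors
  let t : Γ((AD X D hD).obj (.op ⟨n⟩), U) := rs (hUj j) (pb (Φ ≫ pr X n j) UX.1 (τ i))
  let s : Γ((AD X D hD).obj (.op ⟨n⟩), U) := rs le_top (mon ((ADCoord X D hD).app (.op ⟨n⟩)) (Pi.single i (m i)))
  have ht : (divIdeal X D hD n j i).ideal ⟨U, hUa⟩ = Ideal.span {t} := by
    rw [divIdeal, ideal_comap _ _ UX ⟨U, hUa⟩ (hUj j), hτ, Ideal.map_span, Set.image_singleton]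
    rfl
  have hs : (coordIdeal X D hD m n i).ideal ⟨U, hUa⟩ = Ideal.span {s} :=
    ideal_monoIdeal_comap _ _ _
  let μ : Γ(T, W) := rs le_top (mon ξ (Pi.single i (m i)))
  have hsp : rs hp (pb p U s) = μ := by
    simp only [s, μ]
    rw [rs_mon_comp, rs_rs, hξ]
  have hsq : rs hq (pb q U s) = μ := by
    simp only [s, μ]
    rw [rs_mon_comp, rs_rs, hQξ]
  have hpj (j') : W ≤ ((p ≫ Φ) ≫ pr X n j') ⁻¹ᵁ UX.1 := hp.trans (p.preimage_mono (hUj j'))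
  have htp : rs hp (pb p U t) = rs (hpj j) (pb ((p ≫ Φ) ≫ pr X n j) UX.1 (τ i)) := by
    simp only [t]
    rw [pb_rs, rs_rs]
    rfl
  have htq : rs hq (pb q U t) = rs (hpj 0) (pb ((p ≫ Φ) ≫ pr X n 0) UX.1 (τ i)) := by
    simp only [t]
    rw [pb_rs, rs_rs]
    exact pb_congr (a := (q ≫ Φ) ≫ pr X n j) (hQy j) _ _
  have hspan (j') : Ideal.span {rs (hpj j') (pb ((p ≫ Φ) ≫ pr X n j') UX.1 (τ i))} = Ideal.span {μ} := by
    rw [← ideal_monoIdeal_comap ξ (Pi.single i (m i)) ⟨W, hWa⟩, ← hP.div j',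
      ideal_comap _ _ UX ⟨W, hWa⟩ (hpj j'), hτ, Ideal.map_span, Set.image_singleton]
    rfl
  have hcan {a b : Γ(T, W)} (h : μ * a = μ * b) : a = b := cancel_of_dvd_mon hP.dom dvd_rfl h
  have hunit (j') : ∃ v, IsUnit v ∧ rs (hpj j') (pb ((p ≫ Φ) ≫ pr X n j') UX.1 (τ i)) = μ * v := by
    obtain ⟨⟨v, hv⟩, v', hv'⟩ := span_eq_mul (hspan j')
    refine ⟨v, .of_mul_eq_one v' (hcan ?_), hv⟩
    rw [mul_one, ← mul_assoc, ← hv, ← hv']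
  obtain ⟨v, hv, hpv⟩ := hunit j
  obtain ⟨w, hw, hqw⟩ := hunit 0
  have hvw : v - w ∈ RingHom.ker (pb κ W) := by
    obtain ⟨a, ha⟩ := exists_eq_mul_mon ξ (m + e) ⟨W, hWa⟩ (μ * v - μ * w) (by
      rw [← hpv, ← hqw, map_sub, pb_rs, pb_rs, sub_eq_zero]
      exact pb_congr (hP.diag _ (mon_subschemeι ξ (m + e)) j 0) _ _)
    obtain ⟨d, hd⟩ : ∃ d : ι → ℕ, m = (Pi.single i (m i) : ι → ℕ) + d := le_iff_exists_add.mp (show (Pi.single i (m i) : ι → ℕ) ≤ m from fun i' ↦ by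
      by_cases h : i' = i
      · subst h; simp
      · simp [h])
    have : v - w = a * (rs le_top (mon ξ d) * rs le_top (mon ξ e)) := hcan (by
      rw [mul_sub, ha]
      conv_lhs => rw [hd]
      rw [mon_add, mon_add, map_mul, map_mul]
      ring)
    rw [this, RingHom.mem_ker, map_mul, map_mul, rs_mon_comp κ ξ e, hκ, map_zero, mul_zero, mul_zero]
  have hz (z : Γ((AD X D hD).obj (.op ⟨n⟩), U)) : rs hp (pb p U z) - rs hq (pb q U z) ∈ RingHom.ker (pb κ W) := by
    rw [RingHom.mem_ker, map_sub, pb_rs, pb_rs, sub_eq_zero]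
    exact pb_congr (a := κ ≫ p) e1 _ _
  rw [hpv] at htp
  rw [hqw] at htq
  cases b
  · refine ⟨s, hs, fun a b h ↦ ?_, fun c hc ↦ ?_⟩
    · rw [hsp, hsq] at h
      exact hcan (hcan (by rw [← mul_assoc, ← mul_assoc]; exact h))
    · have hc : c ∈ (divIdeal X D hD n j i).ideal ⟨U, hUa⟩ := hc
      rw [ht] at hc
      obtain ⟨z, rfl⟩ := Ideal.mem_span_singleton'.mp hc
      rw [hsp, hsq, map_mul, map_mul, map_mul, map_mul, htp, htq]
      exact (fraction_congr hvw (hz z) hv hw).2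
  · refine ⟨t, ht, fun a b h ↦ ?_, fun c hc ↦ ?_⟩
    · rw [htp, htq] at h
      refine (hv.mul hw).mul_left_cancel (hcan (hcan ?_))
      linear_combination h
    · have hc : c ∈ (coordIdeal X D hD m n i).ideal ⟨U, hUa⟩ := hc
      rw [hs] at hc
      obtain ⟨z, rfl⟩ := Ideal.mem_span_singleton'.mp hc
      rw [htp, htq, map_mul, map_mul, map_mul, map_mul, hsp, hsq]
      exact (fraction_congr hvw (hz z) hv hw).1

variable (X D m) in
/-- The canonical morphisms `P^{(D, M)}_n ⟶ X ^ (n + 1)`. -/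
def PDMToPower : PDM X D hD m ⟶ schPower X := PDMProj X D hD m ≫ ADProj X D hD ≫ PDProj X D hD

lemma AD_hom_ext {p q : T ⟶ (AD X D hD).obj (.op ⟨n⟩)}
    (h1 : p ≫ (ADProj X D hD).app _ = q ≫ (ADProj X D hD).app _)
    (h2 : p ≫ (ADCoord X D hD).app _ = q ≫ (ADCoord X D hD).app _) : p = q :=
  pullback.hom_ext h1 h2

/-- A lift of an admissible point to `P^{(D, M)}_n` is constant modulo `∏ x_i ^ e_i`. -/
lemma Adm.comp_const_PDM (hLP : IsLP D) {p : T ⟶ (PDM X D hD m).obj (.op ⟨n⟩)}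
    (h : Adm D m e n (p ≫ (PDMToPower X D hD m).app _) (p ≫ (PDMCoord X D hD m).app _))
    {K : Scheme.{u}} (κ : K ⟶ T) (hκ : mon (κ ≫ p ≫ (PDMCoord X D hD m).app _) e = 0) :
    κ ≫ p = κ ≫ p ≫ (PDM X D hD m).map (OSimp.const n).op := by
  have h1 : κ ≫ (p ≫ (PDMProj X D hD m).app _ ≫ (ADProj X D hD).app _) =
      κ ≫ ((p ≫ (PDMProj X D hD m).app _ ≫ (ADProj X D hD).app _) ≫ (PD X D hD).map (OSimp.const n).op) := by
    refine Adm.congr_PD (m := m) (ξ := p ≫ (PDMCoord X D hD m).app _) hD hLP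
      (P := p ≫ (PDMProj X D hD m).app _ ≫ (ADProj X D hD).app _)
      (Q := (p ≫ (PDMProj X D hD m).app _ ≫ (ADProj X D hD).app _) ≫ (PD X D hD).map (OSimp.const n).op) ?_ ?_ κ hκ
    · simpa only [PDMToPower, NatTrans.comp_app, Category.assoc] using! h
    · change (_ ≫ (PD X D hD).map _) ≫ (PDProj X D hD).app _ = _ ≫ (PDProj X D hD).app _ ≫ _
      rw [Category.assoc, (PDProj X D hD).naturality]
      rfl
  have h2 : κ ≫ p ≫ (PDMProj X D hD m).app _ =
      κ ≫ (p ≫ (PDMProj X D hD m).app _) ≫ (AD X D hD).map (OSimp.const n).op := by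
    refine AD_hom_ext hD ?_ ?_
    · simp only [Category.assoc] at h1 ⊢
      rw [(ADProj X D hD).naturality]
      exact h1
    · simp only [Category.assoc]
      rw [(ADCoord X D hD).naturality]
      exact congr(κ ≫ p ≫ _ ≫ $((Category.comp_id _).symm))
  refine Adm.congr_PDM (ξ := p ≫ (PDMCoord X D hD m).app _) hD hLP (P := p)
    (Q := p ≫ (PDM X D hD m).map (OSimp.const n).op) ?_ ?_ ?_ κ hκ ?_
  · exact h
  · exact Category.assoc _ _ _
  · change (_ ≫ (PDM X D hD m).map _) ≫ (PDMProj X D hD m).app _ = _ ≫ (PDMProj X D hD m).app _ ≫ _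
    rw [Category.assoc, (PDMProj X D hD m).naturality]
  · change _ = κ ≫ (p ≫ (PDM X D hD m).map _) ≫ (PDMProj X D hD m).app _
    rw [Category.assoc, (PDMProj X D hD m).naturality]
    simpa only [Category.assoc] using! h2

end Tower

/-! ### The universal property of `P^{(R, M)}` -/

lemma dominant_preimage {T T' : Scheme.{u}} (f : T' ⟶ T) [Flat f] (O : T.Opens) [QuasiCompact O.ι]
    [IsSchemeTheoreticallyDominant O.ι] : IsSchemeTheoreticallyDominant (f ⁻¹ᵁ O).ι :=
  .of_isPullback (isPullback_morphismRestrict f O).flip.flip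

instance quasiCompact_preimage_ι {T T' : Scheme.{u}} (f : T' ⟶ T) (O : T.Opens) [QuasiCompact O.ι] :
    QuasiCompact (f ⁻¹ᵁ O).ι :=
  MorphismProperty.of_isPullback (isPullback_morphismRestrict f O) inferInstance

lemma dominant_of_factor {P T : Scheme.{u}} (p : P ⟶ T) [hp : IsSchemeTheoreticallyDominant p] (O : T.Opens)
    (h : ∀ x, p x ∈ O) : IsSchemeTheoreticallyDominant O.ι := by
  have h' : Set.range p ⊆ Set.range O.ι := by
    rintro _ ⟨x, rfl⟩
    rw [Scheme.Opens.range_ι]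
    exact h x
  have : IsSchemeTheoreticallyDominant (IsOpenImmersion.lift O.ι p h' ≫ O.ι) := by
    rwa [IsOpenImmersion.lift_fac]
  exact dominant_of_comp (IsOpenImmersion.lift _ p h') _

lemma xc_comp_mem_basicOpen {ι : Type u} [Fintype ι] {T T' : Scheme.{u}} (f : T' ⟶ T) (ξ : T ⟶ Spec (coordRing ι))
    (i : ι) (x : T') : x ∈ T'.basicOpen (xc (f ≫ ξ) i) ↔ f x ∈ T.basicOpen (xc ξ i) := by
  rw [xc_comp]
  change _ ∈ T'.basicOpen (f.app ⊤ _) ↔ _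
  rw [← Scheme.preimage_basicOpen]
  rfl

section Tower

variable {S : Scheme.{u}} {X : Over S} {ι : Type u} [Fintype ι] [DecidableEq ι]
  {D : ι → X.left.IdealSheafData} (hD : ∀ i, IsFG (D i)) (m : ι → ℕ) (r : ι → ℚ)
  {n : ℕ} {T : Scheme.{u}}

/-- The pullbacks of `D_i` to `P^{(D, M)}_n` are defined by `x_i ^ m_i`. -/
lemma div_PDM (hLP : IsLP D) (j : Fin (n + 1)) (i : ι) :
    (D i).comap ((PDMToPower X D hD m).app (.op ⟨n⟩) ≫ pr X n j) =
      (monoIdeal (Pi.single i (m i))).comap ((PDMCoord X D hD m).app (.op ⟨n⟩)) := by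
  have h1 : (divIdeal X D hD n j i).comap ((PDMProj X D hD m).app (.op ⟨n⟩)) =
      (D i).comap ((PDMToPower X D hD m).app (.op ⟨n⟩) ≫ pr X n j) := by
    rw [divIdeal, ← Scheme.IdealSheafData.comap_comp, PDMToPower, NatTrans.comp_app _ (_ ≫ _), Category.assoc]
  have h2 : (coordIdeal X D hD m n i).comap ((PDMProj X D hD m).app (.op ⟨n⟩)) =
      (monoIdeal (Pi.single i (m i))).comap ((PDMCoord X D hD m).app (.op ⟨n⟩)) := by
    rw [coordIdeal, ← Scheme.IdealSheafData.comap_comp]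
    rfl
  rw [← h1, ← h2]
  exact le_antisymm
    ((centersDM X D hD m n).comap_dilProj_le (divIdeal_isLP hD hLP n) (j, i, false))
    ((centersDM X D hD m n).comap_dilProj_le (divIdeal_isLP hD hLP n) (j, i, true))

lemma dominant_inner_PDM (hm : ∀ i, 1 ≤ m i) (n : ℕ) :
    IsSchemeTheoreticallyDominant (inner ((PDMCoord X D hD m).app (.op ⟨n⟩))).ι := by
  let C := centersDM X D hD m n
  have key : C.dilProj ⁻¹ᵁ C.compl ≤ inner (C.dilProj ≫ (ADCoord X D hD).app (.op ⟨n⟩)) := by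
    intro x hx
    rw [mem_inner]
    intro i
    have hx : C.dilProj x ∈ C.compl := hx
    rw [Centers.mem_compl] at hx
    have h1 := notMem_support_monoIdeal.mp (hx (0, i, false))
    rw [mem_basicOpen_mon] at h1
    have h2 := h1 i (by rw [Pi.single_eq_same]; exact Nat.one_le_iff_ne_zero.mp (hm i))
    exact (xc_comp_mem_basicOpen C.dilProj _ i x).mpr h2
  exact @dominant_mono _ _ _ key (dominant_dilProj_preimage C)

lemma dominant_inner_PRM (hm : ∀ i, 1 ≤ m i) (n : ℕ) :
    IsSchemeTheoreticallyDominant (inner ((PRMCoord X D hD m r).app (.op ⟨n⟩))).ι := by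
  have := dominant_inner_PDM hD m hm n
  let O := inner ((PDMCoord X D hD m).app (.op ⟨n⟩))
  let C := centersRM X D hD m r n
  have h1 : IsSchemeTheoreticallyDominant (C.compl.ι ⁻¹ᵁ O).ι := dominant_preimage C.compl.ι O
  have h2 : IsSchemeTheoreticallyDominant ((C.compl.ι ⁻¹ᵁ O).ι ≫ C.fromCompl) := inferInstance
  refine dominant_of_factor ((C.compl.ι ⁻¹ᵁ O).ι ≫ C.fromCompl)
    (inner (C.dilProj ≫ (PDMCoord X D hD m).app (.op ⟨n⟩))) fun x ↦ ?_
  rw [inner_comp]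
  have h4 : (((C.compl.ι ⁻¹ᵁ O).ι ≫ C.fromCompl) ≫ C.dilProj) x ∈ O := by
    rw [Category.assoc, C.fromCompl_dilProj]
    exact x.2
  exact h4

/-- On a point of a power on which the ideal of the diagonal vanishes, the components are equal. -/
lemma comp_pr_eq_of_diagIdeal_le [IsSeparated X.hom] (y : T ⟶ (schPower X).obj (.op ⟨n⟩)) 
    (h : diagIdeal (schPower X) n ≤ y.ker) (j j') : y ≫ pr X n j = y ≫ pr X n j' := by
  let a := Pi.π (fun _ : Fin (n + 1) ↦ X) j
  let b := Pi.π (fun _ : Fin (n + 1) ↦ X) j'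
  have hΔ (j) : (power X).map (OSimp.toPt n).op ≫ Pi.π (fun _ : Fin (n + 1) ↦ X) j =
    Pi.π (fun _ : Fin (0 + 1) ↦ X) 0 := Over.OverMorphism.ext (map_pr X (OSimp.toPt n) j)
  let l : (power X).obj (.op ⟨0⟩) ⟶ equalizer a b :=
    equalizer.lift ((power X).map (OSimp.toPt n).op) ((hΔ j).trans (hΔ j').symm)
  let ε : (equalizer a b).left ⟶ (schPower X).obj (.op ⟨n⟩) := (equalizer.ι a b).left
  let l' : (schPower X).obj (.op ⟨0⟩) ⟶ (equalizer a b).left := l.left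
  have e : l' ≫ ε = (schPower X).map (OSimp.toPt n).op :=
    congr_arg CommaMorphism.left (equalizer.lift_ι _ ((hΔ j).trans (hΔ j').symm))
  have hε : ε ≫ pr X n j = ε ≫ pr X n j' := congr_arg CommaMorphism.left (equalizer.condition a b)
  have : IsClosedImmersion ε := inferInstanceAs (IsClosedImmersion (equalizer.ι a b).left)
  have h1 : ε.ker ≤ y.ker := by
    refine le_trans ?_ h
    rw [diagIdeal, ← e]
    exact Hom.le_ker_comp _ _
  rw [← IsClosedImmersion.lift_fac ε y h1, Category.assoc, Category.assoc, hε]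

instance quasiCompact_diagonal [IsSeparated X.hom] (n : ℕ) :
    QuasiCompact ((schPower X).map (OSimp.toPt n).op) := by
  let v : X ⟶ Over.mk (𝟙 S) := Over.homMk X.hom
  have h1 : Mono ((schPower (Over.mk (𝟙 S))).map (OSimp.pt (n := n) 0).op) := by
    refine ⟨fun y y' h ↦ schPower_hom_ext fun j ↦ ?_⟩
    have h2 := congr($h ≫ pr (Over.mk (𝟙 S)) 0 0)
    rw [Category.assoc, Category.assoc, map_pr] at h2
    have h3 := comp_pr_hom y j 0
    have h4 := comp_pr_hom y' j 0
    simp only [Over.mk_hom] at h3 h4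
    erw [Category.comp_id, Category.comp_id] at h3 h4
    rw [h3, h4]
    exact h2
  have h2 : IsSeparated ((schPowerMap v).app (.op ⟨n⟩)) :=
    schPowerMap_mem @IsSeparated v (inferInstanceAs (IsSeparated X.hom)) _
  have h3 : IsSeparated ((schPower X).map (OSimp.pt (n := n) 0).op ≫ (schPowerMap v).app (.op ⟨0⟩)) := by
    rw [(schPowerMap v).naturality]
    infer_instance
  have h4 : IsSeparated ((schPower X).map (OSimp.pt (n := n) 0).op) := .of_comp _ ((schPowerMap v).app (.op ⟨0⟩))
  have h5 : (schPower X).map (OSimp.toPt n).op ≫ (schPower X).map (OSimp.pt (n := n) 0).op = 𝟙 _ := by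
    rw [← Functor.map_comp, ← op_comp]
    exact (congrArg (fun f ↦ (schPower X).map (Quiver.Hom.op f))
      (show OSimp.pt (n := n) 0 ≫ OSimp.toPt n = 𝟙 _ from funext fun _ ↦ Subsingleton.elim (α := Fin 1) _ _)).trans
      ((schPower X).map_id _)
  have h6 : QuasiCompact ((schPower X).map (OSimp.toPt n).op ≫
      (schPower X).map (OSimp.pt (n := n) 0).op) := by
    rw [h5]; infer_instance
  exact MorphismProperty.of_postcomp (W := @QuasiCompact) (W' := @QuasiSeparated) _
    ((schPower X).map (OSimp.pt (n := n) 0).op) inferInstance h6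

lemma mul_comap {X Y : Scheme.{u}} (I J : Y.IdealSheafData) (f : X ⟶ Y) :
    (I * J).comap f = I.comap f * J.comap f := by
  have := prod_comap (fun b : Bool ↦ if b then I else J) Finset.univ f
  simpa using this

lemma diagIdeal_naturality {P P' : OS Scheme.{u}} (φ : P ⟶ P') (n : ℕ) :
    (diagIdeal P' n).comap (φ.app (.op ⟨n⟩)) ≤ diagIdeal P n := by
  rw [← Scheme.IdealSheafData.le_map_iff_comap_le, diagIdeal, diagIdeal, Scheme.IdealSheafData.map_ker,
    φ.naturality]
  exact Hom.le_ker_comp _ _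

lemma monoIdeal_comap_le_ker {K : Scheme.{u}} (κ : K ⟶ T) (ξ : T ⟶ Spec (coordRing ι)) (e : ι → ℕ)
    (h : mon (κ ≫ ξ) e = 0) : (monoIdeal e).comap ξ ≤ κ.ker := by
  rw [← Scheme.IdealSheafData.map_bot, Scheme.IdealSheafData.le_map_iff_comap_le,
    ← Scheme.IdealSheafData.comap_comp]
  intro W
  rw [ideal_monoIdeal_comap, h, map_zero, Ideal.span_singleton_zero]
  exact bot_le

instance quasiCompact_diagonal_PD [IsSeparated X.hom] (n : ℕ) :
    QuasiCompact ((PD X D hD).map (OSimp.toPt n).op) := by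
  have h1 : QuasiCompact ((PD X D hD).map (OSimp.toPt n).op ≫ (PDProj X D hD).app _) := by
    rw [(PDProj X D hD).naturality]
    have : QuasiCompact ((PDProj X D hD).app (.op ⟨0⟩)) :=
      inferInstanceAs (QuasiCompact (centersD X D hD 0).dilProj)
    infer_instance
  have h2 : QuasiSeparated ((PDProj X D hD).app (.op ⟨n⟩)) :=
    inferInstanceAs (QuasiSeparated (centersD X D hD n).dilProj)
  exact MorphismProperty.of_postcomp (W := @QuasiCompact) (W' := @QuasiSeparated) _
    ((PDProj X D hD).app (.op ⟨n⟩)) h2 h1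

lemma diagIdeal_comap_dilProj (hLP : IsLP D) (n : ℕ)
    (Δ : (centersD X D hD 0).dil ⟶ (centersD X D hD n).dil) [QuasiCompact Δ]
    (hΔ : Δ ≫ (centersD X D hD n).dilProj =
      (centersD X D hD 0).dilProj ≫ (schPower X).map (OSimp.toPt n).op) :
    (diagIdeal (schPower X) n).comap (centersD X D hD n).dilProj ≤
      ((centersD X D hD n).J 0).comap (centersD X D hD n).dilProj * Δ.ker := by
  let C := centersD X D hD n
  let π : C.dil ⟶ _ := C.dilProj
  choose U hU ht using hLP.centersD hD n
  refine Scheme.IdealSheafData.le_of_iSup_eq_top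
    (fun y ↦ ⟨π ⁻¹ᵁ (U y).1, (U y).2.preimage π⟩)
    (iSup_eq_top_of_forall fun x ↦ ⟨π x, hU _⟩) fun y ↦ ?_
  obtain ⟨t, ht⟩ := ht y 0
  rw [ideal_comap _ π (U y) _ le_rfl, Ideal.map_le_iff_le_comap]
  intro c hc
  obtain ⟨s, hs⟩ := Centers.exists_fraction (𝓒 := C) ht hc
  have e := congr(C.sec (U y) $hs)
  rw [map_mul, C.sec_algMap, C.sec_algMap] at e
  rw [Ideal.mem_comap, RingHom.comp_apply, rs_self]
  rw [← e, Scheme.IdealSheafData.ideal_mul, Pi.mul_apply]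
  refine Ideal.mul_mem_mul ?_ ?_
  · rw [ideal_comap _ π (U y) _ le_rfl]
    have := Ideal.mem_map_of_mem ((rs (le_refl (π ⁻¹ᵁ (U y).1))).comp (pb π (U y).1))
      (show t ∈ (C.J 0).ideal (U y) from ht ▸ Ideal.mem_span_singleton_self t)
    rw [RingHom.comp_apply, rs_self] at this
    exact this
  · rw [Hom.ker_apply]
    change pb Δ (π ⁻¹ᵁ (U y).1) (C.sec (U y) s) = 0
    have h1 := congr(pb Δ _ $e)
    rw [map_mul] at h1
    have h2 : pb Δ _ (pb π _ c) = 0 := by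
      have h3 : pb ((schPower X).map (OSimp.toPt n).op) (U y).1 c = 0 := Hom.ideal_ker_le _ _ hc
      have h4 := pb_congr hΔ le_rfl c
      rw [rs_self] at h4
      refine h4.trans ?_
      change rs _ (pb (centersD X D hD 0).dilProj _ (pb _ _ c)) = 0
      rw [h3, map_zero, map_zero]
    rw [h2] at h1
    refine cancel_of_dominant ((centersD X D hD 0).dilProj ⁻¹ᵁ (centersD X D hD 0).compl)
      (pb Δ (π ⁻¹ᵁ (U y).1) (pb π (U y).1 t)) (fun x hx hxU ↦ ?_) (h1.trans (mul_zero _).symm)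
    have h5 : x ∈ (Δ ≫ π) ⁻¹ᵁ (((schPower X).obj (.op ⟨n⟩)).basicOpen t) := by
      change (Δ ≫ π) x ∈ ((schPower X).obj (.op ⟨n⟩)).basicOpen t
      refine (mem_basicOpen_of_span (y := (Δ ≫ π) x) ht hxU).mpr ?_
      rw [hΔ]
      change (centersD X D hD 0).dilProj x ∈ (centersD X D hD 0).compl at hx
      rw [Centers.mem_compl] at hx
      intro hn
      apply hx 0
      have h6 : ((C.J 0).comap ((schPower X).map (OSimp.toPt n).op)) = (centersD X D hD 0).J 0 := by
        change Scheme.IdealSheafData.comap (Scheme.IdealSheafData.comap _ _) _ = _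
        rw [← Scheme.IdealSheafData.comap_comp, map_pr]
        rfl
      rw [← h6, Scheme.IdealSheafData.support_comap]
      exact hn
    rw [Scheme.preimage_basicOpen] at h5
    exact h5

/-- On `P^{(D)}_n` the ideal of the diagonal of `X ^ (n + 1)` is divisible by the equation of
`D`, the quotients vanishing on the diagonal. -/
lemma diagIdeal_comap_PDProj [IsSeparated X.hom] (hLP : IsLP D) (n : ℕ) :
    (diagIdeal (schPower X) n).comap ((PDProj X D hD).app (.op ⟨n⟩)) ≤
      (∏ i, D i).comap ((PDProj X D hD).app (.op ⟨n⟩) ≫ pr X n 0) * diagIdeal (PD X D hD) n := by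
  have hq := quasiCompact_diagonal_PD hD n
  rw [Scheme.IdealSheafData.comap_comp]
  let Δ : (centersD X D hD 0).dil ⟶ (centersD X D hD n).dil := by
    exact ((PD X D hD).map (OSimp.toPt n).op : (PD X D hD).obj (.op ⟨0⟩) ⟶ (PD X D hD).obj (.op ⟨n⟩))
  have hq : QuasiCompact Δ := hq
  have hΔ : Δ ≫ (centersD X D hD n).dilProj =
      (centersD X D hD 0).dilProj ≫ (schPower X).map (OSimp.toPt n).op :=
    (PDProj X D hD).naturality (OSimp.toPt n).op
  have key := diagIdeal_comap_dilProj hD hLP n Δ hΔ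
  exact key

/-- The universal point of `P^{(R, M)}_n` is admissible. -/
lemma adm_PRM [IsSeparated X.hom] (hLP : IsLP D) (hm : ∀ i, 1 ≤ m i) (n : ℕ) :
    Adm D m (expo m r) n ((PRMToPower X D hD m r).app (.op ⟨n⟩)) ((PRMCoord X D hD m r).app (.op ⟨n⟩)) where
  dom := dominant_inner_PRM hD m r hm n
  div j i := by
    have := congrArg (Scheme.IdealSheafData.comap · ((PRMProj X D hD m r).app (.op ⟨n⟩))) (div_PDM hD m hLP j i)
    simp only [← Scheme.IdealSheafData.comap_comp] at this
    rw [← Category.assoc] at this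
    exact this
  diag {K} κ hκ := by
    refine fun j j' ↦ ?_
    let c := (PRMToPower X D hD m r).app (.op ⟨n⟩)
    let ξ := (PRMCoord X D hD m r).app (.op ⟨n⟩)
    let p := (PRMProj X D hD m r ≫ PDMProj X D hD m ≫ ADProj X D hD).app (.op ⟨n⟩)
    have key : (diagIdeal (schPower X) n).comap c ≤ (monoIdeal (m + expo m r)).comap ξ := by
      have e1 : c = p ≫ (PDProj X D hD).app (.op ⟨n⟩) := by
        simp only [c, p, PRMToPower, NatTrans.comp_app, Category.assoc]
      rw [e1, Scheme.IdealSheafData.comap_comp]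
      refine (Scheme.IdealSheafData.comap_mono _ (diagIdeal_comap_PDProj hD hLP n)).trans ?_
      change Scheme.IdealSheafData.comap _ _ ≤ _
      rw [mul_comap, ← Scheme.IdealSheafData.comap_comp, ← Category.assoc, ← e1]
      have h1 : (∏ i, D i).comap (c ≫ pr X n 0) = (monoIdeal m).comap ξ := by
        rw [prod_comap]
        refine (Finset.prod_congr rfl fun i _ ↦ ?_).trans ((prod_monoIdeal_comap ξ Finset.univ fun i : ι ↦ (Pi.single i (m i) : ι → ℕ)).trans (by rw [Finset.univ_sum_single]))
        have := congrArg (Scheme.IdealSheafData.comap · ((PRMProj X D hD m r).app (.op ⟨n⟩))) (div_PDM hD m hLP (0 : Fin (n + 1)) i)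
        simp only [← Scheme.IdealSheafData.comap_comp] at this
        rw [← Category.assoc] at this
        exact this
      have h2 : (diagIdeal (PD X D hD) n).comap p ≤ (monoIdeal (expo m r)).comap ξ := by
        have h3 := diagIdeal_naturality (PDMProj X D hD m ≫ ADProj X D hD) n
        have h4 := (centersRM X D hD m r n).comap_dilProj_le (monoIdeal_isLP _ (fun _ ↦ _)) ()
        have h5 := (Scheme.IdealSheafData.comap_mono ((PRMProj X D hD m r).app (.op ⟨n⟩)) h3).trans h4
        change Scheme.IdealSheafData.comap (Scheme.IdealSheafData.comap _ _) ((PRMProj X D hD m r).app (.op ⟨n⟩)) ≤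
          Scheme.IdealSheafData.comap (Scheme.IdealSheafData.comap _ ((PDMCoord X D hD m).app (.op ⟨n⟩)))
            ((PRMProj X D hD m r).app (.op ⟨n⟩)) at h5
        rw [← Scheme.IdealSheafData.comap_comp, ← Scheme.IdealSheafData.comap_comp] at h5
        exact h5
      rw [h1]
      refine (show _ ≤ (monoIdeal m).comap ξ * (monoIdeal (expo m r)).comap ξ from
        fun W ↦ Ideal.mul_mono_right (h2 W)).trans (le_of_eq ?_)
      have := prod_monoIdeal_comap ξ (Finset.univ : Finset Bool) (fun b : Bool ↦ if b then m else expo m r)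
      simpa using this
    have h := comp_pr_eq_of_diagIdeal_le (κ ≫ c) (by
      rw [← Scheme.IdealSheafData.map_ker, Scheme.IdealSheafData.le_map_iff_comap_le]
      exact key.trans (monoIdeal_comap_le_ker κ ξ _ hκ)) j j'
    simpa only [Category.assoc] using h

variable {y : T ⟶ (schPower X).obj (.op ⟨n⟩)} {ξ : T ⟶ Spec (coordRing ι)}

variable {m}

set_option maxHeartbeats 1600000 in
/-- The universal property of `P^{(R, M)}_n`: existence. -/
theorem exists_PRM_lift (hLP : IsLP D) (h : Adm D m (expo m r) n y ξ) :
    ∃ l : T ⟶ (PRM X D hD m r).obj (.op ⟨n⟩),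
      l ≫ (PRMToPower X D hD m r).app _ = y ∧ l ≫ (PRMCoord X D hD m r).app _ = ξ := by
  have hd := h.dom
  have h0 : ∀ j x, x ∈ inner ξ → x ∉ ((∏ i, D i).comap (y ≫ pr X n j)).support := fun j x hx ↦ by
    rw [h.div_prod, notMem_support_monoIdeal]
    exact inner_le ξ m hx
  -- the lift to `P^{(D)}_n`
  obtain ⟨p, hp⟩ : ∃ p : T ⟶ (PD X D hD).obj (.op ⟨n⟩), p ≫ (PDProj X D hD).app _ = y := by
    have : IsSchemeTheoreticallyDominant (y ⁻¹ᵁ (centersD X D hD n).compl).ι := by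
      refine @dominant_mono _ (inner ξ) _ (fun x hx ↦ ?_) hd
      refine Centers.mem_compl.mpr fun j hj ↦ h0 j x hx ?_
      rw [Scheme.IdealSheafData.comap_comp, Scheme.IdealSheafData.support_comap]
      exact hj
    refine (centersD X D hD n).exists_dil_lift y (hLP.centersD hD n) fun j ↦ ?_
    refine h.diagIdeal_le.trans ((monoIdeal_comap_le (self_le_add_right m _)).trans ?_)
    rw [← h.div_prod j, Scheme.IdealSheafData.comap_comp]
    rfl
  -- the lift to the product with the affine space
  obtain ⟨q, hq, hqξ⟩ : ∃ q : T ⟶ (AD X D hD).obj (.op ⟨n⟩), q ≫ (ADProj X D hD).app _ = p ∧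
      q ≫ (ADCoord X D hD).app _ = ξ :=
    ⟨pullback.lift p ξ (terminal.hom_ext _ _), pullback.lift_fst _ _ _, pullback.lift_snd _ _ _⟩
  have hqy : q ≫ (ADProj X D hD ≫ PDProj X D hD).app _ = y := by
    rw [NatTrans.comp_app, ← hp, ← hq, Category.assoc]
  have hdiv (j i) : (divIdeal X D hD n j i).comap q = (monoIdeal (Pi.single i (m i))).comap ξ := by
    rw [divIdeal, ← Scheme.IdealSheafData.comap_comp, ← Category.assoc, hqy, h.div]
  have hcoord (i) : (coordIdeal X D hD m n i).comap q = (monoIdeal (Pi.single i (m i))).comap ξ := by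
    rw [coordIdeal, ← Scheme.IdealSheafData.comap_comp, hqξ]
  obtain ⟨p', hp'⟩ : ∃ p' : T ⟶ (PDM X D hD m).obj (.op ⟨n⟩), p' ≫ (PDMProj X D hD m).app _ = q := by
    have hJ (a) : ((centersDM X D hD m n).J a).comap q = (monoIdeal (Pi.single a.2.1 (m a.2.1))).comap ξ := by
      obtain ⟨j, i, b⟩ := a
      cases b
      exacts [hcoord i, hdiv j i]
    have hI (a) : ((centersDM X D hD m n).I a).comap q = (monoIdeal (Pi.single a.2.1 (m a.2.1))).comap ξ := by
      obtain ⟨j, i, b⟩ := a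
      cases b
      exacts [hdiv j i, hcoord i]
    have : IsSchemeTheoreticallyDominant (q ⁻¹ᵁ (centersDM X D hD m n).compl).ι := by
      refine @dominant_mono _ (inner ξ) _ (fun x hx ↦ ?_) hd
      refine Centers.mem_compl.mpr fun a ha ↦
        notMem_support_monoIdeal.mpr (inner_le ξ (Pi.single a.2.1 (m a.2.1)) hx) ?_
      rw [← hJ a, Scheme.IdealSheafData.support_comap]
      exact ha
    exact (centersDM X D hD m n).exists_dil_lift q (divIdeal_isLP hD hLP n) fun a ↦ (hI a).trans_le (hJ a).ge
  have hpξ : p' ≫ (PDMCoord X D hD m).app _ = ξ := by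
    rw [← hqξ, ← hp', PDMCoord, NatTrans.comp_app, Category.assoc]
  have hpy : p' ≫ (PDMToPower X D hD m).app _ = y := by
    rw [← hqy, ← hp', PDMToPower, NatTrans.comp_app _ (_ ≫ _), Category.assoc]
  have hA : Adm D m (expo m r) n (p' ≫ (PDMToPower X D hD m).app _) (p' ≫ (PDMCoord X D hD m).app _) := by
    rwa [hpξ, hpy]
  have hJ : ((monoIdeal (expo m r)).comap ((PDMCoord X D hD m).app (.op ⟨n⟩))).comap p' =
      (monoIdeal (expo m r)).comap ξ := by
    rw [← Scheme.IdealSheafData.comap_comp, hpξ]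
  obtain ⟨l, hl⟩ : ∃ l : T ⟶ (PRM X D hD m r).obj (.op ⟨n⟩), l ≫ (PRMProj X D hD m r).app _ = p' := by
    have : IsSchemeTheoreticallyDominant (p' ⁻¹ᵁ (centersRM X D hD m r n).compl).ι := by
      refine @dominant_mono _ (inner ξ) _ (fun x hx ↦ ?_) hd
      refine Centers.mem_compl.mpr fun a ha ↦
        notMem_support_monoIdeal.mpr (inner_le ξ (expo m r) hx) ?_
      rw [← hJ, Scheme.IdealSheafData.support_comap]
      exact ha
    refine (centersRM X D hD m r n).exists_dil_lift p' (monoIdeal_isLP _ (fun _ ↦ _)) fun _ ↦ ?_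
    refine (diagIdeal_comap_le (PDM X D hD m) p' _ ?_).trans hJ.ge
    refine hA.comp_const_PDM hD hLP _ ?_
    rw [hpξ]
    exact mon_subschemeι _ _
  refine ⟨l, ?_, ?_⟩
  · rw [← hpy, ← hl, PRMToPower, PDMToPower, NatTrans.comp_app _ (_ ≫ _ ≫ _), Category.assoc]
  · rw [← hpξ, ← hl, PRMCoord, NatTrans.comp_app, Category.assoc]


lemma PDM_hom_ext (hLP : IsLP D) {p p' : T ⟶ (PDM X D hD m).obj (.op ⟨n⟩)}
    (hd : IsSchemeTheoreticallyDominant (inner (p ≫ (PDMCoord X D hD m).app _)).ι)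
    (hy : p ≫ (PDMToPower X D hD m).app _ = p' ≫ (PDMToPower X D hD m).app _)
    (hpξ : p ≫ (PDMCoord X D hD m).app _ = p' ≫ (PDMCoord X D hD m).app _) : p = p' := by
  have hdiv (j i) : (D i).comap ((p ≫ (PDMToPower X D hD m).app _) ≫ pr X n j) =
      (monoIdeal (Pi.single i (m i))).comap (p ≫ (PDMCoord X D hD m).app _) := by
    rw [Category.assoc, Scheme.IdealSheafData.comap_comp, div_PDM hD m hLP j i,
      ← Scheme.IdealSheafData.comap_comp]
  let a : PDM X D hD m ⟶ PD X D hD := PDMProj X D hD m ≫ ADProj X D hD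
  have ha : PDMToPower X D hD m = a ≫ PDProj X D hD := (Category.assoc _ _ _).symm
  have ey : p ≫ (PDMToPower X D hD m).app (.op ⟨n⟩) =
      (p ≫ a.app (.op ⟨n⟩)) ≫ (PDProj X D hD).app (.op ⟨n⟩) := by
    rw [ha, NatTrans.comp_app, Category.assoc]
  have ey' : p' ≫ (PDMToPower X D hD m).app (.op ⟨n⟩) =
      (p' ≫ a.app (.op ⟨n⟩)) ≫ (PDProj X D hD).app (.op ⟨n⟩) := by
    rw [ha, NatTrans.comp_app, Category.assoc]
  have e1 : p ≫ a.app (.op ⟨n⟩) = p' ≫ a.app (.op ⟨n⟩) := by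
    have : IsSchemeTheoreticallyDominant
        (((p ≫ a.app (.op ⟨n⟩)) ≫ (PDProj X D hD).app (.op ⟨n⟩)) ⁻¹ᵁ (centersD X D hD n).compl).ι := by
      refine @dominant_mono _ _ _ (fun x hx ↦ ?_) hd
      refine Centers.mem_compl.mpr fun j hj ↦ ?_
      have h3 : x ∉ ((∏ i, D i).comap ((p ≫ (PDMToPower X D hD m).app (.op ⟨n⟩)) ≫ pr X n j)).support := by
        rw [prod_comap, Finset.prod_congr rfl fun i _ ↦ hdiv j i, prod_monoIdeal_comap,
          Finset.univ_sum_single, notMem_support_monoIdeal]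
        exact inner_le _ m hx
      rw [ey, Scheme.IdealSheafData.comap_comp, Scheme.IdealSheafData.support_comap] at h3
      exact h3 hj
    exact @Centers.dil_lift_unique _ _ _ (centersD X D hD n) T _ _ (ey.symm.trans (hy.trans ey')) this
  have e2 : p ≫ (PDMProj X D hD m).app _ = p' ≫ (PDMProj X D hD m).app _ := by
    refine AD_hom_ext hD ?_ ?_
    · rw [Category.assoc, Category.assoc]; exact e1
    · rw [Category.assoc, Category.assoc]; exact hpξ
  have : IsSchemeTheoreticallyDominant
      ((p ≫ (PDMProj X D hD m).app (.op ⟨n⟩)) ⁻¹ᵁ (centersDM X D hD m n).compl).ι := by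
    refine @dominant_mono _ _ _ (fun x hx ↦ ?_) hd
    refine Centers.mem_compl.mpr ?_
    rintro ⟨j, i, b⟩ hb
    have hx' : x ∉ ((monoIdeal (Pi.single i (m i))).comap (p ≫ (PDMCoord X D hD m).app (.op ⟨n⟩))).support :=
      notMem_support_monoIdeal.mpr (inner_le _ _ hx)
    cases b
    · have e : p ≫ (PDMCoord X D hD m).app (.op ⟨n⟩) =
          (p ≫ (PDMProj X D hD m).app (.op ⟨n⟩)) ≫ (ADCoord X D hD).app (.op ⟨n⟩) := (Category.assoc _ _ _).symm
      rw [e, Scheme.IdealSheafData.comap_comp, Scheme.IdealSheafData.support_comap] at hx'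
      exact hx' hb
    · have e : (p ≫ (PDMToPower X D hD m).app (.op ⟨n⟩)) ≫ pr X n j =
          (p ≫ (PDMProj X D hD m).app (.op ⟨n⟩)) ≫ (ADProj X D hD ≫ PDProj X D hD).app (.op ⟨n⟩) ≫ pr X n j := by
        rw [PDMToPower, NatTrans.comp_app _ (_ ≫ _)]
        simp only [Category.assoc]
      rw [← hdiv j i, e, Scheme.IdealSheafData.comap_comp, Scheme.IdealSheafData.support_comap] at hx'
      exact hx' hb
  exact @Centers.dil_lift_unique _ _ _ (centersDM X D hD m n) T _ _ e2 this

/-- The universal property of `P^{(R, M)}_n`: uniqueness. -/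
theorem PRM_hom_ext (hLP : IsLP D) {l l' : T ⟶ (PRM X D hD m r).obj (.op ⟨n⟩)}
    (hd : IsSchemeTheoreticallyDominant (inner (l ≫ (PRMCoord X D hD m r).app _)).ι)
    (h1 : l ≫ (PRMToPower X D hD m r).app _ = l' ≫ (PRMToPower X D hD m r).app _)
    (h2 : l ≫ (PRMCoord X D hD m r).app _ = l' ≫ (PRMCoord X D hD m r).app _) : l = l' := by
  have hc (l : T ⟶ (PRM X D hD m r).obj (.op ⟨n⟩)) : l ≫ (PRMCoord X D hD m r).app (.op ⟨n⟩) =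
      (l ≫ (PRMProj X D hD m r).app (.op ⟨n⟩)) ≫ (PDMCoord X D hD m).app (.op ⟨n⟩) := (Category.assoc _ _ _).symm
  have hy (l : T ⟶ (PRM X D hD m r).obj (.op ⟨n⟩)) : l ≫ (PRMToPower X D hD m r).app (.op ⟨n⟩) =
      (l ≫ (PRMProj X D hD m r).app (.op ⟨n⟩)) ≫ (PDMToPower X D hD m).app (.op ⟨n⟩) := (Category.assoc _ _ _).symm
  rw [hc] at hd
  have e3 := PDM_hom_ext hD hLP hd ((hy l).symm.trans (h1.trans (hy l'))) ((hc l).symm.trans (h2.trans (hc l')))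
  have : IsSchemeTheoreticallyDominant
      ((l ≫ (PRMProj X D hD m r).app (.op ⟨n⟩)) ⁻¹ᵁ (centersRM X D hD m r n).compl).ι := by
    refine @dominant_mono _ _ _ (fun x hx ↦ ?_) hd
    refine Centers.mem_compl.mpr fun _ ha ↦ ?_
    have := notMem_support_monoIdeal.mpr (inner_le _ (expo m r) hx)
    rw [Scheme.IdealSheafData.comap_comp, Scheme.IdealSheafData.support_comap] at this
    exact this ha
  exact @Centers.dil_lift_unique _ _ _ (centersRM X D hD m r n) T l l' e3 this

end Tower

/-! ### Cocartesian squares of finite sets and multiplicativity -/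

section Pushout

lemma OSimp.hom_ext {k l : ℕ} {f g : OSimp.mk k ⟶ OSimp.mk l} (h : ∀ j, f j = g j) : f = g := funext h

variable {l m n : ℕ} {a : OSimp.mk 0 ⟶ OSimp.mk m} {b : OSimp.mk 0 ⟶ OSimp.mk l}
  {c : OSimp.mk m ⟶ OSimp.mk n} {d : OSimp.mk l ⟶ OSimp.mk n}

/-- Test functions on a cocartesian square. -/
lemma exists_desc (h : IsPushout a b c d) (f : Fin (m + 1) → Fin 2) (g : Fin (l + 1) → Fin 2)
    (hfg : f (a 0) = g (b 0)) : ∃ k : Fin (n + 1) → Fin 2, (∀ j, k (c j) = f j) ∧ ∀ j, k (d j) = g j := by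
  let F : OSimp.mk m ⟶ OSimp.mk 1 := f
  let G : OSimp.mk l ⟶ OSimp.mk 1 := g
  have w : a ≫ F = b ≫ G := OSimp.hom_ext fun j ↦ by
    rw [Subsingleton.elim (α := Fin 1) j 0]; exact hfg
  exact ⟨h.desc F G w, fun j ↦ congrFun (h.inl_desc F G w) j, fun j ↦ congrFun (h.inr_desc F G w) j⟩

lemma pushout_injective (h : IsPushout a b c d) : Function.Injective c := fun j j' e ↦ by
  by_contra hne
  obtain ⟨k, hk, -⟩ := exists_desc h (fun i ↦ if i = j then 0 else 1) (fun _ ↦ if a 0 = j then 0 else 1) rfl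
  have h1 := hk j
  have h2 := hk j'
  rw [e, h2] at h1
  simp [Ne.symm hne] at h1

lemma pushout_eq_base (h : IsPushout a b c d) {j j'} (e : c j = d j') : j = a 0 := by
  by_contra hne
  obtain ⟨k, hk, hk'⟩ := exists_desc h (fun i ↦ if i = j then 1 else 0) (fun _ ↦ 0) (by simp [Ne.symm hne])
  have h1 := hk j
  rw [e, hk'] at h1
  simp at h1

lemma pushout_surjective (h : IsPushout a b c d) (j) : (∃ i, c i = j) ∨ ∃ i, d i = j := by
  by_contra! hne
  let F : OSimp.mk n ⟶ OSimp.mk 1 := fun i ↦ (if i = j then 1 else 0 : Fin 2)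
  let G : OSimp.mk n ⟶ OSimp.mk 1 := fun i ↦ (0 : Fin 2)
  have : F = G := h.hom_ext (OSimp.hom_ext fun i ↦ if_neg (hne.1 i)) (OSimp.hom_ext fun i ↦ if_neg (hne.2 i))
  have := congrFun this j
  simp [F, G] at this

/-- The inclusion of `[0, n]` in `[0, n + 1]`. -/
def OSimp.succ (n : ℕ) : OSimp.mk n ⟶ OSimp.mk (n + 1) := (Fin.castSucc : Fin (n + 1) → Fin (n + 2))

/-- `[0, n + 1]` is obtained from `[0, n]` by gluing an edge `[0, 1]` along a vertex. -/
lemma isPushout_edge {n : ℕ} (v : Fin (n + 1)) :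
    IsPushout (OSimp.pt v) (OSimp.pt (n := 1) 0) (OSimp.succ n) (OSimp.edge v.castSucc (Fin.last _)) where
  w := rfl
  isColimit' := ⟨PushoutCocone.IsColimit.mk _
    (fun s ↦ (Fin.lastCases (s.inr (1 : Fin 2)) (fun j : Fin (n + 1) ↦ s.inl j) : Fin (n + 2) → _))
    (fun s ↦ funext fun j : Fin (n + 1) ↦ Fin.lastCases_castSucc (motive := fun _ ↦ _) _)
    (fun s ↦ funext fun j : Fin 2 ↦ by
      have := congrFun s.condition (0 : Fin 1)
      fin_cases j
      · exact (Fin.lastCases_castSucc (motive := fun _ ↦ _) _).trans this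
      · exact Fin.lastCases_last (motive := fun _ ↦ _))
    (fun s f h1 h2 ↦ funext fun j : Fin (n + 2) ↦ by
      induction j using Fin.lastCases with
      | last => 
        refine Eq.trans ?_ (Fin.lastCases_last (motive := fun _ ↦ _)).symm
        exact congrFun h2 (1 : Fin 2)
      | cast j => 
        refine Eq.trans ?_ (Fin.lastCases_castSucc (motive := fun _ ↦ _) _).symm
        exact congrFun h1 j)⟩

end Pushout

section Univ

variable {S : Scheme.{u}} {X : Over S} {ι : Type u} [Fintype ι] [DecidableEq ι]
  (D : ι → X.left.IdealSheafData) (m e : ι → ℕ) {P : OS Scheme.{u}} (y : P ⟶ schPower X)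
  (ξ : ∀ n, P.obj n ⟶ Spec (coordRing ι))

/-- The oversimplicial scheme `P` with its morphisms to the powers of `X` and to the affine space
represents admissible points. -/
structure IsUniv : Prop where
  adm (n : ℕ) : Adm D m e n (y.app (.op ⟨n⟩)) (ξ (.op ⟨n⟩))
  map_ξ {n n'} (f : n ⟶ n') : P.map f ≫ ξ n' = ξ n
  exists_lift {n : ℕ} {T : Scheme.{u}} {z : T ⟶ (schPower X).obj (.op ⟨n⟩)} {ζ : T ⟶ Spec (coordRing ι)}
    (h : Adm D m e n z ζ) : ∃ l : T ⟶ P.obj (.op ⟨n⟩), l ≫ y.app _ = z ∧ l ≫ ξ _ = ζ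
  hom_ext {n : ℕ} {T : Scheme.{u}} {l l' : T ⟶ P.obj (.op ⟨n⟩)}
    (hd : IsSchemeTheoreticallyDominant (inner (l ≫ ξ _)).ι)
    (h1 : l ≫ y.app _ = l' ≫ y.app _) (h2 : l ≫ ξ _ = l' ≫ ξ _) : l = l'
  congr {n : ℕ} {K : Scheme.{u}} (κ : K ⟶ P.obj (.op ⟨n⟩)) (h : mon (κ ≫ ξ _) e = 0)
    (j j' : Fin (n + 1)) : κ ≫ P.map (OSimp.pt j).op = κ ≫ P.map (OSimp.pt j').op

variable {D m e y ξ}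

lemma IsUniv.pt_pr {n : ℕ} (j : Fin (n + 1)) :
    P.map (OSimp.pt j).op ≫ y.app (.op ⟨0⟩) ≫ pr X 0 0 = y.app (.op ⟨n⟩) ≫ pr X n j := by
  rw [← Category.assoc, y.naturality, Category.assoc, map_pr]
  rfl

lemma IsUniv.dom (h : IsUniv D m e y ξ) (n : ℕ) : IsSchemeTheoreticallyDominant (inner (ξ (.op ⟨n⟩))).ι :=
  (h.adm n).dom

/-- The powers of `X` turn a cocartesian square into a cartesian one: existence. -/
lemma exists_schPower_glue {k l n : ℕ} {a : OSimp.mk 0 ⟶ OSimp.mk k} {b : OSimp.mk 0 ⟶ OSimp.mk l} {c : OSimp.mk k ⟶ OSimp.mk n}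
    {d : OSimp.mk l ⟶ OSimp.mk n} (hp : IsPushout a b c d) {T : Scheme.{u}} (s : T ⟶ (schPower X).obj (.op ⟨k⟩))
    (t : T ⟶ (schPower X).obj (.op ⟨l⟩)) (hst : s ≫ pr X k (a 0) = t ≫ pr X l (b 0)) :
    ∃ z : T ⟶ (schPower X).obj (.op ⟨n⟩), z ≫ (schPower X).map c.op = s ∧ z ≫ (schPower X).map d.op = t := by
  let z (j : Fin (n + 1)) : T ⟶ X.left :=
    open Classical in
    if hj : ∃ i, c i = j then s ≫ pr X k hj.choose else
      t ≫ pr X l ((pushout_surjective hp j).resolve_left hj).choose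
  have hzc (i) : z (c i) = s ≫ pr X k i := by
    have hj : ∃ i', c i' = c i := ⟨i, rfl⟩
    simp only [z, dif_pos hj]
    rw [pushout_injective hp hj.choose_spec]
  have hzd (i) : z (d i) = t ≫ pr X l i := by
    by_cases hj : ∃ i', c i' = d i
    · have h1 := pushout_eq_base hp hj.choose_spec
      have h2 := pushout_eq_base hp.flip hj.choose_spec.symm
      simp only [z, dif_pos hj]
      rw [h1, h2, hst]
    · simp only [z, dif_neg hj]
      rw [pushout_injective hp.flip ((pushout_surjective hp (d i)).resolve_left hj).choose_spec]
  have hzS (j) : z j ≫ X.hom = z 0 ≫ X.hom := by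
    have key (j) : z j ≫ X.hom = s ≫ ((power X).obj (.op ⟨k⟩)).hom := by
      rcases pushout_surjective hp j with ⟨i, rfl⟩ | ⟨i, rfl⟩
      · rw [hzc, Category.assoc, pr_hom]
      · rw [hzd, comp_pr_hom t i (b 0), ← hst, Category.assoc, pr_hom]
    rw [key, key]
  refine ⟨powLift z hzS, schPower_hom_ext fun j ↦ ?_, schPower_hom_ext fun j ↦ ?_⟩
  · rw [Category.assoc, map_pr, powLift_pr, hzc]
  · rw [Category.assoc, map_pr, powLift_pr, hzd]

/-- The fibre product inherits from `P_k` the density of the open where the coordinates are invertible, by flatness, so that the glued point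
of the power of `X` is admissible and the universal properties apply. -/
lemma IsUniv.isPullback_of_flat (h : IsUniv D m e y ξ) {l k n : ℕ} {a : OSimp.mk 0 ⟶ OSimp.mk k}
    {b : OSimp.mk 0 ⟶ OSimp.mk l} {c : OSimp.mk k ⟶ OSimp.mk n} {d : OSimp.mk l ⟶ OSimp.mk n}
    (hp : IsPushout a b c d) [Flat (P.map b.op)] :
    IsPullback (P.map c.op) (P.map d.op) (P.map a.op) (P.map b.op) := by
  let F := pullback (P.map a.op) (P.map b.op)
  let p : F ⟶ P.obj (.op ⟨k⟩) := pullback.fst _ _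
  let q : F ⟶ P.obj (.op ⟨l⟩) := pullback.snd _ _
  have hpq : p ≫ P.map a.op = q ≫ P.map b.op := pullback.condition
  have hξ : p ≫ ξ _ = q ≫ ξ _ := by
    rw [← h.map_ξ a.op, ← h.map_ξ b.op, ← Category.assoc, hpq, Category.assoc]
  have hF : IsSchemeTheoreticallyDominant (inner (p ≫ ξ _)).ι := by
    have : Flat p := inferInstanceAs (Flat (pullback.fst _ _))
    have := h.dom k
    rw [inner_comp]
    exact dominant_preimage p _
  have hbase : p ≫ y.app _ ≫ pr X k (a 0) = q ≫ y.app _ ≫ pr X l (b 0) := by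
    have ha : OSimp.pt (a 0) = a := OSimp.hom_ext fun j ↦ congrArg a (Subsingleton.elim (α := Fin 1) _ _)
    have hb : OSimp.pt (b 0) = b := OSimp.hom_ext fun j ↦ congrArg b (Subsingleton.elim (α := Fin 1) _ _)
    rw [← IsUniv.pt_pr (a 0), ← IsUniv.pt_pr (b 0), ha, hb, reassoc_of% hpq]
  -- the corresponding point of the power of `X`
  obtain ⟨Z, hZc, hZd⟩ := exists_schPower_glue hp (p ≫ y.app _) (q ≫ y.app _) (by simpa only [Category.assoc] using hbase)
  have hzc (i) : Z ≫ pr X n (c i) = p ≫ y.app _ ≫ pr X k i := by rw [← map_pr X c, reassoc_of% hZc]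
  have hzd (i) : Z ≫ pr X n (d i) = q ≫ y.app _ ≫ pr X l i := by rw [← map_pr X d, reassoc_of% hZd]
  have hA : Adm D m e n (Z) (p ≫ ξ _) := by
    refine ⟨hF, fun j i ↦ ?_, fun κ hκ j j' ↦ ?_⟩
    · rcases pushout_surjective hp j with ⟨j, rfl⟩ | ⟨j, rfl⟩
      · rw [hzc, Scheme.IdealSheafData.comap_comp, (h.adm k).div, Scheme.IdealSheafData.comap_comp]
      · rw [hzd, hξ, Scheme.IdealSheafData.comap_comp, (h.adm l).div, Scheme.IdealSheafData.comap_comp]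
    · have key (j) : κ ≫ Z ≫ pr X n j = κ ≫ p ≫ y.app _ ≫ pr X k (a 0) := by
        rcases pushout_surjective hp j with ⟨j, rfl⟩ | ⟨j, rfl⟩
        · have := (h.adm k).diag (κ ≫ p) (by rwa [Category.assoc]) j (a 0)
          rw [hzc]
          simpa only [Category.assoc] using this
        · have := (h.adm l).diag (κ ≫ q) (by rwa [Category.assoc, ← hξ]) j (b 0)
          rw [hzd, hbase]
          simpa only [Category.assoc] using this
      rw [key, key]
  obtain ⟨s, hs, hsξ⟩ := h.exists_lift hA
  have hsc : s ≫ P.map c.op = p := by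
    refine h.hom_ext ?_ (schPower_hom_ext fun j ↦ ?_) ?_
    · rw [Category.assoc, h.map_ξ, hsξ]
      exact hF
    · rw [Category.assoc, Category.assoc, NatTrans.naturality_assoc, reassoc_of% hs, map_pr, hzc, Category.assoc]
    · rw [Category.assoc, h.map_ξ, hsξ]
  have hsd : s ≫ P.map d.op = q := by
    refine h.hom_ext ?_ (schPower_hom_ext fun j ↦ ?_) ?_
    · rw [Category.assoc, h.map_ξ, hsξ]
      exact hF
    · rw [Category.assoc, Category.assoc, NatTrans.naturality_assoc, reassoc_of% hs, map_pr, hzd, Category.assoc]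
    · rw [Category.assoc, h.map_ξ, hsξ, hξ]
  have w : P.map c.op ≫ P.map a.op = P.map d.op ≫ P.map b.op := by
    rw [← P.map_comp, ← P.map_comp, ← op_comp, ← op_comp, hp.w]
  let t : P.obj (.op ⟨n⟩) ⟶ F := pullback.lift (P.map c.op) (P.map d.op) w
  have ht1 : t ≫ p = P.map c.op := pullback.lift_fst _ _ w
  have ht2 : t ≫ q = P.map d.op := pullback.lift_snd _ _ w
  have hts : t ≫ s = 𝟙 _ := by
    have e1 : (t ≫ s) ≫ ξ _ = ξ _ := by
      rw [Category.assoc, hsξ, reassoc_of% ht1, h.map_ξ]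
    refine h.hom_ext ?_ (schPower_hom_ext fun j ↦ ?_) ?_
    · rw [e1]
      exact h.dom n
    · rw [Category.assoc, Category.assoc, reassoc_of% hs, Category.id_comp]
      rcases pushout_surjective hp j with ⟨j, rfl⟩ | ⟨j, rfl⟩
      · rw [hzc, reassoc_of% ht1, ← Category.assoc, y.naturality, Category.assoc, map_pr]
      · rw [hzd, reassoc_of% ht2, ← Category.assoc, y.naturality, Category.assoc, map_pr]
    · rw [e1, Category.id_comp]
  have hst : s ≫ t = 𝟙 _ := by
    refine pullback.hom_ext ?_ ?_
    · rw [Category.assoc, Category.id_comp]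
      exact (congr(s ≫ $ht1)).trans hsc
    · rw [Category.assoc, Category.id_comp]
      exact (congr(s ≫ $ht2)).trans hsd
  exact .of_iso_pullback ⟨w⟩ ⟨t, s, hts, hst⟩ ht1 ht2

lemma OSimp.eq_pt {n : ℕ} (a : OSimp.mk 0 ⟶ OSimp.mk n) : a = OSimp.pt (a 0) :=
  OSimp.hom_ext fun j ↦ congrArg a (Subsingleton.elim (α := Fin 1) _ _)

/-- Permutations of `[0, n]` as isomorphisms. -/
def OSimp.perm {n : ℕ} (σ : Equiv.Perm (Fin (n + 1))) : OSimp.mk n ≅ OSimp.mk n where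
  hom := σ
  inv := σ.symm
  hom_inv_id := funext fun j ↦ σ.symm_apply_apply j
  inv_hom_id := funext fun j ↦ σ.apply_symm_apply j

lemma smooth_map_succ (h : IsUniv D m e y ξ) (hs : Smooth (P.map (OSimp.pt (n := 1) 0).op)) (n : ℕ) :
    Smooth (P.map (OSimp.succ n).op) :=
  MorphismProperty.of_isPullback (h.isPullback_of_flat (isPushout_edge 0)).flip hs

/-- `[0, n]` is built from a point by gluing edges, so that smoothness for the edge implies smoothness for all vertices. -/
lemma smooth_map_pt (h : IsUniv D m e y ξ) (hs : Smooth (P.map (OSimp.pt (n := 1) 0).op)) (n : ℕ) (j : Fin (n + 1)) :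
    Smooth (P.map (OSimp.pt j).op) := by
  have h0 : Smooth (P.map (OSimp.pt (n := n) 0).op) := by
    induction n with
    | zero =>
      have : OSimp.pt (n := 0) 0 = 𝟙 _ := OSimp.hom_ext fun j ↦ Subsingleton.elim (α := Fin 1) _ _
      rw [this, op_id, P.map_id]
      infer_instance
    | succ n ih =>
      have : OSimp.pt (n := n + 1) 0 = OSimp.pt (n := n) 0 ≫ OSimp.succ n := rfl
      rw [this, op_comp, P.map_comp]
      have := smooth_map_succ h hs n
      have := ih 0
      infer_instance
  have : OSimp.pt j = OSimp.pt (n := n) 0 ≫ (OSimp.perm (Equiv.swap 0 j)).hom :=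
    OSimp.hom_ext fun i ↦ (Equiv.swap_apply_left _ _).symm
  rw [this, op_comp, P.map_comp]
  infer_instance

lemma IsUniv.isMultiplicative (h : IsUniv D m e y ξ) (hs : Smooth (P.map (OSimp.pt (n := 1) 0).op)) :
    IsMultiplicative P := fun l k n a b c d hp ↦ by
  have : Smooth (P.map b.op) := by
    rw [OSimp.eq_pt b]
    exact smooth_map_pt h hs _ _
  exact h.isPullback_of_flat hp

end Univ

section PRM

variable {S : Scheme.{u}} {X : Over S} {ι : Type u} [Fintype ι] [DecidableEq ι]
  {D : ι → X.left.IdealSheafData} (hD : ∀ i, IsFG (D i)) {m : ι → ℕ} (r : ι → ℚ)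

lemma adm_PDM_zero (hLP : IsLP D) (hm : ∀ i, 1 ≤ m i) (e : ι → ℕ) :
    Adm D m e 0 ((PDMToPower X D hD m).app (.op ⟨0⟩)) ((PDMCoord X D hD m).app (.op ⟨0⟩)) where
  dom := dominant_inner_PDM hD m hm 0
  div := div_PDM hD m hLP
  diag κ _ j j' := by rw [Subsingleton.elim (α := Fin 1) j j']

lemma isIso_PRMProj_zero (hLP : IsLP D) (hm : ∀ i, 1 ≤ m i) : IsIso ((PRMProj X D hD m r).app (.op ⟨0⟩)) := by
  obtain ⟨s, hs, hsξ⟩ := exists_PRM_lift hD r hLP (adm_PDM_zero hD hLP hm (expo m r))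
  have hd := dominant_inner_PDM hD m hm 0
  have hd' := dominant_inner_PRM hD m r hm 0
  have e1 : s ≫ (PRMProj X D hD m r).app (.op ⟨0⟩) = 𝟙 _ := by
    have e : (s ≫ (PRMProj X D hD m r).app (.op ⟨0⟩)) ≫ (PDMCoord X D hD m).app (.op ⟨0⟩) =
        (PDMCoord X D hD m).app (.op ⟨0⟩) := (Category.assoc _ _ _).trans hsξ
    refine PDM_hom_ext hD hLP ?_ ?_ ?_
    · rw [e]; exact hd
    · refine ((Category.assoc _ _ _).trans hs).trans (Category.id_comp _).symm
    · exact e.trans (Category.id_comp _).symm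
  refine ⟨s, ?_, e1⟩
  have e : ((PRMProj X D hD m r).app (.op ⟨0⟩) ≫ s) ≫ (PRMCoord X D hD m r).app (.op ⟨0⟩) =
      (PRMCoord X D hD m r).app (.op ⟨0⟩) := by
    rw [Category.assoc, hsξ]
    rfl
  refine PRM_hom_ext hD r hLP ?_ ?_ ?_
  · rw [e]; exact hd'
  · rw [Category.assoc, hs, Category.id_comp]
    rfl
  · rw [e, Category.id_comp]

/-- `P^{(R, M)}_n` represents admissible points, with exponents `m_i (r_i - 1)`. -/
theorem isUniv_PRM [IsSeparated X.hom] (hLP : IsLP D) (hm : ∀ i, 1 ≤ m i) :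
    IsUniv D m (expo m r) (PRMToPower X D hD m r) (fun n ↦ (PRMCoord X D hD m r).app n) where
  adm := adm_PRM hD m r hLP hm
  map_ξ f := ((PRMCoord X D hD m r).naturality f).trans (Category.comp_id _)
  exists_lift := exists_PRM_lift hD r hLP
  hom_ext := PRM_hom_ext hD r hLP
  congr {n K} κ h j j' := by
    have := isIso_PRMProj_zero hD r hLP hm
    rw [← cancel_mono ((PRMProj X D hD m r).app (.op ⟨0⟩))]
    have hA : Adm D m (expo m r) n ((PRMProj X D hD m r).app (.op ⟨n⟩) ≫ (PDMToPower X D hD m).app _)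
      ((PRMProj X D hD m r).app (.op ⟨n⟩) ≫ (PDMCoord X D hD m).app _) := adm_PRM hD m r hLP hm n
    have h1 := hA.comp_const_PDM hD hLP κ h
    have key (j) : (κ ≫ (PRM X D hD m r).map (OSimp.pt j).op) ≫ (PRMProj X D hD m r).app (.op ⟨0⟩) =
        κ ≫ (PRMProj X D hD m r).app (.op ⟨n⟩) ≫ (PDM X D hD m).map (OSimp.pt 0).op := by
      rw [Category.assoc, (PRMProj X D hD m r).naturality]
      have h2 := congr($h1 ≫ (PDM X D hD m).map (OSimp.pt j).op)
      simp only [Category.assoc, ← Functor.map_comp, ← op_comp] at h2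
      exact h2
    rw [key, key]

end PRM

/-! ### Étale coordinates adapted to a regular system of parameters -/

section Coordinates

open KaehlerDifferential TensorProduct

/-- A smooth algebra whose differentials are free on `d a_i` is étale over the polynomial ring. -/
lemma etale_of_basis {k A K : Type u} [CommRing k] [CommRing A] [Algebra k A] [Algebra.Smooth k A] [Finite K]
    (a : K → A) (b : Module.Basis K A Ω[A⁄k]) (hb : ∀ i, b i = D k A (a i)) :
    (MvPolynomial.aeval a : MvPolynomial K k →ₐ[k] A).toRingHom.Etale := by
  let P := MvPolynomial K k
  let _ : Algebra P A := (MvPolynomial.aeval a : P →ₐ[k] A).toRingHom.toAlgebra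
  have : IsScalarTower k P A := .of_algebraMap_eq' (MvPolynomial.aeval a : P →ₐ[k] A).comp_algebraMap.symm
  have halg (i) : algebraMap P A (.X i) = a i := MvPolynomial.aeval_X a i
  have hbij : Function.Bijective (mapBaseChange k P A) := by
    let b' := (mvPolynomialBasis k K).baseChange A
    have : mapBaseChange k P A = (b'.equiv b (Equiv.refl K)).toLinearMap := by
      refine b'.ext fun i ↦ ?_
      rw [LinearEquiv.coe_coe, Module.Basis.equiv_apply, Equiv.refl_apply, hb]
      simp only [b', Module.Basis.baseChange_apply]
      rw [mvPolynomialBasis_apply, mapBaseChange_tmul, map_D, halg, one_smul]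
    rw [this]
    exact (b'.equiv b (Equiv.refl K)).bijective
  have h1 : Algebra.FormallyEtale P A := by
    refine ⟨?_, ?_⟩
    · refine subsingleton_of_forall_eq 0 fun x ↦ ?_
      obtain ⟨x, rfl⟩ := KaehlerDifferential.map_surjective k P A x
      obtain ⟨x, rfl⟩ := hbij.2 x
      exact (exact_mapBaseChange_map k P A).apply_apply_eq_zero x
    · refine subsingleton_of_forall_eq 0 fun x ↦ ?_
      have h2 : Algebra.H1Cotangent.δ k P A x = 0 := hbij.1 (by
        rw [(Algebra.H1Cotangent.exact_δ_mapBaseChange k P A).apply_apply_eq_zero, map_zero])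
      obtain ⟨z, rfl⟩ := (Algebra.H1Cotangent.exact_map_δ k P A x).mp h2
      rw [Subsingleton.elim z 0, map_zero]
  have h2 : Algebra.FinitePresentation P A := .of_restrict_scalars_finitePresentation k P A
  exact ⟨h1, h2⟩

/-- Over a local ring, a family of elements of a finite free module which is linearly independent
modulo the maximal ideal can be extended to a basis by elements of a given generating family. -/
lemma exists_basis_extension {O M I J : Type u} [CommRing O] [IsLocalRing O] [AddCommGroup M] [Module O M]
    [Module.FinitePresentation O M] [Module.Flat O M] (v : I → M) (w : J → M)
    (hv : LinearIndependent (IsLocalRing.ResidueField O)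
      (TensorProduct.mk O (IsLocalRing.ResidueField O) M 1 ∘ v))
    (hw : Submodule.span O (Set.range w) = ⊤) :
    ∃ (L : Type u) (_ : Finite L) (a : L → J) (b : Module.Basis (I ⊕ L) O M),
      (∀ i, b (.inl i) = v i) ∧ ∀ l, b (.inr l) = w (a l) := by
  let κ := IsLocalRing.ResidueField O
  let V : I ⊕ J → M := Sum.elim v w
  let W := TensorProduct.mk O κ M 1 ∘ V
  have hs : LinearIndepOn κ W (Set.range Sum.inl) := by
    rw [linearIndepOn_range_iff Sum.inl_injective]
    exact hv
  obtain ⟨B, -, hB, hsp, hli⟩ := exists_linearIndepOn_extension hs (Set.subset_univ _)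
  let L := {j : J // Sum.inr j ∈ B}
  let g : I ⊕ L → I ⊕ J := Sum.map id Subtype.val
  have hg : Function.Injective g := Sum.map_injective.mpr ⟨Function.injective_id, Subtype.val_injective⟩
  have hgB : Set.range g = B := by
    ext (i | j)
    · simp only [Set.mem_range, Sum.exists, g, Sum.map_inl, Sum.map_inr, id]
      exact ⟨fun _ ↦ hB ⟨i, rfl⟩, fun _ ↦ .inl ⟨i, rfl⟩⟩
    · simp only [Set.mem_range, Sum.exists, g, Sum.map_inl, Sum.map_inr, id]
      refine ⟨?_, fun h ↦ .inr ⟨⟨j, h⟩, rfl⟩⟩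
      rintro (⟨_, h⟩ | ⟨l, h⟩)
      · cases h
      · obtain rfl := Sum.inr_injective h
        exact l.2
  have hli' : LinearIndependent κ (TensorProduct.mk O κ M 1 ∘ (V ∘ g)) := by
    rw [← hgB, linearIndepOn_range_iff hg] at hli
    exact hli
  have hsp' : Submodule.span κ (Set.range (TensorProduct.mk O κ M 1 ∘ (V ∘ g))) = ⊤ := by
    have h1 := (IsLocalRing.map_tensorProduct_mk_eq_top (N := Submodule.span O (Set.range w))).mpr hw
    rw [← Submodule.span_image, ← Set.range_comp, eq_top_iff, ← SetLike.coe_subset_coe,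
      Submodule.top_coe] at h1
    have h2 : Set.range (TensorProduct.mk O κ M 1 ∘ (V ∘ g)) = W '' B := by
      rw [← hgB, ← Set.range_comp]
      rfl
    rw [h2, eq_top_iff]
    have h3 : Submodule.span κ (Set.range (TensorProduct.mk O κ M 1 ∘ w)) ≤ Submodule.span κ (W '' B) := by
      rw [Submodule.span_le]
      rintro _ ⟨j, rfl⟩
      exact hsp ⟨.inr j, trivial, rfl⟩
    refine le_trans ?_ h3
    exact fun x _ ↦ Submodule.span_subset_span O κ _ (h1 (Set.mem_univ x))
  obtain ⟨b, hb⟩ := Module.exists_basis_of_basis_baseChange (V ∘ g) hli' hsp'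
    (Module.Flat.rTensor_preserves_injective_linearMap _ Subtype.val_injective)
  have : Finite (I ⊕ L) := Module.Finite.finite_basis b
  exact ⟨L, Finite.of_injective (Sum.inr : L → I ⊕ L) Sum.inr_injective, Subtype.val, b,
    fun i ↦ hb _, fun l ↦ hb _⟩

/-- Over a perfect field, elements which are linearly independent in the cotangent space have linearly
independent differentials. -/
lemma linearIndependent_D {k O I : Type u} [Field k] [PerfectField k] [CommRing O] [IsLocalRing O] [Algebra k O]
    [Algebra.EssFiniteType k O] [Algebra.FormallySmooth k O] (t : I → IsLocalRing.maximalIdeal O)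
    (ht : LinearIndependent (IsLocalRing.ResidueField O)
      (fun i ↦ ((IsLocalRing.maximalIdeal O).toCotangent (t i) : IsLocalRing.CotangentSpace O))) :
    LinearIndependent (IsLocalRing.ResidueField O)
      (TensorProduct.mk O (IsLocalRing.ResidueField O) Ω[O⁄k] 1 ∘ fun i ↦ D k O (t i)) := by
  let κ := IsLocalRing.ResidueField O
  have hsurj : Function.Surjective (algebraMap O κ) := IsLocalRing.residue_surjective
  have hκ : Algebra.EssFiniteType k κ := inferInstanceAs (Algebra.EssFiniteType k (O ⧸ IsLocalRing.maximalIdeal O))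
  have hinj : Function.Injective (kerCotangentToTensor k O κ) := by
    obtain ⟨l, hl⟩ := (Algebra.FormallySmooth.iff_split_injection hsurj).mp
      (Algebra.FormallySmooth.of_perfectField : Algebra.FormallySmooth k κ)
    exact Function.LeftInverse.injective fun x ↦ LinearMap.congr_fun hl x
  have hker : RingHom.ker (algebraMap O κ) = IsLocalRing.maximalIdeal O := IsLocalRing.ker_residue
  rw [linearIndependent_iff']
  intro s c hc i hi
  choose d hd using fun i ↦ hsurj (c i)
  have hmem (i) : (t i : O) ∈ RingHom.ker (algebraMap O κ) := by
    rw [hker]; exact (t i).2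
  have h1 : kerCotangentToTensor k O κ (∑ i ∈ s, d i • Ideal.toCotangent (RingHom.ker (algebraMap O κ)) ⟨(t i : O), hmem i⟩) = 0 := by
    rw [map_sum, ← hc]
    refine Finset.sum_congr rfl fun i _ ↦ ?_
    rw [map_smul, kerCotangentToTensor_toCotangent, ← hd i, algebraMap_smul]
    rfl
  have h2 := (injective_iff_map_eq_zero _).mp hinj _ h1
  have h3 : (∑ i ∈ s, d i • (t i : O)) ∈ IsLocalRing.maximalIdeal O ^ 2 := by
    have h4 : Ideal.toCotangent (RingHom.ker (algebraMap O κ)) (∑ i ∈ s, d i • (⟨(t i : O), hmem i⟩ : RingHom.ker (algebraMap O κ))) = 0 := by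
      rw [map_sum, ← h2]
      exact Finset.sum_congr rfl fun i _ ↦ map_smul _ _ _
    rw [Ideal.toCotangent_eq_zero] at h4
    have h5 : (∑ i ∈ s, d i • (t i : O)) ∈ RingHom.ker (algebraMap O κ) ^ 2 := by simpa using h4
    rwa [hker] at h5
  have h5 : ∑ i ∈ s, c i • ((IsLocalRing.maximalIdeal O).toCotangent (t i) : IsLocalRing.CotangentSpace O) = 0 := by
    have h6 : (IsLocalRing.maximalIdeal O).toCotangent (∑ i ∈ s, d i • t i) = 0 := by
      rw [Ideal.toCotangent_eq_zero]
      simpa using h3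
    rw [map_sum] at h6
    refine (Finset.sum_congr rfl fun i _ ↦ ?_).trans h6
    rw [map_smul, ← hd i]
    exact algebraMap_smul κ (d i) ((IsLocalRing.maximalIdeal O).toCotangent (t i) : IsLocalRing.CotangentSpace O)
  exact linearIndependent_iff'.mp ht s c h5 i hi

/-- Elements of a smooth algebra over a perfect field which are part of a regular system of parameters at a
prime are part of a system of étale coordinates in a neighbourhood. -/
lemma exists_etale_coordinates {k A O I : Type u} [Field k] [PerfectField k] [CommRing A] [Algebra k A]
    [Algebra.Smooth k A] [CommRing O] [IsLocalRing O] [Algebra k O] [Algebra A O] [IsScalarTower k A O]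
    (p : Ideal A) [p.IsPrime] [IsLocalization.AtPrime O p] (t : I → A)
    (hmem : ∀ i, algebraMap A O (t i) ∈ IsLocalRing.maximalIdeal O)
    (ht : LinearIndependent (IsLocalRing.ResidueField O)
      (fun i ↦ ((IsLocalRing.maximalIdeal O).toCotangent ⟨_, hmem i⟩ : IsLocalRing.CotangentSpace O))) :
    ∃ (L : Type u) (_ : Finite (I ⊕ L)) (a : L → A) (g : A), g ∉ p ∧
      (MvPolynomial.aeval (fun i ↦ algebraMap A (Localization.Away g) (Sum.elim t a i)) :
        MvPolynomial (I ⊕ L) k →ₐ[k] Localization.Away g).toRingHom.Etale := by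
  have : Algebra.FormallyEtale A O := .of_isLocalization p.primeCompl
  have : Algebra.FormallySmooth k O := .comp k A O
  have : Algebra.EssFiniteType A O := .of_isLocalization _ p.primeCompl
  have : Algebra.EssFiniteType k O := .comp k A O
  have h1 : Module.Finite O Ω[O⁄k] := inferInstance
  have h2 : Module.Projective O Ω[O⁄k] := inferInstance
  have : Module.FinitePresentation O Ω[O⁄k] := Module.finitePresentation_of_projective O _
  let v : I → Ω[O⁄k] := fun i ↦ D k O (algebraMap A O (t i))
  let w : A → Ω[O⁄k] := fun z ↦ KaehlerDifferential.map k k A O (D k A z)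
  have hv : LinearIndependent (IsLocalRing.ResidueField O)
      (TensorProduct.mk O (IsLocalRing.ResidueField O) Ω[O⁄k] 1 ∘ v) :=
    linearIndependent_D (fun i ↦ ⟨_, hmem i⟩) ht
  have hw : Submodule.span O (Set.range w) = ⊤ :=
    span_range_map_derivation_of_isLocalization k A O p.primeCompl
  obtain ⟨L, hL, a, b, hbt, hba⟩ := exists_basis_extension v w hv hw
  have hfin : Finite (I ⊕ L) := Module.Finite.finite_basis b
  let K := I ⊕ L
  let c : K → A := Sum.elim t a
  have hb (i) : b i = D k O (algebraMap A O (c i)) := by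
    rcases i with i | l
    · exact hbt i
    · rw [hba]; exact map_D k k A O (a l)
  let e : (K →₀ A) →ₗ[A] Ω[A⁄k] := Finsupp.linearCombination A fun i ↦ D k A (c i)
  let l₁ : (K →₀ A) →ₗ[A] (K →₀ O) := Finsupp.mapRange.linearMap (Algebra.linearMap A O)
  let l₂ : Ω[A⁄k] →ₗ[A] Ω[O⁄k] := KaehlerDifferential.map k k A O
  have : IsLocalizedModule p.primeCompl l₁ := inferInstance
  let eₚ : (K →₀ O) →ₗ[O] Ω[O⁄k] := IsLocalizedModule.mapExtendScalars p.primeCompl l₁ l₂ O e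
  have heq : eₚ = b.repr.symm := by
    ext i
    trans IsLocalizedModule.map p.primeCompl l₁ l₂ e <| l₁ <| Finsupp.single i 1
    · simp [eₚ, -IsLocalizedModule.map_apply, l₁]
    · simp [l₂, e, hb]
  have heₚ : Function.Bijective eₚ := heq ▸ b.repr.symm.bijective
  obtain ⟨g, hg, h⟩ := Module.FinitePresentation.exists_notMem_bijective e p l₁ l₂ heₚ
  let l₁ₜ : (K →₀ A) →ₗ[A] (K →₀ Localization.Away g) :=
    Finsupp.mapRange.linearMap (Algebra.linearMap A _)
  let l₂ₜ : Ω[A⁄k] →ₗ[A] Ω[Localization.Away g⁄k] := KaehlerDifferential.map k k A (Localization.Away g)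
  rw [← IsLocalizedModule.map_bijective_iff_localizedModuleMap_bijective l₁ₜ l₂ₜ] at h
  let eₜ' : (K →₀ Localization.Away g) →ₗ[Localization.Away g] Ω[Localization.Away g⁄k] :=
    IsLocalizedModule.mapExtendScalars (Submonoid.powers g) l₁ₜ l₂ₜ (Localization.Away g) e
  have : Algebra.Smooth A (Localization.Away g) := inferInstance
  have : Algebra.Smooth k (Localization.Away g) := .comp k A _
  refine ⟨L, hfin, a, g, hg, etale_of_basis _ (.ofRepr (LinearEquiv.ofBijective eₜ' h).symm) fun i ↦ ?_⟩
  rw [Module.Basis.coe_ofRepr]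
  change eₜ' (Finsupp.single i 1) = D k _ (algebraMap A _ (c i))
  trans IsLocalizedModule.map (Submonoid.powers g) l₁ₜ l₂ₜ e <| l₁ₜ <| Finsupp.single i 1
  · simp [eₜ', -IsLocalizedModule.map_apply, l₁ₜ]
  · rw [IsLocalizedModule.map_apply]
    simp [e, l₂ₜ]

end Coordinates

/-! ### Morphisms to affine spaces and charts -/

section Vec

variable {L : Type u} [Fintype L] {T T' S : Scheme.{u}}

/-- The morphism to the integral affine space with given components. -/
def vec (v : L → Γ(T, ⊤)) : T ⟶ Spec (coordRing L) := (AffineSpace.toSpecMvPolyIntEquiv L).symm v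

@[simp] lemma xc_vec (v : L → Γ(T, ⊤)) (l : L) : xc (vec v) l = v l :=
  congrFun ((AffineSpace.toSpecMvPolyIntEquiv L).apply_symm_apply v) l

lemma vec_ext {a b : T ⟶ Spec (coordRing L)} (h : ∀ l, xc a l = xc b l) : a = b :=
  (AffineSpace.toSpecMvPolyIntEquiv L).injective (funext h)

/-- The morphism to an affine space over `S` with given components. -/
def toAff (f : T ⟶ S) (a : T ⟶ Spec (coordRing L)) : T ⟶ 𝔸(L; S) :=
  pullback.lift f a (terminal.hom_ext _ _)

@[simp] lemma toAff_over (f : T ⟶ S) (a : T ⟶ Spec (coordRing L)) :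
    toAff f a ≫ (𝔸(L; S) ↘ S) = f := pullback.lift_fst _ _ _

@[simp] lemma toAff_coord (f : T ⟶ S) (a : T ⟶ Spec (coordRing L)) :
    toAff f a ≫ AffineSpace.toSpecMvPoly L S = a := pullback.lift_snd _ _ _

lemma aff_ext {f g : T ⟶ 𝔸(L; S)} (h1 : f ≫ (𝔸(L; S) ↘ S) = g ≫ (𝔸(L; S) ↘ S))
    (h2 : f ≫ AffineSpace.toSpecMvPoly L S = g ≫ AffineSpace.toSpecMvPoly L S) : f = g :=
  pullback.hom_ext h1 h2

/-- The pullback of a section over an open subset containing the image. -/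
def gp {Y : Scheme.{u}} (f : T ⟶ Y) {U : Y.Opens} (h : ⊤ ≤ f ⁻¹ᵁ U) (c : Γ(Y, U)) : Γ(T, ⊤) := rs h (pb f U c)

lemma gp_comp {Y : Scheme.{u}} (f : T ⟶ Y) {U : Y.Opens} (h : ⊤ ≤ f ⁻¹ᵁ U) (c : Γ(Y, U)) (g : T' ⟶ T) :
    gp (g ≫ f) (U := U) (fun x _ ↦ h (Set.mem_univ (g x))) c = g.appTop (gp f h c) := by
  refine Eq.trans ?_ (pb_rs g h (pb f U c)).symm
  rfl

lemma gp_fromSpec {Y : Scheme.{u}} {U : Y.Opens} (hU : IsAffineOpen U) (h : ⊤ ≤ hU.fromSpec ⁻¹ᵁ U) (c : Γ(Y, U)) :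
    gp hU.fromSpec h c = (ΓSpecIso Γ(Y, U)).inv c := by
  have h1 := ConcreteCategory.congr_hom hU.fromSpec_app_self c
  refine (congrArg (rs h) h1).trans ?_
  refine (rs_rs (X := Spec Γ(Y, U)) (U := ⊤) (V := hU.fromSpec ⁻¹ᵁ U) (W := ⊤) h le_top ((ΓSpecIso Γ(Y, U)).inv c)).trans ?_
  exact rs_self _ _

end Vec

section Chart

variable {S : Scheme.{u}} {X : Over S} {ι : Type u} [Fintype ι] [DecidableEq ι]

/-- A chart adapted to the divisors `D_i`: an open subscheme `U` of `X`, étale over an affine space over `S`,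
such that each `D_i` is on `U` either empty or one of the coordinate hyperplanes, which are distinct. -/
structure Chart (D : ι → X.left.IdealSheafData) where
  U : Scheme.{u}
  j : U ⟶ X.left
  [isOpenImmersion : IsOpenImmersion j]
  L : Type u
  [fintype : Fintype L]
  [decEq : DecidableEq L]
  a : U ⟶ Spec (coordRing L)
  σ : ι → Option L
  inj : ∀ i i' l, σ i = some l → σ i' = some l → i = i'
  div : ∀ i, (D i).comap j = (monoIdeal ((σ i).elim 0 fun l ↦ Pi.single l 1)).comap a
  etale : Etale (toAff (j ≫ X.hom) a)

attribute [instance] Chart.isOpenImmersion Chart.fintype Chart.decEq Chart.etale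

lemma comap_eq_of_gp {L : Type u} [Fintype L] {T Y : Scheme.{u}} (f : T ⟶ Y) (U : Y.affineOpens) (h : ⊤ ≤ f ⁻¹ᵁ U.1)
    (I : Y.IdealSheafData) (t : Γ(Y, U.1)) (ht : I.ideal U = Ideal.span {t}) (a : T ⟶ Spec (coordRing L)) (e : L → ℕ)
    (he : Associated (gp f h t) (mon a e)) : I.comap f = (monoIdeal e).comap a := by
  ext W : 2
  rw [ideal_monoIdeal_comap, ideal_comap I f U W (le_top.trans h), ht, Ideal.map_span, Set.image_singleton]
  have := he.map (rs (le_top : W.1 ≤ ⊤))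
  rw [gp, rs_rs] at this
  exact le_antisymm (Ideal.span_singleton_le_span_singleton.mpr this.symm.dvd)
    (Ideal.span_singleton_le_span_singleton.mpr this.dvd)

open Classical in
/-- Adapted charts exist for divisors with simple normal crossings on a smooth scheme over a perfect field. -/
theorem exists_chart {k : Type u} [Field k] [PerfectField k] {X : Over (Spec (.of k))} [Smooth X.hom]
    {D : ι → X.left.IdealSheafData} (hD : IsSNC D) (x : X.left) :
    ∃ c : Chart D, x ∈ Set.range c.j := by
  obtain ⟨⟨U, hU'⟩, hx, t, ht, hli⟩ := hD.transversal x
  have hU : IsAffineOpen U := hU'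
  dsimp only at t hx
  let A := Γ(X.left, U)
  let φ : CommRingCat.of k ⟶ A := Spec.preimage (hU.fromSpec ≫ X.hom)
  have hφ : Spec.map φ = hU.fromSpec ≫ X.hom := Spec.map_preimage _
  have hφs : φ.hom.Smooth := by
    rw [← HasRingHomProperty.Spec_iff (P := @Smooth), hφ]
    infer_instance
  algebraize [φ.hom]
  let O := X.left.presheaf.stalk x
  let p := hU.primeIdealOf ⟨x, hx⟩
  let _ : Algebra A O := (X.left.presheaf.germ U x hx).hom.toAlgebra
  have hloc : IsLocalization.AtPrime O p.asIdeal := hU.isLocalization_stalk ⟨x, hx⟩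
  let _ : Algebra k O := ((algebraMap A O).comp φ.hom).toAlgebra
  have : IsScalarTower k A O := .of_algebraMap_eq' rfl
  let I := {i // X.left.presheaf.germ U x hx (t i) ∈ IsLocalRing.maximalIdeal O}
  obtain ⟨L, hL, a, g, hg, het⟩ := exists_etale_coordinates (k := k) (A := A) (O := O) p.asIdeal
    (fun i : I ↦ t i.1) (fun i ↦ i.2) hli
  let K := I ⊕ L
  let cc : K → A := Sum.elim (fun i : I ↦ t i.1) a
  let _ : Fintype K := Fintype.ofFinite K
  let h : A := ∏ i, if i ∈ Set.range (Subtype.val : I → ι) then 1 else t i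
  have hh : h ∉ p.asIdeal := by
    rw [Ideal.IsPrime.prod_mem_iff]
    rintro ⟨i, -, hi⟩
    split_ifs at hi with h1
    · exact p.2.one_notMem hi
    · rw [← IsLocalization.AtPrime.to_map_mem_maximal_iff O p.asIdeal] at hi
      exact h1 ⟨⟨i, hi⟩, rfl⟩
  let Ag := Localization.Away g
  let B := Localization.Away (algebraMap A Ag h)
  let β : A →+* B := (algebraMap Ag B).comp (algebraMap A Ag)
  let sp : Spec (.of B) ⟶ Spec A := Spec.map (CommRingCat.ofHom (algebraMap Ag B)) ≫ Spec.map (CommRingCat.ofHom (algebraMap A Ag))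
  have hsp : sp = Spec.map (CommRingCat.ofHom β) := (Spec.map_comp _ _).symm
  have hspo : IsOpenImmersion sp := by
    have h1 : IsOpenImmersion (Spec.map (CommRingCat.ofHom (algebraMap A Ag))) :=
      IsOpenImmersion.of_isLocalization g
    have h2 : IsOpenImmersion (Spec.map (CommRingCat.ofHom (algebraMap Ag B))) :=
      IsOpenImmersion.of_isLocalization (algebraMap A Ag h)
    exact inferInstanceAs (IsOpenImmersion (_ ≫ _))
  let j : Spec (.of B) ⟶ X.left := sp ≫ hU.fromSpec
  have hj : ⊤ ≤ j ⁻¹ᵁ U := fun y _ ↦ by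
    have := hU.range_fromSpec ▸ Set.mem_range_self (f := hU.fromSpec) (sp y)
    exact this
  have hgp (c : A) : gp j hj c = (ΓSpecIso (.of B)).inv (β c) := by
    have h0 : ⊤ ≤ hU.fromSpec ⁻¹ᵁ U := by rw [hU.fromSpec_preimage_self]
    have := gp_comp hU.fromSpec h0 c sp
    refine this.trans ?_
    rw [gp_fromSpec, hsp]
    exact (ConcreteCategory.congr_hom (ΓSpecIso_inv_naturality (CommRingCat.ofHom β)) c).symm
  let σ : ι → Option K := fun i ↦ if hi : X.left.presheaf.germ U x hx (t i) ∈ IsLocalRing.maximalIdeal O then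
    some (.inl ⟨i, hi⟩) else none
  let a' : Spec (.of B) ⟶ Spec (coordRing K) := vec fun κ ↦ gp j hj (cc κ)
  refine ⟨⟨Spec (.of B), j, K, a', σ, ?_, ?_, ?_⟩, ?_⟩
  · intro i i' l h1 h2
    simp only [σ] at h1 h2
    split_ifs at h1 h2 with h3 h4
    · exact congrArg Subtype.val (Sum.inl.inj (Option.some.inj (h1.trans h2.symm)))
  · intro i
    refine comap_eq_of_gp j ⟨U, hU⟩ hj (D i) (t i) (ht i) a' _ ?_
    by_cases hi : X.left.presheaf.germ U x hx (t i) ∈ IsLocalRing.maximalIdeal O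
    · have h1 : σ i = some (.inl ⟨i, hi⟩) := dif_pos hi
      rw [h1, Option.elim_some, mon_single, pow_one, xc_vec]
      exact Associated.refl _
    · have h1 : σ i = none := dif_neg hi
      rw [h1, Option.elim_none, mon_zero, associated_one_iff_isUnit, hgp]
      refine IsUnit.map _ ?_
      have h2 : IsUnit (algebraMap Ag B (algebraMap A Ag h)) := IsLocalization.Away.algebraMap_isUnit _
      refine isUnit_of_dvd_unit ?_ h2
      refine map_dvd β ?_
      have := Finset.dvd_prod_of_mem (fun i ↦ if i ∈ Set.range (Subtype.val : I → ι) then 1 else t i) (Finset.mem_univ i)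
      have e1 : (if i ∈ Set.range (Subtype.val : I → ι) then 1 else t i) = t i :=
        if_neg (by rintro ⟨i', rfl⟩; exact hi i'.2)
      exact e1 ▸ this
  · let ψ : MvPolynomial K k →ₐ[k] Ag := MvPolynomial.aeval (fun i ↦ algebraMap A Ag (cc i))
    let χ : MvPolynomial K k →+* B := (algebraMap Ag B).comp ψ.toRingHom
    have hχ : χ.Etale := by
      refine RingHom.Etale.stableUnderComposition _ _ het ?_
      have : Algebra.Etale Ag B := .of_isLocalizationAway (algebraMap A Ag h)
      exact RingHom.etale_algebraMap.mpr this
    have het : Etale (Spec.map (CommRingCat.ofHom χ)) := (HasRingHomProperty.Spec_iff (P := @Etale)).mpr hχ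
    have key : toAff (j ≫ X.hom) a' = Spec.map (CommRingCat.ofHom χ) ≫ (AffineSpace.SpecIso K (.of k)).inv := by
      refine aff_ext ?_ (vec_ext fun l ↦ ?_)
      · have e1 : (Spec.map (CommRingCat.ofHom χ) ≫ (AffineSpace.SpecIso K (.of k)).inv) ≫ (𝔸(K; Spec (.of k)) ↘ Spec (.of k)) =
            Spec.map (CommRingCat.ofHom χ) ≫ Spec.map (CommRingCat.ofHom MvPolynomial.C) := by
          rw [Category.assoc, AffineSpace.SpecIso_inv_over]
        refine (toAff_over _ _).trans (Eq.trans ?_ e1.symm)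
        change (sp ≫ _) ≫ _ = _
        rw [Category.assoc, ← hφ, hsp, ← Spec.map_comp, ← Spec.map_comp]
        congr 1
        ext z
        change β (φ.hom z) = algebraMap Ag B (ψ (MvPolynomial.C z))
        rw [MvPolynomial.aeval_C]
        rfl
      · rw [toAff_coord, xc_vec, hgp, Category.assoc, xc_comp, xc_comp]
        have := AffineSpace.SpecIso_inv_appTop_coord (n := K) (.of k) l
        refine Eq.trans ?_ (congrArg ((Spec.map (CommRingCat.ofHom χ)).appTop) this).symm
        refine Eq.trans ?_ (ConcreteCategory.congr_hom (ΓSpecIso_inv_naturality (CommRingCat.ofHom χ)) (MvPolynomial.X l))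
        change _ = (ΓSpecIso (.of B)).inv (algebraMap Ag B (ψ (MvPolynomial.X l)))
        rw [MvPolynomial.aeval_X]
        rfl
    rw [key]
    infer_instance
  · have h1 : p ∈ Set.range sp := by
      have e1 := PrimeSpectrum.localization_away_comap_range Ag g
      have e2 := PrimeSpectrum.localization_away_comap_range B (algebraMap A Ag h)
      have hp : p ∈ Set.range (PrimeSpectrum.comap (algebraMap A Ag)) := by
        rw [e1]; exact hg
      obtain ⟨q, hq⟩ := hp
      have hq' : q ∈ Set.range (PrimeSpectrum.comap (algebraMap Ag B)) := by
        rw [e2]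
        intro h3
        apply hh
        rw [← hq]
        exact h3
      obtain ⟨y, hy⟩ := hq'
      exact ⟨y, by rw [← hq, ← hy]; rfl⟩
    obtain ⟨y, hy⟩ := h1
    refine ⟨y, ?_⟩
    change hU.fromSpec (sp y) = x
    rw [hy]
    exact hU.fromSpec_primeIdealOf ⟨x, hx⟩

end Chart

/-! ### Neighbourhoods of the diagonal and division by monomials -/

section Div

/-- Smooth morphisms, as a morphism property. -/
def smoothP : MorphismProperty Scheme.{u} := @Smooth.{u}

instance : HasRingHomProperty smoothP.{u} RingHom.Smooth := inferInstanceAs (HasRingHomProperty @Smooth.{u} RingHom.Smooth)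

/-- Étale morphisms, as a morphism property. -/
def etaleP : MorphismProperty Scheme.{u} := @Etale.{u}

instance : HasRingHomProperty etaleP.{u} RingHom.Etale := inferInstanceAs (HasRingHomProperty @Etale.{u} RingHom.Etale)

instance smooth_affineSpace {L : Type u} [Finite L] (S : Scheme.{u}) : Smooth (𝔸(L; S) ↘ S) := by
  change smoothP.{u} _
  wlog hS : ∃ R, S = Spec R
  · refine (IsZariskiLocalAtTarget.iff_of_openCover (P := smoothP.{u}) S.affineCover).mpr fun i ↦ ?_
    have := this (L := L) (S.affineCover.X i) ⟨_, rfl⟩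
    rwa [← (AffineSpace.isPullback_map (n := L) (S.affineCover.f i)).isoPullback_hom_snd,
      MorphismProperty.cancel_left_of_respectsIso (P := smoothP.{u})] at this
  obtain ⟨R, rfl⟩ := hS
  rw [← MorphismProperty.cancel_left_of_respectsIso (P := smoothP.{u})
    (AffineSpace.SpecIso L R).inv, AffineSpace.SpecIso_inv_over, HasRingHomProperty.Spec_iff (P := smoothP.{u})]
  have : (algebraMap R (MvPolynomial L R)).Smooth := by
    rw [RingHom.smooth_algebraMap]
    exact ⟨inferInstance, inferInstance⟩
  exact this

variable {L ι : Type u} [Fintype L] [Fintype ι] {T S : Scheme.{u}}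

/-- For an unramified morphism `α : U ⟶ A`, the diagonal of `U` has an open neighbourhood in which it is defined by the
equality of the images in `A`. -/
lemma exists_diagonal_nbhd {U A S : Scheme.{u}} (α : U ⟶ A) (f : A ⟶ S) [FormallyUnramified α] [LocallyOfFiniteType α]
    [IsSeparated f] : ∃ Ω : (pullback (α ≫ f) (α ≫ f)).Opens,
      (∀ {K : Scheme.{u}} (κ : K ⟶ pullback (α ≫ f) (α ≫ f)), Set.range κ ⊆ Ω →
        κ ≫ pullback.fst _ _ ≫ α = κ ≫ pullback.snd _ _ ≫ α → κ ≫ pullback.fst _ _ = κ ≫ pullback.snd _ _) ∧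
      ∀ {K : Scheme.{u}} (κ : K ⟶ pullback (α ≫ f) (α ≫ f)), κ ≫ pullback.fst _ _ = κ ≫ pullback.snd _ _ →
        Set.range κ ⊆ Ω := by
  let i : pullback α α ⟶ pullback (α ≫ f) (α ≫ f) := pullback.mapDesc α α f
  have hi : IsClosedImmersion i := inferInstance
  let d : U ⟶ pullback α α := pullback.diagonal α
  have hd : IsOpenImmersion d := inferInstance
  have hi1 : i ≫ pullback.fst _ _ = pullback.fst _ _ := (pullback.lift_fst _ _ _).trans (Category.comp_id _)
  have hi2 : i ≫ pullback.snd _ _ = pullback.snd _ _ := (pullback.lift_snd _ _ _).trans (Category.comp_id _)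
  have hC : IsClosed (i '' (Set.range d)ᶜ) := i.isClosedEmbedding.isClosedMap _ d.isOpenEmbedding.isOpen_range.isClosed_compl
  refine ⟨⟨(i '' (Set.range d)ᶜ)ᶜ, hC.isOpen_compl⟩, fun {K} κ hκ h ↦ ?_, fun {K} κ h ↦ ?_⟩
  · let κ' : K ⟶ pullback α α := pullback.lift (κ ≫ pullback.fst _ _) (κ ≫ pullback.snd _ _) (by simpa using h)
    have h1 : κ' ≫ i = κ := by
      refine pullback.hom_ext ?_ ?_
      · rw [Category.assoc, hi1]; exact pullback.lift_fst _ _ _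
      · rw [Category.assoc, hi2]; exact pullback.lift_snd _ _ _
    have h2 : Set.range κ' ⊆ Set.range d := by
      rintro _ ⟨x, rfl⟩
      by_contra h3
      refine hκ ⟨x, rfl⟩ ⟨κ' x, h3, ?_⟩
      rw [← h1]; rfl
    have h3 := IsOpenImmersion.lift_fac d κ' h2
    have h4 : d ≫ pullback.fst α α = d ≫ pullback.snd α α := by simp [d]
    calc κ ≫ pullback.fst _ _ = κ' ≫ pullback.fst _ _ := (pullback.lift_fst _ _ _).symm
      _ = κ' ≫ pullback.snd _ _ := by rw [← h3, Category.assoc, Category.assoc, h4]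
      _ = κ ≫ pullback.snd _ _ := pullback.lift_snd _ _ _
  · have h1 : κ = (κ ≫ pullback.fst _ _) ≫ d ≫ i := by
      refine pullback.hom_ext ?_ ?_
      · simp [d, hi1]
      · simp [d, hi2, h]
    rintro _ ⟨x, rfl⟩ ⟨z, hz, hzx⟩
    apply hz
    refine ⟨(κ ≫ pullback.fst _ _) x, i.isClosedEmbedding.injective (Eq.trans ?_ hzx.symm)⟩
    exact (congr($h1 x)).symm

lemma exists_section_of_forall {T : Scheme.{u}} (p : ∀ W : T.Opens, Γ(T, W) → Prop)
    (hp : ∀ {W W' : T.Opens} (h : W' ≤ W) s, p W s → p W' (rs h s))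
    (hu : ∀ (W : T.Opens) s s', p W s → p W s' → s = s')
    (hex : ∀ x : T, ∃ (W : T.Opens) (_ : x ∈ W) (s : Γ(T, W)), p W s) :
    ∃ s : Γ(T, ⊤), ∀ x : T, ∃ (W : T.Opens) (_ : x ∈ W), p W (rs le_top s) := by
  choose W hW s hs using hex
  obtain ⟨a, ha, -⟩ := T.sheaf.existsUnique_gluing' W ⊤ (fun x ↦ homOfLE le_top)
    (fun x _ ↦ TopologicalSpace.Opens.mem_iSup.mpr ⟨x, hW x⟩) s
    (fun x x' ↦ hu _ _ _ (hp inf_le_left _ (hs x)) (hp inf_le_right _ (hs x')))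
  refine ⟨a, fun x ↦ ⟨W x, hW x, ?_⟩⟩
  have := ha x
  change rs le_top a = s x at this
  rw [this]
  exact hs x

lemma eq_of_forall_rs {T : Scheme.{u}} {a b : Γ(T, ⊤)}
    (h : ∀ x : T, ∃ (W : T.Opens) (_ : x ∈ W), rs (le_top : W ≤ ⊤) a = rs le_top b) : a = b := by
  choose W hW h using h
  exact T.sheaf.eq_of_locally_eq' W ⊤ (fun x ↦ homOfLE le_top)
    (fun x _ ↦ TopologicalSpace.Opens.mem_iSup.mpr ⟨x, hW x⟩) _ _ h

/-- A function vanishing on the subscheme defined by a monomial is divisible by the monomial. -/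
lemma exists_div_mon {ξ : T ⟶ Spec (coordRing ι)} (hd : IsSchemeTheoreticallyDominant (inner ξ).ι) (e : ι → ℕ)
    (s : Γ(T, ⊤)) (hs : ∀ {K : Scheme.{u}} (κ : K ⟶ T), mon (κ ≫ ξ) e = 0 → κ.appTop s = 0) :
    ∃ a, s = a * mon ξ e := by
  obtain ⟨a, ha⟩ := exists_section_of_forall (fun W a ↦ rs le_top s = a * rs le_top (mon ξ e))
    (fun h a ha ↦ by
      have := congrArg (rs h) ha
      rwa [map_mul, rs_rs, rs_rs] at this)
    (fun W a a' ha ha' ↦ cancel_of_dvd_mon hd (e := e) (dvd_refl _) (by rw [mul_comm, ← ha, ha', mul_comm]))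
    (fun x ↦ by
      obtain ⟨_, ⟨V, hV, rfl⟩, hxV, -⟩ := T.isBasis_affineOpens.exists_subset_of_mem_open
        (Set.mem_univ x) isOpen_univ
      let κ := ((monoIdeal e).comap ξ).subschemeι
      obtain ⟨a, ha⟩ := exists_eq_mul_mon ξ e ⟨V, hV⟩ (rs le_top s) (by
        rw [pb_rs]
        have := hs κ (mon_subschemeι ξ e)
        change rs _ (κ.appTop s) = 0
        rw [this, map_zero])
      exact ⟨V, hxV, a, ha⟩)
  refine ⟨a, eq_of_forall_rs fun x ↦ ?_⟩
  obtain ⟨W, hW, h⟩ := ha x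
  exact ⟨W, hW, by rw [h, map_mul]⟩

lemma cancel_mon {ξ : T ⟶ Spec (coordRing ι)} (hd : IsSchemeTheoreticallyDominant (inner ξ).ι) {e : ι → ℕ}
    {a b : Γ(T, ⊤)} (h : a * mon ξ e = b * mon ξ e) : a = b := by
  refine cancel_of_dvd_mon hd (e := e) (W := ⊤) (t := mon ξ e) ?_ (by rw [mul_comm, h, mul_comm])
  rw [rs_self]

lemma isUnit_of_comap_eq {a : T ⟶ Spec (coordRing L)} {ξ : T ⟶ Spec (coordRing ι)}
    (hd : IsSchemeTheoreticallyDominant (inner ξ).ι) {e : L → ℕ} {e' : ι → ℕ}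
    (h : (monoIdeal e).comap a = (monoIdeal e').comap ξ) {u : Γ(T, ⊤)} (hu : mon a e = u * mon ξ e') : IsUnit u := by
  refine isUnit_of_le_basicOpen _ fun x _ ↦ ?_
  obtain ⟨_, ⟨V, hV, rfl⟩, hxV, -⟩ := T.isBasis_affineOpens.exists_subset_of_mem_open
        (Set.mem_univ x) isOpen_univ
  have h1 := congr(($h).ideal ⟨V, hV⟩)
  rw [ideal_monoIdeal_comap, ideal_monoIdeal_comap] at h1
  obtain ⟨v, hv⟩ := Ideal.span_singleton_le_span_singleton.mp h1.ge
  have h2 : IsUnit (rs (le_top : V ≤ ⊤) u) := by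
    refine .of_mul_eq_one v ?_
    refine cancel_of_dvd_mon hd (e := e') dvd_rfl ?_
    rw [hu, map_mul] at hv
    rw [mul_one]
    nth_rw 2 [hv]
    ring
  have h3 : x ∈ T.basicOpen (rs (le_top : V ≤ ⊤) u) := by
    rw [T.basicOpen_of_isUnit h2]; exact hxV
  change x ∈ T.basicOpen (T.presheaf.map _ _) at h3
  rw [Scheme.basicOpen_res] at h3
  exact h3.2

lemma comap_eq_of_associated {a : T ⟶ Spec (coordRing L)} {ξ : T ⟶ Spec (coordRing ι)} {e : L → ℕ} {e' : ι → ℕ}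
    {u : Γ(T, ⊤)} (hu : IsUnit u) (h : mon a e = u * mon ξ e') :
    (monoIdeal e).comap a = (monoIdeal e').comap ξ := by
  ext W : 2
  rw [ideal_monoIdeal_comap, ideal_monoIdeal_comap, h, map_mul]
  exact Ideal.span_singleton_mul_left_unit (hu.map _) _

lemma exists_unit_of_comap_eq [IsAffine T] {a : T ⟶ Spec (coordRing L)} {ξ : T ⟶ Spec (coordRing ι)}
    (hd : IsSchemeTheoreticallyDominant (inner ξ).ι) {e : L → ℕ} {e' : ι → ℕ}
    (h : (monoIdeal e).comap a = (monoIdeal e').comap ξ) : ∃ u : Γ(T, ⊤), IsUnit u ∧ mon a e = u * mon ξ e' := by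
  have h1 := congr(($h).ideal ⟨⊤, isAffineOpen_top _⟩)
  rw [ideal_monoIdeal_comap, ideal_monoIdeal_comap, rs_self, rs_self] at h1
  obtain ⟨v, hv⟩ := Ideal.span_singleton_le_span_singleton.mp h1.le
  rw [mul_comm] at hv
  exact ⟨v, isUnit_of_comap_eq hd h hv, hv⟩

end Div

section Param

lemma comp_pullback_lift {T T' A B C : Scheme.{u}} {f : A ⟶ C} {g : B ⟶ C} (t : T' ⟶ T) (a : T ⟶ A) (b : T ⟶ B)
    (h : a ≫ f = b ≫ g) (h' : (t ≫ a) ≫ f = (t ≫ b) ≫ g) :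
    pullback.lift (t ≫ a) (t ≫ b) h' = t ≫ pullback.lift a b h := by
  refine pullback.hom_ext ?_ ?_
  · rw [pullback.lift_fst, Category.assoc, pullback.lift_fst]
  · rw [pullback.lift_snd, Category.assoc, pullback.lift_snd]

variable {S : Scheme.{u}} {X : Over S} {ι : Type u} [Fintype ι] [DecidableEq ι]
  {D : ι → X.left.IdealSheafData}

namespace Chart

variable (c : Chart D)

/-- The étale coordinates of a chart. -/
abbrev α : c.U ⟶ 𝔸(c.L; S) := toAff (c.j ≫ X.hom) c.a

lemma α_over : c.α ≫ (𝔸(c.L; S) ↘ S) = c.j ≫ X.hom := toAff_over _ _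

/-- A neighbourhood of the diagonal of a chart in which the diagonal is defined by the equality of the coordinates. -/
def Ω : (pullback (c.α ≫ (𝔸(c.L; S) ↘ S)) (c.α ≫ (𝔸(c.L; S) ↘ S))).Opens := (exists_diagonal_nbhd c.α (𝔸(c.L; S) ↘ S)).choose

/-- The pair of points `k`, `k'` of the chart is in the chosen neighbourhood of the diagonal. -/
def Near {K : Scheme.{u}} (k k' : K ⟶ c.U) : Prop :=
  ∃ h : k ≫ c.α ≫ (𝔸(c.L; S) ↘ S) = k' ≫ c.α ≫ (𝔸(c.L; S) ↘ S), Set.range (pullback.lift k k' h) ⊆ c.Ω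

variable {c} {K : Scheme.{u}} {k k' : K ⟶ c.U}

lemma near_self (k : K ⟶ c.U) : c.Near k k :=
  ⟨rfl, (exists_diagonal_nbhd c.α (𝔸(c.L; S) ↘ S)).choose_spec.2 _ ((pullback.lift_fst _ _ _).trans (pullback.lift_snd _ _ _).symm)⟩

lemma Near.hom_eq (h : c.Near k k') : (k ≫ c.j) ≫ X.hom = (k' ≫ c.j) ≫ X.hom := by
  obtain ⟨h, -⟩ := h
  rw [c.α_over] at h
  simpa using h

lemma Near.comp (h : c.Near k k') {K' : Scheme.{u}} (f : K' ⟶ K) : c.Near (f ≫ k) (f ≫ k') := by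
  obtain ⟨h, h'⟩ := h
  refine ⟨by simp only [Category.assoc] at h ⊢; rw [h], ?_⟩
  rw [comp_pullback_lift f k k' h]
  rintro _ ⟨x, rfl⟩
  exact h' ⟨f x, rfl⟩

lemma Near.eq (h : c.Near k k') (h' : k ≫ c.a = k' ≫ c.a) : k = k' := by
  obtain ⟨h1, h2⟩ := h
  have h3 := (exists_diagonal_nbhd c.α (𝔸(c.L; S) ↘ S)).choose_spec.1 _ h2
    (by
      rw [pullback.lift_fst_assoc, pullback.lift_snd_assoc]
      refine aff_ext (by simpa using h1) (by simpa using h'))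
  exact (pullback.lift_fst _ _ _).symm.trans (h3.trans (pullback.lift_snd _ _ _))

/-- The points of the neighbourhood of the diagonal form an open subscheme. -/
lemma exists_near (h : (k ≫ c.j) ≫ X.hom = (k' ≫ c.j) ≫ X.hom) :
    ∃ O : K.Opens, ∀ {K' : Scheme.{u}} (f : K' ⟶ K), Set.range f ⊆ O ↔ c.Near (f ≫ k) (f ≫ k') := by
  have h : k ≫ c.α ≫ (𝔸(c.L; S) ↘ S) = k' ≫ c.α ≫ (𝔸(c.L; S) ↘ S) := by
    rw [c.α_over]; simpa using h
  refine ⟨pullback.lift k k' h ⁻¹ᵁ c.Ω, fun {K'} f ↦ ⟨fun hf ↦ ?_, fun hf ↦ ?_⟩⟩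
  · refine ⟨by simp only [Category.assoc] at h ⊢; rw [h], ?_⟩
    rw [comp_pullback_lift f k k' h]
    rintro _ ⟨x, rfl⟩
    exact hf ⟨x, rfl⟩
  · obtain ⟨h1, h2⟩ := hf
    rw [comp_pullback_lift f k k' h] at h2
    rintro _ ⟨x, rfl⟩
    exact h2 ⟨x, rfl⟩

/-- The exponent such that `D_i` is defined by the corresponding monomial in the coordinates. -/
def τ (c : Chart D) (i : ι) : c.L → ℕ := (c.σ i).elim 0 fun l ↦ Pi.single l 1

end Chart
end Param

/-! ### Local models of `P_1` -/

section Model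

variable {S : Scheme.{u}} {X : Over S} {ι : Type u} [Fintype ι] [DecidableEq ι]
  {D : ι → X.left.IdealSheafData} {m e : ι → ℕ} {P : OS Scheme.{u}} {y : P ⟶ schPower X}
  {ξ : ∀ n, P.obj n ⟶ Spec (coordRing ι)} {c : Chart D}

variable (m y ξ c) in
/-- An open subscheme `B` of `P_0` lying over a chart, on which the equations of the divisors `D_i` are the powers
`x_i ^ m_i` up to the units `w_i`. -/
structure Param where
  B : Scheme.{u}
  i0 : B ⟶ P.obj (.op ⟨0⟩)
  [isOpenImmersion : IsOpenImmersion i0]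
  y0 : B ⟶ c.U
  hy : y0 ≫ c.j = i0 ≫ y.app (.op ⟨0⟩) ≫ pr X 0 0
  w : ι → Γ(B, ⊤)
  hw : ∀ i, IsUnit (w i)
  hb : ∀ i, mon (y0 ≫ c.a) (c.τ i) = w i * mon (i0 ≫ ξ (.op ⟨0⟩)) (Pi.single i (m i))

attribute [instance] Param.isOpenImmersion

lemma dom_of_flat (h : IsUniv D m e y ξ) {T : Scheme.{u}} {n : ℕ} (f : T ⟶ P.obj (.op ⟨n⟩)) [Flat f] :
    IsSchemeTheoreticallyDominant (inner (f ≫ ξ (.op ⟨n⟩))).ι := by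
  have := h.dom n
  rw [inner_comp]
  exact dominant_preimage f _

/-- On `P_0` the pullback of `D_i` is defined both by a chart coordinate and by `x_i ^ m_i`; on an affine neighbourhood these differ by a unit. -/
lemma exists_param (h : IsUniv D m e y ξ) (c : Chart D) (z : P.obj (.op ⟨0⟩))
    (hz : (y.app (.op ⟨0⟩) ≫ pr X 0 0) z ∈ Set.range c.j) :
    ∃ p : Param m y ξ c, z ∈ Set.range p.i0 := by
  let f := y.app (.op ⟨0⟩) ≫ pr X 0 0
  obtain ⟨_, ⟨V₀, hV, rfl⟩, hzV, hVO⟩ := (P.obj (.op ⟨0⟩)).isBasis_affineOpens.exists_subset_of_mem_open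
    (show z ∈ (f ⁻¹ᵁ c.j.opensRange : Set _) from hz) (f ⁻¹ᵁ c.j.opensRange).isOpen
  let V' : (P.obj (.op ⟨0⟩)).Opens := V₀
  have hVa : IsAffineOpen V' := hV
  let i0 : V'.toScheme ⟶ P.obj (.op ⟨0⟩) := V'.ι
  have : IsAffine V'.toScheme := hVa
  let y0 : V'.toScheme ⟶ c.U := IsOpenImmersion.lift c.j (i0 ≫ f) (by
    rintro _ ⟨x, rfl⟩
    exact hVO x.2)
  have hy : y0 ≫ c.j = i0 ≫ f := IsOpenImmersion.lift_fac _ _ _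
  have hd := dom_of_flat h i0
  have key (i) : (monoIdeal (c.τ i)).comap (y0 ≫ c.a) = (monoIdeal (Pi.single i (m i))).comap (i0 ≫ ξ (.op ⟨0⟩)) := by
    have h1 := (h.adm 0).div 0 i
    rw [Scheme.IdealSheafData.comap_comp (monoIdeal _) i0, ← h1, ← Scheme.IdealSheafData.comap_comp]
    change _ = (D i).comap (i0 ≫ f)
    rw [← hy, Scheme.IdealSheafData.comap_comp, Scheme.IdealSheafData.comap_comp, c.div]
    rfl
  choose w hw hb using fun i ↦ exists_unit_of_comap_eq hd (key i)
  exact ⟨⟨V', i0, y0, hy, w, hw, hb⟩, ⟨z, hzV⟩, rfl⟩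

namespace Param

variable (e) (p : Param m y ξ c) {T T' : Scheme.{u}}

/-- The function `u_i` such that `x_i ^ m_i * u_i` is the equation of `D_i` at the point with coordinates
`a_l + x ^ (m + e) * d_l`. -/
def unit (t : T ⟶ p.B) (d : c.L → Γ(T, ⊤)) (i : ι) : Γ(T, ⊤) :=
  t.appTop (p.w i) + (c.σ i).elim 0 d * mon (t ≫ p.i0 ≫ ξ (.op ⟨0⟩)) (m + e - Pi.single i (m i))

/-- `d` describes the point `q` of the chart in terms of the point `t` of `B`. -/
structure Pt (t : T ⟶ p.B) (q : T ⟶ c.U) (d : c.L → Γ(T, ⊤)) : Prop where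
  rel : ∀ l, xc (q ≫ c.a) l = xc (t ≫ p.y0 ≫ c.a) l + d l * mon (t ≫ p.i0 ≫ ξ (.op ⟨0⟩)) (m + e)
  near : c.Near (t ≫ p.y0) q
  unit : ∀ i, IsUnit (p.unit e t d i)

variable {e p} {t : T ⟶ p.B} {q : T ⟶ c.U} {d : c.L → Γ(T, ⊤)}

lemma unit_comp (f : T' ⟶ T) (i : ι) : p.unit e (f ≫ t) (fun l ↦ f.appTop (d l)) i = f.appTop (p.unit e t d i) := by
  have : (c.σ i).elim 0 (fun l ↦ f.appTop (d l)) = f.appTop ((c.σ i).elim 0 d) := by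
    cases c.σ i <;> simp
  rw [unit, unit, this, map_add, map_mul, Category.assoc, mon_comp f, Scheme.Hom.comp_appTop]
  rfl

lemma Pt.comp (h : p.Pt e t q d) (f : T' ⟶ T) : p.Pt e (f ≫ t) (f ≫ q) (fun l ↦ f.appTop (d l)) where
  rel l := by
    have := congrArg f.appTop (h.rel l)
    rw [map_add, map_mul, ← xc_comp, ← xc_comp, ← mon_comp] at this
    simpa only [Category.assoc] using this
  near := by simpa only [Category.assoc] using h.near.comp f
  unit i := by rw [unit_comp]; exact (h.unit i).map _

/-- At the point obtained by adding `x ^ (m + e) * d` to the coordinates, the equation of `D_i` is still a multiple of `x_i ^ m_i`, because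
`x ^ (m + e)` is. -/
lemma mon_τ (h : ∀ l, xc (q ≫ c.a) l = xc (t ≫ p.y0 ≫ c.a) l + d l * mon (t ≫ p.i0 ≫ ξ (.op ⟨0⟩)) (m + e)) (i : ι) :
    mon (q ≫ c.a) (c.τ i) = p.unit e t d i * mon (t ≫ p.i0 ≫ ξ (.op ⟨0⟩)) (Pi.single i (m i)) := by
  have h1 := congrArg t.appTop (p.hb i)
  rw [map_mul, ← mon_comp, ← mon_comp] at h1
  have h2 : m + e = (m + e - Pi.single i (m i)) + Pi.single i (m i) := by
    refine (tsub_add_cancel_of_le fun i' ↦ ?_).symm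
    by_cases hi : i' = i
    · subst hi; simp
    · simp [Pi.single_eq_of_ne hi]
  rw [unit, add_mul, ← h1, mul_assoc, ← mon_add, ← h2, Chart.τ]
  cases hσ : c.σ i with
  | none => simp [mon_zero]
  | some l => simpa [mon_single] using h l

lemma Pt.comap_eq (h : p.Pt e t q d) (i : ι) :
    (D i).comap (q ≫ c.j) = (monoIdeal (Pi.single i (m i))).comap (t ≫ p.i0 ≫ ξ (.op ⟨0⟩)) := by
  rw [Scheme.IdealSheafData.comap_comp, c.div, ← Scheme.IdealSheafData.comap_comp]
  exact comap_eq_of_associated (h.unit i) (mon_τ h.rel i)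

variable (e p) in
/-- The points described by `Pt` are represented by a scheme étale over an affine space over `B`. -/
lemma exists_rep : ∃ (N : Scheme.{u}) (b : N ⟶ p.B) (q : N ⟶ c.U) (d : c.L → Γ(N, ⊤)), Smooth b ∧ p.Pt e b q d ∧
    (∀ {T : Scheme.{u}} {t : T ⟶ p.B} {q' : T ⟶ c.U} {d' : c.L → Γ(T, ⊤)}, p.Pt e t q' d' →
      ∃ l : T ⟶ N, l ≫ b = t ∧ l ≫ q = q' ∧ ∀ i, l.appTop (d i) = d' i) ∧
    ∀ {T : Scheme.{u}} {l l' : T ⟶ N}, l ≫ b = l' ≫ b → l ≫ q = l' ≫ q → (∀ i, l.appTop (d i) = l'.appTop (d i)) →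
      l = l' := by
  let A := 𝔸(c.L; p.B)
  let o : A ⟶ p.B := A ↘ p.B
  let co : A ⟶ Spec (coordRing c.L) := AffineSpace.toSpecMvPoly c.L p.B
  let v : A ⟶ Spec (coordRing c.L) := vec fun l ↦ xc (o ≫ p.y0 ≫ c.a) l + xc co l * mon (o ≫ p.i0 ≫ ξ (.op ⟨0⟩)) (m + e)
  let β : A ⟶ 𝔸(c.L; S) := toAff (o ≫ p.y0 ≫ c.j ≫ X.hom) v
  let N0 := pullback β c.α
  let n0 : N0 ⟶ A := pullback.fst β c.α
  let q0 : N0 ⟶ c.U := pullback.snd β c.α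
  have hcond : n0 ≫ β = q0 ≫ c.α := pullback.condition
  have hn0 : Etale n0 := inferInstanceAs (Etale (pullback.fst _ _))
  let d0 : c.L → Γ(N0, ⊤) := fun l ↦ n0.appTop (xc co l)
  have hv (l) : n0.appTop (xc v l) = xc ((n0 ≫ o) ≫ p.y0 ≫ c.a) l +
      d0 l * mon ((n0 ≫ o) ≫ p.i0 ≫ ξ (.op ⟨0⟩)) (m + e) := by
    rw [xc_vec, map_add, map_mul, ← xc_comp, ← mon_comp, Category.assoc, Category.assoc]
  have hrel (l) : xc (q0 ≫ c.a) l = xc ((n0 ≫ o) ≫ p.y0 ≫ c.a) l + d0 l * mon ((n0 ≫ o) ≫ p.i0 ≫ ξ (.op ⟨0⟩)) (m + e) := by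
    rw [← hv, ← xc_comp]
    have h1 := congr($hcond ≫ AffineSpace.toSpecMvPoly c.L S)
    rw [Category.assoc, Category.assoc, toAff_coord, toAff_coord] at h1
    rw [h1]
  have hover : (((n0 ≫ o) ≫ p.y0) ≫ c.j) ≫ X.hom = (q0 ≫ c.j) ≫ X.hom := by
    have h1 := congr($hcond ≫ (𝔸(c.L; S) ↘ S))
    rw [Category.assoc, Category.assoc, toAff_over, toAff_over] at h1
    simpa only [Category.assoc] using h1
  obtain ⟨O1, hO1⟩ := Chart.exists_near hover
  let O : N0.Opens := O1 ⊓ N0.basicOpen (∏ i, p.unit e (n0 ≫ o) d0 i)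
  have hO {T : Scheme.{u}} (f : T ⟶ N0) (hf : c.Near (f ≫ (n0 ≫ o) ≫ p.y0) (f ≫ q0))
      (hf' : ∀ i, IsUnit (f.appTop (p.unit e (n0 ≫ o) d0 i))) : Set.range f ⊆ O := by
    rintro _ ⟨x, rfl⟩
    refine ⟨(hO1 f).mpr hf ⟨x, rfl⟩, ?_⟩
    change x ∈ f ⁻¹ᵁ N0.basicOpen _
    rw [Scheme.preimage_basicOpen]
    have h1 : IsUnit (f.appTop (∏ i, p.unit e (n0 ≫ o) d0 i)) := by
      rw [map_prod]
      exact IsUnit.prod_univ_iff.mpr hf'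
    change x ∈ T.basicOpen (f.appTop _)
    rw [T.basicOpen_of_isUnit h1]
    trivial
  let b : O.toScheme ⟶ p.B := O.ι ≫ n0 ≫ o
  have hrange : Set.range O.ι ⊆ O := by rintro _ ⟨x, rfl⟩; exact x.2
  refine ⟨O, b, O.ι ≫ q0, fun l ↦ O.ι.appTop (d0 l), ?_, ⟨fun l ↦ ?_, ?_, fun i ↦ ?_⟩, ?_, ?_⟩
  · have : Smooth o := inferInstance
    infer_instance
  · have := congrArg O.ι.appTop (hrel l)
    rw [map_add, map_mul, ← xc_comp, ← xc_comp, ← mon_comp] at this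
    simpa only [b, Category.assoc] using this
  · have := (hO1 O.ι).mp (hrange.trans fun x hx ↦ hx.1)
    simpa only [b, Category.assoc] using this
  · rw [unit_comp]
    have h1 : IsUnit (O.ι.appTop (∏ i, p.unit e (n0 ≫ o) d0 i)) := by
      refine isUnit_of_le_basicOpen _ fun x _ ↦ ?_
      have : x ∈ O.ι ⁻¹ᵁ N0.basicOpen (∏ i, p.unit e (n0 ≫ o) d0 i) := x.2.2
      rwa [Scheme.preimage_basicOpen] at this
    rw [map_prod] at h1
    exact IsUnit.prod_univ_iff.mp h1 i
  · intro T t q' d' hT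
    let lA : T ⟶ A := toAff t (vec d')
    have hlo : lA ≫ o = t := toAff_over _ _
    have hlc (l) : lA.appTop (xc co l) = d' l := by
      rw [← xc_comp]
      change xc (lA ≫ AffineSpace.toSpecMvPoly _ _) l = _
      rw [toAff_coord, xc_vec]
    have hlβ : lA ≫ β = q' ≫ c.α := by
      refine aff_ext ?_ (vec_ext fun l ↦ ?_)
      · rw [Category.assoc, Category.assoc, toAff_over, toAff_over, reassoc_of% hlo]
        simpa only [Category.assoc] using hT.near.hom_eq
      · rw [Category.assoc, Category.assoc, toAff_coord, toAff_coord, hT.rel, xc_comp, xc_vec, map_add, map_mul, hlc,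
          ← xc_comp, ← mon_comp, reassoc_of% hlo, reassoc_of% hlo]
    let l0 : T ⟶ N0 := pullback.lift lA q' hlβ
    have h1 : l0 ≫ n0 = lA := pullback.lift_fst _ _ _
    have h2 : l0 ≫ q0 = q' := pullback.lift_snd _ _ _
    have h3 (l) : l0.appTop (d0 l) = d' l := by
      rw [← hlc, ← h1, Scheme.Hom.comp_appTop]; rfl
    have h4 : l0 ≫ n0 ≫ o = t := by rw [reassoc_of% h1, hlo]
    have h5 := hO l0 (by
      rw [h2, Category.assoc, reassoc_of% h4]; exact hT.near) (fun i ↦ by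
      rw [← unit_comp, h4]
      simp only [h3]
      exact hT.unit i)
    have h6 := IsOpenImmersion.lift_fac O.ι l0 (by simpa using h5)
    refine ⟨IsOpenImmersion.lift O.ι l0 (by simpa using h5), ?_, ?_, fun i ↦ ?_⟩
    · rw [reassoc_of% h6, h4]
    · rw [reassoc_of% h6, h2]
    · rw [← h3]
      conv_rhs => rw [← h6, Scheme.Hom.comp_appTop]
      rfl
  · intro T l l' h1 h2 h3
    rw [← cancel_mono O.ι]
    refine pullback.hom_ext (aff_ext ?_ (vec_ext fun i ↦ ?_)) ?_
    · simpa only [Category.assoc] using h1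
    · have := h3 i
      change (l.appTop (O.ι.appTop (n0.appTop (xc co i)))) = (l'.appTop (O.ι.appTop (n0.appTop (xc co i)))) at this
      rw [← xc_comp, ← xc_comp, ← xc_comp, ← xc_comp] at this
      simpa only [Category.assoc] using this
    · simpa only [Category.assoc] using h2

variable (e p) in
/-- The open subscheme of `P_1` of pairs of points near each other in the chart `c`, the first in `B`, with its
description by coordinates `d`. -/
structure Model where
  R : Scheme.{u}
  r : R ⟶ P.obj (.op ⟨1⟩)
  [isOpenImmersion : IsOpenImmersion r]
  t : R ⟶ p.B
  q : R ⟶ c.U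
  d : c.L → Γ(R, ⊤)
  ht : r ≫ P.map (OSimp.pt (n := 1) 0).op = t ≫ p.i0
  hq : r ≫ y.app (.op ⟨1⟩) ≫ pr X 1 1 = q ≫ c.j
  smooth : Smooth t
  pt : p.Pt e t q d
  factor : ∀ {K : Scheme.{u}} (κ : K ⟶ P.obj (.op ⟨1⟩)) (t' : K ⟶ p.B) (q' : K ⟶ c.U),
    κ ≫ P.map (OSimp.pt (n := 1) 0).op = t' ≫ p.i0 → κ ≫ y.app (.op ⟨1⟩) ≫ pr X 1 1 = q' ≫ c.j →
    c.Near (t' ≫ p.y0) q' → ∃ l : K ⟶ R, l ≫ r = κ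
  lift : ∀ {T : Scheme.{u}} {t' : T ⟶ p.B} {q' : T ⟶ c.U} {d' : c.L → Γ(T, ⊤)}, p.Pt e t' q' d' →
      ∃ l : T ⟶ R, l ≫ t = t' ∧ l ≫ q = q' ∧ ∀ i, l.appTop (d i) = d' i
  hom_ext : ∀ {T : Scheme.{u}} {l l' : T ⟶ R}, l ≫ t = l' ≫ t → l ≫ q = l' ≫ q →
    (∀ i, l.appTop (d i) = l'.appTop (d i)) → l = l'

attribute [instance] Model.isOpenImmersion Model.smooth

/-- The local description of `P_1`. -/
theorem exists_model (h : IsUniv D m e y ξ) (p : Param m y ξ c) : Nonempty (p.Model e) := by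
  obtain ⟨N, b, qN, dN, hb, hN, hlift, hext⟩ := p.exists_rep e
  let pt0 : P.obj (.op ⟨1⟩) ⟶ P.obj (.op ⟨0⟩) := P.map (OSimp.pt (n := 1) 0).op
  let y1 : P.obj (.op ⟨1⟩) ⟶ X.left := y.app (.op ⟨1⟩) ≫ pr X 1 1
  have hpt0 : pt0 ≫ y.app (.op ⟨0⟩) ≫ pr X 0 0 = y.app (.op ⟨1⟩) ≫ pr X 1 0 := IsUniv.pt_pr (y := y) 0
  have hξ0 : pt0 ≫ ξ (.op ⟨0⟩) = ξ (.op ⟨1⟩) := h.map_ξ _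
  let O : (P.obj (.op ⟨1⟩)).Opens := pt0 ⁻¹ᵁ p.i0.opensRange ⊓ y1 ⁻¹ᵁ c.j.opensRange
  let t1 : O.toScheme ⟶ p.B := IsOpenImmersion.lift p.i0 (O.ι ≫ pt0) (by rintro _ ⟨x, rfl⟩; exact x.2.1)
  let q1 : O.toScheme ⟶ c.U := IsOpenImmersion.lift c.j (O.ι ≫ y1) (by rintro _ ⟨x, rfl⟩; exact x.2.2)
  have ht1 : t1 ≫ p.i0 = O.ι ≫ pt0 := IsOpenImmersion.lift_fac _ _ _
  have hq1 : q1 ≫ c.j = O.ι ≫ y1 := IsOpenImmersion.lift_fac _ _ _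
  obtain ⟨O2, hO2⟩ := Chart.exists_near (c := c) (k := t1 ≫ p.y0) (k' := q1) (by
    rw [Category.assoc t1, p.hy, reassoc_of% ht1, hq1, hpt0]
    simpa only [y1, Category.assoc] using comp_pr_hom (O.ι ≫ y.app (.op ⟨1⟩)) 0 1)
  let R := O2.toScheme
  let r : R ⟶ P.obj (.op ⟨1⟩) := O2.ι ≫ O.ι
  let t : R ⟶ p.B := O2.ι ≫ t1
  let q : R ⟶ c.U := O2.ι ≫ q1
  have hr : IsOpenImmersion r := inferInstance
  have ht : r ≫ pt0 = t ≫ p.i0 := by simp only [r, t, Category.assoc, ht1]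
  have hq : r ≫ y1 = q ≫ c.j := by simp only [r, q, Category.assoc, hq1]
  have hnear : c.Near (t ≫ p.y0) q := by
    have := (hO2 O2.ι).mp (by rintro _ ⟨x, rfl⟩; exact x.2)
    simpa only [t, q, Category.assoc] using this
  have hfac {K : Scheme.{u}} (κ : K ⟶ P.obj (.op ⟨1⟩)) (t' : K ⟶ p.B) (q' : K ⟶ c.U)
      (h1 : κ ≫ pt0 = t' ≫ p.i0) (h2 : κ ≫ y1 = q' ≫ c.j) (h3 : c.Near (t' ≫ p.y0) q') : ∃ l : K ⟶ R, l ≫ r = κ := by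
    have h4 : Set.range κ ⊆ Set.range O.ι := by
      rw [Scheme.Opens.range_ι]
      rintro _ ⟨x, rfl⟩
      exact ⟨⟨t' x, (congr($h1 x)).symm⟩, ⟨q' x, (congr($h2 x)).symm⟩⟩
    let κ1 := IsOpenImmersion.lift O.ι κ h4
    have e1 : κ1 ≫ O.ι = κ := IsOpenImmersion.lift_fac _ _ _
    have e2 : κ1 ≫ t1 = t' := by rw [← cancel_mono p.i0, Category.assoc, ht1, reassoc_of% e1, h1]
    have e3 : κ1 ≫ q1 = q' := by rw [← cancel_mono c.j, Category.assoc, hq1, reassoc_of% e1, h2]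
    have h5 : Set.range κ1 ⊆ Set.range O2.ι := by
      rw [Scheme.Opens.range_ι]
      refine (hO2 κ1).mpr ?_
      rwa [reassoc_of% e2, e3]
    refine ⟨IsOpenImmersion.lift O2.ι κ1 h5, ?_⟩
    change _ ≫ O2.ι ≫ O.ι = _
    rw [IsOpenImmersion.lift_fac_assoc, e1]
  have hξt : t ≫ p.i0 ≫ ξ (.op ⟨0⟩) = r ≫ ξ (.op ⟨1⟩) := by rw [← hξ0, reassoc_of% ht]
  have hdom := dom_of_flat h r
  have hdiv (l) : ∃ d, xc (q ≫ c.a) l - xc (t ≫ p.y0 ≫ c.a) l = d * mon (r ≫ ξ (.op ⟨1⟩)) (m + e) := by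
    refine exists_div_mon hdom _ _ fun κ hκ ↦ ?_
    have h1 := (h.adm 1).diag (κ ≫ r) (by simpa only [Category.assoc] using hκ) 0 1
    rw [← hpt0] at h1
    have h2 : κ ≫ t ≫ p.y0 = κ ≫ q := by
      rw [← cancel_mono c.j]
      simp only [Category.assoc]
      rw [p.hy, ← reassoc_of% ht, ← hq]
      simpa only [Category.assoc] using h1
    rw [map_sub, ← xc_comp, ← xc_comp, ← reassoc_of% h2, Category.assoc, sub_self]
  choose d hd using hdiv
  have hpt : p.Pt e t q d := by
    have hrel : ∀ l, xc (q ≫ c.a) l = xc (t ≫ p.y0 ≫ c.a) l + d l * mon (t ≫ p.i0 ≫ ξ (.op ⟨0⟩)) (m + e) := fun l ↦ by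
      rw [hξt, ← hd]; ring
    refine ⟨hrel, hnear, fun i ↦ ?_⟩
    refine isUnit_of_comap_eq (hξt ▸ hdom) (e' := Pi.single i (m i)) ?_ (mon_τ hrel i)
    have h1 := (h.adm 1).div 1 i
    rw [hξt, Scheme.IdealSheafData.comap_comp (monoIdeal (Pi.single i (m i))) r, ← h1, ← Scheme.IdealSheafData.comap_comp]
    change _ = (D i).comap (r ≫ y1)
    rw [hq, Scheme.IdealSheafData.comap_comp _ q, Scheme.IdealSheafData.comap_comp _ q, c.div]
    rfl
  obtain ⟨ψ, hψb, hψq, hψd⟩ := hlift hpt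
  have hdomN : IsSchemeTheoreticallyDominant (inner ((b ≫ p.i0) ≫ ξ (.op ⟨0⟩))).ι := dom_of_flat h _
  let f : Fin 2 → (N ⟶ X.left) := ![b ≫ p.y0 ≫ c.j, qN ≫ c.j]
  have hf (j : Fin 2) : f j ≫ X.hom = f 0 ≫ X.hom := by
    fin_cases j
    · rfl
    · change (qN ≫ c.j) ≫ X.hom = (b ≫ p.y0 ≫ c.j) ≫ X.hom
      simpa only [Category.assoc] using hN.near.hom_eq.symm
  obtain ⟨φ, hφy, hφξ⟩ := h.exists_lift (n := 1) (z := powLift f hf) (ζ := (b ≫ p.i0) ≫ ξ (.op ⟨0⟩)) {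
    dom := hdomN
    div := fun j i ↦ by
      rw [powLift_pr]
      fin_cases j
      · change (D i).comap (b ≫ p.y0 ≫ c.j) = _
        rw [p.hy, ← Category.assoc, Scheme.IdealSheafData.comap_comp, (h.adm 0).div 0 i,
          ← Scheme.IdealSheafData.comap_comp]
      · change (D i).comap (qN ≫ c.j) = _
        rw [hN.comap_eq, Category.assoc]
    diag := fun κ hκ j j' ↦ by
      have h1 : κ ≫ b ≫ p.y0 = κ ≫ qN := by
        refine Chart.Near.eq (hN.near.comp κ) (vec_ext fun l ↦ ?_)
        have := congrArg κ.appTop (hN.rel l)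
        rw [map_add, map_mul, ← xc_comp, ← xc_comp, ← mon_comp] at this
        simp only [Category.assoc] at this hκ ⊢
        rw [this, hκ, mul_zero, add_zero]
      have h2 (j : Fin 2) : κ ≫ f j = κ ≫ f 0 := by
        fin_cases j
        · rfl
        · change κ ≫ qN ≫ c.j = κ ≫ b ≫ p.y0 ≫ c.j
          rw [← reassoc_of% h1]
      rw [powLift_pr, powLift_pr, h2, h2 j'] }
  have hφ0 : φ ≫ pt0 = b ≫ p.i0 := by
    refine h.hom_ext ?_ (schPower_hom_ext fun j ↦ ?_) ?_
    · rw [Category.assoc, hξ0, hφξ]; exact hdomN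
    · obtain rfl := Subsingleton.elim (α := Fin 1) j 0
      simp only [Category.assoc]
      rw [hpt0, reassoc_of% hφy, powLift_pr, ← p.hy]
      rfl
    · rw [Category.assoc, hξ0, hφξ]
  have hφ1 : φ ≫ y1 = qN ≫ c.j := by
    change φ ≫ y.app _ ≫ _ = _
    rw [reassoc_of% hφy, powLift_pr]; rfl
  obtain ⟨φ', hφ'⟩ := hfac φ b qN hφ0 hφ1 hN.near
  have hφt : φ' ≫ t = b := by rw [← cancel_mono p.i0, Category.assoc, ← ht, reassoc_of% hφ', hφ0]
  have hφq : φ' ≫ q = qN := by rw [← cancel_mono c.j, Category.assoc, ← hq, reassoc_of% hφ', hφ1]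
  have hφd (i) : φ'.appTop (d i) = dN i := by
    refine cancel_mon (e := m + e) hdomN ?_
    have h1 := congrArg φ'.appTop (hd i)
    rw [map_sub, map_mul, ← xc_comp, ← xc_comp, ← mon_comp, reassoc_of% hφ', reassoc_of% hφq, reassoc_of% hφt,
      hN.rel, add_sub_cancel_left, hφξ] at h1
    rw [← h1, Category.assoc]
  have e1 : φ' ≫ ψ = 𝟙 N := by
    refine hext ?_ ?_ fun i ↦ ?_
    · rw [Category.assoc, hψb, hφt, Category.id_comp]
    · rw [Category.assoc, hψq, hφq, Category.id_comp]
    · rw [Scheme.Hom.comp_appTop]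
      change φ'.appTop (ψ.appTop (dN i)) = _
      rw [hψd, hφd]
      simp
  have e2 : ψ ≫ φ' = 𝟙 R := by
    rw [← cancel_mono r, Category.assoc, hφ', Category.id_comp]
    refine (h.hom_ext hdom (schPower_hom_ext (n := 1) fun j ↦ ?_) ?_).symm
    · rw [Category.assoc r, Category.assoc (ψ ≫ φ), Category.assoc ψ, reassoc_of% hφy, powLift_pr]
      fin_cases j
      · change r ≫ y.app _ ≫ pr X 1 0 = ψ ≫ b ≫ p.y0 ≫ c.j
        rw [reassoc_of% hψb, p.hy, ← reassoc_of% ht, hpt0]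
      · change r ≫ y1 = ψ ≫ qN ≫ c.j
        rw [reassoc_of% hψq, hq]
    · rw [Category.assoc ψ, hφξ, Category.assoc b, reassoc_of% hψb, hξt]
  have hψiso : IsIso ψ := ⟨φ', e2, e1⟩
  exact ⟨{
    R := R, r := r, t := t, q := q, d := d, ht := ht, hq := hq, pt := hpt, factor := hfac
    smooth := by rw [← hψb]; infer_instance
    lift := fun hT ↦ by
      obtain ⟨l, h1, h2, h3⟩ := hlift hT
      refine ⟨l ≫ φ', by rw [Category.assoc, hφt, h1], by rw [Category.assoc, hφq, h2], fun i ↦ ?_⟩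
      rw [Scheme.Hom.comp_appTop]
      change l.appTop (φ'.appTop (d i)) = _
      rw [hφd, h3]
    hom_ext := fun {T l l'} h1 h2 h3 ↦ by
      rw [← cancel_mono ψ]
      refine hext ?_ ?_ fun i ↦ ?_
      · simpa only [Category.assoc, hψb] using h1
      · simpa only [Category.assoc, hψq] using h2
      · rw [Scheme.Hom.comp_appTop, Scheme.Hom.comp_appTop]
        change l.appTop (ψ.appTop (dN i)) = l'.appTop (ψ.appTop (dN i))
        rw [hψd, h3] }⟩

end Param
end Model

/-! ### Smoothness of `P_1` over `P_0` -/

lemma smooth_of_forall {T Y : Scheme.{u}} (f : T ⟶ Y)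
    (h : ∀ x : T, ∃ (W : Scheme.{u}) (w : W ⟶ T), IsOpenImmersion w ∧ x ∈ Set.range w ∧ Smooth (w ≫ f)) : Smooth f := by
  choose W w hw hx hs using h
  change smoothP.{u} f
  refine (IsZariskiLocalAtSource.iff_of_openCover (P := smoothP.{u})
    (Cover.mkOfCovers T W w (fun x ↦ ⟨x, hx x⟩) hw)).mpr hs

lemma dominant_of_isIso {T Y : Scheme.{u}} (f : T ⟶ Y) [IsIso f] : IsSchemeTheoreticallyDominant f := inferInstance

lemma comap_eq_top_of_support {T Y : Scheme.{u}} (f : T ⟶ Y) (I : Y.IdealSheafData) (h : ∀ x, f x ∉ I.support) :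
    I.comap f = ⊤ := by
  rw [← Scheme.IdealSheafData.support_eq_bot_iff, eq_bot_iff]
  intro x hx
  rw [Scheme.IdealSheafData.support_comap] at hx
  exact h x hx

section Smooth

variable {S : Scheme.{u}} {X : Over S} {ι : Type u} [Fintype ι] [DecidableEq ι]
  {D : ι → X.left.IdealSheafData} {m e : ι → ℕ} {P : OS Scheme.{u}} {y : P ⟶ schPower X}
  {ξ : ∀ n, P.obj n ⟶ Spec (coordRing ι)} {c : Chart D}

lemma isEmpty_of_mon_eq_zero {T K : Scheme.{u}} (κ : K ⟶ T) (ζ : T ⟶ Spec (coordRing ι)) (e : ι → ℕ)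
    (h : inner ζ = ⊤) (h0 : mon (κ ≫ ζ) e = 0) : IsEmpty K := by
  refine ⟨fun x ↦ ?_⟩
  have h1 : x ∈ inner (κ ≫ ζ) := by rw [inner_comp, h]; trivial
  have h2 := inner_le (κ ≫ ζ) e h1
  rw [h0, Scheme.basicOpen_zero] at h2
  exact h2

/-- The scheme `P_1` is smooth over `P_0` where the coordinates `x_i` are invertible: it is there the product with
the complement of the divisors. -/
lemma smooth_inner [Smooth X.hom] (h : IsUniv D m e y ξ) :
    Smooth ((inner (ξ (.op ⟨1⟩))).ι ≫ P.map (OSimp.pt (n := 1) 0).op) := by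
  let pt0 : P.obj (.op ⟨1⟩) ⟶ P.obj (.op ⟨0⟩) := P.map (OSimp.pt (n := 1) 0).op
  let y1 : P.obj (.op ⟨1⟩) ⟶ X.left := y.app (.op ⟨1⟩) ≫ pr X 1 1
  let x0 : P.obj (.op ⟨0⟩) ⟶ X.left := y.app (.op ⟨0⟩) ≫ pr X 0 0
  have hpt0 : pt0 ≫ x0 = y.app (.op ⟨1⟩) ≫ pr X 1 0 := IsUniv.pt_pr (y := y) 0
  have hξ0 : pt0 ≫ ξ (.op ⟨0⟩) = ξ (.op ⟨1⟩) := h.map_ξ _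
  let O := inner (ξ (.op ⟨1⟩))
  let O0 := inner (ξ (.op ⟨0⟩))
  let C := complement X D
  let E := pullback (O0.ι ≫ x0 ≫ X.hom) (C.ι ≫ X.hom)
  let f0 : E ⟶ O0 := pullback.fst _ _
  let f1 : E ⟶ C := pullback.snd _ _
  have hE : f0 ≫ O0.ι ≫ x0 ≫ X.hom = f1 ≫ C.ι ≫ X.hom := pullback.condition
  let ψ0 : O.toScheme ⟶ O0 := IsOpenImmersion.lift O0.ι (O.ι ≫ pt0) (by
    rw [Scheme.Opens.range_ι]
    rintro _ ⟨x, rfl⟩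
    have h1 : O.ι x ∈ inner (pt0 ≫ ξ (.op ⟨0⟩)) := by rw [hξ0]; exact x.2
    rw [inner_comp] at h1
    exact h1)
  have hψ0 : ψ0 ≫ O0.ι = O.ι ≫ pt0 := IsOpenImmersion.lift_fac _ _ _
  let ψ1 : O.toScheme ⟶ C := IsOpenImmersion.lift C.ι (O.ι ≫ y1) (by
    rw [Scheme.Opens.range_ι]
    rintro _ ⟨x, rfl⟩
    change y1 (O.ι x) ∉ (∏ i, D i).support
    intro h1
    have h2 : O.ι x ∈ ((∏ i, D i).comap y1).support := by
      rw [Scheme.IdealSheafData.support_comap]; exact h1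
    rw [(h.adm 1).div_prod 1] at h2
    exact notMem_support_monoIdeal.mpr (inner_le _ _ x.2) h2)
  have hψ1 : ψ1 ≫ C.ι = O.ι ≫ y1 := IsOpenImmersion.lift_fac _ _ _
  let ψ : O.toScheme ⟶ E := pullback.lift ψ0 ψ1 (by
    rw [reassoc_of% hψ0, reassoc_of% hψ1, reassoc_of% hpt0]
    simpa only [y1, Category.assoc] using comp_pr_hom (O.ι ≫ y.app (.op ⟨1⟩)) 0 1)
  have hf0 : ψ ≫ f0 = ψ0 := pullback.lift_fst _ _ _
  have hf1 : ψ ≫ f1 = ψ1 := pullback.lift_snd _ _ _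
  let ζ : E ⟶ Spec (coordRing ι) := f0 ≫ O0.ι ≫ ξ (.op ⟨0⟩)
  have hζ : inner ζ = ⊤ := by
    simp only [ζ]
    rw [inner_comp, inner_comp]
    exact top_le_iff.mp fun x _ ↦ (f0 x).2
  have hdom : IsSchemeTheoreticallyDominant (inner ζ).ι := by
    rw [hζ]
    exact dominant_of_isIso E.topIso.hom
  have hdomO : IsSchemeTheoreticallyDominant (inner (O.ι ≫ ξ (.op ⟨1⟩))).ι := dom_of_flat h _
  let f : Fin 2 → (E ⟶ X.left) := ![f0 ≫ O0.ι ≫ x0, f1 ≫ C.ι]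
  have hf (j : Fin 2) : f j ≫ X.hom = f 0 ≫ X.hom := by
    fin_cases j
    · rfl
    · change (f1 ≫ C.ι) ≫ X.hom = (f0 ≫ O0.ι ≫ x0) ≫ X.hom
      simpa only [Category.assoc] using hE.symm
  obtain ⟨φ, hφy, hφξ⟩ := h.exists_lift (n := 1) (z := powLift f hf) (ζ := ζ) {
    dom := hdom
    div := fun j i ↦ by
      rw [powLift_pr]
      fin_cases j
      · change (D i).comap (f0 ≫ O0.ι ≫ y.app (.op ⟨0⟩) ≫ pr X 0 0) = _
        rw [← Category.assoc, Scheme.IdealSheafData.comap_comp, (h.adm 0).div 0 i,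
          ← Scheme.IdealSheafData.comap_comp, Category.assoc]
      · change (D i).comap (f1 ≫ C.ι) = _
        rw [comap_eq_top_of_support, comap_eq_top_of_support]
        · intro x hx
          have h1 : x ∈ ((monoIdeal (Pi.single i (m i))).comap ζ).support := by
            rw [Scheme.IdealSheafData.support_comap]; exact hx
          exact notMem_support_monoIdeal.mpr (inner_le ζ _ (hζ.ge (Set.mem_univ x))) h1
        · intro x hx
          exact (f1 x).2 (by
            change _ ∈ (∏ i, D i).support
            rw [← Finset.mul_prod_erase _ _ (Finset.mem_univ i), Scheme.IdealSheafData.support_mul]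
            exact Or.inl hx)
    diag := fun κ hκ j j' ↦ by
      have := isEmpty_of_mon_eq_zero κ ζ _ hζ hκ
      exact (isInitialOfIsEmpty).hom_ext _ _ }
  have hφ0 : φ ≫ pt0 = f0 ≫ O0.ι := by
    refine h.hom_ext ?_ (schPower_hom_ext fun j ↦ ?_) ?_
    · rw [Category.assoc, hξ0, hφξ]; exact hdom
    · obtain rfl := Subsingleton.elim (α := Fin 1) j 0
      change (φ ≫ pt0) ≫ x0 = (f0 ≫ O0.ι) ≫ x0
      rw [Category.assoc, hpt0, reassoc_of% hφy, powLift_pr, Category.assoc]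
      rfl
    · rw [Category.assoc, hξ0, hφξ]
      rfl
  have hφ1 : φ ≫ y1 = f1 ≫ C.ι := by
    change φ ≫ y.app _ ≫ _ = _
    rw [reassoc_of% hφy, powLift_pr]; rfl
  have hφO : Set.range φ ⊆ Set.range O.ι := by
    rw [Scheme.Opens.range_ι]
    rintro _ ⟨x, rfl⟩
    have : x ∈ inner (φ ≫ ξ (.op ⟨1⟩)) := by rw [hφξ, hζ]; trivial
    rw [inner_comp] at this
    exact this
  let φ' : E ⟶ O := IsOpenImmersion.lift O.ι φ hφO
  have hφ' : φ' ≫ O.ι = φ := IsOpenImmersion.lift_fac _ _ _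
  have e1 : φ' ≫ ψ = 𝟙 E := by
    refine pullback.hom_ext ?_ ?_
    · change (φ' ≫ ψ) ≫ f0 = 𝟙 E ≫ f0
      rw [Category.assoc, hf0, Category.id_comp, ← cancel_mono O0.ι, Category.assoc, hψ0, reassoc_of% hφ', hφ0]
    · change (φ' ≫ ψ) ≫ f1 = 𝟙 E ≫ f1
      rw [Category.assoc, hf1, Category.id_comp, ← cancel_mono C.ι, Category.assoc, hψ1, reassoc_of% hφ', hφ1]
  have e2 : ψ ≫ φ' = 𝟙 O.toScheme := by
    rw [← cancel_mono O.ι, Category.assoc, hφ', Category.id_comp]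
    refine (h.hom_ext hdomO (schPower_hom_ext (n := 1) fun j ↦ ?_) ?_).symm
    · rw [Category.assoc O.ι, Category.assoc (ψ ≫ φ), Category.assoc ψ, reassoc_of% hφy, powLift_pr]
      fin_cases j
      · change O.ι ≫ y.app _ ≫ pr X 1 0 = ψ ≫ f0 ≫ O0.ι ≫ x0
        rw [reassoc_of% hf0, reassoc_of% hψ0, hpt0]
      · change O.ι ≫ y1 = ψ ≫ f1 ≫ C.ι
        rw [reassoc_of% hf1, hψ1]
    · rw [Category.assoc ψ, hφξ, reassoc_of% hf0, reassoc_of% hψ0, hξ0]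
  have hψiso : IsIso ψ := ⟨φ', e2, e1⟩
  have : Smooth (C.ι ≫ X.hom) := inferInstance
  have : Smooth f0 := inferInstanceAs (Smooth (pullback.fst _ _))
  change Smooth (O.ι ≫ pt0)
  rw [← hψ0, ← hf0]
  infer_instance

/-- The projection `P_1 ⟶ P_0` is smooth. -/
theorem smooth_pt_zero [Smooth X.hom] (h : IsUniv D m e y ξ) (hm : ∀ i, 1 ≤ m i)
    (hc : ∀ x : X.left, ∃ c : Chart D, x ∈ Set.range c.j) : Smooth (P.map (OSimp.pt (n := 1) 0).op) := by
  refine smooth_of_forall _ fun x ↦ ?_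
  by_cases hx : x ∈ inner (ξ (.op ⟨1⟩))
  · exact ⟨_, (inner (ξ (.op ⟨1⟩))).ι, inferInstance, ⟨⟨x, hx⟩, rfl⟩, smooth_inner h⟩
  -- where some `x_i` vanishes, the two points of `X` agree, so that the local model of `P_1` contains the point
  let κ := (P.obj (.op ⟨1⟩)).fromSpecResidueField x
  let pt0 : P.obj (.op ⟨1⟩) ⟶ P.obj (.op ⟨0⟩) := P.map (OSimp.pt (n := 1) 0).op
  let x0 : P.obj (.op ⟨0⟩) ⟶ X.left := y.app (.op ⟨0⟩) ≫ pr X 0 0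
  obtain ⟨c, hc⟩ := hc (x0 (pt0 x))
  obtain ⟨p, z, hz⟩ := exists_param h c _ hc
  obtain ⟨M⟩ := p.exists_model h
  have hκx (s) : κ s = x := Scheme.fromSpecResidueField_apply _ _
  have hκ : mon (κ ≫ ξ (.op ⟨1⟩)) (m + e) = 0 := by
    rw [mon_comp]
    by_contra h0
    apply hx
    rw [← basicOpen_mon_eq_inner (ξ (.op ⟨1⟩)) (e := m + e) (fun i ↦ by have := hm i; simp; omega)]
    have hF : IsField Γ(Spec ((P.obj (.op ⟨1⟩)).residueField x), ⊤) :=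
      MulEquiv.isField (Field.toIsField ((P.obj (.op ⟨1⟩)).residueField x))
        (ΓSpecIso ((P.obj (.op ⟨1⟩)).residueField x)).commRingCatIsoToRingEquiv.toMulEquiv
    obtain ⟨v, hv⟩ := hF.mul_inv_cancel h0
    have h1 : IsUnit (κ.appTop (mon (ξ (.op ⟨1⟩)) (m + e))) := .of_mul_eq_one v hv
    let s : Spec ((P.obj (.op ⟨1⟩)).residueField x) := IsLocalRing.closedPoint ((P.obj (.op ⟨1⟩)).residueField x)
    have h2 : s ∈ κ ⁻¹ᵁ (P.obj (.op ⟨1⟩)).basicOpen (mon (ξ (.op ⟨1⟩)) (m + e)) := by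
      rw [Scheme.preimage_basicOpen]
      change s ∈ Scheme.basicOpen _ (κ.appTop _)
      rw [Scheme.basicOpen_of_isUnit _ h1]
      trivial
    have h3 : κ s ∈ (P.obj (.op ⟨1⟩)).basicOpen (mon (ξ (.op ⟨1⟩)) (m + e)) := h2
    rwa [hκx] at h3
  have h1 := (h.adm 1).diag κ hκ 0 1
  let t' : Spec ((P.obj (.op ⟨1⟩)).residueField x) ⟶ p.B := IsOpenImmersion.lift p.i0 (κ ≫ pt0) (by
    rintro _ ⟨s, rfl⟩
    exact ⟨z, hz.trans (congrArg pt0 (hκx s).symm)⟩)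
  have ht' : t' ≫ p.i0 = κ ≫ pt0 := IsOpenImmersion.lift_fac _ _ _
  obtain ⟨l, hl⟩ := M.factor κ t' (t' ≫ p.y0) ht'.symm (by
    rw [← h1, Category.assoc, p.hy, reassoc_of% ht']
    exact congrArg (κ ≫ ·) (IsUniv.pt_pr (y := y) (n := 1) 0).symm) (Chart.near_self _)
  refine ⟨M.R, M.r, inferInstance, ?_, ?_⟩
  · let s : Spec ((P.obj (.op ⟨1⟩)).residueField x) := IsLocalRing.closedPoint ((P.obj (.op ⟨1⟩)).residueField x)
    exact ⟨l s, congr($hl s).trans (hκx s)⟩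
  · rw [M.ht]
    infer_instance

end Smooth

/-! ### The boundary and its local coordinates -/

lemma isPullback_of_forall {C : Type*} [Category C] {A B E F : C} {a : A ⟶ B} {b : A ⟶ E} {f : B ⟶ F} {g : E ⟶ F}
    (w : a ≫ f = b ≫ g)
    (hex : ∀ {T : C} (s : T ⟶ B) (t : T ⟶ E), s ≫ f = t ≫ g → ∃ l, l ≫ a = s ∧ l ≫ b = t)
    (hu : ∀ {T : C} (l l' : T ⟶ A), l ≫ a = l' ≫ a → l ≫ b = l' ≫ b → l = l') : IsPullback a b f g := by
  choose l hl hl' using @hex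
  exact ⟨⟨w⟩, ⟨PullbackCone.IsLimit.mk _ (fun s ↦ l s.fst s.snd s.condition) (fun s ↦ hl _ _ _) (fun s ↦ hl' _ _ _)
    fun s q hq hq' ↦ hu _ _ (hq.trans (hl _ _ _).symm) (hq'.trans (hl' _ _ _).symm)⟩⟩

section Boundary

variable {S : Scheme.{u}} {X : Over S} {ι : Type u} [Fintype ι] [DecidableEq ι]
  {D : ι → X.left.IdealSheafData} {m e b : ι → ℕ} {P Q : OS Scheme.{u}} {y : P ⟶ schPower X}
  {ξ : ∀ n, P.obj n ⟶ Spec (coordRing ι)} {c : Chart D}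

variable (ξ b) in
/-- `Q` is the oversimplicial closed subscheme of `P` defined by the monomial with exponent `b`. -/
structure IsBoundary (j : Q ⟶ P) : Prop where
  mono n : Mono (j.app (.op ⟨n⟩))
  mon_eq_zero n : mon (j.app (.op ⟨n⟩) ≫ ξ (.op ⟨n⟩)) b = 0
  exists_lift {n : ℕ} {K : Scheme.{u}} (κ : K ⟶ P.obj (.op ⟨n⟩)) (h : mon (κ ≫ ξ (.op ⟨n⟩)) b = 0) :
    ∃ l : K ⟶ Q.obj (.op ⟨n⟩), l ≫ j.app (.op ⟨n⟩) = κ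

variable {j : Q ⟶ P}

lemma IsBoundary.zero (hQ : IsBoundary b ξ j) {n : ℕ} {K : Scheme.{u}} (κ : K ⟶ Q.obj (.op ⟨n⟩)) :
    mon (κ ≫ j.app (.op ⟨n⟩) ≫ ξ (.op ⟨n⟩)) b = 0 := by
  rw [mon_comp, hQ.mon_eq_zero, map_zero]

lemma IsBoundary.isPullback (hQ : IsBoundary b ξ j) (h : IsUniv D m e y ξ) {n k : ℕ} (f : OSimp.mk k ⟶ OSimp.mk n) :
    IsPullback (Q.map f.op) (j.app (.op ⟨n⟩)) (j.app (.op ⟨k⟩)) (P.map f.op) := by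
  have := hQ.mono
  refine isPullback_of_forall (j.naturality f.op) (fun s t hst ↦ ?_) fun l l' _ hl ↦ ?_
  · obtain ⟨l, hl⟩ := hQ.exists_lift t (by
      have h1 := congr($hst ≫ ξ (.op ⟨k⟩))
      rw [Category.assoc, Category.assoc, h.map_ξ] at h1
      rw [← h1, hQ.zero])
    refine ⟨l, ?_, hl⟩
    rw [← cancel_mono (j.app (.op ⟨k⟩)), Category.assoc, j.naturality, hst, reassoc_of% hl]
  · exact (cancel_mono _).mp hl

lemma IsBoundary.isMultiplicative (hQ : IsBoundary b ξ j) (h : IsUniv D m e y ξ) (hP : IsMultiplicative P) :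
    IsMultiplicative Q := fun l k n f g u v hp ↦ by
  have h1 := (hP f g u v hp)
  have := hQ.mono
  have hc : Q.map u.op ≫ Q.map f.op = Q.map v.op ≫ Q.map g.op := by
    rw [← Q.map_comp, ← Q.map_comp, ← op_comp, ← op_comp, hp.w]
  refine isPullback_of_forall hc (fun s t hst ↦ ?_) fun l l' hl hl' ↦ ?_
  · obtain ⟨q, hq1, hq2⟩ := h1.exists_lift (s ≫ j.app _) (t ≫ j.app _)
      (by rw [Category.assoc, Category.assoc, ← j.naturality, ← j.naturality, reassoc_of% hst])
    obtain ⟨q', hq1', hq2'⟩ := (hQ.isPullback h u).exists_lift s q hq1.symm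
    refine ⟨q', hq1', ?_⟩
    rw [← cancel_mono (j.app _), Category.assoc, j.naturality, reassoc_of% hq2', hq2]
  · refine (hQ.isPullback h u).hom_ext hl (h1.hom_ext ?_ ?_)
    · rw [Category.assoc, Category.assoc, ← j.naturality, reassoc_of% hl]
    · rw [Category.assoc, Category.assoc, ← j.naturality, reassoc_of% hl']

/-- The vertices of a point of `P_n` agree modulo `x ^ e`, hence on the boundary. -/
lemma IsBoundary.pt_eq (hQ : IsBoundary b ξ j) (h : IsUniv D m e y ξ) (hb : b ≤ e) {n : ℕ} (i i' : Fin (n + 1)) :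
    Q.map (OSimp.pt i).op = Q.map (OSimp.pt i').op := by
  have := hQ.mono
  rw [← cancel_mono (j.app (.op ⟨0⟩)), j.naturality, j.naturality]
  exact h.congr _ (mon_eq_zero_of_le hb (hQ.mon_eq_zero n)) i i'

lemma IsBoundary.isStrictlyMultiplicative (hQ : IsBoundary b ξ j) (h : IsUniv D m e y ξ) (hb : b ≤ e)
    (hP : IsMultiplicative P) : IsStrictlyMultiplicative Q :=
  ⟨hQ.isMultiplicative h hP, hQ.pt_eq h hb 0 1⟩

/-- In a neighbourhood of the diagonal of a chart, a function vanishing on the diagonal is a combination of the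
differences of the coordinates. -/
lemma Chart.exists_combination {V : Scheme.{u}} [IsAffine V] {k k' : V ⟶ c.U} (hk : c.Near k k') (F : Γ(V, ⊤))
    (hF : ∀ {K : Scheme.{u}} (κ : K ⟶ V), κ ≫ k = κ ≫ k' → κ.appTop F = 0) :
    ∃ w : c.L → Γ(V, ⊤), F = ∑ l, w l * (xc (k' ≫ c.a) l - xc (k ≫ c.a) l) := by
  let f : c.L → Γ(V, ⊤) := fun l ↦ xc (k' ≫ c.a) l - xc (k ≫ c.a) l
  let I : V.IdealSheafData := Scheme.IdealSheafData.equivOfIsAffine.symm (Ideal.span (Set.range f))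
  have hI : I.ideal ⟨⊤, isAffineOpen_top V⟩ = Ideal.span (Set.range f) :=
    Scheme.IdealSheafData.equivOfIsAffine.apply_symm_apply (Ideal.span (Set.range f))
  have hker (s : Γ(V, ⊤)) : s ∈ Ideal.span (Set.range f) ↔ I.subschemeι.appTop s = 0 := by
    have h1 : I.ideal ⟨⊤, isAffineOpen_top V⟩ = RingHom.ker I.subschemeι.appTop.hom := by
      conv_lhs => rw [← I.ker_subschemeι, Hom.ker_apply]
      rfl
    rw [← hI, h1]
    rfl
  have h1 : F ∈ Ideal.span (Set.range f) := by
    rw [hker]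
    refine hF _ ((hk.comp I.subschemeι).eq (vec_ext fun l ↦ ?_))
    have h2 := (hker (f l)).mp (Ideal.subset_span ⟨l, rfl⟩)
    rw [map_sub, ← xc_comp, ← xc_comp, sub_eq_zero] at h2
    simpa only [Category.assoc] using h2.symm
  obtain ⟨w, hw⟩ := (Ideal.mem_span_range_iff_exists_fun).mp h1
  exact ⟨w, hw.symm⟩

/-- The coordinates of a point of the boundary. -/
def Param.Model.IsCoord {p : Param m y ξ c} (M : p.Model e) (j : Q ⟶ P) {K : Scheme.{u}} (x : K ⟶ Q.obj (.op ⟨1⟩))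
    (v : c.L → Γ(K, ⊤)) : Prop :=
  ∃ l : K ⟶ M.R, l ≫ M.r = x ≫ j.app (.op ⟨1⟩) ∧ v = fun i ↦ l.appTop (M.d i)

namespace Param.Model

variable {p : Param m y ξ c} {M : p.Model e} {K K' : Scheme.{u}} {x x' : K ⟶ Q.obj (.op ⟨1⟩)} {v v' : c.L → Γ(K, ⊤)}

lemma IsCoord.unique (hv : M.IsCoord j x v) (hv' : M.IsCoord j x v') : v = v' := by
  obtain ⟨l, hl, rfl⟩ := hv
  obtain ⟨l', hl', rfl⟩ := hv'
  rw [(cancel_mono M.r).mp (hl.trans hl'.symm)]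

lemma IsCoord.comp (hv : M.IsCoord j x v) (f : K' ⟶ K) : M.IsCoord j (f ≫ x) (fun i ↦ f.appTop (v i)) := by
  obtain ⟨l, hl, rfl⟩ := hv
  refine ⟨f ≫ l, by rw [Category.assoc, hl, Category.assoc], funext fun i ↦ ?_⟩
  rw [Scheme.Hom.comp_appTop]
  rfl

lemma pt_j_eq (hQ : IsBoundary b ξ j) (h : IsUniv D m e y ξ) (hb : b ≤ e) {n : ℕ} (i : Fin (n + 1)) :
    j.app (.op ⟨n⟩) ≫ y.app (.op ⟨n⟩) ≫ pr X n i =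
      Q.map (OSimp.pt 0).op ≫ j.app (.op ⟨0⟩) ≫ y.app (.op ⟨0⟩) ≫ pr X 0 0 := by
  rw [← IsUniv.pt_pr (y := y) i, hQ.pt_eq h hb 0 i, ← Category.assoc, ← j.naturality, Category.assoc]

/-- The point of `B` and the second point of the chart of a point of the boundary. -/
lemma IsCoord.base (hQ : IsBoundary b ξ j) (h : IsUniv D m e y ξ) (hb : b ≤ e) {l : K ⟶ M.R}
    (hl : l ≫ M.r = x ≫ j.app (.op ⟨1⟩)) : (l ≫ M.t) ≫ p.i0 = (x ≫ Q.map (OSimp.pt 0).op) ≫ j.app (.op ⟨0⟩) ∧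
      l ≫ M.q = (l ≫ M.t) ≫ p.y0 := by
  have h0 : (l ≫ M.t) ≫ p.i0 = (x ≫ Q.map (OSimp.pt 0).op) ≫ j.app (.op ⟨0⟩) := by
    have h1 : M.r ≫ P.map (OSimp.pt (n := 1) 0).op = M.t ≫ p.i0 := M.ht
    rw [Category.assoc, ← h1, reassoc_of% hl, Category.assoc, j.naturality]
  refine ⟨h0, ?_⟩
  have h2 : M.r ≫ y.app (.op ⟨1⟩) ≫ pr X 1 1 = M.q ≫ c.j := M.hq
  rw [← cancel_mono c.j]
  simp only [Category.assoc] at h0 hl ⊢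
  rw [← h2, reassoc_of% hl, pt_j_eq hQ h hb, p.hy, reassoc_of% h0]

lemma exists_isCoord (hQ : IsBoundary b ξ j) (h : IsUniv D m e y ξ) (hb : b ≤ e) (M : p.Model e) (t : K ⟶ p.B)
    (ht : t ≫ p.i0 = (x ≫ Q.map (OSimp.pt 0).op) ≫ j.app (.op ⟨0⟩)) : ∃ v, M.IsCoord j x v := by
  obtain ⟨l, hl⟩ := M.factor (x ≫ j.app (.op ⟨1⟩)) t (t ≫ p.y0)
    (by rw [Category.assoc, ← j.naturality, ht, Category.assoc])
    (by rw [Category.assoc, pt_j_eq hQ h hb, Category.assoc, p.hy, reassoc_of% ht])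
    (Chart.near_self _)
  exact ⟨_, l, hl, rfl⟩

lemma IsCoord.ext (hQ : IsBoundary b ξ j) (h : IsUniv D m e y ξ) (hb : b ≤ e) (hv : M.IsCoord j x v)
    (hv' : M.IsCoord j x' v) (hx : x ≫ Q.map (OSimp.pt 0).op = x' ≫ Q.map (OSimp.pt 0).op) : x = x' := by
  obtain ⟨l, hl, rfl⟩ := hv
  obtain ⟨l', hl', h3⟩ := hv'
  have := hQ.mono
  obtain ⟨h1, h2⟩ := IsCoord.base hQ h hb hl
  obtain ⟨h1', h2'⟩ := IsCoord.base hQ h hb hl'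
  have ht : l ≫ M.t = l' ≫ M.t := by rw [← cancel_mono p.i0, h1, hx, h1']
  rw [← cancel_mono (j.app (.op ⟨1⟩)), ← hl, ← hl', M.hom_ext ht (by rw [h2, h2', ht]) fun i ↦ congrFun h3 i]

/-- On the boundary the equations relating the two points of a pair reduce to their equality, so that the coordinates are arbitrary:
together with `exists_isCoord` and `IsCoord.ext`, `Q_1` is locally an affine space over `Q_0`. -/
lemma exists_of_coord (hQ : IsBoundary b ξ j) (h : IsUniv D m e y ξ) (hb : b ≤ e) (M : p.Model e) (t : K ⟶ p.B)
    (z : K ⟶ Q.obj (.op ⟨0⟩)) (ht : t ≫ p.i0 = z ≫ j.app (.op ⟨0⟩)) (v : c.L → Γ(K, ⊤)) :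
    ∃ x, M.IsCoord j x v ∧ x ≫ Q.map (OSimp.pt 0).op = z := by
  have h0 (e') (he : e ≤ e') : mon (t ≫ p.i0 ≫ ξ (.op ⟨0⟩)) e' = 0 := by
    rw [reassoc_of% ht]
    exact mon_eq_zero_of_le (hb.trans he) (hQ.zero z)
  obtain ⟨l, hl, hq, hd⟩ := M.lift (t' := t) (q' := t ≫ p.y0) (d' := v) {
    rel := fun i ↦ by rw [h0 _ (self_le_add_left e m), mul_zero, add_zero, Category.assoc]
    near := Chart.near_self _
    unit := fun i ↦ by
      have h1 : e ≤ m + e - Pi.single i (m i) := fun i' ↦ by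
        by_cases hi : i' = i
        · subst hi; simp
        · simp [Pi.single_eq_of_ne hi]
      rw [Param.unit, h0 _ h1, mul_zero, add_zero]
      exact (p.hw i).map _ }
  have hr : M.r ≫ P.map (OSimp.pt (n := 1) 0).op = M.t ≫ p.i0 := M.ht
  have h1 : (l ≫ M.r) ≫ P.map (OSimp.pt (n := 1) 0).op = z ≫ j.app (.op ⟨0⟩) := by
    rw [Category.assoc, hr, reassoc_of% hl, ht]
  obtain ⟨x, hx⟩ := hQ.exists_lift (l ≫ M.r) (by
    rw [← h.map_ξ (OSimp.pt (n := 1) 0).op, ← Category.assoc, h1, Category.assoc]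
    exact hQ.zero z)
  have := hQ.mono
  refine ⟨x, ⟨l, hx.symm, funext fun i ↦ (hd i).symm⟩, ?_⟩
  rw [← cancel_mono (j.app (.op ⟨0⟩)), Category.assoc, j.naturality, reassoc_of% hx, ← h1, Category.assoc]

/-- Coordinates are additive. -/
lemma IsCoord.add (hQ : IsBoundary b ξ j) (h : IsUniv D m e y ξ) (hb : b ≤ e)
    (x : K ⟶ Q.obj (.op ⟨2⟩)) (hv : M.IsCoord j (x ≫ Q.map (OSimp.edge (n := 2) 0 1).op) v)
    (hv' : M.IsCoord j (x ≫ Q.map (OSimp.edge (n := 2) 1 2).op) v') :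
    M.IsCoord j (x ≫ Q.map (OSimp.edge (n := 2) 0 2).op) (fun i ↦ v i + v' i) := by
  let E01 : P.obj (.op ⟨2⟩) ⟶ P.obj (.op ⟨1⟩) := P.map (OSimp.edge (n := 2) 0 1).op
  let E12 : P.obj (.op ⟨2⟩) ⟶ P.obj (.op ⟨1⟩) := P.map (OSimp.edge (n := 2) 1 2).op
  let E02 : P.obj (.op ⟨2⟩) ⟶ P.obj (.op ⟨1⟩) := P.map (OSimp.edge (n := 2) 0 2).op
  let pt0 : P.obj (.op ⟨1⟩) ⟶ P.obj (.op ⟨0⟩) := P.map (OSimp.pt (n := 1) 0).op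
  let y1 : P.obj (.op ⟨1⟩) ⟶ X.left := y.app (.op ⟨1⟩) ≫ pr X 1 1
  let x0 : P.obj (.op ⟨0⟩) ⟶ X.left := y.app (.op ⟨0⟩) ≫ pr X 0 0
  have E0 : E01 ≫ pt0 = E02 ≫ pt0 := by
    refine (P.map_comp _ _).symm.trans (Eq.trans ?_ (P.map_comp _ _))
    rfl
  have hedge (i k : Fin 3) : P.map (OSimp.edge (n := 2) i k).op ≫ y1 = y.app (.op ⟨2⟩) ≫ pr X 2 k := by
    change P.map (OSimp.edge (n := 2) i k).op ≫ y.app _ ≫ _ = _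
    rw [← Category.assoc, y.naturality, Category.assoc, map_pr]
    rfl
  have hpt (i k : Fin 3) : P.map (OSimp.edge (n := 2) i k).op ≫ pt0 ≫ x0 = y.app (.op ⟨2⟩) ≫ pr X 2 i := by
    rw [← IsUniv.pt_pr (y := y) i]
    change _ ≫ P.map _ ≫ _ = _
    rw [← Category.assoc, ← P.map_comp]
    rfl
  have hξ (i k : Fin 3) : P.map (OSimp.edge (n := 2) i k).op ≫ ξ (.op ⟨1⟩) = ξ (.op ⟨2⟩) := h.map_ξ _
  have hMt : M.r ≫ pt0 = M.t ≫ p.i0 := M.ht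
  have hMq : M.r ≫ y1 = M.q ≫ c.j := M.hq
  obtain ⟨l, hl, rfl⟩ := hv
  obtain ⟨l', hl', rfl⟩ := hv'
  obtain ⟨_, l'', hl'', rfl⟩ := exists_isCoord (x := x ≫ Q.map (OSimp.edge (n := 2) 0 2).op) hQ h hb M (l ≫ M.t) (by
    rw [(IsCoord.base hQ h hb hl).1]
    simp only [Category.assoc, ← Q.map_comp_assoc]
    rfl)
  refine ⟨l'', hl'', ?_⟩
  let F : (P.obj (.op ⟨2⟩)).Opens := E01 ⁻¹ᵁ M.r.opensRange ⊓ E12 ⁻¹ᵁ M.r.opensRange ⊓ E02 ⁻¹ᵁ M.r.opensRange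
  let f01 : F.toScheme ⟶ M.R := IsOpenImmersion.lift M.r (F.ι ≫ E01) (by rintro _ ⟨x, rfl⟩; exact x.2.1.1)
  let f12 : F.toScheme ⟶ M.R := IsOpenImmersion.lift M.r (F.ι ≫ E12) (by rintro _ ⟨x, rfl⟩; exact x.2.1.2)
  let f02 : F.toScheme ⟶ M.R := IsOpenImmersion.lift M.r (F.ι ≫ E02) (by rintro _ ⟨x, rfl⟩; exact x.2.2)
  have h01 : f01 ≫ M.r = F.ι ≫ E01 := IsOpenImmersion.lift_fac _ _ _
  have h12 : f12 ≫ M.r = F.ι ≫ E12 := IsOpenImmersion.lift_fac _ _ _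
  have h02 : f02 ≫ M.r = F.ι ≫ E02 := IsOpenImmersion.lift_fac _ _ _
  have ht : f01 ≫ M.t = f02 ≫ M.t := by
    rw [← cancel_mono p.i0, Category.assoc, Category.assoc, ← hMt, reassoc_of% h01, reassoc_of% h02, E0]
  have hq : f12 ≫ M.q = f02 ≫ M.q := by
    rw [← cancel_mono c.j, Category.assoc, Category.assoc, ← hMq, reassoc_of% h12, reassoc_of% h02, hedge, hedge]
  have htq : f01 ≫ M.q = f12 ≫ M.t ≫ p.y0 := by
    rw [← cancel_mono c.j, Category.assoc, ← hMq, reassoc_of% h01, hedge, Category.assoc, Category.assoc, p.hy,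
      ← reassoc_of% hMt, reassoc_of% h12]
    exact congrArg (F.ι ≫ ·) (hpt 1 2).symm
  have hmon (f : F.toScheme ⟶ M.R) (i k : Fin 3) (hf : f ≫ M.r = F.ι ≫ P.map (OSimp.edge (n := 2) i k).op) :
      (f ≫ M.t) ≫ p.i0 ≫ ξ (.op ⟨0⟩) = F.ι ≫ ξ (.op ⟨2⟩) := by
    have h3 : pt0 ≫ ξ (.op ⟨0⟩) = ξ (.op ⟨1⟩) := h.map_ξ _
    rw [Category.assoc, ← reassoc_of% hMt, h3, reassoc_of% hf, hξ]
  have hadd (i) : f02.appTop (M.d i) = f01.appTop (M.d i) + f12.appTop (M.d i) := by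
    refine cancel_mon (e := m + e) (dom_of_flat h F.ι) ?_
    have r01 := (M.pt.comp f01).rel i
    have r12 := (M.pt.comp f12).rel i
    have r02 := (M.pt.comp f02).rel i
    rw [hmon f01 0 1 h01, htq] at r01
    rw [hmon f12 1 2 h12, hq] at r12
    rw [hmon f02 0 2 h02, ← ht] at r02
    simp only [Category.assoc] at r01 r12 r02
    rw [add_mul]
    linear_combination r01 + r12 - r02
  have hκ {i k : Fin 3} {l : K ⟶ M.R} (hl : l ≫ M.r = (x ≫ Q.map (OSimp.edge (n := 2) i k).op) ≫ j.app (.op ⟨1⟩)) :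
      l ≫ M.r = (x ≫ j.app (.op ⟨2⟩)) ≫ P.map (OSimp.edge (n := 2) i k).op := by
    rw [hl, Category.assoc, Category.assoc, j.naturality]
  have k1 := hκ hl
  have k2 := hκ hl'
  have k3 := hκ hl''
  let κ : K ⟶ F.toScheme := IsOpenImmersion.lift F.ι (x ≫ j.app (.op ⟨2⟩)) (by
    rw [Scheme.Opens.range_ι]
    rintro _ ⟨s, rfl⟩
    exact ⟨⟨⟨l s, congr($k1 s)⟩, ⟨l' s, congr($k2 s)⟩⟩, ⟨l'' s, congr($k3 s)⟩⟩)
  have hκ : κ ≫ F.ι = x ≫ j.app (.op ⟨2⟩) := IsOpenImmersion.lift_fac _ _ _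
  have e1 : l = κ ≫ f01 := by rw [← cancel_mono M.r, Category.assoc, h01, reassoc_of% hκ, k1, Category.assoc]
  have e2 : l' = κ ≫ f12 := by rw [← cancel_mono M.r, Category.assoc, h12, reassoc_of% hκ, k2, Category.assoc]
  have e3 : l'' = κ ≫ f02 := by rw [← cancel_mono M.r, Category.assoc, h02, reassoc_of% hκ, k3, Category.assoc]
  funext i
  rw [e1, e2, e3, Scheme.Hom.comp_appTop, Scheme.Hom.comp_appTop, Scheme.Hom.comp_appTop]
  change κ.appTop (f01.appTop (M.d i)) + κ.appTop (f12.appTop (M.d i)) = κ.appTop (f02.appTop (M.d i))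
  rw [← map_add, hadd]

/-- The coordinates of points of the boundary in different charts are locally related by linear transformations. -/
lemma IsCoord.exists_transition (hQ : IsBoundary b ξ j) (h : IsUniv D m e y ξ) (hb : b ≤ e) {c' : Chart D}
    {p' : Param m y ξ c'} (M : p.Model e) (M' : p'.Model e) (z : K ⟶ Q.obj (.op ⟨0⟩)) {t : K ⟶ p.B} {t' : K ⟶ p'.B}
    (ht : t ≫ p.i0 = z ≫ j.app (.op ⟨0⟩)) (ht' : t' ≫ p'.i0 = z ≫ j.app (.op ⟨0⟩)) (k : K) :
    ∃ (W : K.Opens) (_ : k ∈ W) (w : c'.L → c.L → Γ(W, ⊤)), ∀ {K' : Scheme.{u}} (f : K' ⟶ W)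
      (x : K' ⟶ Q.obj (.op ⟨1⟩)) (_ : x ≫ Q.map (OSimp.pt 0).op = f ≫ W.ι ≫ z) (v : c.L → Γ(K', ⊤)) (v' : c'.L → Γ(K', ⊤)),
      M.IsCoord j x v → M'.IsCoord j x v' → ∀ i, v' i = ∑ l, f.appTop (w i l) * v l := by
  let pt0 : P.obj (.op ⟨1⟩) ⟶ P.obj (.op ⟨0⟩) := P.map (OSimp.pt (n := 1) 0).op
  let y1 : P.obj (.op ⟨1⟩) ⟶ X.left := y.app (.op ⟨1⟩) ≫ pr X 1 1
  have hMt : M.r ≫ pt0 = M.t ≫ p.i0 := M.ht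
  have hMq : M.r ≫ y1 = M.q ≫ c.j := M.hq
  have hMt' : M'.r ≫ pt0 = M'.t ≫ p'.i0 := M'.ht
  have hMq' : M'.r ≫ y1 = M'.q ≫ c'.j := M'.hq
  let A := pullback c.j c'.j
  let u : A ⟶ c.U := pullback.fst _ _
  let u' : A ⟶ c'.U := pullback.snd _ _
  have hu : u ≫ c.j = u' ≫ c'.j := pullback.condition
  let E := pullback (u ≫ c.j ≫ X.hom) (u ≫ c.j ≫ X.hom)
  let s1 : E ⟶ A := pullback.fst _ _
  let s2 : E ⟶ A := pullback.snd _ _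
  have hs : s1 ≫ u ≫ c.j ≫ X.hom = s2 ≫ u ≫ c.j ≫ X.hom := pullback.condition
  obtain ⟨O, hO⟩ := Chart.exists_near (c := c) (k := s1 ≫ u) (k' := s2 ≫ u) (by simpa only [Category.assoc] using hs)
  -- the diagonal point of `E` determined by `z`
  let δ : K ⟶ A := pullback.lift (t ≫ p.y0) (t' ≫ p'.y0) (by
    rw [Category.assoc, Category.assoc, p.hy, p'.hy, reassoc_of% ht, reassoc_of% ht'])
  have hδ : δ ≫ u = t ≫ p.y0 := pullback.lift_fst _ _ _
  have hδ' : δ ≫ u' = t' ≫ p'.y0 := pullback.lift_snd _ _ _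
  let ε : K ⟶ E := pullback.lift δ δ rfl
  have hε1 : ε ≫ s1 = δ := pullback.lift_fst _ _ _
  have hε2 : ε ≫ s2 = δ := pullback.lift_snd _ _ _
  have hεO : ε k ∈ O := (hO ε).mpr (by rw [reassoc_of% hε1, reassoc_of% hε2]; exact Chart.near_self _) ⟨k, rfl⟩
  obtain ⟨_, ⟨V₀, hV₀, rfl⟩, hkV, hVO⟩ := E.isBasis_affineOpens.exists_subset_of_mem_open hεO O.isOpen
  let V : E.Opens := V₀
  have hVa : IsAffineOpen V := hV₀
  have : IsAffine V.toScheme := hVa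
  have hnear : c.Near (V.ι ≫ s1 ≫ u) (V.ι ≫ s2 ≫ u) := (hO V.ι).mp (by
    rw [Scheme.Opens.range_ι]; exact hVO)
  let F (i : c'.L) : Γ(V, ⊤) := xc ((V.ι ≫ s2 ≫ u') ≫ c'.a) i - xc ((V.ι ≫ s1 ≫ u') ≫ c'.a) i
  have hF (i) : ∃ w : c.L → Γ(V, ⊤), F i = ∑ l, w l * (xc ((V.ι ≫ s2 ≫ u) ≫ c.a) l - xc ((V.ι ≫ s1 ≫ u) ≫ c.a) l) := by
    refine Chart.exists_combination hnear (F i) fun κ hκ ↦ ?_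
    have h1 : κ ≫ V.ι ≫ s1 ≫ u' = κ ≫ V.ι ≫ s2 ≫ u' := by
      rw [← cancel_mono c'.j]
      simp only [Category.assoc] at hκ ⊢
      rw [← hu, reassoc_of% hκ]
    simp only [F]
    rw [map_sub, ← xc_comp, ← xc_comp]
    simp only [Category.assoc]
    rw [reassoc_of% h1, sub_self]
  choose w hw using hF
  let W : K.Opens := ε ⁻¹ᵁ V
  let τ : W.toScheme ⟶ V := ε ∣_ V
  have hτ : τ ≫ V.ι = W.ι ≫ ε := morphismRestrict_ι _ _
  refine ⟨W, hkV, fun i l ↦ τ.appTop (w i l), fun {K'} f x hx v v' hv hv' i ↦ ?_⟩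
  obtain ⟨l, hl, rfl⟩ := hv
  obtain ⟨l', hl', rfl⟩ := hv'
  obtain ⟨b1, b2⟩ := IsCoord.base hQ h hb hl
  obtain ⟨b1', b2'⟩ := IsCoord.base hQ h hb hl'
  have hlt : l ≫ M.t = f ≫ W.ι ≫ t := by rw [← cancel_mono p.i0, b1, hx]; simp only [Category.assoc, ht]
  have hlt' : l' ≫ M'.t = f ≫ W.ι ≫ t' := by rw [← cancel_mono p'.i0, b1', hx]; simp only [Category.assoc, ht']
  -- the intersection of the two charts of `P_1`
  let R := pullback M.r M'.r
  let g : R ⟶ M.R := pullback.fst _ _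
  let g' : R ⟶ M'.R := pullback.snd _ _
  have hg : g ≫ M.r = g' ≫ M'.r := pullback.condition
  let β1 : R ⟶ A := pullback.lift (g ≫ M.t ≫ p.y0) (g' ≫ M'.t ≫ p'.y0) (by
    simp only [Category.assoc]
    rw [p.hy, p'.hy, ← reassoc_of% hMt, ← reassoc_of% hMt', reassoc_of% hg])
  let β2 : R ⟶ A := pullback.lift (g ≫ M.q) (g' ≫ M'.q) (by
    rw [Category.assoc, Category.assoc, ← hMq, ← hMq', reassoc_of% hg])
  have hβ1 : β1 ≫ u = g ≫ M.t ≫ p.y0 := pullback.lift_fst _ _ _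
  have hβ1' : β1 ≫ u' = g' ≫ M'.t ≫ p'.y0 := pullback.lift_snd _ _ _
  have hβ2 : β2 ≫ u = g ≫ M.q := pullback.lift_fst _ _ _
  have hβ2' : β2 ≫ u' = g' ≫ M'.q := pullback.lift_snd _ _ _
  let β : R ⟶ E := pullback.lift β1 β2 (by
    rw [reassoc_of% hβ1, reassoc_of% hβ2]
    have := congr(g ≫ $(M.pt.near.hom_eq))
    simpa only [Category.assoc] using this)
  have hβs1 : β ≫ s1 = β1 := pullback.lift_fst _ _ _
  have hβs2 : β ≫ s2 = β2 := pullback.lift_snd _ _ _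
  let RV : R.Opens := β ⁻¹ᵁ V
  let σ : RV.toScheme ⟶ V := β ∣_ V
  have hσ : σ ≫ V.ι = RV.ι ≫ β := morphismRestrict_ι _ _
  let ρ : RV.toScheme ⟶ P.obj (.op ⟨1⟩) := RV.ι ≫ g ≫ M.r
  have hρo : IsOpenImmersion ρ := by
    have : IsOpenImmersion g := inferInstanceAs (IsOpenImmersion (pullback.fst _ _))
    infer_instance
  have h3 : pt0 ≫ ξ (.op ⟨0⟩) = ξ (.op ⟨1⟩) := h.map_ξ _
  have key (i) : (RV.ι ≫ g').appTop (M'.d i) = ∑ l, σ.appTop (w i l) * (RV.ι ≫ g).appTop (M.d l) := by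
    refine cancel_mon (e := m + e) (dom_of_flat h ρ) ?_
    have r1 := (M'.pt.comp (RV.ι ≫ g')).rel i
    have r2 (l) := (M.pt.comp (RV.ι ≫ g)).rel l
    have e1 : ((RV.ι ≫ g') ≫ M'.t) ≫ p'.i0 ≫ ξ (.op ⟨0⟩) = ρ ≫ ξ (.op ⟨1⟩) := by
      simp only [ρ, Category.assoc]
      rw [← reassoc_of% hMt', h3, reassoc_of% hg]
    have e2 : ((RV.ι ≫ g) ≫ M.t) ≫ p.i0 ≫ ξ (.op ⟨0⟩) = ρ ≫ ξ (.op ⟨1⟩) := by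
      simp only [ρ, Category.assoc]
      rw [← reassoc_of% hMt, h3]
    rw [e1] at r1
    simp only [e2] at r2
    have r3 := congrArg σ.appTop (hw i)
    simp only [F, map_sub, map_sum, map_mul, ← xc_comp] at r3
    simp only [Category.assoc] at r1 r2 r3
    simp only [reassoc_of% hσ, reassoc_of% hβs1, reassoc_of% hβs2, reassoc_of% hβ1, reassoc_of% hβ2, reassoc_of% hβ1',
      reassoc_of% hβ2', r1, r2, add_sub_cancel_left] at r3
    rw [r3, Finset.sum_mul]
    exact Finset.sum_congr rfl fun l _ ↦ (mul_assoc _ _ _).symm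
  let ν : K' ⟶ R := pullback.lift l l' (hl.trans hl'.symm)
  have hν : ν ≫ g = l := pullback.lift_fst _ _ _
  have hν' : ν ≫ g' = l' := pullback.lift_snd _ _ _
  have hνβ : ν ≫ β = f ≫ τ ≫ V.ι := by
    have h4 : ν ≫ β1 = f ≫ W.ι ≫ δ := by
      refine pullback.hom_ext ?_ ?_
      · change (ν ≫ β1) ≫ u = (f ≫ W.ι ≫ δ) ≫ u
        simp only [Category.assoc, hβ1, hδ]
        rw [reassoc_of% hν, reassoc_of% hlt]
      · change (ν ≫ β1) ≫ u' = (f ≫ W.ι ≫ δ) ≫ u'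
        simp only [Category.assoc, hβ1', hδ']
        rw [reassoc_of% hν', reassoc_of% hlt']
    have h5 : ν ≫ β2 = f ≫ W.ι ≫ δ := by
      refine pullback.hom_ext ?_ ?_
      · change (ν ≫ β2) ≫ u = (f ≫ W.ι ≫ δ) ≫ u
        simp only [Category.assoc, hβ2, hδ]
        rw [reassoc_of% hν, b2, hlt]
        simp only [Category.assoc]
      · change (ν ≫ β2) ≫ u' = (f ≫ W.ι ≫ δ) ≫ u'
        simp only [Category.assoc, hβ2', hδ']
        rw [reassoc_of% hν', b2', hlt']
        simp only [Category.assoc]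
    rw [hτ]
    refine pullback.hom_ext ?_ ?_
    · change (ν ≫ β) ≫ s1 = (f ≫ W.ι ≫ ε) ≫ s1
      simp only [Category.assoc, hβs1, hε1, h4]
    · change (ν ≫ β) ≫ s2 = (f ≫ W.ι ≫ ε) ≫ s2
      simp only [Category.assoc, hβs2, hε2, h5]
  let μ : K' ⟶ RV.toScheme := IsOpenImmersion.lift RV.ι ν (by
    rw [Scheme.Opens.range_ι]
    rintro _ ⟨s, rfl⟩
    change β (ν s) ∈ V
    have h6 : β (ν s) = V.ι (τ (f s)) := congr($hνβ s)
    rw [h6]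
    exact (τ (f s)).2)
  have hμ : μ ≫ RV.ι = ν := IsOpenImmersion.lift_fac _ _ _
  have hμσ : μ ≫ σ = f ≫ τ := by
    rw [← cancel_mono V.ι, Category.assoc, hσ, reassoc_of% hμ, hνβ, Category.assoc]
  have k1 := congrArg μ.appTop (key i)
  have c1 : l' = μ ≫ RV.ι ≫ g' := by rw [reassoc_of% hμ, hν']
  have c2 : l = μ ≫ RV.ι ≫ g := by rw [reassoc_of% hμ, hν]
  rw [map_sum] at k1
  simp only [map_mul] at k1
  change l'.appTop (M'.d i) = ∑ l_1, f.appTop (τ.appTop (w i l_1)) * l.appTop (M.d l_1)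
  have c3 (a) : f.appTop (τ.appTop a) = μ.appTop (σ.appTop a) := by
    have := congr(($hμσ).appTop a)
    rw [Scheme.Hom.comp_appTop, Scheme.Hom.comp_appTop] at this
    exact this.symm
  simp only [c3]
  rw [c1, c2, Scheme.Hom.comp_appTop μ]
  refine k1.trans (Finset.sum_congr rfl fun l _ ↦ ?_)
  rw [Scheme.Hom.comp_appTop μ]
  rfl

end Param.Model

end Boundary

/-! ### The group of a strictly multiplicative oversimplicial scheme -/

section Grp

open MonoidalCategory CartesianMonoidalCategory MonObj

/-- A group object from operations satisfying the group laws on points. -/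
abbrev grpObjOfPoints {C : Type*} [Category C] [CartesianMonoidalCategory C] {T : C} (one : 𝟙_ C ⟶ T) (mul : T ⊗ T ⟶ T)
    (inv : T ⟶ T) (h1 : ∀ {Y : C} (x : Y ⟶ T), lift (toUnit Y ≫ one) x ≫ mul = x)
    (h2 : ∀ {Y : C} (x : Y ⟶ T), lift x (toUnit Y ≫ one) ≫ mul = x)
    (h3 : ∀ {Y : C} (x y z : Y ⟶ T), lift (lift x y ≫ mul) z ≫ mul = lift x (lift y z ≫ mul) ≫ mul)
    (h4 : ∀ {Y : C} (x : Y ⟶ T), lift (x ≫ inv) x ≫ mul = toUnit Y ≫ one)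
    (h5 : ∀ {Y : C} (x : Y ⟶ T), lift x (x ≫ inv) ≫ mul = toUnit Y ≫ one) : GrpObj T where
  one := one
  mul := mul
  inv := inv
  one_mul := by
    have : one ▷ T = lift (toUnit _ ≫ one) (snd _ _) := by
      ext
      · simp only [whiskerRight_fst, lift_fst]
        rw [toUnit_unique (toUnit _) (fst _ _)]
      · simp
    rw [this, h1]
    exact (leftUnitor_hom _).symm
  mul_one := by
    have : T ◁ one = lift (fst _ _) (toUnit _ ≫ one) := by
      ext
      · simp
      · simp only [whiskerLeft_snd, lift_snd]
        rw [toUnit_unique (toUnit _) (snd _ _)]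
    rw [this, h2]
    exact (rightUnitor_hom _).symm
  mul_assoc := by
    have e1 : mul ▷ T = lift (lift (fst _ _ ≫ fst _ _) (fst _ _ ≫ snd _ _) ≫ mul) (snd (T ⊗ T) T) := by
      ext
      · simp only [whiskerRight_fst, lift_fst]
        rw [← comp_lift, lift_fst_snd, Category.comp_id]
      · simp
    have e2 : (α_ T T T).hom ≫ T ◁ mul = lift (fst _ _ ≫ fst _ _) (lift (fst _ _ ≫ snd _ _) (snd (T ⊗ T) T) ≫ mul) := by
      ext
      · simp
      · simp only [Category.assoc, whiskerLeft_snd, lift_snd]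
        rw [← Category.assoc]
        congr 1
        ext <;> simp
    rw [e1, reassoc_of% e2, h3]
  left_inv := by simpa using h4 (𝟙 T)
  right_inv := by simpa using h5 (𝟙 T)

variable {Q : OS Scheme.{u}} {Z : Scheme.{u}} {b : Q.obj (.op ⟨0⟩) ⟶ Z}

/-- The morphism to `Q_1` underlying a point of the scheme `Q_1` over `Z`. -/
def gpt {Y : Over Z} (x : Y ⟶ groupOver Q b) : Y.left ⟶ Q.obj (.op ⟨1⟩) := x.left

lemma gpt_pt {Y : Over Z} (x : Y ⟶ groupOver Q b) : gpt x ≫ Q.map (OSimp.pt (n := 1) 0).op ≫ b = Y.hom := Over.w x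

lemma gpt_ext {Y : Over Z} {x y : Y ⟶ groupOver Q b} (h : gpt x = gpt y) : x = y := Over.OverMorphism.ext h

lemma gpt_pt_eq [IsIso b] {Y : Over Z} (x y : Y ⟶ groupOver Q b) :
    gpt x ≫ Q.map (OSimp.pt (n := 1) 0).op = gpt y ≫ Q.map (OSimp.pt (n := 1) 0).op := by
  rw [← cancel_mono b, Category.assoc, Category.assoc, gpt_pt, gpt_pt]

namespace IsStrictlyMultiplicative

lemma isPullback_two (hQ : IsStrictlyMultiplicative Q) :
    IsPullback (Q.map (OSimp.edge (n := 2) 0 1).op) (Q.map (OSimp.edge (n := 2) 1 2).op)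
    (Q.map (OSimp.pt (n := 1) 0).op) (Q.map (OSimp.pt (n := 1) 0).op) := by
  have h1 := hQ.multiplicative _ _ _ _ (isPushout_edge (n := 1) 1)
  have h2 : OSimp.succ 1 = OSimp.edge (n := 2) 0 1 := OSimp.hom_ext fun j ↦ by
    change Fin 2 at j
    fin_cases j <;> rfl
  rw [h2, ← hQ.strict] at h1
  exact h1

lemma pt_eq (hQ : IsStrictlyMultiplicative Q) {n : ℕ} (i k : Fin (n + 1)) : Q.map (OSimp.pt i).op = Q.map (OSimp.pt k).op := by
  have e0 : OSimp.pt k = OSimp.pt (n := 1) 0 ≫ OSimp.edge k i := rfl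
  have e1 : OSimp.pt i = OSimp.pt (n := 1) 1 ≫ OSimp.edge k i := rfl
  rw [e0, e1, op_comp, op_comp, Q.map_comp, Q.map_comp, hQ.strict]

lemma isPullback_three (hQ : IsStrictlyMultiplicative Q) :
    IsPullback (Q.map (OSimp.succ 2).op) (Q.map (OSimp.edge (n := 3) 2 3).op)
    (Q.map (OSimp.pt (n := 2) 0).op) (Q.map (OSimp.pt (n := 1) 0).op) := by
  have h1 := hQ.multiplicative _ _ _ _ (isPushout_edge (n := 2) 2)
  rw [hQ.pt_eq 2 0] at h1
  exact h1

/-- The multiplication on `Q_1`. -/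
def mulHom (hQ : IsStrictlyMultiplicative Q) [IsIso b] : groupOver Q b ⊗ groupOver Q b ⟶ groupOver Q b :=
  Over.homMk (hQ.isPullback_two.lift (gpt (fst (groupOver Q b) (groupOver Q b))) (gpt (snd (groupOver Q b) (groupOver Q b)))
    (gpt_pt_eq _ _) ≫ Q.map (OSimp.edge (n := 2) 0 2).op) (by
    have h0 : Q.map (OSimp.edge (n := 2) 0 2).op ≫ Q.map (OSimp.pt (n := 1) 0).op =
        Q.map (OSimp.edge (n := 2) 0 1).op ≫ Q.map (OSimp.pt (n := 1) 0).op := by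
      rw [← Q.map_comp, ← Q.map_comp]; rfl
    change (hQ.isPullback_two.lift _ _ _ ≫ Q.map (OSimp.edge (n := 2) 0 2).op) ≫ Q.map (OSimp.pt (n := 1) 0).op ≫ b = _
    rw [Category.assoc, reassoc_of% h0, IsPullback.lift_fst_assoc, gpt_pt])

lemma exists_two (hQ : IsStrictlyMultiplicative Q) [IsIso b] {Y : Over Z} (x y : Y ⟶ groupOver Q b) :
    ∃ p : Y.left ⟶ Q.obj (.op ⟨2⟩), p ≫ Q.map (OSimp.edge (n := 2) 0 1).op = gpt x ∧
      p ≫ Q.map (OSimp.edge (n := 2) 1 2).op = gpt y :=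
  hQ.isPullback_two.exists_lift (gpt x) (gpt y) (gpt_pt_eq x y)

lemma lift_mulHom (hQ : IsStrictlyMultiplicative Q) [IsIso b] {Y : Over Z} {x y : Y ⟶ groupOver Q b}
    {p : Y.left ⟶ Q.obj (.op ⟨2⟩)} (h1 : p ≫ Q.map (OSimp.edge (n := 2) 0 1).op = gpt x)
    (h2 : p ≫ Q.map (OSimp.edge (n := 2) 1 2).op = gpt y) :
    gpt (lift x y ≫ mulHom (b := b) hQ) = p ≫ Q.map (OSimp.edge (n := 2) 0 2).op := by
  let q : (groupOver Q b ⊗ groupOver Q b).left ⟶ Q.obj (.op ⟨2⟩) := hQ.isPullback_two.lift (gpt (fst (groupOver Q b) (groupOver Q b)))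
    (gpt (snd (groupOver Q b) (groupOver Q b))) (gpt_pt_eq _ _)
  let z : Y.left ⟶ (groupOver Q b ⊗ groupOver Q b).left := (lift x y).left
  have hz1 : z ≫ gpt (fst (groupOver Q b) (groupOver Q b)) = gpt x := congrArg CommaMorphism.left (lift_fst x y)
  have hz2 : z ≫ gpt (snd (groupOver Q b) (groupOver Q b)) = gpt y := congrArg CommaMorphism.left (lift_snd x y)
  change z ≫ q ≫ Q.map (OSimp.edge (n := 2) 0 2).op = _
  have : z ≫ q = p := by
    refine hQ.isPullback_two.hom_ext ?_ ?_
    · rw [Category.assoc, IsPullback.lift_fst, h1, hz1]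
    · rw [Category.assoc, IsPullback.lift_snd, h2, hz2]
  rw [reassoc_of% this]

/-- The unit of `Q_1`. -/
def oneHom (hQ : IsStrictlyMultiplicative Q) [IsIso b] : 𝟙_ (Over Z) ⟶ groupOver Q b :=
  Over.homMk (inv b ≫ Q.map (OSimp.toPt 1).op) (by
    have h0 : Q.map (OSimp.toPt 1).op ≫ Q.map (OSimp.pt (n := 1) 0).op = 𝟙 _ := by
      have h1 : OSimp.pt (n := 1) 0 ≫ OSimp.toPt 1 = 𝟙 (OSimp.mk 0) := OSimp.hom_ext fun j ↦ by
        change Fin 1 at j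
        exact Subsingleton.elim (α := Fin 1) _ _
      rw [← Q.map_comp, ← op_comp, h1]
      exact Q.map_id _
    change (inv b ≫ Q.map (OSimp.toPt 1).op) ≫ Q.map (OSimp.pt (n := 1) 0).op ≫ b = 𝟙 Z
    rw [Category.assoc, reassoc_of% h0, IsIso.inv_hom_id])

lemma toUnit_oneHom (hQ : IsStrictlyMultiplicative Q) [IsIso b] {Y : Over Z} (x : Y ⟶ groupOver Q b) (i : Fin 2) :
    gpt (toUnit Y ≫ oneHom (b := b) hQ) = gpt x ≫ Q.map (OSimp.edge (n := 1) i i).op := by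
  have h1 : gpt x ≫ Q.map (OSimp.pt (n := 1) 0).op ≫ b = Y.hom := gpt_pt x
  have h2 : OSimp.edge (n := 1) i i = OSimp.toPt 1 ≫ OSimp.pt i := OSimp.hom_ext fun j ↦ by
    change Fin 2 at j
    fin_cases j <;> rfl
  change Y.hom ≫ inv b ≫ Q.map (OSimp.toPt 1).op = _
  rw [h2, op_comp, Q.map_comp, hQ.pt_eq i 0, ← h1, Category.assoc, Category.assoc, IsIso.hom_inv_id_assoc]

/-- The inverse of `Q_1`. -/
def invHom (hQ : IsStrictlyMultiplicative Q) (b : Q.obj (.op ⟨0⟩) ⟶ Z) : groupOver Q b ⟶ groupOver Q b :=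
  Over.homMk (Q.map (OSimp.edge (n := 1) 1 0).op) (by
    have h0 : Q.map (OSimp.edge (n := 1) 1 0).op ≫ Q.map (OSimp.pt (n := 1) 0).op = Q.map (OSimp.pt (n := 1) 1).op := by
      rw [← Q.map_comp]; rfl
    change Q.map (OSimp.edge (n := 1) 1 0).op ≫ Q.map (OSimp.pt (n := 1) 0).op ≫ b = Q.map (OSimp.pt (n := 1) 0).op ≫ b
    rw [reassoc_of% h0, hQ.strict])

lemma map_tri {n : ℕ} (f : OSimp.mk 2 ⟶ OSimp.mk n) (i k : Fin 3) :
    Q.map f.op ≫ Q.map (OSimp.edge (n := 2) i k).op = Q.map (OSimp.edge (f i) (f k)).op := by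
  rw [← Q.map_comp, ← op_comp]
  congr 2
  refine OSimp.hom_ext fun j ↦ ?_
  change Fin 2 at j
  fin_cases j <;> rfl

lemma map_edge_id : Q.map (OSimp.edge (n := 1) 0 1).op = 𝟙 _ := by
  rw [← Q.map_id]
  have : OSimp.edge (n := 1) 0 1 = 𝟙 _ := OSimp.hom_ext fun j ↦ by
    change Fin 2 at j
    fin_cases j <;> rfl
  rw [this]
  rfl

/-- The triangle of `[0, n]` with given vertices. -/
def _root_.RamGrp.OSimp.tri {n : ℕ} (i j k : Fin (n + 1)) : OSimp.mk 2 ⟶ OSimp.mk n := (![i, j, k] : Fin 3 → _)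

lemma tri_mul (hQ : IsStrictlyMultiplicative Q) [IsIso b] {n : ℕ} {Y : Over Z} {x y : Y ⟶ groupOver Q b}
    (p : Y.left ⟶ Q.obj (.op ⟨n⟩)) (i j k : Fin (n + 1))
    (h1 : p ≫ Q.map (OSimp.edge i j).op = gpt x) (h2 : p ≫ Q.map (OSimp.edge j k).op = gpt y) :
    gpt (lift x y ≫ mulHom (b := b) hQ) = p ≫ Q.map (OSimp.edge i k).op := by
  have e (a c : Fin 3) := map_tri (Q := Q) (OSimp.tri i j k) a c
  rw [lift_mulHom hQ (p := p ≫ Q.map (OSimp.tri i j k).op), Category.assoc, e]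
  · rfl
  · rw [Category.assoc, e]; exact h1
  · rw [Category.assoc, e]; exact h2

/-- The points `x`, `y`, `z` are the consecutive edges of a tetrahedron, whose edge from `0` to `3` is computed through `2` and through `1`. -/
lemma assoc (hQ : IsStrictlyMultiplicative Q) [IsIso b] {Y : Over Z} (x y z : Y ⟶ groupOver Q b) :
    lift (lift x y ≫ mulHom (b := b) hQ) z ≫ mulHom (b := b) hQ =
      lift x (lift y z ≫ mulHom (b := b) hQ) ≫ mulHom (b := b) hQ := by
  obtain ⟨p, hp1, hp2⟩ := hQ.exists_two x y
  have h1 : gpt x ≫ Q.map (OSimp.pt (n := 1) 0).op ≫ b = Y.hom := gpt_pt x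
  have h2 : gpt z ≫ Q.map (OSimp.pt (n := 1) 0).op ≫ b = Y.hom := gpt_pt z
  obtain ⟨q, hq1, hq2⟩ := hQ.isPullback_three.exists_lift p (gpt z) (by
    have h3 : Q.map (OSimp.edge (n := 2) 0 1).op ≫ Q.map (OSimp.pt (n := 1) 0).op = Q.map (OSimp.pt (n := 2) 0).op := by
      rw [← Q.map_comp]; rfl
    rw [← cancel_mono b, Category.assoc, Category.assoc, h2, ← h1, ← hp1, ← h3]
    simp only [Category.assoc])
  have e (a c : Fin 3) := map_tri (Q := Q) (OSimp.succ 2) a c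
  have q01 : q ≫ Q.map (OSimp.edge (n := 3) 0 1).op = gpt x := by
    rw [← hp1, ← hq1, Category.assoc, e]; rfl
  have q12 : q ≫ Q.map (OSimp.edge (n := 3) 1 2).op = gpt y := by
    rw [← hp2, ← hq1, Category.assoc, e]; rfl
  refine gpt_ext ?_
  rw [tri_mul hQ q 0 2 3 (tri_mul hQ q 0 1 2 q01 q12).symm hq2, tri_mul hQ q 0 1 3 q01 (tri_mul hQ q 1 2 3 q12 hq2).symm]

/-- The group structure on `Q_1`. -/
abbrev grpObj (hQ : IsStrictlyMultiplicative Q) (b : Q.obj (.op ⟨0⟩) ⟶ Z) [IsIso b] : GrpObj (groupOver Q b) :=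
  grpObjOfPoints hQ.oneHom hQ.mulHom (hQ.invHom b)
    (fun {Y} x ↦ gpt_ext (by
      rw [tri_mul hQ (gpt x) 0 0 1 (toUnit_oneHom hQ x 0).symm (by rw [map_edge_id]; exact Category.comp_id _), map_edge_id]
      exact Category.comp_id _))
    (fun {Y} x ↦ gpt_ext (by
      rw [tri_mul hQ (gpt x) 0 1 1 (by rw [map_edge_id]; exact Category.comp_id _) (toUnit_oneHom hQ x 1).symm, map_edge_id]
      exact Category.comp_id _))
    (assoc hQ)
    (fun {Y} x ↦ gpt_ext (by
      rw [tri_mul hQ (gpt x) 1 0 1 rfl (by rw [map_edge_id]; exact Category.comp_id _), toUnit_oneHom hQ x 1]))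
    (fun {Y} x ↦ gpt_ext (by
      rw [tri_mul hQ (gpt x) 0 1 0 (by rw [map_edge_id]; exact Category.comp_id _) rfl, toUnit_oneHom hQ x 0]))

lemma isAssociated (hQ : IsStrictlyMultiplicative Q) (b : Q.obj (.op ⟨0⟩) ⟶ Z) [hb : IsIso b] :
    letI := hQ.grpObj b
    IsAssociated Q b := by
  let _ := hQ.grpObj b
  refine ⟨hb, hQ, ?_, rfl, ?_⟩
  · change b ≫ inv b ≫ Q.map (OSimp.toPt 1).op = _
    rw [IsIso.hom_inv_id_assoc]
  · let Y : Over Z := Over.mk (Q.map (OSimp.edge (n := 2) 0 1).op ≫ (groupOver Q b).hom)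
    let x : Y ⟶ groupOver Q b := Over.homMk (Q.map (OSimp.edge (n := 2) 0 1).op)
    let y : Y ⟶ groupOver Q b := Over.homMk (Q.map (OSimp.edge (n := 2) 1 2).op) (hQ.comm b).symm
    have := tri_mul hQ (b := b) (x := x) (y := y) (𝟙 _) 0 1 2 (Category.id_comp _) (Category.id_comp _)
    exact this.trans (Category.id_comp _)

/-- A morphism of strictly multiplicative objects is a homomorphism of groups. -/
lemma isMonHom {P : OS Scheme.{u}} (hP : IsStrictlyMultiplicative P) (hQ : IsStrictlyMultiplicative Q) (φ : P ⟶ Q)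
    (b : Q.obj (.op ⟨0⟩) ⟶ Z) [IsIso b] [IsIso (φ.app (.op ⟨0⟩) ≫ b)] :
    letI := hP.grpObj (φ.app (.op ⟨0⟩) ≫ b)
    letI := hQ.grpObj b
    IsMonHom (groupHom φ b) := by
  let _ := hP.grpObj (φ.app (.op ⟨0⟩) ≫ b)
  let _ := hQ.grpObj b
  refine ⟨Over.OverMorphism.ext ?_, Over.OverMorphism.ext ?_⟩
  · change (inv (φ.app (.op ⟨0⟩) ≫ b) ≫ P.map (OSimp.toPt 1).op) ≫ φ.app _ = inv b ≫ Q.map (OSimp.toPt 1).op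
    rw [Category.assoc, φ.naturality, IsIso.inv_comp_eq]
    simp
  · let T := groupOver P (φ.app (.op ⟨0⟩) ≫ b)
    obtain ⟨p, h1, h2⟩ := hP.exists_two (fst T T) (snd T T)
    have e1 := hP.lift_mulHom h1 h2
    rw [lift_fst_snd, Category.id_comp] at e1
    have h3 : fst T T ≫ groupHom φ b = fst T T ≫ groupHom φ b := rfl
    have e2 := hQ.lift_mulHom (b := b) (x := fst T T ≫ groupHom φ b) (y := snd T T ≫ groupHom φ b) (p := p ≫ φ.app _)
      (by rw [Category.assoc, ← φ.naturality, reassoc_of% h1]; rfl)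
      (by rw [Category.assoc, ← φ.naturality, reassoc_of% h2]; rfl)
    have e3 : groupHom φ b ⊗ₘ groupHom φ b = lift (fst T T ≫ groupHom φ b) (snd T T ≫ groupHom φ b) := by
      ext <;> simp [T]
    change gpt hP.mulHom ≫ φ.app _ = gpt ((groupHom φ b ⊗ₘ groupHom φ b) ≫ hQ.mulHom)
    rw [e3]
    refine Eq.trans ?_ e2.symm
    rw [e1, Category.assoc, Category.assoc, φ.naturality]

end IsStrictlyMultiplicative

end Grp

/-! ### The vector bundle structure on the boundary -/

section Bundle

open MonoidalCategory CartesianMonoidalCategory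

variable {S : Scheme.{u}} {X : Over S} {ι : Type u} [Fintype ι] [DecidableEq ι]
  {D : ι → X.left.IdealSheafData} {m e b : ι → ℕ} {P Q : OS Scheme.{u}} {y : P ⟶ schPower X}
  {ξ : ∀ n, P.obj n ⟶ Spec (coordRing ι)} {j : Q ⟶ P}

lemma eq_of_forall_open {K : Scheme.{u}} {a a' : Γ(K, ⊤)}
    (h : ∀ k : K, ∃ (O : K.Opens) (_ : k ∈ O), O.ι.appTop a = O.ι.appTop a') : a = a' := by
  refine eq_of_forall_rs fun k ↦ ?_
  obtain ⟨O, hk, hO⟩ := h k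
  refine ⟨O.ι ''ᵁ ⊤, ⟨⟨k, hk⟩, trivial, rfl⟩, ?_⟩
  exact hO

variable (m e y ξ j) in
/-- The point `x'` of the vector bundle is the multiple of `x` by the function `a`, in all the coordinate systems. -/
structure IsSmul {K : Scheme.{u}} (a : Γ(K, ⊤)) (x x' : K ⟶ Q.obj (.op ⟨1⟩)) : Prop where
  base : x' ≫ Q.map (OSimp.pt 0).op = x ≫ Q.map (OSimp.pt 0).op
  coord : ∀ (c : Chart D) (p : Param m y ξ c) (M : p.Model e) (K' : Scheme.{u}) (f : K' ⟶ K) (v v' : c.L → Γ(K', ⊤)),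
    M.IsCoord j (f ≫ x) v → M.IsCoord j (f ≫ x') v' → ∀ i, v' i = f.appTop a * v i

variable {K K' : Scheme.{u}} {a : Γ(K, ⊤)} {x x' x'' : K ⟶ Q.obj (.op ⟨1⟩)}

lemma exists_local_model (h : IsUniv D m e y ξ) (hc : ∀ x : X.left, ∃ c : Chart D, x ∈ Set.range c.j)
    (z : K ⟶ Q.obj (.op ⟨0⟩)) (k : K) :
    ∃ (c : Chart D) (p : Param m y ξ c) (_ : p.Model e) (O : K.Opens) (_ : k ∈ O) (t : O.toScheme ⟶ p.B),
      t ≫ p.i0 = (O.ι ≫ z) ≫ j.app (.op ⟨0⟩) := by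
  obtain ⟨c, hk⟩ := hc ((y.app (.op ⟨0⟩) ≫ pr X 0 0) ((z ≫ j.app (.op ⟨0⟩)) k))
  obtain ⟨p, hp⟩ := exists_param h c _ hk
  obtain ⟨M⟩ := p.exists_model (e := e) h
  let O : K.Opens := (z ≫ j.app (.op ⟨0⟩)) ⁻¹ᵁ p.i0.opensRange
  have hO : Set.range ((O.ι ≫ z) ≫ j.app (.op ⟨0⟩)) ⊆ Set.range p.i0 := by
    rintro _ ⟨s, rfl⟩
    exact s.2
  exact ⟨c, p, M, O, hp, IsOpenImmersion.lift p.i0 _ hO, IsOpenImmersion.lift_fac _ _ _⟩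

namespace IsSmul

lemma comp (hx : IsSmul (D := D) m e y ξ j a x x') (f : K' ⟶ K) :
    IsSmul (D := D) m e y ξ j (f.appTop a) (f ≫ x) (f ≫ x') where
  base := by rw [Category.assoc, hx.base, Category.assoc]
  coord c p M K'' g v v' hv hv' i := by
    rw [← Category.assoc] at hv hv'
    rw [hx.coord c p M K'' _ v v' hv hv', Scheme.Hom.comp_appTop]
    rfl

lemma unique (hQ : IsBoundary b ξ j) (h : IsUniv D m e y ξ) (hb : b ≤ e)
    (hc : ∀ x : X.left, ∃ c : Chart D, x ∈ Set.range c.j) (hx : IsSmul (D := D) m e y ξ j a x x')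
    (hx' : IsSmul (D := D) m e y ξ j a x x'') : x' = x'' := by
  refine ext_of_open _ _ fun k ↦ ?_
  obtain ⟨c, p, M, O, hk, t, ht⟩ := exists_local_model (j := j) h hc (x ≫ Q.map (OSimp.pt 0).op) k
  refine ⟨O, O.ι, inferInstance, ⟨⟨k, hk⟩, rfl⟩, ?_⟩
  obtain ⟨v, hv⟩ := Param.Model.exists_isCoord (x := O.ι ≫ x) hQ h hb M t (by simpa only [Category.assoc] using ht)
  obtain ⟨v', hv'⟩ := Param.Model.exists_isCoord (x := O.ι ≫ x') hQ h hb M t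
    (by rw [Category.assoc _ x', hx.base]; simpa only [Category.assoc] using ht)
  obtain ⟨v'', hv''⟩ := Param.Model.exists_isCoord (x := O.ι ≫ x'') hQ h hb M t
    (by rw [Category.assoc _ x'', hx'.base]; simpa only [Category.assoc] using ht)
  have : v' = v'' := funext fun i ↦ by
    rw [hx.coord c p M O O.ι v v' hv hv' i, hx'.coord c p M O O.ι v v'' hv hv'' i]
  subst this
  exact hv'.ext hQ h hb hv'' (by rw [Category.assoc, Category.assoc, hx.base, hx'.base])

lemma of_cover (h : ∀ k : K, ∃ (O : K.Opens) (_ : k ∈ O), IsSmul (D := D) m e y ξ j (O.ι.appTop a) (O.ι ≫ x) (O.ι ≫ x')) :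
    IsSmul (D := D) m e y ξ j a x x' where
  base := ext_of_open _ _ fun k ↦ by
    obtain ⟨O, hk, hO⟩ := h k
    exact ⟨O, O.ι, inferInstance, ⟨⟨k, hk⟩, rfl⟩, by simpa only [Category.assoc] using hO.base⟩
  coord c p M K' f v v' hv hv' i := by
    refine eq_of_forall_open fun k ↦ ?_
    obtain ⟨O, hk, hO⟩ := h (f k)
    refine ⟨f ⁻¹ᵁ O, hk, ?_⟩
    have e1 : (f ∣_ O) ≫ O.ι = (f ⁻¹ᵁ O).ι ≫ f := morphismRestrict_ι _ _
    have h1 := hv.comp (f ⁻¹ᵁ O).ι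
    have h2 := hv'.comp (f ⁻¹ᵁ O).ι
    rw [← reassoc_of% e1] at h1 h2
    have h3 := hO.coord c p M _ _ _ _ h1 h2 i
    have e2 := congr(($e1).appTop a)
    rw [Scheme.Hom.comp_appTop, Scheme.Hom.comp_appTop] at e2
    rw [map_mul]
    exact h3.trans (congrArg (· * _) e2)

/-- It suffices to check a scalar multiplication in one system of coordinates, since the changes of coordinates are linear. -/
lemma of_coord (hQ : IsBoundary b ξ j) (h : IsUniv D m e y ξ) (hb : b ≤ e) {c : Chart D} {p : Param m y ξ c}
    (M : p.Model e) {v : c.L → Γ(K, ⊤)} (hv : M.IsCoord j x v) (hv' : M.IsCoord j x' (fun i ↦ a * v i))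
    (hx : x' ≫ Q.map (OSimp.pt 0).op = x ≫ Q.map (OSimp.pt 0).op) : IsSmul (D := D) m e y ξ j a x x' where
  base := hx
  coord c' p' M' K' f u u' hu hu' i := by
    refine eq_of_forall_open fun k ↦ ?_
    have hv1 := hv.comp f
    have hv1' := hv'.comp f
    obtain ⟨l, hl, -⟩ := id hv1
    obtain ⟨l', hl', -⟩ := id hu
    obtain ⟨W, hk, w, hw⟩ := Param.Model.IsCoord.exists_transition hQ h hb M M' ((f ≫ x) ≫ Q.map (OSimp.pt 0).op)
      (Param.Model.IsCoord.base hQ h hb hl).1 (Param.Model.IsCoord.base hQ h hb hl').1 k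
    refine ⟨W, hk, ?_⟩
    have h1 := hw (𝟙 _) (W.ι ≫ f ≫ x) (by simp only [Category.assoc, Category.id_comp]) _ _ (hv1.comp W.ι) (hu.comp W.ι) i
    have h2 := hw (𝟙 _) (W.ι ≫ f ≫ x') (by simp only [Category.assoc, Category.id_comp, hx]) _ _ (hv1'.comp W.ι)
      (hu'.comp W.ι) i
    rw [map_mul, h1, h2, Finset.mul_sum]
    refine Finset.sum_congr rfl fun l _ ↦ ?_
    rw [map_mul, map_mul]
    ring

lemma exists_smul (hQ : IsBoundary b ξ j) (h : IsUniv D m e y ξ) (hb : b ≤ e)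
    (hc : ∀ x : X.left, ∃ c : Chart D, x ∈ Set.range c.j) (a : Γ(K, ⊤)) (x : K ⟶ Q.obj (.op ⟨1⟩)) :
    ∃ x', IsSmul (D := D) m e y ξ j a x x' := by
  have hex (k : K) : ∃ (O : K.Opens) (_ : k ∈ O) (x' : O.toScheme ⟶ Q.obj (.op ⟨1⟩)),
      IsSmul (D := D) m e y ξ j (O.ι.appTop a) (O.ι ≫ x) x' := by
    obtain ⟨c, p, M, O, hk, t, ht⟩ := exists_local_model (j := j) h hc (x ≫ Q.map (OSimp.pt 0).op) k
    obtain ⟨v, hv⟩ := Param.Model.exists_isCoord (x := O.ι ≫ x) hQ h hb M t (by simpa only [Category.assoc] using ht)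
    obtain ⟨x', hx', hx0⟩ := Param.Model.exists_of_coord hQ h hb M t _ ht (fun i ↦ O.ι.appTop a * v i)
    exact ⟨O, hk, x', of_coord hQ h hb M hv hx' (by rw [hx0, Category.assoc])⟩
  choose O hO x' hx' using hex
  obtain ⟨x₁, hx₁⟩ := exists_glue (fun k ↦ (O k).toScheme) (fun k ↦ (O k).ι) (fun k ↦ ⟨k, ⟨k, hO k⟩, rfl⟩) x'
    fun k k' s s' hs ↦ by
      have e1 : pullback.fst (O k).ι (O k').ι ≫ (O k).ι = pullback.snd (O k).ι (O k').ι ≫ (O k').ι := pullback.condition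
      refine ⟨pullback (O k).ι (O k').ι, pullback.fst _ _, pullback.snd _ _, inferInstance, ?_, e1, ?_⟩
      · rw [IsOpenImmersion.range_pullbackFst]
        exact ⟨s', hs.symm⟩
      · have h1 := (hx' k).comp (pullback.fst (O k).ι (O k').ι)
        have h2 := (hx' k').comp (pullback.snd (O k).ι (O k').ι)
        rw [← reassoc_of% e1] at h2
        have e2 := congr(($e1).appTop a)
        rw [Scheme.Hom.comp_appTop, Scheme.Hom.comp_appTop] at e2
        refine h1.unique hQ h hb hc ?_
        have e3 : (pullback.fst (O k).ι (O k').ι).appTop ((O k).ι.appTop a) =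
          (pullback.snd (O k).ι (O k').ι).appTop ((O k').ι.appTop a) := e2
        rw [e3]
        exact h2
  exact ⟨x₁, of_cover fun k ↦ ⟨O k, hO k, by rw [hx₁ k]; exact hx' k⟩⟩

end IsSmul

/-- The boundary `Q_1` is the additive group of a vector bundle over `Q_0`: multiplication by functions is defined in coordinates, and does not
depend on them since the transition maps are linear. -/
theorem isVectorBundle (hQ : IsBoundary b ξ j) (h : IsUniv D m e y ξ) (hb : b ≤ e)
    (hc : ∀ x : X.left, ∃ c : Chart D, x ∈ Set.range c.j) (hS : IsStrictlyMultiplicative Q) {Z : Scheme.{u}}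
    (β : Q.obj (.op ⟨0⟩) ⟶ Z) [IsIso β] : letI := hS.grpObj β; IsVectorBundle (groupOver Q β) := by
  let _ := hS.grpObj β
  have gb {Y : Over Z} (x : Y ⟶ groupOver Q β) : gpt x ≫ Q.map (OSimp.pt 0).op = Y.hom ≫ inv β := by
    rw [← cancel_mono β, Category.assoc, gpt_pt, Category.assoc, IsIso.inv_hom_id, Category.comp_id]
  choose sm hsm using fun (K : Scheme.{u}) (a : Γ(K, ⊤)) (x : K ⟶ Q.obj (.op ⟨1⟩)) ↦ IsSmul.exists_smul hQ h hb hc a x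
  let mk {Y : Over Z} (f : Y.left ⟶ Q.obj (.op ⟨1⟩)) (hf : f ≫ Q.map (OSimp.pt 0).op = Y.hom ≫ inv β) :
      Y ⟶ groupOver Q β := Over.homMk f (by
    change f ≫ Q.map (OSimp.pt 0).op ≫ β = _
    rw [reassoc_of% hf, IsIso.inv_hom_id, Category.comp_id])
  have hmk {Y : Over Z} (f : Y.left ⟶ Q.obj (.op ⟨1⟩)) (hf) : gpt (mk f hf) = f := rfl
  refine ⟨fun Y a x ↦ mk (sm Y.left a (gpt x)) ((hsm Y.left a (gpt x)).base.trans (gb x)), fun Y Y' g a x ↦ gpt_ext ?_, fun z ↦ ?_⟩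
  · exact ((hsm Y.left a (gpt x)).comp g.left).unique hQ h hb hc (hsm Y'.left _ _)
  · obtain ⟨c, hk⟩ := hc ((y.app (.op ⟨0⟩) ≫ pr X 0 0) ((inv β ≫ j.app (.op ⟨0⟩)) z))
    obtain ⟨p, hp⟩ := exists_param h c _ hk
    obtain ⟨M⟩ := p.exists_model (e := e) h
    have : Fintype c.L := inferInstance
    let U : Z.Opens := (inv β ≫ j.app (.op ⟨0⟩)) ⁻¹ᵁ p.i0.opensRange
    let t (Y : Over Z) (hY : Set.range Y.hom ⊆ U) : Y.left ⟶ p.B :=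
      IsOpenImmersion.lift p.i0 (Y.hom ≫ inv β ≫ j.app (.op ⟨0⟩)) (by
        rintro _ ⟨s, rfl⟩
        exact hY ⟨s, rfl⟩)
    have ht (Y : Over Z) (hY : Set.range Y.hom ⊆ U) : t Y hY ≫ p.i0 = (Y.hom ≫ inv β) ≫ j.app (.op ⟨0⟩) := by
      rw [Category.assoc]
      exact IsOpenImmersion.lift_fac _ _ _
    have hex (Y : Over Z) (hY : Set.range Y.hom ⊆ U) (x : Y ⟶ groupOver Q β) : ∃ v, M.IsCoord j (gpt x) v :=
      Param.Model.exists_isCoord hQ h hb M (t Y hY) (by rw [gb, ht Y hY])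
    choose co hco using hex
    let ε := Fintype.equivFin c.L
    let E (Y : Over Z) (hY : Set.range Y.hom ⊆ U) : (Y ⟶ groupOver Q β) ≃ (Fin (Fintype.card c.L) → Γ(Y.left, ⊤)) :=
      Equiv.ofBijective (fun x i ↦ co Y hY x (ε.symm i)) ⟨fun x x' hx ↦ gpt_ext ((hco Y hY x).ext hQ h hb
        (by
          have : co Y hY x = co Y hY x' := funext fun i ↦ by simpa using congrFun hx (ε i)
          rw [this]
          exact hco Y hY x') (by rw [gb, gb])), fun v ↦ by
        obtain ⟨x, hx, hx0⟩ := Param.Model.exists_of_coord hQ h hb M (t Y hY) (Y.hom ≫ inv β) (ht Y hY) (fun i ↦ v (ε i))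
        refine ⟨mk x hx0, funext fun i ↦ ?_⟩
        have := (hco Y hY (mk x hx0)).unique hx
        change co Y hY (mk x hx0) (ε.symm i) = _
        rw [this]
        exact congrArg v (Equiv.apply_symm_apply _ _)⟩
    have hE (Y) (hY) (x) (i) : E Y hY x i = co Y hY x (ε.symm i) := rfl
    refine ⟨U, hp, Fintype.card c.L, E, fun Y Y' hY hY' g x i ↦ ?_, fun Y hY x x' ↦ funext fun i ↦ ?_, fun Y hY a x i ↦ ?_⟩
    · have := (hco Y' hY' (g ≫ x)).unique ((hco Y hY x).comp g.left)
      rw [hE, this, hE]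
    · obtain ⟨q, h1, h2⟩ := hS.exists_two x x'
      have h3 : gpt (lift x x' ≫ MonObj.mul) = q ≫ Q.map (OSimp.edge (n := 2) 0 2).op := hS.lift_mulHom h1 h2
      have h4 := Param.Model.IsCoord.add hQ h hb q (M := M) (v := co Y hY x) (v' := co Y hY x')
        (by rw [h1]; exact hco Y hY x) (by rw [h2]; exact hco Y hY x')
      rw [← h3] at h4
      have := (hco Y hY _).unique h4
      rw [hE, this]
      rfl
    · have := (hsm Y.left a (gpt x)).coord c p M Y.left (𝟙 _) (co Y hY x) _ (by rw [Category.id_comp]; exact hco Y hY x)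
        (by rw [Category.id_comp]; exact hco Y hY (mk (sm Y.left a (gpt x)) ((hsm Y.left a (gpt x)).base.trans (gb x)))) (ε.symm i)
      rw [hE, this, hE]
      simp

end Bundle

/-! ### The boundary `T^{(R, M)}` -/

lemma IsSNC.isLP {X : Scheme.{u}} {ι : Type*} {D : ι → X.IdealSheafData} (h : IsSNC D) : IsLP D := fun x ↦ by
  obtain ⟨U, hx, t, ht, -⟩ := h.transversal x
  exact ⟨U, hx, fun i ↦ ⟨t i, ht i⟩⟩

/-- The exponent of the monomial defining the boundary. -/
def bexpo {ι : Type*} (r : ι → ℚ) : ι → ℕ := fun i ↦ if 1 < r i then 1 else 0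

lemma bexpo_le_expo {ι : Type u} [Fintype ι] {m : ι → ℕ} {r : ι → ℚ} (hm : ∀ i, 1 ≤ m i) (hmr : ∀ i, ∃ a : ℤ, m i * r i = a) :
    bexpo r ≤ expo m r := fun i ↦ by
  unfold bexpo expo
  split_ifs with h
  · obtain ⟨a, ha⟩ := hmr i
    refine Nat.le_floor ?_
    have h1 : (0 : ℚ) < m i * (r i - 1) := mul_pos (by exact_mod_cast hm i) (by linarith)
    rw [mul_sub, ha, mul_one] at h1 ⊢
    have h2 : 0 < a - m i := by exact_mod_cast h1
    have h3 : 1 ≤ a - m i := h2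
    exact_mod_cast h3
  · exact Nat.zero_le _

section TRM

variable {S : Scheme.{u}} {X : Over S} {ι : Type u} [Fintype ι] [DecidableEq ι]
  {D : ι → X.left.IdealSheafData} (hD : ∀ i, IsFG (D i)) (m : ι → ℕ) (r : ι → ℚ)

lemma mono_TRMι (n : OSimpᵒᵖ) : Mono ((TRMι X D hD m r).app n) :=
  inferInstanceAs (Mono (pullback.fst ((PRMCoord X D hD m r).app n) (boundaryIdeal r).subschemeι))

lemma isBoundary_TRM : IsBoundary (bexpo r) (fun n ↦ (PRMCoord X D hD m r).app n) (TRMι X D hD m r) where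
  mono n := mono_TRMι hD m r _
  mon_eq_zero n := by
    have h0 : mon (boundaryIdeal r).subschemeι (bexpo r) = 0 := by
      have := mon_subschemeι (𝟙 (Spec (coordRing ι))) (bexpo r)
      rwa [Scheme.IdealSheafData.comap_id, Category.comp_id] at this
    let s : (TRM X D hD m r).obj (.op ⟨n⟩) ⟶ (boundaryIdeal r).subscheme := pullback.snd _ _
    have h1 : (TRMι X D hD m r).app (.op ⟨n⟩) ≫ (PRMCoord X D hD m r).app (.op ⟨n⟩) =
        s ≫ (boundaryIdeal r).subschemeι := pullback.condition
    rw [h1, mon_comp, h0, map_zero]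
  exists_lift {n K} κ h := by
    have h1 : (boundaryIdeal r).subschemeι.ker ≤ (κ ≫ (PRMCoord X D hD m r).app (.op ⟨n⟩)).ker := by
      have := monoIdeal_comap_le_ker (κ ≫ (PRMCoord X D hD m r).app (.op ⟨n⟩)) (𝟙 _) (bexpo r)
        (by rw [Category.comp_id]; exact h)
      rw [Scheme.IdealSheafData.comap_id] at this
      rw [Scheme.IdealSheafData.ker_subschemeι]
      exact this
    exact ⟨pullback.lift κ (IsClosedImmersion.lift _ _ h1) (IsClosedImmersion.lift_fac _ _ h1).symm, pullback.lift_fst _ _ _⟩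

lemma isIso_TRMToZM [IsSeparated X.hom] (hLP : IsLP D) (hm : ∀ i, 1 ≤ m i) : IsIso (TRMToZM X D hD m r) := by
  have := isIso_PRMProj_zero hD r hLP hm
  rw [TRMToZM]
  exact pullback.map_isIso _ _ _ _ _ _ _ _ _

variable [Smooth X.hom] [IsSeparated X.hom]

lemma isMultiplicative_PRM (hLP : IsLP D) (hm : ∀ i, 1 ≤ m i) (hc : ∀ x : X.left, ∃ c : Chart D, x ∈ Set.range c.j) :
    IsMultiplicative (PRM X D hD m r) :=
  (isUniv_PRM hD r hLP hm).isMultiplicative (smooth_pt_zero (isUniv_PRM hD r hLP hm) hm hc)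

lemma isStrictlyMultiplicative_TRM (hLP : IsLP D) (hm : ∀ i, 1 ≤ m i) (hc : ∀ x : X.left, ∃ c : Chart D, x ∈ Set.range c.j)
    (hmr : ∀ i, ∃ a : ℤ, m i * r i = a) : IsStrictlyMultiplicative (TRM X D hD m r) :=
  (isBoundary_TRM hD m r).isStrictlyMultiplicative (isUniv_PRM hD r hLP hm) (bexpo_le_expo hm hmr)
    (isMultiplicative_PRM hD m r hLP hm hc)

lemma smooth_TRMGroup (hLP : IsLP D) (hm : ∀ i, 1 ≤ m i) (hc : ∀ x : X.left, ∃ c : Chart D, x ∈ Set.range c.j) :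
    Smooth (TRMGroup X D hD m r).hom := by
  have := isIso_TRMToZM hD m r hLP hm
  have h1 : Smooth ((TRM X D hD m r).map (OSimp.pt (n := 1) 0).op) :=
    MorphismProperty.of_isPullback ((isBoundary_TRM hD m r).isPullback (isUniv_PRM hD r hLP hm) (OSimp.pt (n := 1) 0)).flip
      (smooth_pt_zero (isUniv_PRM hD r hLP hm) hm hc)
  change Smooth ((TRM X D hD m r).map (OSimp.pt (n := 1) 0).op ≫ TRMToZM X D hD m r)
  infer_instance

end TRM

/-! ### Descent of the étale locus for algebras -/

section Descent

open TensorProduct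

/-- Flatness over `A` descends along the faithfully flat extension `C → L`. -/
lemma flat_of_comp (A C L : Type*) [CommRing A] [CommRing C] [CommRing L] [Algebra A C] [Algebra C L] [Algebra A L]
    [IsScalarTower A C L] [Module.FaithfullyFlat C L] [Module.Flat A L] : Module.Flat A C := by
  refine Module.Flat.iff_lTensor_preserves_injective_linearMap.mpr fun N N' _ _ _ _ f hf ↦ ?_
  have h1 := Module.Flat.lTensor_preserves_injective_linearMap (M := L) f hf
  let e1 := AlgebraTensorModule.cancelBaseChange A C L L N
  let e2 := AlgebraTensorModule.cancelBaseChange A C L L N'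
  have hc (x) : e2 ((f.baseChange C).lTensor L x) = f.lTensor L (e1 x) := by
    induction x with
    | zero => simp
    | add x y hx hy => simp only [map_add, hx, hy]
    | tmul l y =>
      induction y with
      | zero => simp
      | add x y hx hy => simp only [map_add, tmul_add, hx, hy]
      | tmul c n => simp [e1, e2]
  have h2 : Function.Injective ((f.baseChange C).lTensor L) := fun x y hxy ↦
    e1.injective (h1 (by rw [← hc, ← hc, hxy]))
  exact (Module.FaithfullyFlat.lTensor_injective_iff_injective C L _).mp h2

lemma subsingleton_of_faithfullyFlat (R L' C L M : Type*) [CommRing R] [CommRing L'] [CommRing C] [CommRing L] [Algebra R L']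
    [Algebra R C] [Algebra C L] [Algebra L' L] [Algebra R L] [IsScalarTower R C L] [IsScalarTower R L' L]
    [Module.FaithfullyFlat C L] [AddCommGroup M] [Module R M] [Subsingleton (L' ⊗[R] M)] : Subsingleton (C ⊗[R] M) := by
  refine (Module.FaithfullyFlat.subsingleton_tensorProduct_iff_right C L).mp ?_
  have h1 : Subsingleton (L ⊗[L'] (L' ⊗[R] M)) := inferInstance
  have h2 : Subsingleton (L ⊗[R] M) := (AlgebraTensorModule.cancelBaseChange R L' L L M).symm.toEquiv.subsingleton
  exact (AlgebraTensorModule.cancelBaseChange R C L L M).toEquiv.subsingleton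

/-- Étaleness descends along flat morphisms to the source. -/
lemma exists_etale_away {A R L' : Type u} [CommRing A] [CommRing R] [CommRing L'] [Algebra A R] [Algebra R L'] [Algebra A L']
    [IsScalarTower A R L'] [IsNoetherianRing A] [Algebra.FiniteType A R] [Module.Flat R L'] [Algebra.FinitePresentation R L']
    [Module.Flat A L'] [Subsingleton (L' ⊗[R] Ω[R⁄A])] (p : PrimeSpectrum L') :
    ∃ g : R, g ∉ (p.comap (algebraMap R L')).asIdeal ∧ Algebra.Etale A (Localization.Away g) ∧
      ∀ (M : Type u) [AddCommGroup M] [Module R M] [Subsingleton (L' ⊗[R] M)], Subsingleton (Localization.Away g ⊗[R] M) := by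
  have ho : IsOpenMap (PrimeSpectrum.comap (algebraMap R L')) := PrimeSpectrum.isOpenMap_comap_of_hasGoingDown_of_finitePresentation
  obtain ⟨_, ⟨_, ⟨g, rfl⟩, rfl⟩, hpg, hg⟩ := PrimeSpectrum.isBasis_basic_opens.exists_subset_of_mem_open
    (show p.comap (algebraMap R L') ∈ Set.range (PrimeSpectrum.comap (algebraMap R L')) from ⟨p, rfl⟩) ho.isOpen_range
  let C := Localization.Away g
  let L := Localization.Away (algebraMap R L' g)
  have hu : IsUnit (algebraMap R L g) := IsLocalization.Away.algebraMap_isUnit (S := L) (algebraMap R L' g)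
  let φ : C →+* L := IsLocalization.Away.lift g hu
  let _ : Algebra C L := φ.toAlgebra
  have : IsScalarTower R C L := .of_algebraMap_eq' (IsLocalization.Away.lift_comp g hu).symm
  have : IsScalarTower A R L := .of_algebraMap_eq fun a ↦ by
    rw [IsScalarTower.algebraMap_apply R L' L, ← IsScalarTower.algebraMap_apply A R L', IsScalarTower.algebraMap_apply A L' L]
  have : IsScalarTower A C L := .of_algebraMap_eq fun a ↦ by
    rw [IsScalarTower.algebraMap_apply A R C, ← IsScalarTower.algebraMap_apply R C L, ← IsScalarTower.algebraMap_apply A R L]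
  have : Module.Flat L' L := IsLocalization.flat L (.powers (algebraMap R L' g))
  have : Module.Flat R L := .trans R L' L
  have : Module.Flat A L := .trans A L' L
  have : Module.Flat C L := (Module.flat_iff_of_isLocalization C (.powers g) L).mpr inferInstance
  have : Module.FaithfullyFlat C L := .of_comap_surjective fun q ↦ by
    have hq : q.comap (algebraMap R C) ∈ PrimeSpectrum.basicOpen g := by
      rw [← SetLike.mem_coe, ← PrimeSpectrum.localization_away_comap_range C g]
      exact ⟨q, rfl⟩
    obtain ⟨p', hp'⟩ := hg hq
    have hp1 : p' ∈ Set.range (PrimeSpectrum.comap (algebraMap L' L)) := by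
      rw [PrimeSpectrum.localization_away_comap_range L (algebraMap R L' g)]
      change _ ∉ _
      have : g ∉ (q.comap (algebraMap R C)).asIdeal := hq
      rw [← hp'] at this
      exact this
    obtain ⟨p'', rfl⟩ := hp1
    refine ⟨p'', PrimeSpectrum.localization_comap_injective C (.powers g) ?_⟩
    rw [← hp', ← PrimeSpectrum.comap_comp_apply, ← PrimeSpectrum.comap_comp_apply, ← IsScalarTower.algebraMap_eq,
      ← IsScalarTower.algebraMap_eq]
  have : Module.Flat A C := flat_of_comp A C L
  have key (M : Type u) [AddCommGroup M] [Module R M] [Subsingleton (L' ⊗[R] M)] : Subsingleton (C ⊗[R] M) :=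
    subsingleton_of_faithfullyFlat R L' C L M
  refine ⟨g, hpg, ?_, fun M _ _ _ ↦ key M⟩
  have h1 : Algebra.FinitePresentation A R := Algebra.FinitePresentation.of_finiteType.mp inferInstance
  have : Algebra.FinitePresentation R C := IsLocalization.Away.finitePresentation g
  have : Algebra.FinitePresentation A C := .trans A R C
  have : Algebra.FormallyEtale R C := .of_isLocalization (.powers g)
  have : Algebra.FormallyUnramified A C := by
    rw [Algebra.formallyUnramified_iff]
    have := key (Ω[R⁄A])
    exact (KaehlerDifferential.tensorKaehlerEquivOfFormallyEtale A R C).symm.toEquiv.subsingleton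
  exact Algebra.Etale.of_formallyUnramified_of_flat

lemma exists_subalgebra_fg {A B A₁ : Type u} [CommRing A] [CommRing B] [CommRing A₁] [Algebra A B] [Algebra A A₁]
    (T : Finset (A₁ ⊗[A] B)) : ∃ C : Subalgebra A B, C.FG ∧ ∀ x ∈ T, x ∈ C.baseChange A₁ := by
  classical
  choose C hC hx using fun x : A₁ ⊗[A] B ↦ exists_fg_and_mem_baseChange x
  refine ⟨T.sup C, ?_, fun x h ↦ ?_⟩
  · induction T using Finset.induction with
    | empty => rw [Finset.sup_empty]; exact Subalgebra.fg_bot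
    | insert a s _ ih => rw [Finset.sup_insert]; exact (hC a).sup ih
  · 
    obtain ⟨y, hy⟩ := hx x
    have h1 : C x ≤ T.sup C := Finset.le_sup h
    refine ⟨Algebra.TensorProduct.map (.id A₁ A₁) (Subalgebra.inclusion h1) y, Eq.trans ?_ hy⟩
    change (((Algebra.TensorProduct.map (.id A₁ A₁) (T.sup C).val).comp (Algebra.TensorProduct.map (.id A₁ A₁) (Subalgebra.inclusion h1))) y) = _
    rw [← Algebra.TensorProduct.map_comp]
    rfl

/-- An algebra which is of finite type after base change and localization is defined over a finitely generated
subalgebra. -/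
lemma exists_subalgebra_etale {A B A₁ : Type u} [CommRing A] [CommRing B] [CommRing A₁] [Algebra A B] [Algebra A A₁]
    [Module.Flat A A₁] (h : A₁ ⊗[A] B) [Algebra.Etale A₁ (Localization.Away h)] :
    ∃ (A' : Subalgebra A B) (_ : A'.FG) (h' : A₁ ⊗[A] A'), Algebra.TensorProduct.map (.id A₁ A₁) A'.val h' = h ∧
      Algebra.Etale A₁ (Localization.Away h') ∧ ∀ b : B, ∃ (y : A₁ ⊗[A] A') (n : ℕ),
        (1 ⊗ₜ[A] b) * h ^ n = Algebra.TensorProduct.map (.id A₁ A₁) A'.val y := by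
  classical
  let Eh := Localization.Away h
  obtain ⟨s, hs⟩ := (inferInstance : Algebra.FiniteType A₁ Eh).out
  choose n e he using fun x : Eh ↦ IsLocalization.Away.surj h x
  obtain ⟨A', hA', hT⟩ := exists_subalgebra_fg (insert h (s.image e))
  let E' := A₁ ⊗[A] A'
  let φ : E' →ₐ[A₁] A₁ ⊗[A] B := Algebra.TensorProduct.map (.id A₁ A₁) A'.val
  have hφ : Function.Injective φ := Module.Flat.lTensor_preserves_injective_linearMap A'.val.toLinearMap Subtype.val_injective
  have hφr (x) (hx : x ∈ A'.baseChange A₁) : ∃ y, φ y = x := hx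
  obtain ⟨h', hh'⟩ := hφr h (hT h (Finset.mem_insert_self _ _))
  let L' := Localization.Away h'
  have hmap : (Submonoid.powers h').map φ.toRingHom = Submonoid.powers h := by
    rw [Submonoid.map_powers]
    exact congrArg _ hh'
  have hle : Submonoid.powers h' ≤ (Submonoid.powers h).comap φ.toRingHom := Submonoid.map_le_iff_le_comap.mp hmap.le
  let ψ : L' →+* Eh := IsLocalization.map Eh φ.toRingHom hle
  have hψ (x : E') : ψ (algebraMap E' L' x) = algebraMap _ Eh (φ x) := IsLocalization.map_eq hle x
  let ψ' : L' →ₐ[A₁] Eh := { ψ with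
    commutes' := fun a ↦ by
      have h1 : algebraMap A₁ L' a = algebraMap E' L' (algebraMap A₁ E' a) := IsScalarTower.algebraMap_apply ..
      have h2 : algebraMap A₁ Eh a = algebraMap _ Eh (algebraMap A₁ (A₁ ⊗[A] B) a) := IsScalarTower.algebraMap_apply ..
      change ψ _ = _
      rw [h1, hψ, h2, φ.commutes] }
  have hψi : Function.Injective ψ' := by
    have h3 : IsLocalization ((Submonoid.powers h').map φ.toRingHom) Eh := by rw [hmap]; infer_instance
    exact IsLocalization.map_injective_of_injective (M := .powers h') (S := L') (g := φ.toRingHom) Eh hφ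
  have hψs : Function.Surjective ψ' := by
    rw [← AlgHom.range_eq_top, ← top_le_iff, ← hs, Algebra.adjoin_le_iff]
    intro x hx
    obtain ⟨y, hy⟩ := hφr (e x) (hT _ (Finset.mem_insert_of_mem (Finset.mem_image_of_mem _ hx)))
    have hu : IsUnit (algebraMap E' L' h') := IsLocalization.Away.algebraMap_isUnit h'
    obtain ⟨u, hu⟩ := hu
    refine ⟨algebraMap E' L' y * (↑u⁻¹ : L') ^ n x, ?_⟩
    have h4 : ψ (algebraMap E' L' h') = algebraMap _ Eh h := by rw [hψ, hh']
    have hu' : IsUnit (algebraMap _ Eh h ^ n x) := (IsLocalization.Away.algebraMap_isUnit h).pow _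
    refine hu'.mul_right_cancel ?_
    rw [he x]
    change ψ _ * _ = _
    rw [map_mul, hψ, hy, mul_assoc, ← h4, ← map_pow, ← map_mul, ← mul_pow, ← hu, Units.inv_mul, one_pow, map_one, mul_one]
  refine ⟨A', hA', h', hh', .of_equiv (AlgEquiv.ofBijective ψ' ⟨hψi, hψs⟩).symm, fun b ↦ ?_⟩
  obtain ⟨l, hl⟩ := hψs (algebraMap (A₁ ⊗[A] B) Eh ((1 : A₁) ⊗ₜ[A] b))
  obtain ⟨k, y, hy⟩ := IsLocalization.Away.surj h' l
  have h5 := congrArg ψ hy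
  rw [map_mul, map_pow, hψ, hψ, hh', show ψ l = _ from hl, ← map_pow, ← map_mul] at h5
  obtain ⟨⟨_, k', rfl⟩, h6⟩ := (IsLocalization.eq_iff_exists (.powers h) Eh).mp h5
  refine ⟨h' ^ k' * y, k' + k, ?_⟩
  change _ = φ _
  rw [map_mul, map_pow, hh', pow_add, ← h6]
  change _ = h ^ k' * _
  ring

attribute [local instance] Algebra.TensorProduct.rightAlgebra in
/-- If `A'` and `B` agree after base change to `A₁` and inversion of `h'`, the cokernel of `A' → B` vanishes over `L'`. -/
lemma subsingleton_quotient {A B A₁ A' L' : Type u} [CommRing A] [CommRing B] [CommRing A₁] [CommRing A'] [CommRing L'] [Algebra A B]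
    [Algebra A A₁] [Algebra A A'] [Algebra A' B] [IsScalarTower A A' B] [Algebra (A₁ ⊗[A] A') L'] [Algebra A L'] [Algebra A₁ L'] [Algebra A' L']
    [IsScalarTower A A₁ L'] [IsScalarTower A A' L'] [IsScalarTower A₁ (A₁ ⊗[A] A') L'] [IsScalarTower A' (A₁ ⊗[A] A') L']
    (h' : A₁ ⊗[A] A') (hu : IsUnit (algebraMap _ L' h')) (hb : ∀ b : B, ∃ (y : A₁ ⊗[A] A') (n : ℕ),
      (1 ⊗ₜ[A] b) * (Algebra.TensorProduct.map (.id A₁ A₁) (IsScalarTower.toAlgHom A A' B) h') ^ n =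
        Algebra.TensorProduct.map (.id A₁ A₁) (IsScalarTower.toAlgHom A A' B) y) :
    Subsingleton (L' ⊗[A'] (B ⧸ LinearMap.range (Algebra.linearMap A' B))) := by
  let K := B ⧸ LinearMap.range (Algebra.linearMap A' B)
  let π : B →ₗ[A'] K := Submodule.mkQ _
  let φ := Algebra.TensorProduct.map (.id A₁ A₁) (IsScalarTower.toAlgHom A A' B)
  let χ : A₁ ⊗[A] B →ₗ[A] L' ⊗[A'] K := TensorProduct.lift
    (LinearMap.mk₂ A (fun a b ↦ (algebraMap A₁ L' a) ⊗ₜ[A'] π b) (fun a a' b ↦ by rw [map_add, add_tmul])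
      (fun c a b ↦ by rw [Algebra.smul_def, map_mul, ← IsScalarTower.algebraMap_apply, ← Algebra.smul_def, smul_tmul'])
      (fun a b b' ↦ by rw [map_add, tmul_add])
      (fun c a b ↦ by rw [← algebraMap_smul A' c b, map_smul, ← smul_tmul, algebraMap_smul, smul_tmul']))
  have hχ (a b) : χ (a ⊗ₜ b) = (algebraMap A₁ L' a) ⊗ₜ[A'] π b := rfl
  have h1 (y : A₁ ⊗[A] A') (x : A₁ ⊗[A] B) : χ (φ y * x) = algebraMap _ L' y • χ x := by
    induction y with
    | zero => simp
    | add y y' hy hy' => simp only [map_add, add_mul, add_smul, hy, hy']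
    | tmul a r =>
      induction x with
      | zero => simp
      | add y y' hy hy' => simp only [map_add, mul_add, smul_add, hy, hy']
      | tmul a' b =>
        have e1 : φ (a ⊗ₜ r) = a ⊗ₜ algebraMap A' B r := rfl
        have e2 : algebraMap A' B r * b = r • b := (Algebra.smul_def r b).symm
        have e3 : algebraMap (A₁ ⊗[A] A') L' (a ⊗ₜ r) = r • algebraMap A₁ L' a := by
          have e4 : a ⊗ₜ[A] r = algebraMap A₁ (A₁ ⊗[A] A') a * algebraMap A' (A₁ ⊗[A] A') r := by
            rw [Algebra.TensorProduct.algebraMap_apply, Algebra.TensorProduct.right_algebraMap_apply]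
            simp
          rw [e4, map_mul, ← IsScalarTower.algebraMap_apply, ← IsScalarTower.algebraMap_apply, mul_comm, ← Algebra.smul_def]
        rw [e1, Algebra.TensorProduct.tmul_mul_tmul, hχ, hχ, e2, map_smul, ← smul_tmul, e3, smul_tmul', map_mul,
          smul_eq_mul, smul_mul_assoc]
  have h2 (y : A₁ ⊗[A] A') : χ (φ y) = 0 := by
    have e1 : χ 1 = 0 := by
      rw [Algebra.TensorProduct.one_def, hχ, show π 1 = 0 from (Submodule.Quotient.mk_eq_zero _).mpr ⟨1, map_one (algebraMap A' B)⟩, tmul_zero]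
    rw [← mul_one (φ y), h1, e1, smul_zero]
  have h3 (b : B) : (1 : L') ⊗ₜ[A'] π b = 0 := by
    obtain ⟨y, n, hy⟩ := hb b
    have e1 := congrArg χ hy
    rw [mul_comm, ← map_pow, h1, h2, map_pow] at e1
    have e2 := (hu.pow n).smul_eq_zero.mp e1
    rwa [hχ, map_one] at e2
  refine subsingleton_of_forall_eq 0 fun x ↦ ?_
  induction x with
  | zero => rfl
  | add x y hx hy => rw [hx, hy, add_zero]
  | tmul l k =>
    obtain ⟨b, rfl⟩ := Submodule.mkQ_surjective _ k
    have h5 : l • ((1 : L') ⊗ₜ[A'] π b) = 0 := by rw [h3, smul_zero]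
    rw [smul_tmul', smul_eq_mul, mul_one] at h5
    exact h5

lemma bijective_of_subsingleton {R B : Type u} [CommRing R] [CommRing B] [Algebra R B] (hi : Function.Injective (algebraMap R B)) (g : R)
    [Subsingleton (Localization.Away g ⊗[R] (B ⧸ LinearMap.range (Algebra.linearMap R B)))] :
    Function.Bijective (Localization.awayMap (algebraMap R B) g) := by
  have hmap (x : R) : Localization.awayMap (algebraMap R B) g (algebraMap R _ x) = algebraMap B _ (algebraMap R B x) :=
    IsLocalization.map_eq _ _
  refine ⟨?_, fun x ↦ ?_⟩
  · have : (Submonoid.powers g).map (algebraMap R B) = Submonoid.powers (algebraMap R B g) := Submonoid.map_powers _ _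
    have h3 : IsLocalization ((Submonoid.powers g).map (algebraMap R B)) (Localization.Away (algebraMap R B g)) := by
      rw [this]; infer_instance
    exact IsLocalization.map_injective_of_injective (M := .powers g) (S := Localization.Away g) (g := algebraMap R B) _ hi
  · obtain ⟨n, b, hb⟩ := IsLocalization.Away.surj (algebraMap R B g) x
    let K := B ⧸ LinearMap.range (Algebra.linearMap R B)
    have h1 : TensorProduct.mk R (Localization.Away g) K 1 (Submodule.Quotient.mk b) = 0 := Subsingleton.elim _ _
    obtain ⟨⟨_, k, rfl⟩, hk⟩ := (IsLocalizedModule.eq_zero_iff (.powers g) (TensorProduct.mk R (Localization.Away g) K 1)).mp h1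
    obtain ⟨a, ha⟩ := (Submodule.Quotient.mk_eq_zero _).mp ((Submodule.Quotient.mk_smul _ _ _).trans hk)
    obtain ⟨u, hu⟩ := IsLocalization.Away.algebraMap_isUnit (S := Localization.Away g) g
    refine ⟨algebraMap R _ a * (↑u⁻¹ : Localization.Away g) ^ (k + n), ?_⟩
    have h4 : IsUnit (algebraMap B (Localization.Away (algebraMap R B g)) (algebraMap R B g)) :=
      IsLocalization.Away.algebraMap_isUnit _
    refine (h4.pow (k + n)).mul_right_cancel ?_
    rw [map_mul, hmap, ← hmap g, mul_assoc, ← map_pow, ← map_mul, ← mul_pow, ← hu, Units.inv_mul, one_pow, map_one, mul_one,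
      hu, map_pow, hmap, pow_add, mul_left_comm, hb, ← map_pow, ← map_mul, ← map_pow, ← Algebra.smul_def]
    exact congrArg _ ha

lemma etale_away_of_bijective {A R B : Type u} [CommRing A] [CommRing R] [CommRing B] [Algebra A R] [Algebra A B] [Algebra R B]
    [IsScalarTower A R B] {g : R} [Algebra.Etale A (Localization.Away g)]
    (h : Function.Bijective (Localization.awayMap (algebraMap R B) g)) :
    Algebra.Etale A (Localization.Away (algebraMap R B g)) := by
  let e : Localization.Away g →ₐ[A] Localization.Away (algebraMap R B g) := { Localization.awayMap (algebraMap R B) g with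
    commutes' := fun a ↦ by
      have h1 : algebraMap A (Localization.Away g) a = algebraMap R _ (algebraMap A R a) := IsScalarTower.algebraMap_apply ..
      have h2 : algebraMap A (Localization.Away (algebraMap R B g)) a = algebraMap B _ (algebraMap A B a) :=
        IsScalarTower.algebraMap_apply ..
      rw [h1, h2, IsScalarTower.algebraMap_apply A R B]
      exact IsLocalization.map_eq _ _ }
  exact .of_equiv (AlgEquiv.ofBijective e h)

attribute [local instance] Algebra.TensorProduct.rightAlgebra in
/-- The étale locus of an algebra can be computed after a flat base change. -/
theorem exists_etale_of_baseChange {A B A₁ : Type u} [CommRing A] [CommRing B] [CommRing A₁] [Algebra A B] [Algebra A A₁]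
    [IsNoetherianRing A] [Module.Flat A A₁] [Algebra.FinitePresentation A A₁] (h : A₁ ⊗[A] B)
    [Algebra.Etale A₁ (Localization.Away h)] (p : PrimeSpectrum (A₁ ⊗[A] B)) (hp : h ∉ p.asIdeal) :
    ∃ g : B, g ∉ (p.comap (Algebra.TensorProduct.includeRight (R := A) (A := A₁) (B := B)).toRingHom).asIdeal ∧
      Algebra.Etale A (Localization.Away g) := by
  obtain ⟨A', hA', h', rfl, hL', hb⟩ := exists_subalgebra_etale h
  let L' := Localization.Away h'
  let φ := Algebra.TensorProduct.map (.id A₁ A₁) A'.val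
  have hK := subsingleton_quotient (L' := L') (B := B) h' (IsLocalization.Away.algebraMap_isUnit h') hb
  have hfl : Module.Flat A' (A₁ ⊗[A] A') := .of_linearEquiv (Algebra.TensorProduct.commRight A A' A₁).symm.toLinearEquiv
  have hfp : Algebra.FinitePresentation A' (A₁ ⊗[A] A') := .equiv (Algebra.TensorProduct.commRight A A' A₁)
  have : Algebra.FiniteType A A' := A'.fg_iff_finiteType.mp hA'
  have : Module.Flat (A₁ ⊗[A] A') L' := IsLocalization.flat L' (.powers h')
  have : Module.Flat A' L' := .trans A' (A₁ ⊗[A] A') L'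
  have : Algebra.FinitePresentation (A₁ ⊗[A] A') L' := IsLocalization.Away.finitePresentation h'
  have : Algebra.FinitePresentation A' L' := .trans A' (A₁ ⊗[A] A') L'
  have : Module.Flat A L' := .trans A A₁ L'
  have : Algebra.FormallyEtale (A₁ ⊗[A] A') L' := .of_isLocalization (.powers h')
  have hΩ : Subsingleton (L' ⊗[A'] Ω[A'⁄A]) := by
    have e1 := KaehlerDifferential.tensorKaehlerEquivOfFormallyEtale A₁ (A₁ ⊗[A] A') L'
    have e2 := KaehlerDifferential.tensorKaehlerEquiv A A₁ A' (A₁ ⊗[A] A')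
    have h1 : Subsingleton (L' ⊗[A₁ ⊗[A] A'] Ω[(A₁ ⊗[A] A')⁄A₁]) := e1.toEquiv.subsingleton
    have e3 := LinearEquiv.lTensor L' e2
    have h2 := e3.toEquiv.subsingleton
    exact (AlgebraTensorModule.cancelBaseChange A' (A₁ ⊗[A] A') L' L' Ω[A'⁄A]).symm.toEquiv.subsingleton
  obtain ⟨p', hp'⟩ : ∃ p' : PrimeSpectrum L', p'.comap (algebraMap _ L') = p.comap φ.toRingHom := by
    have : p.comap φ.toRingHom ∈ Set.range (PrimeSpectrum.comap (algebraMap (A₁ ⊗[A] A') L')) := by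
      rw [PrimeSpectrum.localization_away_comap_range L' h']
      exact hp
    exact this
  obtain ⟨g, hg, hC, hM⟩ := exists_etale_away (A := A) (R := A') p'
  have := hM (B ⧸ LinearMap.range (Algebra.linearMap A' B))
  have hbij := bijective_of_subsingleton (R := A') (B := B) Subtype.val_injective g
  refine ⟨g, fun h1 ↦ hg ?_, ?_⟩
  · change algebraMap A' L' g ∈ p'.asIdeal
    rw [IsScalarTower.algebraMap_apply A' (A₁ ⊗[A] A') L']
    have h2 : algebraMap A' (A₁ ⊗[A] A') g ∈ (p'.comap (algebraMap _ L')).asIdeal := by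
      rw [hp']
      exact h1
    exact h2
  · have h3 : IsScalarTower A A' B := inferInstance
    exact etale_away_of_bijective (A := A) (R := A') (B := B) (g := g) hbij

end Descent

/-! ### Étale loci and flat base change -/

section EtaleLocus

variable {Q P : Scheme.{u}} (f : Q ⟶ P)

lemma etale_etaleLocus : Etale ((etaleLocus f).ι ≫ f) := by
  have h : ∀ x : (etaleLocus f).toScheme, ∃ (W : Scheme.{u}) (w : W ⟶ (etaleLocus f).toScheme),
      IsOpenImmersion w ∧ x ∈ Set.range w ∧ Etale (w ≫ (etaleLocus f).ι ≫ f) := by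
    rintro ⟨x, hx⟩
    obtain ⟨O, hO, hxO⟩ := TopologicalSpace.Opens.mem_sSup.mp hx
    have hle : O ≤ etaleLocus f := le_sSup hO
    refine ⟨O, Q.homOfLE hle, inferInstance, ⟨⟨x, hxO⟩, ?_⟩, ?_⟩
    · apply (etaleLocus f).ι.injective
      have := congr($(Q.homOfLE_ι hle) ⟨x, hxO⟩)
      exact this
    · rw [Scheme.homOfLE_ι_assoc]
      exact hO
  choose W w hw hx hs using h
  change etaleP.{u} _
  exact (IsZariskiLocalAtSource.iff_of_openCover (P := etaleP.{u})
    (Cover.mkOfCovers _ W w (fun x ↦ ⟨x, hx x⟩) hw)).mpr hs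

lemma mem_etaleLocus_of {K : Scheme.{u}} (k : K ⟶ Q) [IsOpenImmersion k] (h : Etale (k ≫ f)) (x : K) :
    k x ∈ etaleLocus f := by
  refine TopologicalSpace.Opens.mem_sSup.mpr ⟨k.opensRange, ?_, ⟨x, rfl⟩⟩
  change Etale (k.opensRange.ι ≫ f)
  have : k.opensRange.ι ≫ f = k.isoOpensRange.inv ≫ k ≫ f := by
    rw [← Category.assoc, Scheme.Hom.isoOpensRange_inv_comp]
  rw [this]
  infer_instance

end EtaleLocus

section Descent

open TensorProduct

/-- Affine case of `mem_etaleLocus_of_pullback`. -/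
lemma exists_etale_nbhd_Spec (A A₁ B : Type u) [CommRing A] [CommRing A₁] [CommRing B] [Algebra A A₁] [Algebra A B]
    [IsNoetherianRing A] [Module.Flat A A₁] [Algebra.FinitePresentation A A₁] {N : Scheme.{u}}
    (n : N ⟶ Spec (.of (A₁ ⊗[A] B))) [IsOpenImmersion n]
    (h : Etale (n ≫ Spec.map (CommRingCat.ofHom (algebraMap A₁ (A₁ ⊗[A] B))))) (x : N) :
    ∃ (Z : Scheme.{u}) (z : Z ⟶ Spec (.of B)), IsOpenImmersion z ∧
      Spec.map (CommRingCat.ofHom (Algebra.TensorProduct.includeRight (R := A) (A := A₁) (B := B)).toRingHom) (n x) ∈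
        Set.range z ∧ Etale (z ≫ Spec.map (CommRingCat.ofHom (algebraMap A B))) := by
  let p : PrimeSpectrum (A₁ ⊗[A] B) := n x
  obtain ⟨_, ⟨_, ⟨t, rfl⟩, rfl⟩, hp, hle⟩ := PrimeSpectrum.isBasis_basic_opens.exists_subset_of_mem_open
    (show p ∈ (n.opensRange : Set (Spec (.of (A₁ ⊗[A] B)))) from ⟨x, rfl⟩) n.opensRange.2
  let q : Spec (.of (Localization.Away t)) ⟶ Spec (.of (A₁ ⊗[A] B)) :=
    Spec.map (CommRingCat.ofHom (algebraMap (A₁ ⊗[A] B) (Localization.Away t)))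
  have hq : Set.range q ⊆ Set.range n := by
    refine subset_trans (subset_of_eq ?_) hle
    exact PrimeSpectrum.localization_away_comap_range (Localization.Away t) t
  have : IsOpenImmersion q := inferInstance
  let l := IsOpenImmersion.lift n q hq
  have hl : l ≫ n = q := IsOpenImmersion.lift_fac n q hq
  have : IsOpenImmersion l := by
    have : IsOpenImmersion (l ≫ n) := hl ▸ ‹IsOpenImmersion q›
    exact IsOpenImmersion.of_comp l n
  have h1 : Etale (Spec.map (CommRingCat.ofHom (algebraMap A₁ (Localization.Away t)))) := by
    have : Spec.map (CommRingCat.ofHom (algebraMap A₁ (Localization.Away t))) =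
        l ≫ n ≫ Spec.map (CommRingCat.ofHom (algebraMap A₁ (A₁ ⊗[A] B))) := by
      rw [reassoc_of% hl]
      change _ = Spec.map _ ≫ Spec.map _
      rw [← Spec.map_comp, ← CommRingCat.ofHom_comp, ← IsScalarTower.algebraMap_eq]
    rw [this]
    infer_instance
  have h2 : Algebra.Etale A₁ (Localization.Away t) := by
    have := (HasRingHomProperty.Spec_iff (P := etaleP.{u})).mp h1
    exact RingHom.etale_algebraMap.mp this
  obtain ⟨g, hg, hE⟩ := exists_etale_of_baseChange t p hp
  refine ⟨_, Spec.map (CommRingCat.ofHom (algebraMap B (Localization.Away g))), inferInstance, ?_, ?_⟩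
  · have := PrimeSpectrum.localization_away_comap_range (Localization.Away g) g
    exact this.ge hg
  · rw [← Spec.map_comp, ← CommRingCat.ofHom_comp, ← IsScalarTower.algebraMap_eq]
    change etaleP.{u} _
    rw [HasRingHomProperty.Spec_iff (P := etaleP.{u})]
    exact RingHom.etale_algebraMap.mpr hE

/-- A point of an affine scheme over a locally noetherian base is in the étale locus as soon as this holds for a point above it after a flat,
finitely presented base change. The scheme is not assumed of finite type, as needed for normalizations. -/
lemma mem_etaleLocus_of_pullback {Q P P' N : Scheme.{u}} (f : Q ⟶ P) [IsAffineHom f] [IsLocallyNoetherian P]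
    (g : P' ⟶ P) [Flat g] [LocallyOfFinitePresentation g] (n : N ⟶ pullback f g) [IsOpenImmersion n]
    (h : Etale (n ≫ pullback.snd f g)) (x : N) : (n ≫ pullback.fst f g) x ∈ etaleLocus f := by
  obtain ⟨_, ⟨U₀, hU₀, rfl⟩, hxU, -⟩ := P.isBasis_affineOpens.exists_subset_of_mem_open
    (Set.mem_univ ((n ≫ pullback.fst f g ≫ f) x)) isOpen_univ
  let U : P.Opens := U₀
  have hU : IsAffineOpen U := hU₀
  have hx' : g ((n ≫ pullback.snd f g) x) ∈ U := by
    rw [← Scheme.Hom.comp_apply, Category.assoc, ← pullback.condition]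
    exact hxU
  obtain ⟨_, ⟨V₀, hV₀, rfl⟩, hxV, hVU⟩ := P'.isBasis_affineOpens.exists_subset_of_mem_open
    (show (n ≫ pullback.snd f g) x ∈ (g ⁻¹ᵁ U : Set P') from hx') (g ⁻¹ᵁ U).2
  let V : P'.Opens := V₀
  have hV : IsAffineOpen V := hV₀
  have hVU : V ≤ g ⁻¹ᵁ U := hVU
  have hW : IsAffineOpen (f ⁻¹ᵁ U) := hU.preimage f
  let A := Γ(P, U)
  let B := Γ(Q, f ⁻¹ᵁ U)
  let A₁ := Γ(P', V)
  let _ : Algebra A B := (f.app U).hom.toAlgebra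
  let _ : Algebra A A₁ := (g.appLE U V hVU).hom.toAlgebra
  have : IsNoetherianRing A := IsLocallyNoetherian.component_noetherian ⟨U, hU⟩
  have : Module.Flat A A₁ := HasRingHomProperty.appLE (P := @Flat) g inferInstance ⟨U, hU⟩ ⟨V, hV⟩ hVU
  have : Algebra.FinitePresentation A A₁ :=
    HasRingHomProperty.appLE (P := @LocallyOfFinitePresentation) g inferInstance ⟨U, hU⟩ ⟨V, hV⟩ hVU
  let a : Spec (.of A₁) ⟶ Spec (.of A) := Spec.map (CommRingCat.ofHom (algebraMap A A₁))
  let b : Spec (.of B) ⟶ Spec (.of A) := Spec.map (CommRingCat.ofHom (algebraMap A B))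
  have ha : a ≫ hU.fromSpec = hV.fromSpec ≫ g := by
    exact hU.SpecMap_appLE_fromSpec g hV hVU
  have hb : b ≫ hU.fromSpec = hW.fromSpec ≫ f := by
    have := hU.SpecMap_appLE_fromSpec f hW le_rfl
    rw [Scheme.Hom.appLE_eq_app] at this
    exact this
  let k : pullback b a ⟶ pullback f g := pullback.map b a f g hW.fromSpec hV.fromSpec hU.fromSpec hb ha
  have hxr : n x ∈ Set.range k := by
    rw [Scheme.Pullback.range_map]
    refine ⟨?_, ?_⟩
    · rw [IsAffineOpen.range_fromSpec]
      exact hxU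
    · rw [IsAffineOpen.range_fromSpec]
      exact hxV
  obtain ⟨x', hx''⟩ := hxr
  let k' : Spec (.of (A₁ ⊗[A] B)) ⟶ pullback f g := (pullbackSpecIso A A₁ B).inv ≫ (pullbackSymmetry a b).hom ≫ k
  let x'' : Spec (.of (A₁ ⊗[A] B)) := ((pullbackSymmetry a b).inv ≫ (pullbackSpecIso A A₁ B).hom) x'
  have hk'x : k' x'' = n x := by
    rw [← hx'', ← Scheme.Hom.comp_apply]
    congr 1
    simp [k']
  obtain ⟨w, hw1, hw2⟩ := Scheme.Pullback.exists_preimage_pullback x x'' hk'x.symm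
  have hsnd : k' ≫ pullback.snd f g = Spec.map (CommRingCat.ofHom (algebraMap A₁ (A₁ ⊗[A] B))) ≫ hV.fromSpec := by
    have := pullbackSpecIso_inv_fst_assoc A A₁ B hV.fromSpec
    simp only [k', k, Category.assoc, pullback.lift_snd, pullback.map, pullbackSymmetry_hom_comp_snd_assoc]
    exact this
  have hfst : k' ≫ pullback.fst f g = Spec.map (CommRingCat.ofHom
      (Algebra.TensorProduct.includeRight (R := A) (A := A₁) (B := B)).toRingHom) ≫ hW.fromSpec := by
    have := pullbackSpecIso_inv_snd_assoc A A₁ B hW.fromSpec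
    simp only [k', k, Category.assoc, pullback.lift_fst, pullback.map, pullbackSymmetry_hom_comp_fst_assoc]
    exact this
  have hE : Etale (pullback.snd n k' ≫ Spec.map (CommRingCat.ofHom (algebraMap A₁ (A₁ ⊗[A] B)))) := by
    have h1 : Etale ((pullback.snd n k' ≫ Spec.map (CommRingCat.ofHom (algebraMap A₁ (A₁ ⊗[A] B)))) ≫ hV.fromSpec) := by
      rw [Category.assoc, ← hsnd, ← pullback.condition_assoc]
      infer_instance
    exact Etale.of_comp _ hV.fromSpec
  obtain ⟨Z, z, hz, ⟨y, hy⟩, hZ⟩ := exists_etale_nbhd_Spec A A₁ B (pullback.snd n k') hE w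
  have h1 : Etale ((z ≫ hW.fromSpec) ≫ f) := by
    rw [Category.assoc, ← hb, ← Category.assoc]
    infer_instance
  have h2 := mem_etaleLocus_of f (z ≫ hW.fromSpec) h1 y
  have h3 : (z ≫ hW.fromSpec) y = (n ≫ pullback.fst f g) x := by
    rw [Scheme.Hom.comp_apply, hy, ← Scheme.Hom.comp_apply, ← hfst, hw2, Scheme.Hom.comp_apply, hk'x,
      ← Scheme.Hom.comp_apply]
  rwa [h3] at h2

end Descent

/-! ### Integrally closed opens and sections of normalizations -/

section NormalOpen

/-- A quasi-compact quasi-separated morphism along which the target is integrally closed. -/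
structure IsNormalIn {X Y : Scheme.{u}} (j : X ⟶ Y) : Prop where
  quasiCompact : QuasiCompact j
  quasiSeparated : QuasiSeparated j
  isIso : IsIso j.fromNormalization

variable {X Y : Scheme.{u}}

lemma IsNormalIn.comp_left {X' : Scheme.{u}} {j : X ⟶ Y} (h : IsNormalIn j) (e : X' ⟶ X) [IsIso e] :
    IsNormalIn (e ≫ j) := by
  have := h.quasiCompact
  have := h.quasiSeparated
  have := h.isIso
  refine ⟨inferInstance, inferInstance, ?_⟩
  have h1 : (e ≫ j) ≫ 𝟙 Y = e ≫ j := by simp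
  have h2 : j ≫ 𝟙 Y = inv e ≫ e ≫ j := by simp
  have : IsIso (normMap h1) := by
    refine ⟨normMap h2, ?_, ?_⟩
    · refine norm_ext ?_ ?_
      · simp [normMap_from]
      · rw [← Category.assoc, to_normMap, Category.assoc, to_normMap]
        simp
    · refine norm_ext ?_ ?_
      · simp [normMap_from]
      · rw [← Category.assoc, to_normMap, Category.assoc, to_normMap]
        simp
  have h3 := normMap_from h1
  rw [Category.comp_id] at h3
  rw [← h3]
  infer_instance

/-- Relative normalization commutes with smooth base change. -/
lemma IsNormalIn.pullback_snd {j : X ⟶ Y} (h : IsNormalIn j) {Y' : Scheme.{u}} (w : Y' ⟶ Y) [Smooth w] :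
    IsNormalIn (pullback.snd j w) := by
  have := h.quasiCompact
  have := h.quasiSeparated
  have := h.isIso
  refine ⟨inferInstance, inferInstance, ?_⟩
  rw [← normalizationPullback_snd]
  infer_instance

lemma IsNormalIn.of_isPullback {X' Y' : Scheme.{u}} {j : X ⟶ Y} (h : IsNormalIn j) {a : X' ⟶ X} {j' : X' ⟶ Y'}
    {w : Y' ⟶ Y} (hp : IsPullback a j' j w) [Smooth w] : IsNormalIn j' := by
  rw [← hp.isoPullback_hom_snd]
  exact (h.pullback_snd w).comp_left _

lemma isPullback_preimage_ι (w : X ⟶ Y) (O : Y.Opens) : IsPullback (w ∣_ O) (w ⁻¹ᵁ O).ι O.ι w :=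
  isPullback_morphismRestrict w O

lemma IsNormalIn.preimage {O : Y.Opens} (h : IsNormalIn O.ι) (w : X ⟶ Y) [Smooth w] : IsNormalIn (w ⁻¹ᵁ O).ι :=
  h.of_isPullback (isPullback_preimage_ι w O)

end NormalOpen

section Sections

variable {X Y : Scheme.{u}}

lemma isOpenImmersion_of_section (q : Y ⟶ X) [Etale q] (σ : X ⟶ Y) (h : σ ≫ q = 𝟙 X) : IsOpenImmersion σ := by
  have : Etale (σ ≫ q) := by rw [h]; infer_instance
  have : Etale σ := Etale.of_comp σ q
  have : Mono σ := by
    have : Mono (σ ≫ q) := by rw [h]; infer_instance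
    exact mono_of_mono σ q
  exact IsOpenImmersion.of_flat_of_mono σ

lemma isClosedImmersion_of_section (q : Y ⟶ X) [IsSeparated q] (σ : X ⟶ Y) (h : σ ≫ q = 𝟙 X) :
    IsClosedImmersion σ := by
  have : IsClosedImmersion (σ ≫ q) := by rw [h]; infer_instance
  exact IsClosedImmersion.of_comp σ q

/-- A section over the trace of a dense open on which the covering is finite étale extends to a section into the étale
locus of the normalization: the graph of the section is a connected component, so its normalization, which is the base, is an open and closed
piece of the normalization. -/
lemma exists_section_etaleLocus {C P W : Scheme.{u}} (f : C ⟶ P) [QuasiCompact f] [QuasiSeparated f]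
    [IsLocallyNoetherian P] (O : P.Opens) (hO : IsNormalIn O.ι) (c : C ⟶ O.toScheme) [Etale c] [IsFinite c]
    (hc : c ≫ O.ι = f) (w : W ⟶ P) [Smooth w] (s₀ : (w ⁻¹ᵁ O).toScheme ⟶ C) (hs₀ : s₀ ≫ f = (w ⁻¹ᵁ O).ι ≫ w) :
    ∃ s : W ⟶ f.normalization, s ≫ f.fromNormalization = w ∧ (w ⁻¹ᵁ O).ι ≫ s = s₀ ≫ f.toNormalization ∧
      ∀ x, s x ∈ etaleLocus f.fromNormalization := by
  let j : (w ⁻¹ᵁ O).toScheme ⟶ W := (w ⁻¹ᵁ O).ι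
  let g : pullback f w ⟶ W := pullback.snd f w
  let σ : (w ⁻¹ᵁ O).toScheme ⟶ pullback f w := pullback.lift s₀ j hs₀
  have hσ : σ ≫ g = j := pullback.lift_snd _ _ _
  have hσ1 : σ ≫ pullback.fst f w = s₀ := pullback.lift_fst _ _ _
  have hj := isPullback_preimage_ι w O
  let q : pullback f w ⟶ (w ⁻¹ᵁ O).toScheme := hj.lift (pullback.fst f w ≫ c) g (by
    rw [Category.assoc, hc]; exact pullback.condition)
  have hq1 : q ≫ (w ∣_ O) = pullback.fst f w ≫ c := hj.lift_fst _ _ _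
  have hq : q ≫ j = g := hj.lift_snd _ _ _
  have hqp : IsPullback (pullback.fst f w) q c (w ∣_ O) := by
    refine IsPullback.of_bot (v₂₁ := j) (v₂₂ := O.ι) (h₃₁ := w) ?_ hq1.symm hj
    rw [hq, hc]
    exact .of_hasPullback f w
  have hqE : Etale q := by
    rw [← hqp.isoPullback_hom_snd]
    infer_instance
  have hqF : IsFinite q := MorphismProperty.of_isPullback (P := @IsFinite) hqp ‹IsFinite c›
  have hσq : σ ≫ q = 𝟙 _ := by
    have : Mono j := inferInstanceAs (Mono (w ⁻¹ᵁ O).ι)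
    rw [← cancel_mono j, Category.assoc, hq, hσ, Category.id_comp]
  have hσo : IsOpenImmersion σ := isOpenImmersion_of_section q σ hσq
  have hσc : IsClosedImmersion σ := isClosedImmersion_of_section q σ hσq
  let R : (pullback f w).Opens := ⟨(Set.range σ)ᶜ, σ.isClosedEmbedding.isClosed_range.isOpen_compl⟩
  have hRc : IsCompl σ.opensRange R.ι.opensRange := by
    rw [Opens.opensRange_ι]
    constructor
    · rw [disjoint_iff]
      ext x
      simp [R]
    · rw [codisjoint_iff]
      ext x
      simp [R, em]
  have hRq : QuasiCompact R.ι := by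
    have : IsClosed (Set.range R.ι) := by
      rw [Opens.range_ι]
      exact σ.isOpenEmbedding.isOpen_range.isClosed_compl
    have := IsClosedImmersion.of_isPreimmersion R.ι this
    infer_instance
  obtain ⟨e⟩ := nonempty_isColimit_binaryCofanMk_of_isCompl σ R.ι hRc
  have hσg : IsNormalIn (σ ≫ g) := hσ ▸ hO.preimage w
  have := hσg.isIso
  let n : W ⟶ pullback f.fromNormalization w :=
    inv (σ ≫ g).fromNormalization ≫ coprod.inl ≫ (g.normalizationCoprodIso e).hom ≫ f.normalizationPullback w
  have hn : n ≫ pullback.snd f.fromNormalization w = 𝟙 W := by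
    simp only [n, Category.assoc]
    rw [normalizationPullback_snd, inl_normalizationCoprodIso_hom_fromNormalization, IsIso.inv_hom_id]
  have hn1 : j ≫ n ≫ pullback.fst f.fromNormalization w = s₀ ≫ f.toNormalization := by
    have : j = (σ ≫ g).toNormalization ≫ (σ ≫ g).fromNormalization := by
      rw [toNormalization_fromNormalization, hσ]
    rw [this]
    simp only [n, Category.assoc, IsIso.hom_inv_id_assoc]
    rw [toNormalization_inl_normalizationCoprodIso_hom_assoc, toNormalization_normalizationPullback_fst, reassoc_of% hσ1]
  have hno : IsOpenImmersion n := inferInstance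
  refine ⟨n ≫ pullback.fst f.fromNormalization w, ?_, hn1, fun x ↦ ?_⟩
  · rw [Category.assoc, pullback.condition, reassoc_of% hn]
  · exact mem_etaleLocus_of_pullback f.fromNormalization w n (by rw [hn]; infer_instance) x

end Sections

/-! ### Multiplicative morphisms and coverings -/

section MultiplicativeHom

variable {Q P : OS Scheme.{u}} {φ : Q ⟶ P} {l m n : ℕ} {a : OSimp.mk 0 ⟶ OSimp.mk m} {b : OSimp.mk 0 ⟶ OSimp.mk l}
  {c : OSimp.mk m ⟶ OSimp.mk n} {d : OSimp.mk l ⟶ OSimp.mk n}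

lemma IsMultiplicativeHom.exists_lift (h : IsMultiplicativeHom φ) (hp : IsPushout a b c d) {T : Scheme.{u}}
    (x : T ⟶ Q.obj (.op ⟨m⟩)) (y : T ⟶ Q.obj (.op ⟨l⟩)) (t : T ⟶ P.obj (.op ⟨n⟩))
    (hx : x ≫ φ.app _ = t ≫ P.map c.op) (hy : y ≫ φ.app _ = t ≫ P.map d.op) :
    ∃ z : T ⟶ Q.obj (.op ⟨n⟩), z ≫ Q.map c.op = x ∧ z ≫ Q.map d.op = y ∧ z ≫ φ.app _ = t := by
  have hpb := h a b c d hp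
  let X : T ⟶ pullback (φ.app (.op ⟨m⟩)) (P.map c.op) := pullback.lift x t hx
  let Y : T ⟶ pullback (φ.app (.op ⟨l⟩)) (P.map d.op) := pullback.lift y t hy
  have hX : X ≫ pullback.fst _ _ = x := pullback.lift_fst _ _ _
  have hX' : X ≫ pullback.snd _ _ = t := pullback.lift_snd _ _ _
  have hY : Y ≫ pullback.fst _ _ = y := pullback.lift_fst _ _ _
  have hY' : Y ≫ pullback.snd _ _ = t := pullback.lift_snd _ _ _
  let z := hpb.lift X Y (hX'.trans hY'.symm)
  have h1 := hpb.lift_fst X Y (hX'.trans hY'.symm)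
  have h2 := hpb.lift_snd X Y (hX'.trans hY'.symm)
  refine ⟨z, ?_, ?_, ?_⟩
  · have := congr($h1 ≫ pullback.fst _ _)
    rwa [Category.assoc, pullback.lift_fst, hX] at this
  · have := congr($h2 ≫ pullback.fst _ _)
    rwa [Category.assoc, pullback.lift_fst, hY] at this
  · have := congr($h1 ≫ pullback.snd _ _)
    exact (congr(z ≫ $(pullback.lift_snd _ _ (φ.naturality c.op)))).symm.trans (((Category.assoc _ _ _).symm.trans this).trans hX')

lemma IsMultiplicativeHom.hom_ext (h : IsMultiplicativeHom φ) (hp : IsPushout a b c d) {T : Scheme.{u}}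
    {z z' : T ⟶ Q.obj (.op ⟨n⟩)} (h1 : z ≫ Q.map c.op = z' ≫ Q.map c.op) (h2 : z ≫ Q.map d.op = z' ≫ Q.map d.op)
    (h3 : z ≫ φ.app _ = z' ≫ φ.app _) : z = z' := by
  refine (h a b c d hp).hom_ext (pullback.hom_ext ?_ ?_) (pullback.hom_ext ?_ ?_)
  · rwa [Category.assoc, Category.assoc, pullback.lift_fst]
  · rwa [Category.assoc, Category.assoc, pullback.lift_snd]
  · rwa [Category.assoc, Category.assoc, pullback.lift_fst]
  · rwa [Category.assoc, Category.assoc, pullback.lift_snd]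

/-- Multiplicativity of a morphism, in terms of points: a point of `Q_n` is given by a point of `P_n` with lifts of its two faces. -/
lemma isMultiplicativeHom_of (hex : ∀ ⦃l m n : ℕ⦄ (a : OSimp.mk 0 ⟶ OSimp.mk m) (b : OSimp.mk 0 ⟶ OSimp.mk l)
    (c : OSimp.mk m ⟶ OSimp.mk n) (d : OSimp.mk l ⟶ OSimp.mk n), IsPushout a b c d → ∀ (T : Scheme.{u})
    (x : T ⟶ Q.obj (.op ⟨m⟩)) (y : T ⟶ Q.obj (.op ⟨l⟩)) (t : T ⟶ P.obj (.op ⟨n⟩))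
    (_ : x ≫ φ.app _ = t ≫ P.map c.op) (_ : y ≫ φ.app _ = t ≫ P.map d.op),
    ∃ z : T ⟶ Q.obj (.op ⟨n⟩), z ≫ Q.map c.op = x ∧ z ≫ Q.map d.op = y ∧ z ≫ φ.app _ = t)
    (hu : ∀ ⦃l m n : ℕ⦄ (a : OSimp.mk 0 ⟶ OSimp.mk m) (b : OSimp.mk 0 ⟶ OSimp.mk l)
    (c : OSimp.mk m ⟶ OSimp.mk n) (d : OSimp.mk l ⟶ OSimp.mk n), IsPushout a b c d → ∀ (T : Scheme.{u})
    (z z' : T ⟶ Q.obj (.op ⟨n⟩)) (_ : z ≫ Q.map c.op = z' ≫ Q.map c.op) (_ : z ≫ Q.map d.op = z' ≫ Q.map d.op)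
    (_ : z ≫ φ.app _ = z' ≫ φ.app _), z = z') : IsMultiplicativeHom φ := by
  intro l m n a b c d hp
  let X : Q.obj (.op ⟨n⟩) ⟶ pullback (φ.app (.op ⟨m⟩)) (P.map c.op) :=
    pullback.lift (f := φ.app _) (g := P.map c.op) (Q.map c.op) (φ.app _) (φ.naturality c.op)
  let Y : Q.obj (.op ⟨n⟩) ⟶ pullback (φ.app (.op ⟨l⟩)) (P.map d.op) :=
    pullback.lift (f := φ.app _) (g := P.map d.op) (Q.map d.op) (φ.app _) (φ.naturality d.op)
  have hX : X ≫ pullback.fst _ _ = Q.map c.op := pullback.lift_fst _ _ _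
  have hX' : X ≫ pullback.snd _ _ = φ.app _ := pullback.lift_snd _ _ _
  have hY : Y ≫ pullback.fst _ _ = Q.map d.op := pullback.lift_fst _ _ _
  have hY' : Y ≫ pullback.snd _ _ = φ.app _ := pullback.lift_snd _ _ _
  have w : X ≫ pullback.snd _ _ = Y ≫ pullback.snd _ _ := hX'.trans hY'.symm
  change IsPullback X Y _ _
  refine isPullback_of_forall w (fun {T} x y hxy ↦ ?_) (fun {T} z z' h1 h2 ↦ ?_)
  · obtain ⟨z, hz1, hz2, hz3⟩ := hex a b c d hp T (x ≫ pullback.fst _ _) (y ≫ pullback.fst _ _) (x ≫ pullback.snd _ _)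
      (by rw [Category.assoc, Category.assoc, pullback.condition])
      (by rw [hxy, Category.assoc, Category.assoc, pullback.condition])
    refine ⟨z, pullback.hom_ext ?_ ?_, pullback.hom_ext ?_ ?_⟩
    · rw [Category.assoc, hX, hz1]
    · rw [Category.assoc, hX', hz3]
    · rw [Category.assoc, hY, hz2]
    · rw [Category.assoc, hY', hz3, hxy]
  · refine hu a b c d hp T z z' ?_ ?_ ?_
    · rw [← hX, reassoc_of% h1]
    · rw [← hY, reassoc_of% h2]
    · rw [← hX', reassoc_of% h1]

/-- A diagram which is multiplicative relatively to a multiplicative one is multiplicative. -/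
lemma IsMultiplicativeHom.isMultiplicative (h : IsMultiplicativeHom φ) (hP : IsMultiplicative P)
    (hmono : Mono (φ.app (.op ⟨0⟩))) : IsMultiplicative Q := by
  intro l m n a b c d hp
  have hw : Q.map c.op ≫ Q.map a.op = Q.map d.op ≫ Q.map b.op := by
    rw [← Q.map_comp, ← Q.map_comp, ← op_comp, ← op_comp, hp.w]
  refine isPullback_of_forall hw (fun {T} x y hxy ↦ ?_) (fun {T} z z' h1 h2 ↦ ?_)
  · have hPp := hP a b c d hp
    have hc : (x ≫ φ.app _) ≫ P.map a.op = (y ≫ φ.app _) ≫ P.map b.op := by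
      rw [Category.assoc, Category.assoc, ← φ.naturality, ← φ.naturality, reassoc_of% hxy]
    obtain ⟨z, hz1, hz2, -⟩ := h.exists_lift hp x y (hPp.lift _ _ hc) (hPp.lift_fst _ _ hc).symm (hPp.lift_snd _ _ hc).symm
    exact ⟨z, hz1, hz2⟩
  · refine h.hom_ext hp h1 h2 ((hP a b c d hp).hom_ext ?_ ?_)
    · rw [Category.assoc, Category.assoc, ← φ.naturality, reassoc_of% h1]
    · rw [Category.assoc, Category.assoc, ← φ.naturality, reassoc_of% h2]

end MultiplicativeHom

section Cover

/-- An oversimplicial scheme `C` over `P` which is finite étale over the open subschemes `O n` of `P`, along which `P` is normal, and which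
is relatively multiplicative. -/
structure IsCover {C P : OS Scheme.{u}} (π : C ⟶ P) (O : ∀ n, (P.obj n).Opens) : Prop where
  isLocallyNoetherian (n) : IsLocallyNoetherian (P.obj n)
  isNormalIn (n) : IsNormalIn (O n).ι
  preimage {n n'} (f : n ⟶ n') : P.map f ⁻¹ᵁ O n' = O n
  exists_fac (n) : ∃ c : C.obj n ⟶ (O n).toScheme, Etale c ∧ IsFinite c ∧ c ≫ (O n).ι = π.app n
  exists_fac_zero : ∃ c : C.obj (.op ⟨0⟩) ⟶ (O (.op ⟨0⟩)).toScheme, IsIso c ∧ c ≫ (O (.op ⟨0⟩)).ι = π.app (.op ⟨0⟩)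
  isMultiplicativeHom : IsMultiplicativeHom π
  smooth_map_succ (n) : Smooth (P.map (OSimp.succ n).op)

variable {C P : OS Scheme.{u}} {π : C ⟶ P} {O : ∀ n, (P.obj n).Opens} [∀ n, QuasiCompact (π.app n)]
  [∀ n, QuasiSeparated (π.app n)]

/-- Over `O n` the normalization is the covering itself, which is already finite there. -/
lemma IsCover.isPullback (h : IsCover π O) (n) : ∃ c : C.obj n ⟶ (O n).toScheme,
    IsPullback (π.app n).toNormalization c (π.app n).fromNormalization (O n).ι := by
  obtain ⟨c, h1, h2, hc⟩ := h.exists_fac n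
  have hp : IsPullback (𝟙 _) c (π.app n) (O n).ι := by
    refine isPullback_of_forall (by rw [Category.id_comp, hc]) (fun {T} x y hxy ↦ ⟨x, Category.comp_id _, ?_⟩)
      (fun {T} z z' h1 h2 ↦ by simpa using h1)
    rw [← cancel_mono (O n).ι, Category.assoc, hc, hxy]
  let i := hp.isoPullback
  have hi1 : i.hom ≫ pullback.fst (π.app n) (O n).ι = 𝟙 _ := hp.isoPullback_hom_fst
  have hi : i.hom ≫ pullback.snd (π.app n) (O n).ι = c := hp.isoPullback_hom_snd
  have : IsIntegralHom (pullback.snd (π.app n) (O n).ι) := by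
    have : pullback.snd (π.app n) (O n).ι = i.inv ≫ c := by rw [← hi, Iso.inv_hom_id_assoc]
    rw [this]
    infer_instance
  let t : C.obj n ⟶ pullback (π.app n).fromNormalization (O n).ι :=
    i.hom ≫ (pullback.snd (π.app n) (O n).ι).toNormalization ≫ (π.app n).normalizationPullback (O n).ι
  have ht : IsIso t := inferInstance
  have ht1 : t ≫ pullback.fst _ _ = (π.app n).toNormalization := by
    simp only [t, Category.assoc, toNormalization_normalizationPullback_fst]
    rw [reassoc_of% hi1]
  have ht2 : t ≫ pullback.snd _ _ = c := by
    simp only [t, Category.assoc, normalizationPullback_snd, toNormalization_fromNormalization]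
    rw [hi]
  exact ⟨c, .of_iso_pullback ⟨by rw [toNormalization_fromNormalization, hc]⟩ (asIso t) ht1 ht2⟩

/-- The morphism from a diagram of schemes to the relative normalization. -/
def normOSTo (π : C ⟶ P) [∀ n, QuasiCompact (π.app n)] [∀ n, QuasiSeparated (π.app n)] : C ⟶ normOS π where
  app n := (π.app n).toNormalization
  naturality _ _ f := (to_normMap (π.naturality f).symm).symm

lemma normOSTo_app_proj (n) : (normOSTo π).app n ≫ (normOSProj π).app n = π.app n :=
  (π.app n).toNormalization_fromNormalization

lemma normOS_ext {n} {T' T : Scheme.{u}} (u : T' ⟶ T) (hu : IsSchemeTheoreticallyDominant u)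
    {a b : T ⟶ (normOS π).obj n} (h : a ≫ (normOSProj π).app n = b ≫ (normOSProj π).app n) (h' : u ≫ a = u ≫ b) :
    a = b :=
  ext_of_dominant u (π.app n).fromNormalization a b h h'

lemma IsCover.mono (h : IsCover π O) (n) : Mono ((normOSTo π).app n) := by
  obtain ⟨c, hc⟩ := h.isPullback n
  exact hc.mono_fst_of_mono

lemma IsCover.exists_lift (h : IsCover π O) {n} {T : Scheme.{u}} (a : T ⟶ (normOS π).obj n)
    (ha : ∀ x, (a ≫ (normOSProj π).app n) x ∈ O n) :
    ∃ b : T ⟶ C.obj n, b ≫ (normOSTo π).app n = a := by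
  obtain ⟨c, hc⟩ := h.isPullback n
  have hO : Set.range (a ≫ (normOSProj π).app n) ⊆ Set.range (O n).ι := by
    rw [Opens.range_ι]
    rintro _ ⟨x, rfl⟩
    exact ha x
  exact ⟨hc.lift a (IsOpenImmersion.lift (O n).ι _ hO) (IsOpenImmersion.lift_fac (O n).ι _ hO).symm, hc.lift_fst _ _ _⟩

lemma IsNormalIn.dominant {X Y : Scheme.{u}} {j : X ⟶ Y} (h : IsNormalIn j) : IsSchemeTheoreticallyDominant j := by
  have := h.quasiCompact
  have := h.quasiSeparated
  have := h.isIso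
  rw [← toNormalization_fromNormalization j]
  infer_instance

lemma IsCover.dominant (h : IsCover π O) {n} {T : Scheme.{u}} (t : T ⟶ P.obj n) [Smooth t] :
    IsSchemeTheoreticallyDominant (t ⁻¹ᵁ O n).ι :=
  ((h.isNormalIn n).preimage t).dominant

/-- Over a smooth base, sections of the covering extend to the étale locus of the normalization. -/
lemma IsCover.exists_section (h : IsCover π O) {n} {T : Scheme.{u}} (t : T ⟶ P.obj n) [Smooth t]
    (b : (t ⁻¹ᵁ O n).toScheme ⟶ C.obj n) (hb : b ≫ π.app n = (t ⁻¹ᵁ O n).ι ≫ t) :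
    ∃ s : T ⟶ (normOS π).obj n, s ≫ (normOSProj π).app n = t ∧ (t ⁻¹ᵁ O n).ι ≫ s = b ≫ (normOSTo π).app n ∧
      ∀ x, s x ∈ etaleLocus ((normOSProj π).app n) := by
  have := h.isLocallyNoetherian n
  obtain ⟨c, h1, h2, hc⟩ := h.exists_fac n
  exact exists_section_etaleLocus (π.app n) (O n) (h.isNormalIn n) c hc t b hb

lemma IsCover.mem_iff (h : IsCover π O) {n n'} (f : n ⟶ n') (x : P.obj n) : P.map f x ∈ O n' ↔ x ∈ O n := by
  rw [← h.preimage f]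
  rfl

/-- A smooth base with a morphism to the normalization has image in the étale locus. -/
lemma IsCover.mem_etaleLocus (h : IsCover π O) {n} {T : Scheme.{u}} (a : T ⟶ (normOS π).obj n)
    (ha : Smooth (a ≫ (normOSProj π).app n)) (x : T) : a x ∈ etaleLocus ((normOSProj π).app n) := by
  let w := a ≫ (normOSProj π).app n
  obtain ⟨b, hb⟩ := h.exists_lift ((w ⁻¹ᵁ O n).ι ≫ a) (fun ⟨y, hy⟩ ↦ by
    rw [Category.assoc]
    exact hy)
  have hb' : b ≫ π.app n = (w ⁻¹ᵁ O n).ι ≫ w := by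
    rw [← normOSTo_app_proj, reassoc_of% hb]
  obtain ⟨s, hs1, hs2, hs⟩ := h.exists_section w b hb'
  have e : s = a := normOS_ext (w ⁻¹ᵁ O n).ι (h.dominant w) hs1 (hs2.trans hb)
  rw [← e]
  exact hs x

variable {l m n : ℕ} {a : OSimp.mk 0 ⟶ OSimp.mk m} {b : OSimp.mk 0 ⟶ OSimp.mk l}
    {c : OSimp.mk m ⟶ OSimp.mk n} {d : OSimp.mk l ⟶ OSimp.mk n}

/-- The normalization inherits from the covering the gluing of points with values in smooth schemes. -/
lemma IsCover.exists_glue (h : IsCover π O) (hp : IsPushout a b c d) {T : Scheme.{u}}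
    (x : T ⟶ (normOS π).obj (.op ⟨m⟩)) (y : T ⟶ (normOS π).obj (.op ⟨l⟩)) (t : T ⟶ P.obj (.op ⟨n⟩)) [Smooth t]
    (hx : x ≫ (normOSProj π).app _ = t ≫ P.map c.op) (hy : y ≫ (normOSProj π).app _ = t ≫ P.map d.op) :
    ∃ z : T ⟶ (normOS π).obj (.op ⟨n⟩), z ≫ (normOS π).map c.op = x ∧ z ≫ (normOS π).map d.op = y ∧
      z ≫ (normOSProj π).app _ = t := by
  let u : (t ⁻¹ᵁ O (.op ⟨n⟩)).toScheme ⟶ T := (t ⁻¹ᵁ O (.op ⟨n⟩)).ι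
  have hd : IsSchemeTheoreticallyDominant u := h.dominant t
  have hu (y) : t (u y) ∈ O (.op ⟨n⟩) := y.2
  have key (k) (f : OSimp.mk k ⟶ OSimp.mk n) (x : T ⟶ (normOS π).obj (.op ⟨k⟩))
      (hx : x ≫ (normOSProj π).app _ = t ≫ P.map f.op) : ∃ x₀ : _ ⟶ C.obj (.op ⟨k⟩), x₀ ≫ (normOSTo π).app _ = u ≫ x := by
    refine h.exists_lift (u ≫ x) fun y ↦ ?_
    rw [Category.assoc, hx, ← Category.assoc]
    exact (h.mem_iff f.op _).mpr (hu y)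
  obtain ⟨x₀, hx₀⟩ := key m c x hx
  obtain ⟨y₀, hy₀⟩ := key l d y hy
  obtain ⟨z₀, hz1, hz2, hz3⟩ := h.isMultiplicativeHom.exists_lift hp x₀ y₀ (u ≫ t)
    (by rw [← normOSTo_app_proj, reassoc_of% hx₀, Category.assoc, hx])
    (by rw [← normOSTo_app_proj, reassoc_of% hy₀, Category.assoc, hy])
  obtain ⟨s, hs1, hs2, -⟩ := h.exists_section t z₀ hz3
  refine ⟨s, normOS_ext u hd ?_ ?_, normOS_ext u hd ?_ ?_, hs1⟩
  · rw [Category.assoc, NatTrans.naturality, reassoc_of% hs1, hx]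
  · rw [reassoc_of% hs2, ← NatTrans.naturality, reassoc_of% hz1, hx₀]
  · rw [Category.assoc, NatTrans.naturality, reassoc_of% hs1, hy]
  · rw [reassoc_of% hs2, ← NatTrans.naturality, reassoc_of% hz2, hy₀]

/-- Points with values in a scheme which is smooth over a term of `P` are determined by their components. -/
lemma IsCover.glue_ext (h : IsCover π O) (hp : IsPushout a b c d) {T : Scheme.{u}}
    {z z' : T ⟶ (normOS π).obj (.op ⟨n⟩)} (h1 : z ≫ (normOS π).map c.op = z' ≫ (normOS π).map c.op)
    (h2 : z ≫ (normOS π).map d.op = z' ≫ (normOS π).map d.op)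
    (h3 : z ≫ (normOSProj π).app _ = z' ≫ (normOSProj π).app _) {k} (t : T ⟶ P.obj k) [Smooth t] (f : k ⟶ .op ⟨n⟩)
    (ht : z ≫ (normOSProj π).app _ = t ≫ P.map f) : z = z' := by
  let u : (t ⁻¹ᵁ O k).toScheme ⟶ T := (t ⁻¹ᵁ O k).ι
  have hu (y) : t (u y) ∈ O k := y.2
  refine normOS_ext u (h.dominant t) h3 ?_
  have hr (z : T ⟶ (normOS π).obj (.op ⟨n⟩)) (hz : z ≫ (normOSProj π).app _ = t ≫ P.map f) :
      ∃ b : _ ⟶ C.obj (.op ⟨n⟩), b ≫ (normOSTo π).app _ = u ≫ z := by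
    refine h.exists_lift (u ≫ z) fun y ↦ ?_
    rw [Category.assoc, hz, ← Category.assoc]
    exact (h.mem_iff f _).mpr (hu y)
  obtain ⟨b, hb⟩ := hr z ht
  obtain ⟨b', hb'⟩ := hr z' (h3.symm.trans ht)
  have key (k) (f : OSimp.mk k ⟶ OSimp.mk n) (e : z ≫ (normOS π).map f.op = z' ≫ (normOS π).map f.op) :
      b ≫ C.map f.op = b' ≫ C.map f.op := by
    have := h.mono (.op ⟨k⟩)
    rw [← cancel_mono ((normOSTo π).app (.op ⟨k⟩)), Category.assoc, Category.assoc, NatTrans.naturality,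
      reassoc_of% hb, reassoc_of% hb', e]
  have : b = b' := by
    refine h.isMultiplicativeHom.hom_ext hp (key _ c h1) (key _ d h2) ?_
    rw [← normOSTo_app_proj, reassoc_of% hb, reassoc_of% hb', h3]
  rw [← hb, ← hb', this]

/-- Up to a permutation, an injection is an initial segment, hence a composition of edge gluings. -/
lemma IsCover.smooth_map (h : IsCover π O) (f : OSimp.mk m ⟶ OSimp.mk n) (hf : Function.Injective f) :
    Smooth (P.map f.op) := by
  obtain ⟨k, rfl⟩ : ∃ k, n = m + k := by
    have := Fintype.card_le_of_injective _ hf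
    simp only [Fintype.card_fin] at this
    exact ⟨n - m, by omega⟩
  have key (k : ℕ) : ∃ g : OSimp.mk m ⟶ OSimp.mk (m + k), Function.Injective g ∧ Smooth (P.map g.op) := by
    induction k with
    | zero =>
      have e : P.map (𝟙 (OSimp.mk m)).op = 𝟙 _ := P.map_id _
      have : Smooth (P.map (𝟙 (OSimp.mk m)).op) := by rw [e]; infer_instance
      exact ⟨𝟙 _, Function.injective_id, this⟩
    | succ k ih =>
      obtain ⟨g, hg, hs⟩ := ih
      have := h.smooth_map_succ (m + k)
      exact ⟨g ≫ OSimp.succ (m + k), (Fin.castSucc_injective _).comp hg, by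
        rw [op_comp, P.map_comp]; infer_instance⟩
  obtain ⟨g, hg, hs⟩ := key k
  obtain ⟨σ, hσ⟩ : ∃ σ : Equiv.Perm (Fin (m + k + 1)), ∀ j, σ (g j) = f j := by
    classical
    let e : {x // x ∈ Set.range g} ≃ {x // x ∈ Set.range f} :=
      (Equiv.ofInjective _ hg).symm.trans (Equiv.ofInjective _ hf)
    refine ⟨e.extendSubtype, fun j ↦ ?_⟩
    rw [Equiv.extendSubtype_apply_of_mem e _ ⟨j, rfl⟩]
    change (Equiv.ofInjective _ hf ((Equiv.ofInjective _ hg).symm ⟨g j, _⟩) : Fin _) = f j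
    have : (Equiv.ofInjective _ hg).symm ⟨g j, ⟨j, rfl⟩⟩ = j := Equiv.ofInjective_symm_apply hg j
    rw [this]
    rfl
  have : f = g ≫ (OSimp.perm σ).hom := OSimp.hom_ext fun j ↦ (hσ j).symm
  rw [this, op_comp, P.map_comp]
  infer_instance

end Cover

/-! ### Stability and multiplicativity of the étale loci -/

section Stable

variable {C P : OS Scheme.{u}} {π : C ⟶ P} {O : ∀ n, (P.obj n).Opens} [∀ n, QuasiCompact (π.app n)]
  [∀ n, QuasiSeparated (π.app n)]

/-- The étale loci of the relative normalizations. -/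
def etaleOpens (π : C ⟶ P) [∀ n, QuasiCompact (π.app n)] [∀ n, QuasiSeparated (π.app n)] (n) :
    ((normOS π).obj n).Opens := etaleLocus ((normOSProj π).app n)

instance (n) : Etale ((etaleOpens π n).ι ≫ (normOSProj π).app n) := etale_etaleLocus _

/-- The transition morphism attached to `f` preserves the étale loci. -/
def IsStable (π : C ⟶ P) [∀ n, QuasiCompact (π.app n)] [∀ n, QuasiSeparated (π.app n)] {m n : ℕ}
    (f : OSimp.mk m ⟶ OSimp.mk n) : Prop :=
  ∀ x ∈ etaleOpens π (.op ⟨n⟩), (normOS π).map f.op x ∈ etaleOpens π (.op ⟨m⟩)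

variable {l m n : ℕ}

lemma IsStable.comp {f : OSimp.mk l ⟶ OSimp.mk m} {g : OSimp.mk m ⟶ OSimp.mk n} (hf : IsStable π f)
    (hg : IsStable π g) : IsStable π (f ≫ g) := fun x hx ↦ by
  have h := hf _ (hg x hx)
  rw [op_comp, (normOS π).map_comp]
  exact h

lemma isStable_id : IsStable π (𝟙 (OSimp.mk n)) := fun x hx ↦ by
  have : (normOS π).map (𝟙 (OSimp.mk n)).op = 𝟙 _ := (normOS π).map_id _
  rw [this]
  exact hx

lemma IsCover.mem_etaleOpens (h : IsCover π O) {n} {T : Scheme.{u}} (a : T ⟶ (normOS π).obj n)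
    (ha : Smooth (a ≫ (normOSProj π).app n)) (x : T) : a x ∈ etaleOpens π n := h.mem_etaleLocus a ha x

lemma IsCover.exists_lift_etaleOpens (h : IsCover π O) {n} {T : Scheme.{u}} (a : T ⟶ (normOS π).obj n)
    (ha : ∀ x, a x ∈ etaleOpens π n) : ∃ b : T ⟶ (etaleOpens π n).toScheme, b ≫ (etaleOpens π n).ι = a := by
  have hO : Set.range a ⊆ Set.range (etaleOpens π n).ι := by
    rw [Opens.range_ι]
    rintro _ ⟨x, rfl⟩
    exact ha x
  exact ⟨IsOpenImmersion.lift (etaleOpens π n).ι _ hO, IsOpenImmersion.lift_fac _ _ _⟩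

/-- Restriction to a face is smooth on the base, and smooth schemes map into the étale locus. -/
lemma IsCover.isStable_of_injective (h : IsCover π O) (f : OSimp.mk m ⟶ OSimp.mk n) (hf : Function.Injective f) :
    IsStable π f := fun x hx ↦ by
  have := h.smooth_map f hf
  refine h.mem_etaleOpens ((etaleOpens π (.op ⟨n⟩)).ι ≫ (normOS π).map f.op) ?_ ⟨x, hx⟩
  rw [Category.assoc, NatTrans.naturality, ← Category.assoc]
  infer_instance

/-- The fibre product of two étale schemes over the base of a cocartesian square. -/
lemma exists_prod {P : OS Scheme.{u}} (c : OSimp.mk m ⟶ OSimp.mk n) (d : OSimp.mk l ⟶ OSimp.mk n) {A B : Scheme.{u}}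
    (α : A ⟶ P.obj (.op ⟨m⟩)) (β : B ⟶ P.obj (.op ⟨l⟩)) [Etale α] [Etale β] :
    ∃ (F : Scheme.{u}) (x : F ⟶ A) (y : F ⟶ B) (t : F ⟶ P.obj (.op ⟨n⟩)), Etale t ∧ x ≫ α = t ≫ P.map c.op ∧
      y ≫ β = t ≫ P.map d.op ∧
      (∀ (T : Scheme.{u}) (x' : T ⟶ A) (y' : T ⟶ B) (t' : T ⟶ P.obj (.op ⟨n⟩)), x' ≫ α = t' ≫ P.map c.op →
        y' ≫ β = t' ≫ P.map d.op → ∃ i : T ⟶ F, i ≫ x = x' ∧ i ≫ y = y' ∧ i ≫ t = t') ∧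
      (∀ (T : Scheme.{u}) (i i' : T ⟶ F), i ≫ x = i' ≫ x → i ≫ y = i' ≫ y → i ≫ t = i' ≫ t → i = i') := by
  let A' := pullback α (P.map c.op)
  let B' := pullback β (P.map d.op)
  let a : A' ⟶ P.obj (.op ⟨n⟩) := pullback.snd _ _
  let b : B' ⟶ P.obj (.op ⟨n⟩) := pullback.snd _ _
  have ha : Etale a := inferInstanceAs (Etale (pullback.snd _ _))
  have hb : Etale b := inferInstanceAs (Etale (pullback.snd _ _))
  refine ⟨pullback a b, pullback.fst a b ≫ pullback.fst _ _, pullback.snd a b ≫ pullback.fst _ _,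
    pullback.fst a b ≫ a, inferInstance, ?_, ?_, ?_, ?_⟩
  · rw [Category.assoc, Category.assoc, pullback.condition]
  · rw [pullback.condition, Category.assoc, Category.assoc, pullback.condition]
  · intro T x' y' t' hx hy
    let u : T ⟶ A' := pullback.lift x' t' hx
    let v : T ⟶ B' := pullback.lift y' t' hy
    have hu : u ≫ pullback.fst _ _ = x' := pullback.lift_fst _ _ _
    have hu' : u ≫ a = t' := pullback.lift_snd _ _ _
    have hv : v ≫ pullback.fst _ _ = y' := pullback.lift_fst _ _ _
    have hv' : v ≫ b = t' := pullback.lift_snd _ _ _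
    refine ⟨pullback.lift u v (hu'.trans hv'.symm), ?_, ?_, ?_⟩
    · rw [pullback.lift_fst_assoc, hu]
    · rw [pullback.lift_snd_assoc, hv]
    · rw [pullback.lift_fst_assoc, hu']
  · intro T i i' h1 h2 h3
    have h4 : i ≫ pullback.snd a b ≫ b = i' ≫ pullback.snd a b ≫ b := by rwa [← pullback.condition]
    refine pullback.hom_ext (pullback.hom_ext ?_ ?_) (pullback.hom_ext ?_ ?_)
    · simpa only [Category.assoc] using h1
    · rw [Category.assoc, Category.assoc]
      exact h3
    · simpa only [Category.assoc] using h2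
    · rw [Category.assoc, Category.assoc]
      exact h4

/-- The retraction of `[0, N]` in `[0, N + 1]` sending the last vertex to `v`. -/
def OSimp.retract {N : ℕ} (v : Fin (N + 1)) : OSimp.mk (N + 1) ⟶ OSimp.mk N :=
  (Fin.lastCases v id : Fin (N + 2) → Fin (N + 1))

lemma OSimp.succ_retract {N : ℕ} (v : Fin (N + 1)) : OSimp.succ N ≫ OSimp.retract v = 𝟙 _ :=
  OSimp.hom_ext fun j ↦ Fin.lastCases_castSucc (motive := fun _ ↦ Fin (N + 1)) j

lemma OSimp.retract_last {N : ℕ} (v : Fin (N + 1)) : OSimp.retract v (Fin.last (N + 1)) = v :=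
  Fin.lastCases_last (motive := fun _ ↦ Fin (N + 1))

lemma OSimp.edge_retract {N : ℕ} (v : Fin (N + 1)) :
    OSimp.edge v.castSucc (Fin.last _) ≫ OSimp.retract v = OSimp.toPt 1 ≫ OSimp.pt v :=
  OSimp.hom_ext fun j : Fin 2 ↦ by
    fin_cases j
    · exact congrFun (OSimp.succ_retract v) v
    · exact OSimp.retract_last v

/-- An étale point of the normalization over a degenerate simplex is degenerate, since it is glued from its face and from a degenerate
edge, and degenerate edges are étale points by the bound on the ramification. -/
lemma IsCover.isStable_retract (h : IsCover π O)
    (hb : ∀ x, (normOS π).map (OSimp.toPt 1).op x ∈ etaleOpens π (.op ⟨1⟩)) {N : ℕ} (v : Fin (N + 1)) :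
    IsStable π (OSimp.retract v) := fun x hx ↦ by
  let W := etaleOpens π (.op ⟨N⟩)
  let W₁ := etaleOpens π (.op ⟨1⟩)
  let c := OSimp.succ N
  let d : OSimp.mk 1 ⟶ OSimp.mk (N + 1) := OSimp.edge v.castSucc (Fin.last _)
  obtain ⟨F, xF, yF, t, ht, hx', hy', hex, -⟩ := exists_prod (P := P) c d
    (W.ι ≫ (normOSProj π).app _) (W₁.ι ≫ (normOSProj π).app _)
  obtain ⟨z, hz1, hz2, hz3⟩ := h.exists_glue (isPushout_edge v) (xF ≫ W.ι) (yF ≫ W₁.ι) t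
    (by rw [Category.assoc]; exact hx') (by rw [Category.assoc]; exact hy')
  obtain ⟨y, hy⟩ := h.exists_lift_etaleOpens
    ((W.ι ≫ (normOS π).map (OSimp.pt v).op) ≫ (normOS π).map (OSimp.toPt 1).op) (fun x ↦ hb _)
  have hyd : y ≫ W₁.ι = W.ι ≫ (normOS π).map (OSimp.retract v).op ≫ (normOS π).map d.op := by
    rw [hy, Category.assoc, ← Functor.map_comp, ← Functor.map_comp, ← op_comp, ← op_comp]
    exact congr(W.ι ≫ (normOS π).map (Quiver.Hom.op $((OSimp.edge_retract v).symm)))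
  have hid : (normOS π).map (OSimp.retract v).op ≫ (normOS π).map c.op = 𝟙 _ := by
    rw [← Functor.map_comp, ← op_comp, OSimp.succ_retract]
    exact (normOS π).map_id _
  have hid' : P.map (OSimp.retract v).op ≫ P.map c.op = 𝟙 _ := by
    rw [← Functor.map_comp, ← op_comp, OSimp.succ_retract]
    exact P.map_id _
  obtain ⟨i, hi1, hi2, hi3⟩ := hex W (𝟙 _) y (W.ι ≫ (normOSProj π).app _ ≫ P.map (OSimp.retract v).op)
    (by rw [Category.assoc, Category.assoc, hid', Category.comp_id, Category.id_comp])
    (by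
      rw [reassoc_of% hyd, NatTrans.naturality]
      simp only [Category.assoc, NatTrans.naturality_assoc])
  have e : i ≫ z = W.ι ≫ (normOS π).map (OSimp.retract v).op := by
    refine h.glue_ext (isPushout_edge v) ?_ ?_ ?_ (W.ι ≫ (normOSProj π).app _) (OSimp.retract v).op ?_
    · rw [Category.assoc, Category.assoc, hz1, reassoc_of% hi1, hid, Category.comp_id]
    · rw [Category.assoc, Category.assoc, hz2, reassoc_of% hi2, hyd]
    · rw [Category.assoc, Category.assoc, hz3, hi3, NatTrans.naturality]
    · rw [Category.assoc, hz3, hi3, Category.assoc]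
  have : (i ≫ z) (⟨x, hx⟩ : W.toScheme) ∈ etaleOpens π _ :=
    h.mem_etaleOpens z (by rw [hz3]; infer_instance) (i ⟨x, hx⟩)
  rw [e] at this
  exact this

/-- A retraction is a composition of retractions of one vertex each. -/
lemma IsCover.isStable_of_retraction (h : IsCover π O)
    (hb : ∀ x, (normOS π).map (OSimp.toPt 1).op x ∈ etaleOpens π (.op ⟨1⟩)) (k : ℕ)
    (f : OSimp.mk (n + k) ⟶ OSimp.mk n) (hf : ∀ j : Fin (n + 1), f (⟨j, by omega⟩ : Fin (n + k + 1)) = j) :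
    IsStable π f := by
  induction k with
  | zero =>
    have : f = 𝟙 _ := OSimp.hom_ext fun j ↦ hf j
    rw [this]
    exact isStable_id
  | succ k ih =>
    let v : Fin (n + k + 1) := ⟨(f (Fin.last (n + k + 1)) : Fin (n + 1)),
      (Fin.is_lt (n := n + 1) (f (Fin.last (n + k + 1)))).trans_le (by omega)⟩
    have : f = OSimp.retract v ≫ OSimp.succ (n + k) ≫ f := OSimp.hom_ext fun j : Fin (n + k + 2) ↦ by
      change f j = f (Fin.castSucc (OSimp.retract v j : Fin (n + k + 1)))
      induction j using Fin.lastCases with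
      | last =>
        rw [OSimp.retract_last]
        exact (hf (f (Fin.last (n + k + 1)))).symm
      | cast j => exact congr(f (Fin.castSucc $((congrFun (OSimp.succ_retract v) j).symm)))
    rw [this]
    exact (h.isStable_retract hb v).comp (ih _ fun j ↦ hf j)

/-- Any map factors as an injection followed by a retraction of a larger simplex. -/
lemma IsCover.isStable (h : IsCover π O)
    (hb : ∀ x, (normOS π).map (OSimp.toPt 1).op x ∈ etaleOpens π (.op ⟨1⟩)) (f : OSimp.mk m ⟶ OSimp.mk n) :
    IsStable π f := by
  let g : OSimp.mk m ⟶ OSimp.mk (n + (m + 1)) := fun j : Fin (m + 1) ↦ (⟨n + 1 + j, by omega⟩ : Fin (n + (m + 1) + 1))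
  let k : OSimp.mk (n + (m + 1)) ⟶ OSimp.mk n := fun j : Fin (n + (m + 1) + 1) ↦
    (if hj : (j : ℕ) < n + 1 then ⟨j, hj⟩ else f (⟨j - (n + 1), by omega⟩ : Fin (m + 1)) : Fin (n + 1))
  have hg : Function.Injective g := fun i j hij ↦ by
    have := congr(Fin.val $hij)
    simp only [g] at this
    exact Fin.ext (by omega)
  have hk : ∀ j : Fin (n + 1), k (⟨j, by omega⟩ : Fin (n + (m + 1) + 1)) = j := fun j ↦ dif_pos j.2
  have : f = g ≫ k := OSimp.hom_ext fun j ↦ by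
    change _ = k (g j)
    have : ¬ (n + 1 + (j : Fin (m + 1)).1 < n + 1) := by omega
    simp only [k, g]
    rw [dif_neg this]
    congr 1
    exact Fin.ext (by simp)
  rw [this]
  exact (h.isStable_of_injective g hg).comp (h.isStable_of_retraction hb _ k hk)

lemma IsCover.etaleOpens_le (h : IsCover π O)
    (hb : ∀ x, (normOS π).map (OSimp.toPt 1).op x ∈ etaleOpens π (.op ⟨1⟩)) ⦃c d : OSimpᵒᵖ⦄ (g : c ⟶ d) :
    etaleOpens π c ≤ (normOS π).map g ⁻¹ᵁ etaleOpens π d :=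
  h.isStable hb (m := d.unop.len) (n := c.unop.len) g.unop

variable (hW : ∀ ⦃c d : OSimpᵒᵖ⦄ (g : c ⟶ d), etaleOpens π c ≤ (normOS π).map g ⁻¹ᵁ etaleOpens π d)

/-- The étale loci, over the base. -/
def etaleProj : openOS (etaleOpens π) hW ⟶ P := openOSι (etaleOpens π) hW ≫ normOSProj π

lemma etale_etaleProj (n) : Etale ((etaleProj hW).app n) := etale_etaleLocus _

lemma openOSι_map {c d : OSimpᵒᵖ} (g : c ⟶ d) :
    (openOS (etaleOpens π) hW).map g ≫ (openOSι (etaleOpens π) hW).app d =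
      (openOSι (etaleOpens π) hW).app c ≫ (normOS π).map g := NatTrans.naturality _ _

/-- The fibre product of two étale loci is étale over `P_n`, so that its points glue in the normalization, and the glued point lies in the étale
locus. -/
lemma IsCover.isMultiplicativeHom_etaleProj (h : IsCover π O) : IsMultiplicativeHom (etaleProj hW) := by
  let ω := openOSι (etaleOpens π) hW
  have hω (n) : Mono (ω.app n) := inferInstanceAs (Mono (etaleOpens π n).ι)
  have hq (n) : (etaleProj hW).app n = ω.app n ≫ (normOSProj π).app n := rfl
  have key : ∀ ⦃l m n : ℕ⦄ (a : OSimp.mk 0 ⟶ OSimp.mk m) (b : OSimp.mk 0 ⟶ OSimp.mk l)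
      (c : OSimp.mk m ⟶ OSimp.mk n) (d : OSimp.mk l ⟶ OSimp.mk n), IsPushout a b c d →
      ∃ (F : Scheme.{u}) (x : F ⟶ (openOS (etaleOpens π) hW).obj (.op ⟨m⟩))
      (y : F ⟶ (openOS (etaleOpens π) hW).obj (.op ⟨l⟩)) (t : F ⟶ P.obj (.op ⟨n⟩))
      (z : F ⟶ (openOS (etaleOpens π) hW).obj (.op ⟨n⟩)) (i : (openOS (etaleOpens π) hW).obj (.op ⟨n⟩) ⟶ F),
      z ≫ (openOS (etaleOpens π) hW).map c.op = x ∧ z ≫ (openOS (etaleOpens π) hW).map d.op = y ∧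
      z ≫ (etaleProj hW).app _ = t ∧ i ≫ z = 𝟙 _ ∧
      (∀ (T : Scheme.{u}) (x' : T ⟶ (openOS (etaleOpens π) hW).obj (.op ⟨m⟩))
        (y' : T ⟶ (openOS (etaleOpens π) hW).obj (.op ⟨l⟩)) (t' : T ⟶ P.obj (.op ⟨n⟩)),
        x' ≫ (etaleProj hW).app _ = t' ≫ P.map c.op →
        y' ≫ (etaleProj hW).app _ = t' ≫ P.map d.op → ∃ i : T ⟶ F, i ≫ x = x' ∧ i ≫ y = y' ∧ i ≫ t = t') ∧
      (∀ (T : Scheme.{u}) (i i' : T ⟶ F), i ≫ x = i' ≫ x → i ≫ y = i' ≫ y → i ≫ t = i' ≫ t → i = i') := by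
    intro l m n a b c d hp
    have := etale_etaleProj hW (.op ⟨m⟩)
    have := etale_etaleProj hW (.op ⟨l⟩)
    have := etale_etaleProj hW (.op ⟨n⟩)
    obtain ⟨F, x, y, t, ht, hx, hy, hex, hu⟩ := exists_prod (P := P) c d ((etaleProj hW).app _) ((etaleProj hW).app _)
    obtain ⟨z, hz1, hz2, hz3⟩ := h.exists_glue hp (x ≫ ω.app _) (y ≫ ω.app _) t
      (by rw [Category.assoc, ← hq, hx]) (by rw [Category.assoc, ← hq, hy])
    obtain ⟨z', hz'⟩ : ∃ z' : F ⟶ (openOS (etaleOpens π) hW).obj (.op ⟨n⟩), z' ≫ ω.app _ = z :=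
      h.exists_lift_etaleOpens z (h.mem_etaleOpens z (by rw [hz3]; infer_instance))
    have e1 : z' ≫ (openOS (etaleOpens π) hW).map c.op = x := by
      rw [← cancel_mono (ω.app _), Category.assoc, openOSι_map, reassoc_of% hz', hz1]
    have e2 : z' ≫ (openOS (etaleOpens π) hW).map d.op = y := by
      rw [← cancel_mono (ω.app _), Category.assoc, openOSι_map, reassoc_of% hz', hz2]
    have e3 : z' ≫ (etaleProj hW).app _ = t := by rw [hq, reassoc_of% hz', hz3]
    obtain ⟨i, hi1, hi2, hi3⟩ := hex _ ((openOS (etaleOpens π) hW).map c.op) ((openOS (etaleOpens π) hW).map d.op)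
      ((etaleProj hW).app _) ((etaleProj hW).naturality _) ((etaleProj hW).naturality _)
    refine ⟨F, x, y, t, z', i, e1, e2, e3, ?_, hex, hu⟩
    rw [← cancel_mono (ω.app _), Category.assoc, hz', Category.id_comp]
    refine h.glue_ext hp ?_ ?_ ?_ ((etaleProj hW).app _) (𝟙 _) ?_
    · rw [Category.assoc, hz1, reassoc_of% hi1, openOSι_map]
    · rw [Category.assoc, hz2, reassoc_of% hi2, openOSι_map]
    · rw [Category.assoc, hz3, hi3, hq]
    · rw [Category.assoc, hz3, hi3, P.map_id, Category.comp_id]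
  refine isMultiplicativeHom_of ?_ ?_
  · intro l m n a b c d hp T x' y' t' hx hy
    obtain ⟨F, x, y, t, z, i, h1, h2, h3, -, hex, -⟩ := key a b c d hp
    obtain ⟨j, hj1, hj2, hj3⟩ := hex T x' y' t' hx hy
    exact ⟨j ≫ z, by rw [Category.assoc, h1, hj1], by rw [Category.assoc, h2, hj2], by rw [Category.assoc, h3, hj3]⟩
  · intro l m n a b c d hp T w w' e1 e2 e3
    obtain ⟨F, x, y, t, z, i, h1, h2, h3, hi, hex, hu⟩ := key a b c d hp
    have : w ≫ i = w' ≫ i := by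
      refine hu T _ _ ?_ ?_ ?_
      · rw [← h1, Category.assoc, Category.assoc, reassoc_of% hi, e1]
      · rw [← h2, Category.assoc, Category.assoc, reassoc_of% hi, e2]
      · rw [← h3, Category.assoc, Category.assoc, reassoc_of% hi, e3]
    rw [← Category.comp_id w, ← Category.comp_id w', ← hi, reassoc_of% this]

lemma IsCover.isIso_normOSProj_zero (h : IsCover π O) : IsIso ((normOSProj π).app (.op ⟨0⟩)) := by
  obtain ⟨c, hc, hc'⟩ := h.exists_fac_zero
  have := (h.isNormalIn (.op ⟨0⟩)).comp_left c
  rw [hc'] at this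
  exact this.isIso

lemma IsCover.isIso_etaleProj_zero (h : IsCover π O) : IsIso ((etaleProj hW).app (.op ⟨0⟩)) := by
  have := h.isIso_normOSProj_zero
  have htop : etaleOpens π (.op ⟨0⟩) = ⊤ := top_le_iff.mp fun x _ ↦
    h.mem_etaleOpens (𝟙 _) (by rw [Category.id_comp]; infer_instance) x
  have hι (U : ((normOS π).obj (.op ⟨0⟩)).Opens) (hU : U = ⊤) : IsIso U.ι := by
    subst hU
    exact inferInstanceAs (IsIso (Scheme.topIso _).hom)
  have := hι _ htop
  exact inferInstanceAs (IsIso ((etaleOpens π (.op ⟨0⟩)).ι ≫ (normOSProj π).app (.op ⟨0⟩)))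

end Stable

/-! ### Base change to the boundary -/

section BaseChange

variable {T P W : OS Scheme.{u}} (j : T ⟶ P) (φ : W ⟶ P)

lemma isPullback_pbOS (n) : IsPullback ((pbOSFst j φ).app n) ((pbOSSnd j φ).app n) (j.app n) (φ.app n) :=
  .of_hasPullback _ _

/-- Multiplicativity is stable under base change. -/
lemma IsMultiplicativeHom.pbOS (h : IsMultiplicativeHom φ) : IsMultiplicativeHom (pbOSFst j φ) := by
  refine isMultiplicativeHom_of ?_ ?_
  · intro l m n a b c d hp E x y t hx hy
    obtain ⟨z, hz1, hz2, hz3⟩ := h.exists_lift hp (x ≫ (pbOSSnd j φ).app _) (y ≫ (pbOSSnd j φ).app _) (t ≫ j.app _)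
      (by rw [Category.assoc, ← (isPullback_pbOS j φ _).w, reassoc_of% hx, Category.assoc, j.naturality])
      (by rw [Category.assoc, ← (isPullback_pbOS j φ _).w, reassoc_of% hy, Category.assoc, j.naturality])
    have h1 := (isPullback_pbOS j φ (.op ⟨n⟩)).lift_fst t z hz3.symm
    have h2 := (isPullback_pbOS j φ (.op ⟨n⟩)).lift_snd t z hz3.symm
    refine ⟨(isPullback_pbOS j φ _).lift t z hz3.symm, ?_, ?_, h1⟩
    · refine (isPullback_pbOS j φ _).hom_ext ?_ ?_
      · rw [Category.assoc, (pbOSFst j φ).naturality, reassoc_of% h1, hx]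
      · rw [Category.assoc, (pbOSSnd j φ).naturality, reassoc_of% h2, hz1]
    · refine (isPullback_pbOS j φ _).hom_ext ?_ ?_
      · rw [Category.assoc, (pbOSFst j φ).naturality, reassoc_of% h1, hy]
      · rw [Category.assoc, (pbOSSnd j φ).naturality, reassoc_of% h2, hz2]
  · intro l m n a b c d hp E z z' h1 h2 h3
    refine (isPullback_pbOS j φ _).hom_ext h3 (h.hom_ext hp ?_ ?_ ?_)
    · rw [Category.assoc, Category.assoc, ← (pbOSSnd j φ).naturality, reassoc_of% h1]
    · rw [Category.assoc, Category.assoc, ← (pbOSSnd j φ).naturality, reassoc_of% h2]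
    · rw [Category.assoc, Category.assoc, ← (isPullback_pbOS j φ _).w, reassoc_of% h3]

lemma IsMultiplicativeHom.isStrictlyMultiplicative {Q P : OS Scheme.{u}} {φ : Q ⟶ P} (h : IsMultiplicativeHom φ)
    (hP : IsStrictlyMultiplicative P) (hmono : Mono (φ.app (.op ⟨0⟩))) : IsStrictlyMultiplicative Q where
  multiplicative := h.isMultiplicative hP.multiplicative hmono
  strict := by
    rw [← cancel_mono (φ.app (.op ⟨0⟩)), φ.naturality, φ.naturality, hP.strict]

end BaseChange

section Concrete

variable {S : Scheme.{u}} (X : Over S) {ι : Type u} [Fintype ι] [DecidableEq ι]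
  (D : ι → X.left.IdealSheafData) (hD : ∀ i, IsFG (D i)) (m : ι → ℕ) (r : ι → ℚ)
  {G : Type u} [Group G] [Finite G] {V : Scheme.{u}} (v : V ⟶ (complement X D).toScheme) [IsFinite v]
  (ρ : G →* Aut V) (hρ : ∀ g, (ρ g).hom ≫ v = v)

/-- The statement for a divisor with local coordinates, granted that the quotients of the powers of the torsor define a covering. -/
theorem main_of_isCover [Smooth X.hom] [IsSeparated X.hom] (hLP : IsLP D) (hm : ∀ i, 1 ≤ m i)
    (hc : ∀ x : X.left, ∃ c : Chart D, x ∈ Set.range c.j) (hmr : ∀ i, ∃ a : ℤ, m i * r i = a)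
    (hcov : IsCover (CPRMProj X D hD m r v ρ hρ) (fun n ↦ inner ((PRMCoord X D hD m r).app n)))
    (hbounded : IsBounded X D hD m r v ρ hρ) :
    ∃ hW : WRMStable X D hD m r v ρ hρ,
      IsStrictlyMultiplicative (ERM X D hD m r v ρ hρ hW) ∧
      (∀ n, Etale ((ERMProj X D hD m r v ρ hρ hW).app n)) ∧
      IsMultiplicativeHom (ERMProj X D hD m r v ρ hρ hW) ∧
      ∃ (_ : GrpObj (ERMGroup X D hD m r v ρ hρ hW))
        (_ : GrpObj (TRMGroup X D hD m r)),
        IsAssociated (ERM X D hD m r v ρ hρ hW)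
          (ERMToZM X D hD m r v ρ hρ hW) ∧
        IsAssociated (TRM X D hD m r) (TRMToZM X D hD m r) ∧
        Smooth (ERMGroup X D hD m r v ρ hρ hW).hom ∧
        Smooth (TRMGroup X D hD m r).hom ∧
        IsVectorBundle (TRMGroup X D hD m r) ∧
        Etale (ERMGroupHom X D hD m r v ρ hρ hW).left ∧
        IsMonHom (ERMGroupHom X D hD m r v ρ hρ hW) := by
  have := quasiCompact_CPRMProj X D hD m r v ρ hρ
  have := quasiSeparated_CPRMProj X D hD m r v ρ hρ
  obtain ⟨B, hB, hBE⟩ := hbounded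
  have hb : ∀ x, (normOS (CPRMProj X D hD m r v ρ hρ)).map (OSimp.toPt 1).op x ∈
      etaleOpens (CPRMProj X D hD m r v ρ hρ) (.op ⟨1⟩) := fun x ↦
    (le_sSup (show B ∈ {O | Etale (O.ι ≫ (QRMProj X D hD m r v ρ hρ).app (.op ⟨1⟩))} from hBE) :
      B ≤ etaleLocus _) (hB ⟨x, rfl⟩)
  have hW : WRMStable X D hD m r v ρ hρ := hcov.etaleOpens_le hb
  have hE (n) : Etale ((WRMProj X D hD m r v ρ hρ hW).app n) :=
    etale_etaleProj (π := CPRMProj X D hD m r v ρ hρ) hW n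
  have hM : IsMultiplicativeHom (WRMProj X D hD m r v ρ hρ hW) := hcov.isMultiplicativeHom_etaleProj hW
  have h0 : IsIso ((WRMProj X D hD m r v ρ hρ hW).app (.op ⟨0⟩)) := hcov.isIso_etaleProj_zero hW
  have hTS := isStrictlyMultiplicative_TRM hD m r hLP hm hc hmr
  have hEE (n) : Etale ((ERMProj X D hD m r v ρ hρ hW).app n) :=
    inferInstanceAs (Etale (pullback.fst _ ((WRMProj X D hD m r v ρ hρ hW).app n)))
  have hEM : IsMultiplicativeHom (ERMProj X D hD m r v ρ hρ hW) := hM.pbOS (TRMι X D hD m r) _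
  have hE0 : IsIso ((ERMProj X D hD m r v ρ hρ hW).app (.op ⟨0⟩)) :=
    inferInstanceAs (IsIso (pullback.fst _ ((WRMProj X D hD m r v ρ hρ hW).app _)))
  have hES : IsStrictlyMultiplicative (ERM X D hD m r v ρ hρ hW) :=
    hEM.isStrictlyMultiplicative hTS inferInstance
  have hTZ : IsIso (TRMToZM X D hD m r) := isIso_TRMToZM hD m r hLP hm
  have hEZ : IsIso (ERMToZM X D hD m r v ρ hρ hW) := inferInstance
  have hTsm := smooth_TRMGroup hD m r hLP hm hc
  refine ⟨hW, hES, hEE, hEM, hES.grpObj _, hTS.grpObj _, hES.isAssociated _, hTS.isAssociated _, ?_, hTsm, ?_,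
    hEE _, hES.isMonHom hTS _ _⟩
  · have h1 : Smooth (ERMGroupHom X D hD m r v ρ hρ hW).left := inferInstanceAs (Smooth ((ERMProj X D hD m r v ρ hρ hW).app (.op ⟨1⟩)))
    rw [← Over.w (ERMGroupHom X D hD m r v ρ hρ hW)]
    infer_instance
  · exact isVectorBundle (isBoundary_TRM hD m r) (isUniv_PRM hD r hLP hm) (bexpo_le_expo hm hmr) hc hTS _

end Concrete

/-! ### Normality from affine space -/

section NormalAffine

/-- A normal domain is integrally closed in its localizations. -/
lemma bijective_algebraMap_integralClosure {R B : Type*} [CommRing R] [IsDomain R] [IsIntegrallyClosed R] [CommRing B]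
    [Algebra R B] (f : R) (hf : f ≠ 0) [IsLocalization.Away f B] :
    Function.Bijective (algebraMap R (integralClosure R B)) := by
  have hle : Submonoid.powers f ≤ nonZeroDivisors R := powers_le_nonZeroDivisors_of_noZeroDivisors hf
  refine ⟨fun a b hab ↦ IsLocalization.injective B hle (congrArg Subtype.val hab), fun ⟨x, hx⟩ ↦ ?_⟩
  let K := FractionRing R
  let l : B →ₐ[R] K := IsLocalization.liftAlgHom (M := Submonoid.powers f) (f := Algebra.ofId R K) fun y ↦
    IsUnit.mk0 _ fun h0 ↦ nonZeroDivisors.ne_zero (hle y.2) (IsFractionRing.injective R K (h0.trans (map_zero _).symm))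
  obtain ⟨r, hr⟩ := IsIntegrallyClosed.isIntegral_iff.mp ((show IsIntegral R x from hx).map l)
  obtain ⟨⟨a, s⟩, ha⟩ := IsLocalization.surj (Submonoid.powers f) x
  refine ⟨r, Subtype.ext ?_⟩
  have h1 := congrArg l ha
  rw [map_mul, ← hr, l.commutes, l.commutes, ← map_mul] at h1
  have h2 := IsFractionRing.injective R K h1
  change algebraMap R B r = x
  refine (IsLocalization.map_units B s).mul_right_cancel ?_
  rw [ha, ← map_mul, h2]

/-- A normal affine integral scheme is integrally closed along its basic open subschemes. -/
lemma isNormalIn_basicOpen {Y : Scheme.{u}} [IsAffine Y] [IsDomain Γ(Y, ⊤)] [IsIntegrallyClosed Γ(Y, ⊤)] (f : Γ(Y, ⊤))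
    (hf : f ≠ 0) : IsNormalIn (Y.basicOpen f).ι := by
  have htop : IsAffineOpen (⊤ : Y.Opens) := isAffineOpen_top Y
  have hqc : QuasiCompact (Y.basicOpen f).ι := by
    have : IsAffine (Y.basicOpen f).toScheme := htop.basicOpen f
    infer_instance
  refine ⟨hqc, inferInstance, ?_⟩
  let j := (Y.basicOpen f).ι
  have hj : QuasiCompact j := hqc
  have : IsAffine j.normalization := isAffine_of_isAffineHom j.fromNormalization
  let R := Γ(Y, ⊤)
  let B := Γ((Y.basicOpen f).toScheme, j ⁻¹ᵁ ⊤)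
  let _ : Algebra R B := (j.app ⊤).hom.toAlgebra
  have : IsLocalization.Away f B := by
    have h1 := htop.isLocalization_basicOpen f
    let e₀ : Γ(Y, Y.basicOpen f) ≃+* B := (Y.basicOpen f).topIso.symm.commRingCatIsoToRingEquiv
    let e : Γ(Y, Y.basicOpen f) ≃ₐ[R] B := .ofRingEquiv (f := e₀) fun r ↦ by
      have h2 : Y.presheaf.map (homOfLE (Y.basicOpen_le f)).op ≫ (Y.basicOpen f).topIso.inv = j.app ⊤ := by
        simp only [j, Scheme.Opens.topIso_inv, Scheme.Opens.ι_app]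
        exact (Y.presheaf.map_comp _ _).symm
      exact congr($(h2).hom r)
    exact IsLocalization.isLocalization_of_algEquiv (Submonoid.powers f) e
  have hbot : Function.Bijective (algebraMap R (integralClosure R B)) := bijective_algebraMap_integralClosure f hf
  have happ : IsIso (j.fromNormalization.app ⊤) := by
    rw [fromNormalization_app j htop]
    have : IsIso (CommRingCat.ofHom (algebraMap R (integralClosure R B))) :=
      (ConcreteCategory.isIso_iff_bijective _).mpr hbot
    exact IsIso.comp_isIso' this inferInstance
  exact ((MorphismProperty.isomorphisms _).arrow_mk_iso_iff (arrowIsoSpecΓOfIsAffine j.fromNormalization)).mpr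
    (inferInstanceAs (IsIso (Spec.map (j.fromNormalization.app ⊤))))

/-- Affine space over a field is integrally closed along the complement of the coordinate hyperplanes. -/
lemma isNormalIn_inner_affineSpace {ι : Type u} [Fintype ι] (k : Type u) [Field k] :
    IsNormalIn (inner (AffineSpace.toSpecMvPoly ι (Spec (.of k)))).ι := by
  let Y := 𝔸(ι; Spec (.of k))
  let i : Y ≅ Spec (.of (MvPolynomial ι k)) := AffineSpace.SpecIso ι (.of k)
  have : IsAffine Y := .of_isIso i.hom
  let e : MvPolynomial ι k ≃+* Γ(Y, ⊤) :=
    ((ΓSpecIso (.of (MvPolynomial ι k))).symm ≪≫ (Scheme.Γ.mapIso i.op)).commRingCatIsoToRingEquiv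
  have : IsDomain Γ(Y, ⊤) := e.symm.toMulEquiv.isDomain _
  have : IsIntegrallyClosed Γ(Y, ⊤) := .of_equiv e
  let x : Y ⟶ Spec (coordRing ι) := AffineSpace.toSpecMvPoly ι (Spec (.of k))
  refine isNormalIn_basicOpen _ fun h0 ↦ ?_
  have h1 := mon_comp (toAff (𝟙 (Spec (.of k))) (vec fun _ : ι ↦ 1)) x (fun _ ↦ 1)
  change mon (toAff _ _ ≫ AffineSpace.toSpecMvPoly ι (Spec (.of k))) _ = _ at h1
  rw [toAff_coord] at h1
  have h2 : mon x (fun _ ↦ 1) = 0 := h0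
  rw [h2, map_zero] at h1
  have h3 : mon (vec fun _ : ι ↦ (1 : Γ(Spec (.of k), ⊤))) (fun _ ↦ 1) = 1 := by simp [mon, xc_vec]
  have : Nontrivial Γ(Spec (.of k), ⊤) := (ΓSpecIso (.of k)).commRingCatIsoToRingEquiv.toEquiv.nontrivial
  exact one_ne_zero (h3.symm.trans h1)

end NormalAffine

section Smooth

variable {S : Scheme.{u}} {X : Over S} {ι : Type u} [Fintype ι] [DecidableEq ι]
  {D : ι → X.left.IdealSheafData} {m e : ι → ℕ} {P : OS Scheme.{u}} {y : P ⟶ schPower X}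
  {ξ : ∀ n, P.obj n ⟶ Spec (coordRing ι)} {c : Chart D}

/-- The morphism from the first term of `P` to the affine space with coordinates `x_i` over the base. -/
def coordAff (y : P ⟶ schPower X) (ξ : ∀ n, P.obj n ⟶ Spec (coordRing ι)) : P.obj (.op ⟨0⟩) ⟶ 𝔸(ι; S) :=
  toAff (y.app (.op ⟨0⟩) ≫ pr X 0 0 ≫ X.hom) (ξ _)

variable (m c) in
/-- The local model of `P_0` over a chart: the coordinate `a_l` is `z_l` times a monomial in the `x_i`, where `z_l` is a unit when
`a_l = 0` is one of the divisors. -/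
lemma exists_zero_model (hdom : IsSchemeTheoreticallyDominant (inner (AffineSpace.toSpecMvPoly ι S)).ι) :
    ∃ (M : Scheme.{u}) (f : M ⟶ 𝔸(ι; S)) (q : M ⟶ c.U) (z : c.L → Γ(M, ⊤)), Smooth f ∧
      (∀ i, (D i).comap (q ≫ c.j) = (monoIdeal (Pi.single i (m i))).comap (f ≫ AffineSpace.toSpecMvPoly ι S)) ∧
      f ≫ (𝔸(ι; S) ↘ S) = q ≫ c.j ≫ X.hom ∧
      (∀ l, xc (q ≫ c.a) l = z l * mon (f ≫ AffineSpace.toSpecMvPoly ι S) (fun i ↦ if c.σ i = some l then m i else 0)) ∧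
      (∀ {T : Scheme.{u}} (f' : T ⟶ 𝔸(ι; S)) (q' : T ⟶ c.U) (z' : c.L → Γ(T, ⊤)),
        f' ≫ (𝔸(ι; S) ↘ S) = q' ≫ c.j ≫ X.hom →
        (∀ l, xc (q' ≫ c.a) l = z' l * mon (f' ≫ AffineSpace.toSpecMvPoly ι S) (fun i ↦ if c.σ i = some l then m i else 0)) →
        (∀ i, IsUnit ((c.σ i).elim (mon (f' ≫ AffineSpace.toSpecMvPoly ι S) (Pi.single i (m i))) z')) →
        ∃ g : T ⟶ M, g ≫ f = f' ∧ g ≫ q = q' ∧ ∀ l, g.appTop (z l) = z' l) ∧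
      (∀ {T : Scheme.{u}} (g g' : T ⟶ M), g ≫ f = g' ≫ f → g ≫ q = g' ≫ q →
        (∀ l, g.appTop (z l) = g'.appTop (z l)) → g = g') := by
  let A₀ := 𝔸(ι; S)
  let A := 𝔸(c.L; A₀)
  let o : A ⟶ A₀ := A ↘ A₀
  let x₀ : A₀ ⟶ Spec (coordRing ι) := AffineSpace.toSpecMvPoly ι S
  let co : A ⟶ Spec (coordRing c.L) := AffineSpace.toSpecMvPoly c.L A₀
  let ε (l : c.L) : ι → ℕ := fun i ↦ if c.σ i = some l then m i else 0
  have hε (i l) (h : c.σ i = some l) : ε l = Pi.single i (m i) := by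
    funext i'
    by_cases hi : i' = i
    · subst hi; simp [ε, h]
    · have : c.σ i' ≠ some l := fun h' ↦ hi (c.inj _ _ _ h' h)
      simp [ε, hi, this]
  let v : A ⟶ Spec (coordRing c.L) := vec fun l ↦ xc co l * mon (o ≫ x₀) (ε l)
  let β : A ⟶ 𝔸(c.L; S) := toAff (o ≫ (𝔸(ι; S) ↘ S)) v
  let M₀ := pullback β c.α
  let n₀ : M₀ ⟶ A := pullback.fst β c.α
  let q₀ : M₀ ⟶ c.U := pullback.snd β c.α
  have hcond : n₀ ≫ β = q₀ ≫ c.α := pullback.condition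
  have hn₀ : Etale n₀ := inferInstanceAs (Etale (pullback.fst _ _))
  let un (i : ι) : Γ(A, ⊤) := (c.σ i).elim (mon (o ≫ x₀) (Pi.single i (m i))) (fun l ↦ xc co l)
  let O : M₀.Opens := M₀.basicOpen (n₀.appTop (∏ i, un i))
  have hOu (i) : IsUnit ((O.ι ≫ n₀).appTop (un i)) := by
    have h1 : IsUnit (O.ι.appTop (n₀.appTop (∏ i, un i))) := by
      refine isUnit_of_le_basicOpen _ fun x _ ↦ ?_
      have : x ∈ O.ι ⁻¹ᵁ M₀.basicOpen (n₀.appTop (∏ i, un i)) := x.2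
      rwa [Scheme.preimage_basicOpen] at this
    rw [map_prod, map_prod] at h1
    have := IsUnit.prod_univ_iff.mp h1 i
    rw [Scheme.Hom.comp_appTop]
    exact this
  have hrel₀ (l) : xc (q₀ ≫ c.a) l = n₀.appTop (xc co l) * mon (n₀ ≫ o ≫ x₀) (ε l) := by
    have h1 := congr($hcond ≫ AffineSpace.toSpecMvPoly c.L S)
    rw [Category.assoc, Category.assoc, toAff_coord, toAff_coord] at h1
    rw [← h1, xc_comp, xc_vec, map_mul, ← mon_comp]
  have hover₀ : n₀ ≫ o ≫ (𝔸(ι; S) ↘ S) = q₀ ≫ c.j ≫ X.hom := by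
    have h1 := congr($hcond ≫ (𝔸(c.L; S) ↘ S))
    rwa [Category.assoc, Category.assoc, toAff_over, toAff_over] at h1
  let f : O.toScheme ⟶ A₀ := O.ι ≫ n₀ ≫ o
  let q : O.toScheme ⟶ c.U := O.ι ≫ q₀
  let z (l : c.L) : Γ(O.toScheme, ⊤) := (O.ι ≫ n₀).appTop (xc co l)
  have hrel (l) : xc (q ≫ c.a) l = z l * mon (f ≫ x₀) (ε l) := by
    have := congrArg O.ι.appTop (hrel₀ l)
    rw [map_mul, ← xc_comp, ← mon_comp] at this
    simpa only [Category.assoc, q, z, f, Scheme.Hom.comp_appTop] using! this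
  have hf : Smooth f := by
    have : Smooth o := inferInstance
    infer_instance
  have hfd : IsSchemeTheoreticallyDominant (inner (f ≫ x₀)).ι := by
    rw [inner_comp]
    exact dominant_preimage f _
  refine ⟨O, f, q, z, hf, fun i ↦ ?_, ?_, hrel, ?_, ?_⟩
  · rw [Scheme.IdealSheafData.comap_comp, c.div, ← Scheme.IdealSheafData.comap_comp]
    have hu := hOu i
    cases hσ : c.σ i with
    | none =>
      simp only [un, hσ, Option.elim_none] at hu
      rw [← mon_comp] at hu
      obtain ⟨w, hw⟩ := hu.exists_right_inv
      refine comap_eq_of_associated (u := w) (.of_mul_eq_one_right _ hw) ?_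
      simp only [Option.elim_none]
      rw [mul_comm w]
      simpa only [mon_zero, f, Category.assoc] using hw.symm
    | some l =>
      simp only [un, hσ, Option.elim_some] at hu
      refine comap_eq_of_associated (u := z l) hu ?_
      have := hrel l
      rw [hε i l hσ] at this
      simpa [mon_single] using this
  · simp only [f, q, Category.assoc, hover₀]
  · intro T f' q' z' h1 h2 h3
    let lA : T ⟶ A := toAff f' (vec z')
    have hlo : lA ≫ o = f' := toAff_over _ _
    have hlc (l) : lA.appTop (xc co l) = z' l := by
      rw [← xc_comp]
      change xc (lA ≫ AffineSpace.toSpecMvPoly _ _) l = _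
      rw [toAff_coord, xc_vec]
    have hlβ : lA ≫ β = q' ≫ c.α := by
      refine aff_ext ?_ (vec_ext fun l ↦ ?_)
      · rw [Category.assoc, Category.assoc, toAff_over, toAff_over, reassoc_of% hlo, h1]
      · rw [Category.assoc, Category.assoc, toAff_coord, toAff_coord, h2, xc_comp, xc_vec, map_mul, hlc,
          ← mon_comp, reassoc_of% hlo]
    let g₀ : T ⟶ M₀ := pullback.lift lA q' hlβ
    have e1 : g₀ ≫ n₀ = lA := pullback.lift_fst _ _ _
    have e2 : g₀ ≫ q₀ = q' := pullback.lift_snd _ _ _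
    have hun (i) : lA.appTop (un i) = (c.σ i).elim (mon (f' ≫ x₀) (Pi.single i (m i))) z' := by
      cases hσ : c.σ i with
      | none => simp only [un, hσ, Option.elim_none, ← mon_comp, reassoc_of% hlo]
      | some l => simp only [un, hσ, Option.elim_some, hlc]
    have hr : Set.range g₀ ⊆ Set.range O.ι := by
      rw [Opens.range_ι]
      rintro _ ⟨x, rfl⟩
      change x ∈ g₀ ⁻¹ᵁ M₀.basicOpen _
      rw [Scheme.preimage_basicOpen]
      change x ∈ T.basicOpen (g₀.appTop (n₀.appTop _))
      have h4 : IsUnit (g₀.appTop (n₀.appTop (∏ i, un i))) := by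
        have : g₀.appTop (n₀.appTop (∏ i, un i)) = lA.appTop (∏ i, un i) := by rw [← e1, Scheme.Hom.comp_appTop]; rfl
        rw [this, map_prod]
        exact IsUnit.prod_univ_iff.mpr fun i ↦ by rw [hun]; exact h3 i
      rw [T.basicOpen_of_isUnit h4]
      trivial
    have e3 := IsOpenImmersion.lift_fac O.ι g₀ hr
    refine ⟨IsOpenImmersion.lift O.ι g₀ hr, ?_, ?_, fun l ↦ ?_⟩
    · rw [reassoc_of% e3, reassoc_of% e1, hlo]
    · rw [reassoc_of% e3, e2]
    · have : (IsOpenImmersion.lift O.ι g₀ hr ≫ O.ι ≫ n₀) = lA := by rw [reassoc_of% e3, e1]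
      rw [← hlc l, ← this, Scheme.Hom.comp_appTop]
      rfl
  · intro T g g' h1 h2 h3
    rw [← cancel_mono O.ι]
    refine pullback.hom_ext (aff_ext ?_ (vec_ext fun l ↦ ?_)) ?_
    · simpa only [Category.assoc] using h1
    · have := h3 l
      change g.appTop ((O.ι ≫ n₀).appTop (xc co l)) = g'.appTop ((O.ι ≫ n₀).appTop (xc co l)) at this
      rw [← xc_comp, ← xc_comp, ← xc_comp] at this
      simpa only [Category.assoc] using this
    · simpa only [Category.assoc] using h2

lemma Param.smooth_coordAff (h : IsUniv D m e y ξ) (hdom : IsSchemeTheoreticallyDominant (inner (AffineSpace.toSpecMvPoly ι S)).ι)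
    (p : Param m y ξ c) : Smooth (p.i0 ≫ coordAff y ξ) := by
  obtain ⟨M, f, q, z, hf, hdiv, hover, hrel, hlift, hext⟩ := exists_zero_model m c hdom
  let x₀ : 𝔸(ι; S) ⟶ Spec (coordRing ι) := AffineSpace.toSpecMvPoly ι S
  have hdom' {T : Scheme.{u}} (f : T ⟶ 𝔸(ι; S)) [Flat f] : IsSchemeTheoreticallyDominant (inner (f ≫ x₀)).ι := by
    rw [inner_comp]
    exact dominant_preimage f _
  obtain ⟨φ, hφy, hφξ⟩ := h.exists_lift (n := 0) (z := powLift (fun _ ↦ q ≫ c.j) fun _ ↦ rfl) (ζ := f ≫ x₀)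
    { dom := hdom' f
      div := fun j i ↦ by rw [powLift_pr]; exact hdiv i
      diag := fun κ hκ j j' ↦ by rw [Subsingleton.elim (α := Fin 1) j j'] }
  have hφ : φ ≫ y.app _ ≫ pr X 0 0 = q ≫ c.j := by
    rw [reassoc_of% hφy, powLift_pr]
  have hφf : φ ≫ coordAff y ξ = f := by
    refine aff_ext ?_ ?_
    · rw [Category.assoc, coordAff, toAff_over, hover, reassoc_of% hφ]
    · rw [Category.assoc, coordAff, toAff_coord, hφξ]
  let f₁ : p.B ⟶ 𝔸(ι; S) := p.i0 ≫ coordAff y ξ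
  have hf₁ : f₁ ≫ x₀ = p.i0 ≫ ξ _ := by
    change (_ ≫ toAff _ _) ≫ AffineSpace.toSpecMvPoly _ _ = _
    rw [Category.assoc, toAff_coord]
  have hd₁ := dom_of_flat h p.i0
  classical
  let z₁ (l : c.L) : Γ(p.B, ⊤) := if hl : ∃ i, c.σ i = some l then p.w hl.choose else xc (p.y0 ≫ c.a) l
  have hz₁ (i l) (hi : c.σ i = some l) : z₁ l = p.w i := by
    have hl : ∃ i, c.σ i = some l := ⟨i, hi⟩
    simp only [z₁, dif_pos hl]
    rw [c.inj _ _ _ hl.choose_spec hi]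
  obtain ⟨ψ, hψf, hψq, hψz⟩ := hlift f₁ p.y0 z₁ (by
      change (_ ≫ toAff _ _) ≫ _ = _
      rw [Category.assoc, toAff_over, reassoc_of% p.hy])
    (fun l ↦ by
      change _ = _ * mon (f₁ ≫ x₀) _
      rw [hf₁]
      by_cases hl : ∃ i, c.σ i = some l
      · obtain ⟨i, hi⟩ := hl
        have hb := p.hb i
        have he : (fun i ↦ if c.σ i = some l then m i else 0) = Pi.single i (m i) := by
          funext i'
          by_cases hi' : i' = i
          · subst hi'; simp [hi]
          · have : c.σ i' ≠ some l := fun h' ↦ hi' (c.inj _ _ _ h' hi)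
            simp [hi', this]
        have hτ : c.τ i = Pi.single l 1 := by simp [Chart.τ, hi]
        rw [hz₁ i l hi, he, ← hb, hτ, mon_single, pow_one]
      · have he : (fun i ↦ if c.σ i = some l then m i else 0) = (0 : ι → ℕ) := by
          funext i
          exact if_neg fun h ↦ hl ⟨i, h⟩
        simp only [z₁, dif_neg hl]
        rw [he, mon_zero, mul_one])
    (fun i ↦ by
      change IsUnit ((c.σ i).elim (mon (f₁ ≫ x₀) _) z₁)
      rw [hf₁]
      cases hσ : c.σ i with
      | none =>
        have hb := p.hb i
        have hτ : c.τ i = 0 := by simp [Chart.τ, hσ]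
        rw [hτ, mon_zero] at hb
        exact .of_mul_eq_one_right _ hb.symm
      | some l =>
        simp only [Option.elim_some]
        rw [hz₁ i l hσ]
        exact p.hw i)
  have hψφ : ψ ≫ φ = p.i0 := by
    refine h.hom_ext ?_ (schPower_hom_ext fun j ↦ ?_) ?_
    · rw [Category.assoc, hφξ, reassoc_of% hψf, hf₁]
      exact hd₁
    · obtain rfl : j = 0 := Subsingleton.elim (α := Fin 1) _ _
      simp only [Category.assoc]
      rw [hφ, reassoc_of% hψq, p.hy]
    · rw [Category.assoc, hφξ, reassoc_of% hψf, hf₁]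
  -- `B` is the inverse image of `B` in the model
  let B' : M.Opens := φ ⁻¹ᵁ p.i0.opensRange
  let g : B'.toScheme ⟶ p.B := IsOpenImmersion.lift p.i0 (B'.ι ≫ φ) (by rintro _ ⟨x, rfl⟩; exact x.2)
  have hg : g ≫ p.i0 = B'.ι ≫ φ := IsOpenImmersion.lift_fac _ _ _
  have hgf : g ≫ f₁ = B'.ι ≫ f := by
    rw [reassoc_of% hg, hφf]
  have hgq : g ≫ p.y0 = B'.ι ≫ q := by
    rw [← cancel_mono c.j, Category.assoc, p.hy, reassoc_of% hg, hφ, Category.assoc]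
  have hgψ : g ≫ ψ = B'.ι := by
    refine hext _ _ ?_ ?_ fun l ↦ ?_
    · rw [Category.assoc, hψf, hgf]
    · rw [Category.assoc, hψq, hgq]
    · refine cancel_mon (hdom' (B'.ι ≫ f)) (e := fun i ↦ if c.σ i = some l then m i else 0) ?_
      have e1 := congrArg (g ≫ ψ).appTop (hrel l)
      have e2 := congrArg B'.ι.appTop (hrel l)
      rw [map_mul, ← xc_comp, ← mon_comp] at e1 e2
      have e3 : (g ≫ ψ) ≫ f ≫ x₀ = B'.ι ≫ f ≫ x₀ := by rw [Category.assoc, reassoc_of% hψf, reassoc_of% hgf]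
      have e4 : (g ≫ ψ) ≫ q ≫ c.a = B'.ι ≫ q ≫ c.a := by rw [Category.assoc, reassoc_of% hψq, reassoc_of% hgq]
      rw [e3, e4, e2] at e1
      rw [Category.assoc]
      exact e1.symm
  let ψ' : p.B ⟶ B'.toScheme := IsOpenImmersion.lift B'.ι ψ (by
    rw [Opens.range_ι]
    rintro _ ⟨x, rfl⟩
    exact ⟨x, (congr($hψφ x)).symm⟩)
  have hψ' : ψ' ≫ B'.ι = ψ := IsOpenImmersion.lift_fac _ _ _
  have : IsIso ψ' := by
    refine ⟨g, ?_, ?_⟩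
    · rw [← cancel_mono p.i0, Category.assoc, hg, reassoc_of% hψ', hψφ, Category.id_comp]
    · rw [← cancel_mono B'.ι, Category.assoc, hψ', hgψ, Category.id_comp]
  rw [← hψφ, Category.assoc, hφf, ← hψ', Category.assoc]
  infer_instance

/-- `P_0` is smooth over the affine space with coordinates `x_i`. -/
theorem smooth_coordAff (h : IsUniv D m e y ξ) (hdom : IsSchemeTheoreticallyDominant (inner (AffineSpace.toSpecMvPoly ι S)).ι)
    (hc : ∀ x : X.left, ∃ c : Chart D, x ∈ Set.range c.j) : Smooth (coordAff y ξ) := by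
  refine smooth_of_forall _ fun z ↦ ?_
  obtain ⟨c, hz⟩ := hc ((y.app (.op ⟨0⟩) ≫ pr X 0 0) z)
  obtain ⟨p, hp⟩ := exists_param h c z hz
  exact ⟨p.B, p.i0, inferInstance, hp, p.smooth_coordAff h hdom⟩

end Smooth

/-! ### Powers of open immersions and the open where the coordinates are invertible -/

section PowerMap

variable {S : Scheme.{u}} {X Y : Over S} {T : Scheme.{u}} {n : ℕ}

lemma schPowerMap_pr (i : Y ⟶ X) (j : Fin (n + 1)) :
    (schPowerMap i).app (.op ⟨n⟩) ≫ pr X n j = pr Y n j ≫ i.left :=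
  congr_arg CommaMorphism.left (Limits.Pi.map_π (fun _ : Fin (n + 1) ↦ i) j)

/-- Powers of open immersions are defined by conditions on the components. -/
lemma exists_schPower_lift (i : Y ⟶ X) [IsOpenImmersion i.left] (t : T ⟶ (schPower X).obj (.op ⟨n⟩))
    (ht : ∀ j, Set.range (t ≫ pr X n j) ⊆ Set.range i.left) :
    ∃ t' : T ⟶ (schPower Y).obj (.op ⟨n⟩), t' ≫ (schPowerMap i).app _ = t := by
  have hf (j) : IsOpenImmersion.lift i.left _ (ht j) ≫ i.left = t ≫ pr X n j := IsOpenImmersion.lift_fac _ _ _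
  refine ⟨powLift (fun j ↦ IsOpenImmersion.lift i.left _ (ht j)) fun j ↦ ?_, schPower_hom_ext fun j ↦ ?_⟩
  · rw [← Over.w i, reassoc_of% hf, reassoc_of% hf, pr_hom, pr_hom]
  · rw [Category.assoc, schPowerMap_pr, ← Category.assoc, powLift_pr, hf]

end PowerMap

section Inner

variable {S : Scheme.{u}} {X : Over S} {ι : Type u} [Fintype ι] [DecidableEq ι]
  {D : ι → X.left.IdealSheafData} {m e : ι → ℕ}

/-- All the points `y_j` are outside the divisors exactly where the coordinates `x_i` are invertible. -/
lemma Adm.preimage_complement {n : ℕ} {T : Scheme.{u}} {y : T ⟶ (schPower X).obj (.op ⟨n⟩)} {ξ : T ⟶ Spec (coordRing ι)}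
    (h : Adm D m e n y ξ) (hm : ∀ i, 1 ≤ m i) (j) : (y ≫ pr X n j) ⁻¹ᵁ complement X D = inner ξ := by
  ext x
  rw [← basicOpen_mon_eq_inner ξ (e := m) fun i ↦ Nat.one_le_iff_ne_zero.mp (hm i)]
  have h1 : x ∉ ((∏ i, D i).comap (y ≫ pr X n j)).support ↔ x ∈ T.basicOpen (mon ξ m) := by
    rw [h.div_prod]
    exact notMem_support_monoIdeal
  rw [Scheme.IdealSheafData.support_comap] at h1
  exact h1

/-- The open where the coordinates are invertible is the inverse image of the power of `X ∖ D`. -/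
lemma exists_isPullback_inner {n : ℕ} {T : Scheme.{u}} {y : T ⟶ (schPower X).obj (.op ⟨n⟩)} {ξ : T ⟶ Spec (coordRing ι)}
    (h : Adm D m e n y ξ) (hm : ∀ i, 1 ≤ m i) :
    ∃ g, IsPullback g (inner ξ).ι ((schPowerMap (complOverι X D)).app (.op ⟨n⟩)) y := by
  have hr : Set.range (complOverι X D).left = complement X D := Opens.range_ι _
  obtain ⟨g, hg⟩ := exists_schPower_lift (complOverι X D) ((inner ξ).ι ≫ y) fun j ↦ by
    rw [hr]
    rintro _ ⟨x, rfl⟩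
    have : x.1 ∈ (y ≫ pr X n j) ⁻¹ᵁ complement X D := by
      rw [h.preimage_complement hm]
      exact x.2
    exact this
  have hs : IsOpenImmersion ((schPowerMap (complOverι X D)).app (.op ⟨n⟩)) :=
    schPowerMap_mem @IsOpenImmersion _ inferInstance _
  refine ⟨g, isPullback_of_forall hg (fun {K} a b hab ↦ ?_) (fun {K} z z' _ h2 ↦ (cancel_mono (inner ξ).ι).mp h2)⟩
  have hO : Set.range b ⊆ Set.range (inner ξ).ι := by
    rw [Opens.range_ι]
    rintro _ ⟨x, rfl⟩
    change b x ∈ inner ξ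
    rw [← h.preimage_complement hm 0]
    have h1 : b ≫ y ≫ pr X n 0 = (a ≫ pr _ n 0) ≫ (complOverι X D).left := by
      rw [← reassoc_of% hab, schPowerMap_pr, Category.assoc]
    have h2 := congr($h1 x)
    change (y ≫ pr X n 0) (b x) ∈ (complement X D : Set X.left)
    rw [← hr]
    exact ⟨_, h2.symm⟩
  have hl := IsOpenImmersion.lift_fac (inner ξ).ι b hO
  refine ⟨IsOpenImmersion.lift (inner ξ).ι b hO, ?_, hl⟩
  rw [← cancel_mono ((schPowerMap (complOverι X D)).app (.op ⟨n⟩)), Category.assoc, hg, reassoc_of% hl, hab]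

variable {P : OS Scheme.{u}} {y : P ⟶ schPower X} {ξ : ∀ n, P.obj n ⟶ Spec (coordRing ι)}

lemma IsUniv.preimage_inner (h : IsUniv D m e y ξ) {n n'} (f : n ⟶ n') : P.map f ⁻¹ᵁ inner (ξ n') = inner (ξ n) := by
  rw [← inner_comp, h.map_ξ]

end Inner

section OverField

variable {k : Type u} [Field k] {X : Over (Spec (.of k))} {ι : Type u} [Fintype ι] [DecidableEq ι]
  {D : ι → X.left.IdealSheafData} {m e : ι → ℕ} {P : OS Scheme.{u}} {y : P ⟶ schPower X}
  {ξ : ∀ n, P.obj n ⟶ Spec (coordRing ι)} [Smooth X.hom]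

/-- Every `P_n` is smooth over an affine space over the field, compatibly with the coordinates `x_i`; hence `P_n` is locally noetherian and
integrally closed along the open where the `x_i` are invertible. -/
lemma IsUniv.exists_smooth (h : IsUniv D m e y ξ) (hm : ∀ i, 1 ≤ m i) (hc : ∀ x : X.left, ∃ c : Chart D, x ∈ Set.range c.j)
    (n : OSimpᵒᵖ) : ∃ w : P.obj n ⟶ 𝔸(ι; Spec (.of k)), Smooth w ∧ w ≫ AffineSpace.toSpecMvPoly ι (Spec (.of k)) = ξ n := by
  obtain ⟨⟨n⟩⟩ := n
  have h1 : Smooth (P.map (OSimp.pt (n := n) 0).op) := smooth_map_pt h (smooth_pt_zero h hm hc) n 0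
  have h2 := smooth_coordAff h (isNormalIn_inner_affineSpace k).dominant hc
  refine ⟨P.map (OSimp.pt (n := n) 0).op ≫ coordAff y ξ, inferInstance, ?_⟩
  rw [Category.assoc, coordAff, toAff_coord, h.map_ξ]

lemma IsUniv.isLocallyNoetherian (h : IsUniv D m e y ξ) (hm : ∀ i, 1 ≤ m i)
    (hc : ∀ x : X.left, ∃ c : Chart D, x ∈ Set.range c.j) (n : OSimpᵒᵖ) : IsLocallyNoetherian (P.obj n) := by
  obtain ⟨w, hw, -⟩ := h.exists_smooth hm hc n
  have : LocallyOfFiniteType (𝔸(ι; Spec (.of k)) ↘ Spec (.of k)) := inferInstance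
  exact LocallyOfFiniteType.isLocallyNoetherian (w ≫ (𝔸(ι; Spec (.of k)) ↘ Spec (.of k)))

lemma IsUniv.isNormalIn (h : IsUniv D m e y ξ) (hm : ∀ i, 1 ≤ m i)
    (hc : ∀ x : X.left, ∃ c : Chart D, x ∈ Set.range c.j) (n : OSimpᵒᵖ) : IsNormalIn (inner (ξ n)).ι := by
  obtain ⟨w, hw, hw'⟩ := h.exists_smooth hm hc n
  rw [← hw', inner_comp]
  exact (isNormalIn_inner_affineSpace k).preimage w

end OverField

/-! ### Galois descent along torsors -/

section Galois

open TensorProduct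

/-- Galois descent for rings with a semilinear action: if `S₀` is a Galois extension of `R` with group `G`, in the sense that
`∑ c_i g(d_i)` is `1` for `g = 1` and `0` otherwise, then every `S₀`-algebra `S` with a compatible action is the base change of its ring of
invariants, because `s = ∑ tr(s d_i) c_i`. -/
lemma isPushout_of_galois {R S₀ S G : Type u} [CommRing R] [CommRing S₀] [CommRing S] [Fintype G] [DecidableEq G]
    (a : G → S₀ →+* S₀) (b : G → S →+* S) (w : S₀ →+* S) (hw : ∀ g s, b g (w s) = w (a g s)) (g₁ : G) (ha₁ : ∀ s, a g₁ s = s)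
    (hb₁ : ∀ s, b g₁ s = s)
    (B : Subring S) (hB : ∀ g, ∀ x ∈ B, b g x = x) (htr : ∀ s, ∑ g, b g s ∈ B) (f : R →+* S₀) (q : R →+* B)
    (hq : ∀ x, w (f x) = q x) (hR : ∀ s, ∃ x, f x = ∑ g, a g s) {κ : Type*} (I : Finset κ) (c d : κ → S₀)
    (hcd : ∀ g, ∑ i ∈ I, c i * a g (d i) = if g = g₁ then 1 else 0) :
    IsPushout (CommRingCat.ofHom f) (CommRingCat.ofHom q) (CommRingCat.ofHom w) (CommRingCat.ofHom B.subtype) := by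
  let _ : Algebra R S₀ := f.toAlgebra
  let _ : Algebra R B := q.toAlgebra
  let _ : Algebra S₀ S := w.toAlgebra
  let _ : Algebra R S := (w.comp f).toAlgebra
  have : IsScalarTower R S₀ S := .of_algebraMap_eq fun _ ↦ rfl
  have : IsScalarTower R B S := .of_algebraMap_eq hq
  let tr (s : S) : B := ⟨∑ g, b g s, htr s⟩
  let Φ : S₀ ⊗[R] B →ₐ[R] S := Algebra.TensorProduct.productMap (IsScalarTower.toAlgHom R S₀ S) (IsScalarTower.toAlgHom R B S)
  let ψ (s : S) : S₀ ⊗[R] B := ∑ i ∈ I, c i ⊗ₜ tr (s * w (d i))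
  have hψ_add (s s') : ψ (s + s') = ψ s + ψ s' := by
    simp only [ψ]
    rw [← Finset.sum_add_distrib]
    refine Finset.sum_congr rfl fun i _ ↦ ?_
    rw [← tmul_add]
    congr 1
    exact Subtype.ext (by simp [tr, add_mul, Finset.sum_add_distrib])
  have hΦψ (s) : Φ (ψ s) = s := by
    have h1 : Φ (ψ s) = ∑ i ∈ I, w (c i) * ∑ g, b g (s * w (d i)) := by
      rw [map_sum]
      exact Finset.sum_congr rfl fun i _ ↦ Algebra.TensorProduct.productMap_apply_tmul _ _ _ _
    have h2 (g) : ∑ i ∈ I, w (c i) * b g (s * w (d i)) = if g = g₁ then s else 0 := by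
      have : ∑ i ∈ I, w (c i) * b g (s * w (d i)) = b g s * w (∑ i ∈ I, c i * a g (d i)) := by
        rw [map_sum, Finset.mul_sum]
        refine Finset.sum_congr rfl fun i _ ↦ ?_
        rw [map_mul, map_mul, hw]
        ring
      rw [this, hcd]
      split_ifs with h
      · rw [h, hb₁, map_one, mul_one]
      · rw [map_zero, mul_zero]
    rw [h1]
    simp_rw [Finset.mul_sum]
    rw [Finset.sum_comm]
    simp_rw [h2]
    simp
  have hψΦ (x) : ψ (Φ x) = x := by
    induction x with
    | zero => rw [map_zero]; simp [ψ, tr]; exact Finset.sum_eq_zero fun i _ ↦ tmul_zero _ _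
    | add x y hx hy => rw [map_add, hψ_add, hx, hy]
    | tmul s β =>
      have h1 : Φ (s ⊗ₜ β) = w s * β := Algebra.TensorProduct.productMap_apply_tmul _ _ _ _
      rw [h1]
      choose x hx using fun i ↦ hR (s * d i)
      have h2 (i) : tr (w s * β * w (d i)) = x i • β := by
        refine Subtype.ext ?_
        change ∑ g, b g _ = ((q (x i) * β : B) : S)
        rw [Subring.coe_mul, ← hq, hx, map_sum, Finset.sum_mul]
        refine Finset.sum_congr rfl fun g _ ↦ ?_
        rw [map_mul, map_mul, hB g _ β.2, hw, hw, map_mul, map_mul]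
        ring
      simp only [ψ, h2]
      have h3 (i) : c i ⊗ₜ[R] (x i • β) = (c i * ∑ g, a g (s * d i)) ⊗ₜ[R] β := by
        rw [← smul_tmul, ← hx, mul_comm]
        rfl
      simp only [h3]
      rw [← sum_tmul]
      congr 1
      have h4 (g) : ∑ i ∈ I, c i * a g (s * d i) = if g = g₁ then s else 0 := by
        have : ∑ i ∈ I, c i * a g (s * d i) = a g s * ∑ i ∈ I, c i * a g (d i) := by
          rw [Finset.mul_sum]
          refine Finset.sum_congr rfl fun i _ ↦ ?_
          rw [map_mul]
          ring
        rw [this, hcd]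
        split_ifs with h
        · rw [h, ha₁, mul_one]
        · rw [mul_zero]
      simp_rw [Finset.mul_sum]
      rw [Finset.sum_comm]
      simp_rw [h4]
      simp
  let e : S₀ ⊗[R] B ≃ₐ[R] S := .ofBijective Φ ⟨Function.LeftInverse.injective hψΦ, Function.RightInverse.surjective hΦψ⟩
  refine (CommRingCat.isPushout_tensorProduct R S₀ B).of_iso (.refl _) (.refl _) (.refl _)
    (RingEquiv.toCommRingCatIso e.toRingEquiv) ?_ ?_ ?_ ?_
  · simp
  · simp
  · ext s
    exact (Algebra.TensorProduct.productMap_apply_tmul _ _ s (1 : B)).trans (by simp; rfl)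
  · ext s
    exact (Algebra.TensorProduct.productMap_apply_tmul _ _ (1 : S₀) s).trans (by simp; rfl)

end Galois

section Torsor

open TensorProduct

variable {G : Type u} [Group G] [Finite G] {V U : Scheme.{u}} {v : V ⟶ U} {ρ : G →* Aut V}

/-- The graph of the action of an element of `G` in `V ×_U V`. -/
def IsTorsor.graph (hv : IsTorsor v ρ) (g : G) : V ⟶ pullback v v :=
  pullback.lift (f := v) (g := v) (𝟙 V) (ρ g).hom ((Category.id_comp v).trans (hv.comp g).symm)

lemma IsTorsor.graph_fst (hv : IsTorsor v ρ) (g : G) : hv.graph g ≫ pullback.fst v v = 𝟙 V := pullback.lift_fst _ _ _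

lemma IsTorsor.graph_snd (hv : IsTorsor v ρ) (g : G) : hv.graph g ≫ pullback.snd v v = (ρ g).hom := pullback.lift_snd _ _ _

lemma IsTorsor.isOpenImmersion_graph (hv : IsTorsor v ρ) (g : G) : IsOpenImmersion (hv.graph g) := by
  have := hv.isIso
  have h : hv.graph g = Sigma.ι (fun _ : G ↦ V) g ≫ Sigma.desc hv.graph := (Sigma.ι_desc _ _).symm
  rw [h]
  exact MorphismProperty.comp_mem @IsOpenImmersion _ _ inferInstance
    (show IsOpenImmersion (Sigma.desc hv.graph) from @IsOpenImmersion.of_isIso _ _ _ hv.isIso)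

lemma IsTorsor.exists_graph (hv : IsTorsor v ρ) (x : ↥(pullback v v)) : ∃ g z, hv.graph g z = x := by
  have : IsIso (Sigma.desc hv.graph) := hv.isIso
  obtain ⟨w, rfl⟩ := (Sigma.desc hv.graph).surjective x
  obtain ⟨⟨g, z⟩, rfl⟩ := (sigmaMk fun _ : G ↦ V).surjective w
  refine ⟨g, z, ?_⟩
  rw [sigmaMk_mk, ← Scheme.Hom.comp_apply, Sigma.ι_desc]

variable {R S₀ : CommRingCat.{u}} {f : R ⟶ S₀} {j : Spec S₀ ⟶ V} {i : Spec R ⟶ U}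

/-- The graphs of the elements of `G` are disjoint in `V ×_U V`. The sum is the element of `S₀ ⊗ S₀` given by
the function with value `1` on the graph of `1` and `0` on the others. -/
lemma IsTorsor.exists_sum [DecidableEq G] (hv : IsTorsor v ρ) (hw : Spec.map f ≫ i = j ≫ v) [Mono j] (a : G → (S₀ ⟶ S₀))
    (hfa : ∀ g, f ≫ a g = f)
    (ha : ∀ g, Spec.map (a g) ≫ j = j ≫ (ρ g).hom) :
    ∃ I : Finset (S₀ × S₀), ∀ g, ∑ p ∈ I, p.1 * a g p.2 = if g = 1 then 1 else 0 := by
  have : IsIso (Sigma.desc hv.graph) := hv.isIso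
  -- the function on `V ×_U V` which is `1` on the diagonal and `0` elsewhere
  let e : pullback v v ⟶ Spec (coordRing PUnit) :=
    inv (Sigma.desc hv.graph) ≫ Sigma.desc fun g : G ↦ vec fun _ ↦ if g = 1 then 1 else 0
  have he (g) : hv.graph g ≫ e = vec fun _ ↦ if g = 1 then 1 else 0 := by
    rw [← Sigma.ι_desc hv.graph g, Category.assoc, IsIso.hom_inv_id_assoc, Sigma.ι_desc]
  let _ : Algebra R S₀ := f.hom.toAlgebra
  let lr : S₀ ⟶ .of (S₀ ⊗[R] S₀) := CommRingCat.ofHom Algebra.TensorProduct.includeLeftRingHom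
  let rr : S₀ ⟶ .of (S₀ ⊗[R] S₀) := CommRingCat.ofHom Algebra.TensorProduct.includeRight.toRingHom
  have hlr : f ≫ lr = f ≫ rr := by
    ext x
    exact Algebra.TensorProduct.tmul_one_eq_one_tmul x
  let k : Spec (.of (S₀ ⊗[R] S₀)) ⟶ pullback v v := pullback.lift (Spec.map lr ≫ j) (Spec.map rr ≫ j) (by
    rw [Category.assoc, Category.assoc, ← hw, ← Spec.map_comp_assoc, ← Spec.map_comp_assoc, hlr])
  let t : S₀ ⊗[R] S₀ := (ΓSpecIso _).hom (xc (k ≫ e) PUnit.unit)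
  obtain ⟨I, hI⟩ := TensorProduct.exists_finset t
  refine ⟨I, fun g ↦ ?_⟩
  let ag : S₀ →ₐ[R] S₀ := { (a g).hom with commutes' := fun r ↦ congr($(hfa g) r) }
  let μ : S₀ ⊗[R] S₀ →ₐ[R] S₀ := Algebra.TensorProduct.lift (.id R S₀) ag fun _ _ ↦ .all _ _
  have hμ (s s' : S₀) : μ (s ⊗ₜ[R] s') = s * a g s' := by
    simp only [μ]
    rw [Algebra.TensorProduct.lift_tmul]
    rfl
  let μ' : .of (S₀ ⊗[R] S₀) ⟶ S₀ := CommRingCat.ofHom μ.toRingHom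
  have h1 : lr ≫ μ' = 𝟙 _ := by
    ext x
    exact (hμ x 1).trans (by simp)
  have h2 : rr ≫ μ' = a g := by
    ext x
    exact (hμ 1 x).trans (by simp)
  have h3 : Spec.map μ' ≫ k = j ≫ hv.graph g := by
    refine pullback.hom_ext ?_ ?_
    · rw [Category.assoc, Category.assoc, pullback.lift_fst, hv.graph_fst, ← Spec.map_comp_assoc, h1]
      simp
    · rw [Category.assoc, Category.assoc, pullback.lift_snd, hv.graph_snd, ← Spec.map_comp_assoc, h2, ha]
  have h4 : μ t = if g = 1 then 1 else 0 := by
    have h5 : (Spec.map μ').appTop (xc (k ≫ e) PUnit.unit) = if g = 1 then 1 else 0 := by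
      rw [← xc_comp, reassoc_of% h3, he, xc_comp, xc_vec]
      split_ifs
      · rw [map_one]
      · rw [map_zero]
    have h6 := congr($(ΓSpecIso_naturality μ') (xc (k ≫ e) PUnit.unit))
    change (ΓSpecIso _).hom ((Spec.map μ').appTop _) = μ t at h6
    rw [← h6, h5]
    split_ifs
    · rw [map_one]
    · rw [map_zero]
  rw [← h4, hI, map_sum]
  exact Finset.sum_congr rfl fun p _ ↦ (hμ p.1 p.2).symm

/-- The functions on `U` are the invariant functions on `V`, by faithfully flat descent. -/
lemma IsTorsor.exists_of_invariant (hv : IsTorsor v ρ) (hp : IsPullback j (Spec.map f) v i) [IsOpenImmersion j] (a : G → (S₀ ⟶ S₀))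
    (ha : ∀ g, Spec.map (a g) ≫ j = j ≫ (ρ g).hom) (s : S₀) (hs : ∀ g, a g s = s) : ∃ x, f x = s := by
  let _ : Algebra R S₀ := f.hom.toAlgebra
  let lr : S₀ ⟶ .of (S₀ ⊗[R] S₀) := CommRingCat.ofHom Algebra.TensorProduct.includeLeftRingHom
  let rr : S₀ ⟶ .of (S₀ ⊗[R] S₀) := CommRingCat.ofHom Algebra.TensorProduct.includeRight.toRingHom
  have hlr : f ≫ lr = f ≫ rr := by
    ext x
    exact Algebra.TensorProduct.tmul_one_eq_one_tmul x
  let k : Spec (.of (S₀ ⊗[R] S₀)) ⟶ pullback v v := pullback.lift (Spec.map lr ≫ j) (Spec.map rr ≫ j) (by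
    rw [Category.assoc, Category.assoc, hp.w, ← Spec.map_comp_assoc, ← Spec.map_comp_assoc, hlr])
  have hk1 : k ≫ pullback.fst v v = Spec.map lr ≫ j := pullback.lift_fst _ _ _
  have hk2 : k ≫ pullback.snd v v = Spec.map rr ≫ j := pullback.lift_snd _ _ _
  let φ : Spec S₀ ⟶ Spec (coordRing PUnit) := vec fun _ ↦ (ΓSpecIso _).inv s
  have hφ (g) : Spec.map (a g) ≫ φ = φ := by
    refine vec_ext fun l ↦ ?_
    rw [xc_comp, xc_vec]
    have := congr($(ΓSpecIso_inv_naturality (a g)) s)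
    exact this.symm.trans (congrArg (ΓSpecIso S₀).inv (hs g))
  -- the graphs of the elements of `G` cover `V ×_U V`
  have hlr' : Spec.map lr ≫ φ = Spec.map rr ≫ φ := by
    refine ext_of_open _ _ fun x ↦ ?_
    obtain ⟨g, z, hz⟩ := hv.exists_graph (k x)
    obtain ⟨x', hx', -⟩ := Scheme.Pullback.exists_preimage_pullback x z hz.symm
    have := hv.isOpenImmersion_graph g
    let p := pullback.fst k (hv.graph g)
    let p' := pullback.snd k (hv.graph g)
    have hpp : p ≫ k = p' ≫ hv.graph g := pullback.condition
    refine ⟨_, p, inferInstance, ⟨x', hx'⟩, ?_⟩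
    have e1 : p ≫ Spec.map lr ≫ j = p' := by rw [← hk1, reassoc_of% hpp, hv.graph_fst, Category.comp_id]
    have e2 : p ≫ Spec.map rr ≫ j = p' ≫ (ρ g).hom := by rw [← hk2, reassoc_of% hpp, hv.graph_snd]
    have e3 : p ≫ Spec.map rr = p ≫ Spec.map lr ≫ Spec.map (a g) := by
      rw [← cancel_mono j, Category.assoc, e2, ← e1]
      simp only [Category.assoc, ha]
    rw [reassoc_of% e3, hφ]
  have h1 : lr s = rr s := by
    have h2 := congr(xc $hlr' PUnit.unit)
    rw [xc_comp, xc_comp, xc_vec] at h2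
    have e1 := congr($(ΓSpecIso_inv_naturality lr) s)
    have e2 := congr($(ΓSpecIso_inv_naturality rr) s)
    have h3 := e1.trans (h2.trans e2.symm)
    exact (ConcreteCategory.bijective_of_isIso (ΓSpecIso (.of (S₀ ⊗[R] S₀))).inv).1 h3
  have : Module.FaithfullyFlat R S₀ := by
    have := hv.etale
    have := hv.surjective
    have h2 : Flat (Spec.map f) := MorphismProperty.of_isPullback (P := @Flat) hp inferInstance
    have h3 : Surjective (Spec.map f) := MorphismProperty.of_isPullback (P := @Surjective) hp inferInstance
    exact (flat_and_surjective_SpecMap_iff f).mp ⟨h2, h3⟩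
  have h4 : s ∈ (RingHom.eqLocus lr.hom rr.hom : Set S₀) := h1
  exact (Algebra.IsEffective.eqLocus_includeLeft_includeRight (R := R) (S := S₀) (.of_faithfullyFlat _ _)).le h4

end Torsor

/-! ### Quotients of schemes over a torsor -/

section Local

variable {X C V U : Scheme.{u}}

lemma isPullback_of_range {B A : Scheme.{u}} {i : B ⟶ X} {p : B ⟶ A} {s : X ⟶ C} {c : A ⟶ C} [IsOpenImmersion i] [IsOpenImmersion c]
    (h : i ≫ s = p ≫ c) (hr : s ⁻¹' Set.range c ⊆ Set.range i) : IsPullback i p s c := by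
  refine isPullback_of_forall h (fun {T} x y hxy ↦ ?_) (fun {T} z z' h1 _ ↦ (cancel_mono i).mp h1)
  have hO : Set.range x ⊆ Set.range i := by
    rintro _ ⟨τ, rfl⟩
    exact hr ⟨y τ, congr($hxy τ).symm⟩
  have hl := IsOpenImmersion.lift_fac i x hO
  refine ⟨IsOpenImmersion.lift i x hO, hl, ?_⟩
  rw [← cancel_mono c, Category.assoc, ← h, reassoc_of% hl, hxy]

/-- A commutative square is cartesian if it becomes so on an open covering of `C`. -/
lemma isPullback_of_cover {w : X ⟶ V} {s : X ⟶ C} {v : V ⟶ U} {t : C ⟶ U} (h : w ≫ v = s ≫ t) {J : Type u} {A B : J → Scheme.{u}}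
    (c : ∀ a, A a ⟶ C) [∀ a, IsOpenImmersion (c a)] (hc : ∀ x : C, ∃ a, x ∈ Set.range (c a)) {i : ∀ a, B a ⟶ X} {p : ∀ a, B a ⟶ A a}
    (h1 : ∀ a, IsPullback (i a) (p a) s (c a)) (h2 : ∀ a, IsPullback (i a ≫ w) (p a) v (c a ≫ t)) : IsPullback w s v t := by
  have hu {T : Scheme.{u}} (z z' : T ⟶ X) (hw : z ≫ w = z' ≫ w) (hs : z ≫ s = z' ≫ s) : z = z' := by
    refine ext_of_open _ _ fun τ ↦ ?_
    obtain ⟨a, ha⟩ := hc ((z ≫ s) τ)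
    obtain ⟨x, hx⟩ := ha
    obtain ⟨τ', hτ', -⟩ := Scheme.Pullback.exists_preimage_pullback τ x hx.symm
    let q := pullback.fst (z ≫ s) (c a)
    let q' := pullback.snd (z ≫ s) (c a)
    have hq : (q ≫ z) ≫ s = q' ≫ c a := (Category.assoc _ _ _).trans pullback.condition
    have hq' : (q ≫ z') ≫ s = q' ≫ c a := 
      (Category.assoc _ _ _).trans ((congrArg (q ≫ ·) hs.symm).trans ((Category.assoc _ _ _).symm.trans hq))
    refine ⟨_, q, inferInstance, ⟨τ', hτ'⟩, ?_⟩
    have e1 := (h1 a).lift_fst _ _ hq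
    have e2 := (h1 a).lift_fst _ _ hq'
    rw [← e1, ← e2]
    congr 1
    refine (h2 a).hom_ext ?_ ?_
    · rw [reassoc_of% e1, reassoc_of% e2, hw]
    · rw [(h1 a).lift_snd, (h1 a).lift_snd]
  refine isPullback_of_forall h (fun {T} x y hxy ↦ ?_) (fun {T} z z' ↦ hu z z')
  let q (a) := pullback.fst y (c a)
  let q' (a) := pullback.snd y (c a)
  have hq (a) : q a ≫ y = q' a ≫ c a := pullback.condition
  have hl (a) : (q a ≫ x) ≫ v = q' a ≫ c a ≫ t := by rw [Category.assoc, hxy, reassoc_of% hq]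
  let l (a) := (h2 a).lift _ _ (hl a)
  have hlw (a) : l a ≫ i a ≫ w = q a ≫ x := (h2 a).lift_fst _ _ _
  have hls (a) : l a ≫ i a ≫ s = q a ≫ y := by
    have : l a ≫ p a = q' a := (h2 a).lift_snd _ _ _
    rw [(h1 a).w, reassoc_of% this, hq]
  have hcov (τ : T) : ∃ a, τ ∈ Set.range (q a) := by
    obtain ⟨a, x, hx⟩ := hc (y τ)
    obtain ⟨τ', hτ', -⟩ := Scheme.Pullback.exists_preimage_pullback τ x hx.symm
    exact ⟨a, τ', hτ'⟩
  obtain ⟨z, hz⟩ := exists_glue _ q hcov (fun a ↦ l a ≫ i a) fun a a' τ τ' e ↦ by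
    obtain ⟨τ'', h3, -⟩ := Scheme.Pullback.exists_preimage_pullback τ τ' e
    refine ⟨pullback (q a) (q a'), pullback.fst _ _, pullback.snd _ _, inferInstance, ⟨τ'', h3⟩, pullback.condition, hu _ _ ?_ ?_⟩
    · simp only [Category.assoc, hlw]
      rw [pullback.condition_assoc]
    · simp only [Category.assoc, hls]
      rw [pullback.condition_assoc]
  refine ⟨z, ext_of_open _ _ fun τ ↦ ?_, ext_of_open _ _ fun τ ↦ ?_⟩
  · obtain ⟨a, ha⟩ := hcov τ
    exact ⟨_, q a, inferInstance, ha, by rw [reassoc_of% hz, hlw]⟩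
  · obtain ⟨a, ha⟩ := hcov τ
    exact ⟨_, q a, inferInstance, ha, by rw [reassoc_of% hz, hls]⟩

end Local

section Quot

variable {G : Type u} [Group G] [Finite G] {X Y V U : Scheme.{u}} {φ : X ⟶ Y} [IsAffineHom φ] {v : V ⟶ U} {ρ : G →* Aut V}

lemma SpecMap_act {σ : X ⟶ X} (h : σ ≫ φ = φ) {O : Y.Opens} (hO : IsAffineOpen (φ ⁻¹ᵁ O)) :
    Spec.map (CommRingCat.ofHom (act h O)) ≫ hO.fromSpec = hO.fromSpec ≫ σ :=
  hO.SpecMap_appLE_fromSpec σ hO (preimage_le_of_comp_eq h O)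

lemma act_comp {σ τ μ : X ⟶ X} (hσ : σ ≫ φ = φ) (hτ : τ ≫ φ = φ) (hμ : μ ≫ φ = φ) (h : μ = σ ≫ τ) (O : Y.Opens) (x : Γ(X, φ ⁻¹ᵁ O)) :
    act hμ O x = act hσ O (act hτ O x) := by
  subst h
  simp only [act, RingHom.comp_apply, pb_rs, rs_rs]
  rfl

lemma act_id {σ : X ⟶ X} (hσ : σ ≫ φ = φ) (h : σ = 𝟙 X) (O : Y.Opens) (x : Γ(X, φ ⁻¹ᵁ O)) : act hσ O x = x := by
  subst h
  exact rs_self _ _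

lemma act_of_comm {σ : X ⟶ X} (hσ : σ ≫ φ = φ) {τ : V ⟶ V} (hτ : τ ≫ v = v) {w : X ⟶ V} {u : Y ⟶ U} (hu : φ ≫ u = w ≫ v)
    (h : σ ≫ w = w ≫ τ) {O : U.Opens} {O' : Y.Opens} (hO : O' ≤ u ⁻¹ᵁ O) (x : Γ(V, v ⁻¹ᵁ O)) :
    act hσ O' (rs (le_of_comm hu hO) (pb w _ x)) = rs (le_of_comm hu hO) (pb w _ (act hτ O x)) := by
  have hle : φ ⁻¹ᵁ O' ≤ (σ ≫ w) ⁻¹ᵁ v ⁻¹ᵁ O :=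
    (preimage_le_of_comp_eq hσ O').trans (σ.preimage_mono (le_of_comm hu hO))
  have h1 := pb_congr h hle x
  simp only [act, RingHom.comp_apply, pb_rs, rs_rs]
  exact h1

/-- If `V ⟶ U` is a `G`-torsor and `X ⟶ V` is equivariant, then `X` is the base change of `V` to the quotient of `X` by `G`. -/
theorem isPullback_quot (hv : IsTorsor v ρ) (σ : G → (X ⟶ X)) (hσ : ∀ g, σ g ≫ φ = φ) (hσ₁ : σ 1 = 𝟙 X)
    (hσm : ∀ g h, σ (g * h) = σ h ≫ σ g) {w : X ⟶ V} (hw : ∀ g, σ g ≫ w = w ≫ (ρ g).hom) {u : Y ⟶ U} (hu : φ ≫ u = w ≫ v) :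
    IsPullback w (invariants σ hσ).fromSource v ((invariants σ hσ).toBase ≫ u) := by
  classical
  have := Fintype.ofFinite G
  have := hv.finite
  let 𝓑 := invariants σ hσ
  let J := {p : U.affineOpens × Y.affineOpens // p.2.1 ≤ u ⁻¹ᵁ p.1.1}
  have hX (p : J) : IsAffineOpen (φ ⁻¹ᵁ p.1.2.1) := p.1.2.2.preimage φ
  have hV (p : J) : IsAffineOpen (v ⁻¹ᵁ p.1.1.1) := p.1.1.2.preimage v
  refine isPullback_of_cover (J := J) (c := fun p ↦ 𝓑.chart p.1.2) (i := fun p ↦ (hX p).fromSpec)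
    (p := fun p ↦ Spec.map (CommRingCat.ofHom (𝓑.B p.1.2).subtype)) ?_ (fun x ↦ ?_) (fun p ↦ ?_) (fun p ↦ ?_)
  · exact hu.symm.trans ((congrArg (· ≫ u) 𝓑.fromSource_toBase.symm).trans (Category.assoc _ _ _))
  · obtain ⟨U₀, U', hU, hx⟩ := exists_small (𝓑.toBase x) u
    refine ⟨⟨(U₀, U'), hU⟩, ?_⟩
    have : x ∈ 𝓑.toBase ⁻¹ᵁ U'.1 := hx
    rwa [𝓑.toBase_preimage U'] at this
  · refine isPullback_of_range ?_ ?_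
    · have h1 := 𝓑.ι_fromSource p.1.2
      have : IsIso (φ ⁻¹ᵁ p.1.2.1).toSpecΓ := by rw [← (hX p).isoSpec_hom]; infer_instance
      rw [← cancel_epi (φ ⁻¹ᵁ p.1.2.1).toSpecΓ, IsAffineOpen.toSpecΓ_fromSpec_assoc, h1]
      rfl
    · rintro x hx
      rw [(hX p).range_fromSpec]
      have : 𝓑.fromSource x ∈ 𝓑.toBase ⁻¹ᵁ p.1.2.1 := by
        rw [𝓑.toBase_preimage]
        exact hx
      have h1 := congr($(𝓑.fromSource_toBase) x)
      change φ x ∈ p.1.2.1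
      rw [← h1]
      exact this
  · let f : Γ(U, p.1.1.1) ⟶ Γ(V, v ⁻¹ᵁ p.1.1.1) := v.app p.1.1.1
    let q : Γ(U, p.1.1.1) →+* 𝓑.B p.1.2 := (𝓑.algMap p.1.2).comp (u.appLE p.1.1.1 p.1.2.1 p.2).hom
    let w' : Γ(V, v ⁻¹ᵁ p.1.1.1) →+* Γ(X, φ ⁻¹ᵁ p.1.2.1) := (rs (le_of_comm hu p.2)).comp (pb w _)
    let a (g : G) := act (hv.comp g) p.1.1.1
    let b (g : G) := act (hσ g) p.1.2.1
    have hjv : Spec.map f ≫ p.1.1.2.fromSpec = (hV p).fromSpec ≫ v := by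
      have := p.1.1.2.SpecMap_appLE_fromSpec v (hV p) le_rfl
      rwa [← Hom.app_eq_appLE] at this
    have hi₁ : IsOpenImmersion (hV p).fromSpec := (hV p).isOpenImmersion_fromSpec
    have hi₂ : IsOpenImmersion p.1.1.2.fromSpec := p.1.1.2.isOpenImmersion_fromSpec
    have hp : IsPullback (hV p).fromSpec (Spec.map f) v p.1.1.2.fromSpec :=
      isPullback_of_range hjv.symm (by rw [(hV p).range_fromSpec, p.1.1.2.range_fromSpec]; exact subset_rfl)
    have ha (g) : Spec.map (CommRingCat.ofHom (a g)) ≫ (hV p).fromSpec = (hV p).fromSpec ≫ (ρ g).hom :=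
      SpecMap_act (hv.comp g) (hV p)
    obtain ⟨I, hI⟩ := hv.exists_sum hjv (fun g ↦ CommRingCat.ofHom (a g)) (fun g ↦ by
      ext x; exact act_pb (hv.comp g) p.1.1.1 x) ha
    have hring := isPushout_of_galois a b w' (fun g s ↦ act_of_comm _ _ hu (hw g) p.2 s) 1
      (fun s ↦ act_id _ (by rw [map_one]; rfl) _ s) (fun s ↦ act_id _ hσ₁ _ s) (𝓑.B p.1.2)
      (fun g x hx ↦ Subring.mem_iInf.mp hx g) (fun s ↦ Subring.mem_iInf.mpr fun h ↦ ?_) f.hom q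
      (fun x ↦ ?_) (fun s ↦ hv.exists_of_invariant hp (fun g ↦ CommRingCat.ofHom (a g)) ha _ fun h ↦ ?_) I Prod.fst Prod.snd hI
    · have e1 : (hX p).fromSpec ≫ w = Spec.map (CommRingCat.ofHom w') ≫ (hV p).fromSpec :=
        ((hV p).SpecMap_appLE_fromSpec w (hX p) (le_of_comm hu p.2)).symm
      have e2 : 𝓑.chart p.1.2 ≫ 𝓑.toBase ≫ u = Spec.map (CommRingCat.ofHom q) ≫ p.1.1.2.fromSpec := by
        rw [← Category.assoc, 𝓑.chart_toBase, Category.assoc, ← p.1.1.2.SpecMap_appLE_fromSpec u p.1.2.2 p.2, ← Spec.map_comp_assoc]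
        rfl
      rw [e1, e2]
      exact (isPullback_SpecMap_of_isPushout _ _ _ _ hring).paste_horiz hp
    · change act (hσ h) _ _ = _
      rw [map_sum]
      refine Fintype.sum_equiv (Equiv.mulRight h) _ _ fun g ↦ ?_
      exact (act_comp (hσ h) (hσ g) (hσ (g * h)) (hσm g h) _ s).symm
    · change rs _ (pb w _ (pb v _ x)) = pb φ _ (rs p.2 (pb u _ x))
      rw [pb_rs]
      exact (pb_congr hu (le_of_comm (f := 𝟙 U) (f' := φ) (by rw [Category.comp_id]) p.2) x).symm
    · change act (hv.comp h) _ _ = _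
      rw [map_sum]
      refine Fintype.sum_equiv (Equiv.mulRight h) _ _ fun g ↦ ?_
      exact (act_comp (hv.comp h) (hv.comp g) (hv.comp (g * h)) (by rw [map_mul]; rfl) _ s).symm

end Quot

/-! ### Quotients of the powers of a torsor -/

section QuotPower

variable {S : Scheme.{u}} {G : Type u} [Group G] [Finite G] {W Y X : Over S} {φ : W ⟶ Y} [IsFinite φ.left] {ρ : G →* Aut W.left}
  {α : G → (W ⟶ W)} {hα : ∀ g, schPowerMap (α g) ≫ schPowerMap φ = schPowerMap φ}

/-- The power `W ^ (n + 1)` is the base change of `W` to its quotient by `G`, through the `j`-th projection. -/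
lemma isPullback_quotOS (hv : IsTorsor φ.left ρ) (hαρ : ∀ g, (α g).left = (ρ g).hom) (n : ℕ) (j : Fin (n + 1)) :
    IsPullback (pr W n j) (invariants (fun g ↦ (schPowerMap (α g)).app (.op ⟨n⟩)) fun g ↦ congr($(hα g).app (.op ⟨n⟩))).fromSource
      φ.left ((quotOSProj (schPowerMap φ) (fun g ↦ schPowerMap (α g)) hα).app (.op ⟨n⟩) ≫ pr Y n j) := by
  have : IsAffineHom ((schPowerMap φ).app (.op ⟨n⟩)) := schPowerMap_mem @IsAffineHom φ inferInstance _
  refine isPullback_quot hv (fun g ↦ (schPowerMap (α g)).app (.op ⟨n⟩)) (fun g ↦ congr($(hα g).app (.op ⟨n⟩)))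
    (schPower_hom_ext fun i ↦ ?_) (fun g h ↦ schPower_hom_ext fun i ↦ ?_) (fun g ↦ ?_) (schPowerMap_pr φ j)
  · rw [schPowerMap_pr, hαρ, map_one, Category.id_comp]
    exact Category.comp_id _
  · rw [Category.assoc, schPowerMap_pr, schPowerMap_pr, reassoc_of% @schPowerMap_pr, hαρ, hαρ, hαρ, map_mul]
    rfl
  · rw [schPowerMap_pr, hαρ]

lemma isIso_pr_zero (X : Over S) : IsIso (pr X 0 0) := by
  refine ⟨powLift (fun _ ↦ 𝟙 _) fun _ ↦ rfl, schPower_hom_ext fun j ↦ ?_, powLift_pr _ _ _⟩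
  obtain rfl : j = 0 := Subsingleton.elim (α := Fin 1) _ _
  rw [Category.assoc, powLift_pr, Category.comp_id, Category.id_comp]

lemma isIso_quotOSProj_zero (hv : IsTorsor φ.left ρ) (hαρ : ∀ g, (α g).left = (ρ g).hom) :
    IsIso ((quotOSProj (schPowerMap φ) (fun g ↦ schPowerMap (α g)) hα).app (.op ⟨0⟩)) := by
  have h := isPullback_quotOS (hα := hα) hv hαρ 0 0
  have := hv.etale
  have := hv.surjective
  have := isIso_pr_zero Y
  have h1 : IsIso ((quotOSProj (schPowerMap φ) (fun g ↦ schPowerMap (α g)) hα).app (.op ⟨0⟩) ≫ pr Y 0 0) :=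
    MorphismProperty.of_isPullback_of_descendsAlong (P := .isomorphisms _) (Q := @Surjective ⊓ @Flat ⊓ @QuasiCompact) h
      ⟨⟨inferInstance, inferInstance⟩, inferInstance⟩ (isIso_pr_zero W)
  exact IsIso.of_isIso_comp_right _ (pr Y 0 0)

/-- Both properties descend along the covering `W ⟶ Y`: after this base change the quotient becomes `W ^ (n + 1)`. -/
lemma etale_and_finite_quotOSProj (hv : IsTorsor φ.left ρ) (hαρ : ∀ g, (α g).left = (ρ g).hom) (n : ℕ) :
    Etale ((quotOSProj (schPowerMap φ) (fun g ↦ schPowerMap (α g)) hα).app (.op ⟨n⟩)) ∧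
      IsFinite ((quotOSProj (schPowerMap φ) (fun g ↦ schPowerMap (α g)) hα).app (.op ⟨n⟩)) := by
  let 𝓑 := invariants (fun g ↦ (schPowerMap (α g)).app (.op ⟨n⟩)) fun g ↦ congr($(hα g).app (.op ⟨n⟩))
  let π := 𝓑.toBase
  have h : IsPullback (pr W n 0) 𝓑.fromSource φ.left (π ≫ pr Y n 0) := isPullback_quotOS (hα := hα) hv hαρ n 0
  have := hv.etale
  have := hv.surjective
  let b := pullback.snd φ.left (pr Y n 0)
  let k : (schPower W).obj (.op ⟨n⟩) ⟶ pullback φ.left (pr Y n 0) := pullback.lift (pr W n 0) ((schPowerMap φ).app _) (schPowerMap_pr φ 0).symm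
  have hk1 : k ≫ pullback.fst _ _ = pr W n 0 := pullback.lift_fst _ _ _
  have hk2 : k ≫ b = (schPowerMap φ).app _ := pullback.lift_snd _ _ _
  have hp : IsPullback k 𝓑.fromSource b π := by
    refine IsPullback.of_right (h₁₂ := pullback.fst φ.left (pr Y n 0)) (h₂₂ := pr Y n 0) (v₁₃ := φ.left) ?_ ?_ (.of_hasPullback _ _)
    · rw [hk1]
      exact h
    · rw [hk2]
      exact 𝓑.fromSource_toBase.symm
  have hb : (@Surjective ⊓ @Flat ⊓ @QuasiCompact : MorphismProperty Scheme.{u}) b :=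
    ⟨⟨inferInstanceAs (Surjective (pullback.snd _ _)), inferInstanceAs (Flat (pullback.snd _ _))⟩,
      inferInstanceAs (QuasiCompact (pullback.snd _ _))⟩
  have hbE : Etale b := inferInstanceAs (Etale (pullback.snd _ _))
  have hbF : IsFinite b := inferInstanceAs (IsFinite (pullback.snd _ _))
  have hkE : Etale k := by
    have : Etale (k ≫ b) := by
      rw [hk2]
      exact schPowerMap_mem @Etale φ inferInstance _
    exact Etale.of_comp k b
  have hkF : IsFinite k := by
    have : IsFinite (k ≫ b) := by
      rw [hk2]
      exact schPowerMap_mem @IsFinite φ inferInstance _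
    exact MorphismProperty.of_postcomp (W := @IsFinite) (W' := @IsSeparated) k b inferInstance this
  refine ⟨MorphismProperty.of_isPullback_of_descendsAlong hp hb hkE, ?_⟩
  have h1 : UniversallyClosed π := MorphismProperty.of_isPullback_of_descendsAlong (P := @UniversallyClosed) hp hb inferInstance
  have h2 : LocallyOfFiniteType π := MorphismProperty.of_isPullback_of_descendsAlong (P := @LocallyOfFiniteType) hp hb inferInstance
  have h3 : IsAffineHom π := inferInstance
  exact IsFinite.iff_isProper_and_isAffineHom.mpr ⟨(show IsProper π from { }), h3⟩

/-- The quotients of the powers of a torsor form a multiplicative oversimplicial scheme over the powers of the base: after base change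
to `W` through a vertex, they become the powers of `W`. -/
theorem isMultiplicativeHom_quotOSProj (hv : IsTorsor φ.left ρ) (hαρ : ∀ g, (α g).left = (ρ g).hom) (i : Y ⟶ X)
    [IsOpenImmersion i.left] :
    IsMultiplicativeHom (quotOSProj (schPowerMap φ) (fun g ↦ schPowerMap (α g)) hα ≫ schPowerMap i) := by
  let Q := quotOS (schPowerMap φ) (fun g ↦ schPowerMap (α g)) hα
  let π : Q ⟶ schPower Y := quotOSProj (schPowerMap φ) (fun g ↦ schPowerMap (α g)) hα
  let s (n : ℕ) : (schPower W).obj (.op ⟨n⟩) ⟶ Q.obj (.op ⟨n⟩) :=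
    (invariants (fun g ↦ (schPowerMap (α g)).app (.op ⟨n⟩)) fun g ↦ congr($(hα g).app (.op ⟨n⟩))).fromSource
  have hs {m n : ℕ} (f : OSimp.mk m ⟶ OSimp.mk n) : s n ≫ Q.map f.op = (schPower W).map f.op ≫ s m :=
    QCSubalgebra.fromSource_map (mapsTo_invariants (schPowerMap φ) (fun g ↦ schPowerMap (α g)) hα f.op)
  have hsq (n) (j : Fin (n + 1)) : IsPullback (pr W n j) (s n) φ.left (π.app (.op ⟨n⟩) ≫ pr Y n j) :=
    isPullback_quotOS (hα := hα) hv hαρ n j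
  have hi (n) : IsOpenImmersion ((schPowerMap i).app (.op ⟨n⟩)) := schPowerMap_mem @IsOpenImmersion i inferInstance _
  have := hv.etale
  have := hv.surjective
  -- uniqueness is tested after base change to `W`, where the points come from the powers of `W`
  have hu ⦃l m n : ℕ⦄ (a : OSimp.mk 0 ⟶ OSimp.mk m) (b : OSimp.mk 0 ⟶ OSimp.mk l)
      (c : OSimp.mk m ⟶ OSimp.mk n) (d : OSimp.mk l ⟶ OSimp.mk n) (hp : IsPushout a b c d) (T : Scheme.{u})
      (z z' : T ⟶ Q.obj (.op ⟨n⟩)) (h1 : z ≫ Q.map c.op = z' ≫ Q.map c.op) (h2 : z ≫ Q.map d.op = z' ≫ Q.map d.op) : z = z' := by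
    have hcd : c (a 0) = d (b 0) := congr($(hp.w) 0)
    let u := z ≫ π.app _ ≫ pr Y n (c (a 0))
    have hu' : u = z' ≫ π.app _ ≫ pr Y n (c (a 0)) := by
      simp only [u]
      rw [← map_pr Y c, ← π.naturality_assoc, reassoc_of% h1]
    let q := pullback.snd φ.left u
    let τ := pullback.fst φ.left u
    have hτ : τ ≫ φ.left = q ≫ u := pullback.condition
    have hτ1 : τ ≫ φ.left = (q ≫ z) ≫ π.app _ ≫ pr Y n (c (a 0)) := hτ.trans (Category.assoc _ _ _).symm
    have hτ2 : τ ≫ φ.left = (q ≫ z') ≫ π.app _ ≫ pr Y n (c (a 0)) := hτ.trans ((congrArg (q ≫ ·) hu').trans (Category.assoc _ _ _).symm)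
    let w := (hsq n (c (a 0))).lift τ (q ≫ z) hτ1
    let w' := (hsq n (c (a 0))).lift τ (q ≫ z') hτ2
    have hw1 : w ≫ pr W n _ = τ := (hsq n (c (a 0))).lift_fst _ _ _
    have hw2 : w ≫ s n = q ≫ z := (hsq n (c (a 0))).lift_snd _ _ _
    have hw1' : w' ≫ pr W n _ = τ := (hsq n (c (a 0))).lift_fst _ _ _
    have hw2' : w' ≫ s n = q ≫ z' := (hsq n (c (a 0))).lift_snd _ _ _
    have hwc : w ≫ (schPower W).map c.op = w' ≫ (schPower W).map c.op := by
      refine (hsq m (a 0)).hom_ext ?_ ?_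
      · rw [Category.assoc, Category.assoc, map_pr, hw1, hw1']
      · rw [Category.assoc, Category.assoc, ← hs, reassoc_of% hw2, reassoc_of% hw2', h1]
    have hwd : w ≫ (schPower W).map d.op = w' ≫ (schPower W).map d.op := by
      refine (hsq l (b 0)).hom_ext ?_ ?_
      · rw [Category.assoc, Category.assoc, map_pr, ← hcd, hw1, hw1']
      · rw [Category.assoc, Category.assoc, ← hs, reassoc_of% hw2, reassoc_of% hw2', h2]
    have hww : w = w' := schPower_hom_ext fun j ↦ by
      rcases pushout_surjective hp j with ⟨j, rfl⟩ | ⟨j, rfl⟩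
      · rw [← map_pr W c, reassoc_of% hwc]
      · rw [← map_pr W d, reassoc_of% hwd]
    have : Epi q := by
      have : EffectiveEpi (pullback.snd φ.left u) := inferInstance
      exact inferInstanceAs (Epi (pullback.snd φ.left u))
    rw [← cancel_epi q, ← hw2, ← hw2', hww]
  refine isMultiplicativeHom_of (fun l m n a b c d hp T x y t hx hy ↦ ?_) fun l m n a b c d hp T z z' h1 h2 _ ↦ hu a b c d hp T z z' h1 h2
  have hcd : c (a 0) = d (b 0) := congr($(hp.w) 0)
  replace hx : x ≫ π.app _ ≫ (schPowerMap i).app _ = t ≫ (schPower X).map c.op := hx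
  replace hy : y ≫ π.app _ ≫ (schPowerMap i).app _ = t ≫ (schPower X).map d.op := hy
  obtain ⟨t, rfl⟩ := exists_schPower_lift i t fun j ↦ by
    rcases pushout_surjective hp j with ⟨j, rfl⟩ | ⟨j, rfl⟩
    · rw [← map_pr X c, ← reassoc_of% hx, schPowerMap_pr]
      simp only [← Category.assoc]
      rintro _ ⟨τ, rfl⟩
      exact ⟨_, rfl⟩
    · rw [← map_pr X d, ← reassoc_of% hy, schPowerMap_pr]
      simp only [← Category.assoc]
      rintro _ ⟨τ, rfl⟩
      exact ⟨_, rfl⟩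
  have hx : x ≫ π.app _ = t ≫ (schPower Y).map c.op := by
    rw [← cancel_mono ((schPowerMap i).app (.op ⟨m⟩)), Category.assoc, hx, Category.assoc, Category.assoc, (schPowerMap i).naturality]
  have hy : y ≫ π.app _ = t ≫ (schPower Y).map d.op := by
    rw [← cancel_mono ((schPowerMap i).app (.op ⟨l⟩)), Category.assoc, hy, Category.assoc, Category.assoc, (schPowerMap i).naturality]
  -- the components lift to the powers of `W` after the base change `q`, and the glued point descends by uniqueness
  let u := t ≫ pr Y n (c (a 0))
  let q := pullback.snd φ.left u
  let τ := pullback.fst φ.left u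
  have hτ : τ ≫ φ.left = q ≫ u := pullback.condition
  have hτx : τ ≫ φ.left = (q ≫ x) ≫ π.app _ ≫ pr Y m (a 0) := by
    rw [hτ, Category.assoc, reassoc_of% hx, map_pr]
  have hτy : τ ≫ φ.left = (q ≫ y) ≫ π.app _ ≫ pr Y l (b 0) := by
    rw [hτ, Category.assoc, reassoc_of% hy, map_pr, ← hcd]
  let x' := (hsq m (a 0)).lift τ (q ≫ x) hτx
  let y' := (hsq l (b 0)).lift τ (q ≫ y) hτy
  have hx1 : x' ≫ pr W m _ = τ := (hsq m (a 0)).lift_fst _ _ _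
  have hx2 : x' ≫ s m = q ≫ x := (hsq m (a 0)).lift_snd _ _ _
  have hy1 : y' ≫ pr W l _ = τ := (hsq l (b 0)).lift_fst _ _ _
  have hy2 : y' ≫ s l = q ≫ y := (hsq l (b 0)).lift_snd _ _ _
  obtain ⟨z', hz'c, hz'd⟩ := exists_schPower_glue hp x' y' (hx1.trans hy1.symm)
  have hzc : (z' ≫ s n) ≫ Q.map c.op = q ≫ x := by rw [Category.assoc, hs, reassoc_of% hz'c, hx2]
  have hzd : (z' ≫ s n) ≫ Q.map d.op = q ≫ y := by rw [Category.assoc, hs, reassoc_of% hz'd, hy2]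
  have hq : EffectiveEpi q := inferInstanceAs (EffectiveEpi (pullback.snd φ.left u))
  obtain ⟨z, hz⟩ : ∃ z : T ⟶ Q.obj (.op ⟨n⟩), q ≫ z = z' ≫ s n :=
    ⟨EffectiveEpi.desc q (z' ≫ s n) fun g₁ g₂ hg ↦ hu a b c d hp _ _ _
      (by simp only [Category.assoc] at hzc ⊢; rw [hzc, reassoc_of% hg]) (by simp only [Category.assoc] at hzd ⊢; rw [hzd, reassoc_of% hg]),
      EffectiveEpi.fac _ _ _⟩
  have h1 : z ≫ Q.map c.op = x := by rw [← cancel_epi q, reassoc_of% hz, ← hzc, Category.assoc]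
  have h2 : z ≫ Q.map d.op = y := by rw [← cancel_epi q, reassoc_of% hz, ← hzd, Category.assoc]
  refine ⟨z, h1, h2, ?_⟩
  have h3 : z ≫ π.app _ = t := schPower_hom_ext fun j ↦ by
    rcases pushout_surjective hp j with ⟨j, rfl⟩ | ⟨j, rfl⟩
    · rw [← map_pr Y c, Category.assoc, ← π.naturality_assoc, reassoc_of% h1, reassoc_of% hx]
    · rw [← map_pr Y d, Category.assoc, ← π.naturality_assoc, reassoc_of% h2, reassoc_of% hy]
  change z ≫ π.app _ ≫ (schPowerMap i).app _ = _
  rw [reassoc_of% h3]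

end QuotPower

/-! ### The covering of `P^{(R, M)}` -/

section Cover

lemma exists_isPullback_fac {C O P Q Y X : Scheme.{u}} {g : O ⟶ Y} {o : O ⟶ P} {s : Y ⟶ X} {y : P ⟶ X} {a : C ⟶ P} {b : C ⟶ Q}
    {q : Q ⟶ Y} (hg : IsPullback g o s y) (hC : IsPullback a b y (q ≫ s)) : ∃ c : C ⟶ O, IsPullback b c q g ∧ c ≫ o = a := by
  have h1 : (b ≫ q) ≫ s = a ≫ y := (Category.assoc _ _ _).trans hC.w.symm
  have h2 : hg.lift _ _ h1 ≫ g = b ≫ q := hg.lift_fst _ _ _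
  have h3 : hg.lift _ _ h1 ≫ o = a := hg.lift_snd _ _ _
  exact ⟨_, .of_bot (by rw [h3]; exact hC.flip) h2.symm hg, h3⟩

variable {k : Type u} [Field k] (X : Over (Spec (.of k))) [Smooth X.hom] [IsSeparated X.hom]
  {ι : Type u} [Fintype ι] [DecidableEq ι] (D : ι → X.left.IdealSheafData) (hD : ∀ i, IsFG (D i)) (m : ι → ℕ) (r : ι → ℚ)
  {G : Type u} [Group G] [Finite G] {V : Scheme.{u}} (v : V ⟶ (complement X D).toScheme) [IsFinite v] (ρ : G →* Aut V)

/-- The quotients `V ^ (n + 1) / G`, pulled back to `P^{(R, M)}`, are a covering in the sense of `IsCover`. -/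
theorem isCover_CPRMProj (hv : IsTorsor v ρ) (hLP : IsLP D) (hm : ∀ i, 1 ≤ m i)
    (hc : ∀ x : X.left, ∃ c : Chart D, x ∈ Set.range c.j) :
    IsCover (CPRMProj X D hD m r v ρ hv.comp) (fun n ↦ inner ((PRMCoord X D hD m r).app n)) := by
  have h := isUniv_PRM hD r hLP hm
  have hv' : IsTorsor (coverOverHom X D v).left ρ := hv
  let α (g : G) : coverOver X D v ⟶ coverOver X D v := Over.homMk (ρ g).hom (by simp [coverOver, reassoc_of% hv.comp g])
  have hα : ∀ g, schPowerMap (α g) ≫ schPowerMap (coverOverHom X D v) = schPowerMap (coverOverHom X D v) :=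
    diagAction_comp X D v ρ hv.comp
  let π := quotOSProj (schPowerMap (coverOverHom X D v)) (fun g ↦ schPowerMap (α g)) hα
  have key (n : ℕ) : ∃ (g : _) (b : _) (c : (CPRM X D hD m r v ρ hv.comp).obj (.op ⟨n⟩) ⟶ (inner ((PRMCoord X D hD m r).app (.op ⟨n⟩))).toScheme),
      IsPullback b c (π.app (.op ⟨n⟩)) g ∧ c ≫ (inner ((PRMCoord X D hD m r).app (.op ⟨n⟩))).ι = (CPRMProj X D hD m r v ρ hv.comp).app (.op ⟨n⟩) := by
    obtain ⟨g, hg⟩ := exists_isPullback_inner (h.adm n) hm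
    obtain ⟨c, hc1, hc2⟩ := exists_isPullback_fac hg
      (show IsPullback _ _ _ (π.app (.op ⟨n⟩) ≫ (schPowerMap (complOverι X D)).app (.op ⟨n⟩)) from
        isPullback_pbOS (PRMToPower X D hD m r) (CRMProj X D v ρ hv.comp) (.op ⟨n⟩))
    exact ⟨g, _, c, hc1, hc2⟩
  refine ⟨h.isLocallyNoetherian hm hc, h.isNormalIn hm hc, h.preimage_inner, ?_, ?_, ?_, fun n ↦ smooth_map_succ h (smooth_pt_zero h hm hc) n⟩
  · rintro ⟨⟨n⟩⟩
    obtain ⟨g, b, c, hp, hc'⟩ := key n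
    obtain ⟨h1, h2⟩ := etale_and_finite_quotOSProj (hα := hα) hv' (fun _ ↦ rfl) n
    have h1 : Etale (π.app (.op ⟨n⟩)) := h1
    refine ⟨c, ?_, MorphismProperty.of_isPullback (P := @IsFinite) hp h2, hc'⟩
    rw [← hp.isoPullback_hom_snd]
    infer_instance
  · obtain ⟨g, b, c, hp, hc'⟩ := key 0
    have h1 : IsIso (π.app (.op ⟨0⟩)) := isIso_quotOSProj_zero (hα := hα) hv' fun _ ↦ rfl
    exact ⟨c, MorphismProperty.of_isPullback (P := .isomorphisms _) hp h1, hc'⟩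
  · exact IsMultiplicativeHom.pbOS _ _ (isMultiplicativeHom_quotOSProj (hα := hα) hv' (fun _ ↦ rfl) (complOverι X D))

end Cover

end RamGrp

end

theorem mainTheorem2 {k : Type u} [Field k] [PerfectField k]
    (X : Over (Spec (.of k))) [Smooth X.hom] [IsSeparated X.hom]
    {ι : Type u} [Fintype ι] [DecidableEq ι]
    (D : ι → X.left.IdealSheafData) (hD : IsSNC D)
    {G : Type u} [Group G] [Finite G] {V : Scheme.{u}}
    (v : V ⟶ (complement X D).toScheme) [IsFinite v] (ρ : G →* Aut V) (hv : IsTorsor v ρ)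
    (r : ι → ℚ) (hr : ∀ i, 1 ≤ r i) (m : ι → ℕ) (hm : ∀ i, 1 ≤ m i)
    (hmr : ∀ i, ∃ a : ℤ, m i * r i = a)
    (hbounded : IsBounded X D hD.isFG m r v ρ hv.comp) :
    ∃ hW : WRMStable X D hD.isFG m r v ρ hv.comp,
      IsStrictlyMultiplicative (ERM X D hD.isFG m r v ρ hv.comp hW) ∧
      (∀ n, Etale ((ERMProj X D hD.isFG m r v ρ hv.comp hW).app n)) ∧
      IsMultiplicativeHom (ERMProj X D hD.isFG m r v ρ hv.comp hW) ∧
      ∃ (_ : GrpObj (ERMGroup X D hD.isFG m r v ρ hv.comp hW))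
        (_ : GrpObj (TRMGroup X D hD.isFG m r)),
        IsAssociated (ERM X D hD.isFG m r v ρ hv.comp hW)
          (ERMToZM X D hD.isFG m r v ρ hv.comp hW) ∧
        IsAssociated (TRM X D hD.isFG m r) (TRMToZM X D hD.isFG m r) ∧
        Smooth (ERMGroup X D hD.isFG m r v ρ hv.comp hW).hom ∧
        Smooth (TRMGroup X D hD.isFG m r).hom ∧
        IsVectorBundle (TRMGroup X D hD.isFG m r) ∧
        Etale (ERMGroupHom X D hD.isFG m r v ρ hv.comp hW).left ∧
        IsMonHom (ERMGroupHom X D hD.isFG m r v ρ hv.comp hW) :=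
  main_of_isCover X D hD.isFG m r v ρ hv.comp hD.isLP hm (exists_chart hD) hmr
    (isCover_CPRMProj X D hD.isFG m r v ρ hv hD.isLP hm (exists_chart hD)) hbounded
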